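/- Let $n\ge 1$, $1<p<\infty$, $n-1<\theta<n-1+p$ and $\mathsf s=(n-1+p-\theta)/p\in(0,1)$. Write $x=(x_1,x')\in\mathbb R^n_+=\{x_1>0\}$. Spaces. Fix smooth functions $\zeta_k\ge 0$ ($k\in\mathbb Z$), supported in $\{e^{-k-k_0}<x_1<e^{-k+k_0}\}$ for a fixed integer $k_0\ge1$, with $|D^m\zeta_k|\le N(m)e^{mk}$ and $\sum_k\zeta_k=1$ on $\mathbb R^n_+$. For $\gamma,\vartheta\in\mathbb R$ let $\|u\|^p_{H^\gamma_{p,\vartheta}}=\sum_{k}e^{k\vartheta}\|\zeta_{-k}(e^k\cdot)u(e^k\cdot)\|^p_{H^\gamma_p(\mathbb R^n)}$ for $u\in\mathcal D'(\mathbb R^n_+)$, where $H^\gamma_p(\mathbb R^n)$ is the Bessel potential space; let $\mathbb H^\gamma_{p,\vartheta}=L_p(\mathbb R;H^\gamma_{p,\vartheta})$ and $\|f\|^p_{\mathbb L_{p,\vartheta}}=\int_{\mathbb R}\int_{\mathbb R^n_+}|f|^px_1^{\vartheta-n}\,dx\,dt$. The space $\widetilde{\mathfrak H}^\gamma_{p,\theta}(\mathbb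 R)$ consists of the $u$ with $$\|u\|_{\widetilde{\mathfrak H}^\gamma_{p,\theta}(\mathbb R)}:=\|u\|_{\mathbb H^{\gamma-1}_{p,\theta}}+\|Du\|_{\mathbb H^{\gamma-1}_{p,\theta}}+\|u_t\|_{\mathbb H^{\gamma-2}_{p,\theta+p}}<\infty ,$$ where $u_t$ is defined by $(u(t),\phi)=(u(s),\phi)+\int_s^t(u_t(r),\phi)\,dr$ for a.e. $s,t$ and all $\phi\in C_0^\infty(\mathbb R^n_+)$. The space $W^{\mathsf s/2,\mathsf s}_p(\mathbb R\times\mathbb R^{n-1})$ has the norm $\|g\|_{L_p}+[g]_{W^{\mathsf s/2,0}_p}+[g]_{W^{0,\mathsf s}_p}$ with $$[g]^p_{W^{\mathsf s/2,0}_p}=\iint\frac{\|g(r,\cdot)-g(t,\cdot)\|^p_{L_p(\mathbb R^{n-1})}}{|t-r|^{1+\mathsf sp/2}}\,dr\,dt,\qquad [g]^p_{W^{0,\mathsf s}_p}=\iiint\frac{|g(t,x')-g(t,y')|^p}{|x'-y'|^{n-1+\mathsf sp}}\,dx'\,dy'\,dt$$ (the latter is $0$ if $n=1$). The trace operator $\mathcal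 T$ is the extension by continuity, from $\widetilde{\mathfrak H}^1_{p,\theta}(\mathbb R)$ to $W^{\mathsf s/2,\mathsf s}_p(\mathbb R\times\mathbb R^{n-1})$, of the restriction $\varphi\mapsto\varphi|_{x_1=0}$ of functions $\varphi\in C_0^\infty(\overline{\mathbb R\times\mathbb R^n_+})$: $\mathcal Tu=g$ means that $\varphi_m\to u$ and $\varphi_m|_{x_1=0}\to g$ in these spaces for some sequence of such $\varphi_m$. Statement. There is a cut-off $\eta\in C^\infty(\mathbb R)$ with $\eta=1$ on $(-\infty,1]$ and $\eta=0$ on $[2,\infty)$ such that the following holds. For $g\in W^{\mathsf s/2,\mathsf s}_p(\mathbb R\times\mathbb R^{n-1})$ put $$v(t,x)=\int_{\mathbb R}\int_{\mathbb R^{n-1}}P(t-s,x_1,x'-y')\,g(s,y')\,dy'\,ds,\qquad P(t,x)=1_{t>0}\,(4\pi t)^{-n/2}\,\frac{x_1}{t}\,e^{-|x|^2/(4t)},\qquad u(t,x)=\eta(x_1)v(t,x).$$ (i) The integral converges absolutely for all $(t,x)\in\mathbb R\times\mathbb R^n_+$, and $v,u\in C^\infty(\mathbb R\times\mathbb R^n_+)$.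 (ii) For every $\gamma\in\mathbb R$, $u\in\widetilde{\mathfrak H}^\gamma_{p,\theta}(\mathbb R)$, $\mathcal Tu=g$ (in particular $u\in\widetilde{\mathfrak H}^1_{p,\theta}(\mathbb R)$), and $\|u\|_{\widetilde{\mathfrak H}^\gamma_{p,\theta}(\mathbb R)}\le N\|g\|_{W^{\mathsf s/2,\mathsf s}_p}$ with $N=N(n,p,\theta,\gamma)$ (and the fixed $\zeta_k$ that define the norm). (iii) For every $m=0,1,2,\dots$ there is $N=N(n,p,\theta,m)$ such that, for spatial multi-indices $\alpha$ with $|\alpha|=m+1$ and $\beta$ with $|\beta|=m$, $$\|D^\alpha v\|_{\mathbb L_{p,\theta+mp}}+\|D^\beta v_t\|_{\mathbb L_{p,\theta+(m+1)p}}\le N\big([g]_{W^{\mathsf s/2,0}_p}+[g]_{W^{0,\mathsf s}_p}\big),$$ $$\|u\|_{\mathbb L_{p,\theta}}+\|D^\alpha u\|_{\mathbb L_{p,\theta+mp}}+\|D^\beta u_t\|_{\mathbb L_{p,\theta+(m+1)p}}\le N\|g\|_{W^{\mathsf s/2,\mathsf s}_p}.$$ -/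

import Mathlib

open MeasureTheory TopologicalSpace Filter
open scoped ENNReal NNReal ContDiff Distributions SchwartzMap LineDeriv Topology

noncomputable section

/-! Throughout, `n = d + 1`; a point of `ℝⁿ` is `x = (x₁, x')` with `x₁ = x 0` and `x' ∈ ℝᵈ`.
Functions and distributions are complex-valued, which includes the real-valued ones. -/

namespace WeightedTrace

/-- `ℝⁿ` with `n = d + 1`. -/
abbrev Space (d : ℕ) := EuclideanSpace ℝ (Fin (d + 1))

/-- `ℝⁿ⁻¹`, the boundary of the half-space. -/
abbrev Bdry (d : ℕ) := EuclideanSpace ℝ (Fin d)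

/-- The point `(x₁, x')`. -/
def mkPoint {d : ℕ} (r : ℝ) (y : Bdry d) : Space d :=
  WithLp.toLp 2 (Fin.cons r (fun i => y i))

/-- The tangential part `x'` of `x = (x₁, x')`. -/
def tang {d : ℕ} (x : Space d) : Bdry d := WithLp.toLp 2 (fun i => x i.succ)

/-- The half-space `ℝⁿ₊ = {x₁ > 0}`; the distance of `x` to its boundary is `x₁`. -/
def halfSpace (d : ℕ) : Opens (Space d) :=
  ⟨{x | 0 < x 0}, isOpen_lt continuous_const (by fun_prop)⟩

/-- The `i`-th standard basis vector. -/
abbrev stdVec {d : ℕ} (i : Fin (d + 1)) : Space d := EuclideanSpace.single i (1 : ℝ)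

/-! ### The weighted Sobolev spaces `H^γ_{p,θ}` of the half-space -/

/-- An admissible partition of unity `{ζ_k}` of the half-space: `ζ_k` is smooth and non-negative, is
supported where `e^{-k-k₀} < x₁ < e^{-k+k₀}`, satisfies `|D^m ζ_k| ≤ N(m) e^{mk}`, and
`∑_k ζ_k = 1` on the half-space. -/
structure WeightPartition (d : ℕ) where
  k₀ : ℕ
  k₀_pos : 0 < k₀
  ζ : ℤ → Space d → ℝ
  contDiff : ∀ k, ContDiff ℝ ∞ (ζ k)
  nonneg : ∀ k x, 0 ≤ ζ k x
  tsupport_subset : ∀ k, tsupport (ζ k) ⊆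
    {x | Real.exp (-(k : ℝ) - k₀) < x 0 ∧ x 0 < Real.exp (-(k : ℝ) + k₀)}
  bound : ∀ m : ℕ, ∃ N : ℝ, ∀ k x, ‖iteratedFDeriv ℝ m (ζ k) x‖ ≤ N * Real.exp (m * (k : ℝ))
  hasSum_one : ∀ x : Space d, 0 < x 0 → HasSum (fun k => ζ k x) 1

/-- Admissible partitions exist. -/
theorem weightPartition_nonempty (d : ℕ) : Nonempty (WeightPartition d) := by
  have hec : (2 : ℝ) < Real.exp 1 := by have := Real.exp_one_gt_d9; linarith
  let A : ℝ → ℝ := fun r => Real.smoothTransition (r - 1)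
  have hA : ContDiff ℝ ∞ A := Real.smoothTransition.contDiff.comp (contDiff_id.sub contDiff_const)
  have hA0 : ∀ r ≤ 1, A r = 0 := fun r hr =>
    Real.smoothTransition.zero_of_nonpos (by linarith)
  have hA1 : ∀ r, 2 ≤ r → A r = 1 := fun r hr =>
    Real.smoothTransition.one_of_one_le (by linarith)
  have hAm : Monotone A := fun a b h => Real.smoothTransition.monotone (by linarith)
  let f : ℝ → ℝ := fun r => A (Real.exp 1 * r) - A r
  have hf : ContDiff ℝ ∞ f := (hA.comp (contDiff_const.mul contDiff_id)).sub hA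
  have hfs : Function.support f ⊆ Set.Icc (Real.exp (-1)) 2 := by
    intro r hr
    by_contra hc
    apply hr
    rw [Set.mem_Icc, not_and_or, not_le, not_le] at hc
    rcases hc with h | h
    · have h1 : Real.exp 1 * r ≤ 1 := by
        have : Real.exp 1 * r ≤ Real.exp 1 * Real.exp (-1) := by gcongr
        rwa [← Real.exp_add, add_neg_cancel, Real.exp_zero] at this
      have h2 : r ≤ 1 := h.le.trans (by simp)
      simp [f, hA0 _ h1, hA0 _ h2]
    · have h1 : 2 ≤ Real.exp 1 * r := by nlinarith
      simp [f, hA1 _ h1, hA1 _ h.le]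
  have hfc : HasCompactSupport f :=
    HasCompactSupport.of_support_subset_isCompact isCompact_Icc hfs
  let L : ℤ → Space d →L[ℝ] ℝ := fun k => Real.exp (k : ℝ) • EuclideanSpace.proj 0
  have hL : ∀ k x, L k x = Real.exp (k : ℝ) * x 0 := fun k x => by simp [L]
  have hLn : ∀ k, ‖L k‖ ≤ Real.exp (k : ℝ) := fun k => by
    refine ContinuousLinearMap.opNorm_le_bound _ (Real.exp_pos _).le fun x => ?_
    rw [hL, norm_mul, Real.norm_of_nonneg (Real.exp_pos _).le]
    gcongr
    exact PiLp.norm_apply_le x 0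
  refine ⟨⟨2, by norm_num, fun k x => f (L k x), fun k => hf.comp (L k).contDiff, ?_, ?_, ?_, ?_⟩⟩
  · intro k x
    simp only [f, hL]
    rcases le_total 0 (x 0) with h | h
    · refine sub_nonneg.2 (hAm ?_)
      have : 0 ≤ Real.exp (k : ℝ) * x 0 := by positivity
      nlinarith
    · have h0 : Real.exp (k : ℝ) * x 0 ≤ 0 :=
        mul_nonpos_of_nonneg_of_nonpos (Real.exp_pos _).le h
      have h1 : Real.exp 1 * (Real.exp (k : ℝ) * x 0) ≤ 0 :=
        mul_nonpos_of_nonneg_of_nonpos (Real.exp_pos _).le h0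
      rw [hA0 _ (by linarith), hA0 _ (by linarith)]
      simp
  · intro k
    have hcl : IsClosed ((L k) ⁻¹' Set.Icc (Real.exp (-1)) 2) :=
      isClosed_Icc.preimage (L k).continuous
    have hsub : Function.support (fun x => f (L k x)) ⊆ (L k) ⁻¹' Set.Icc (Real.exp (-1)) 2 :=
      fun x hx => hfs hx
    refine (closure_minimal hsub hcl).trans fun x hx => ?_
    rw [Set.mem_preimage, hL, Set.mem_Icc] at hx
    have hx0 : x 0 = Real.exp (-(k : ℝ)) * (Real.exp (k : ℝ) * x 0) := by
      rw [← mul_assoc, ← Real.exp_add, neg_add_cancel, Real.exp_zero, one_mul]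
    constructor
    · rw [hx0, sub_eq_add_neg, Real.exp_add]
      refine mul_lt_mul_of_pos_left (lt_of_lt_of_le ?_ hx.1) (Real.exp_pos _)
      exact Real.exp_lt_exp.2 (by norm_num)
    · rw [hx0, Real.exp_add]
      refine mul_lt_mul_of_pos_left (lt_of_le_of_lt hx.2 ?_) (Real.exp_pos _)
      exact hec.trans (Real.exp_lt_exp.2 (by norm_num))
  · intro m
    obtain ⟨C, hC⟩ := (hf.continuous_iteratedFDeriv (m := m)
      (by exact_mod_cast le_top)).bounded_above_of_compact_support (hfc.iteratedFDeriv m)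
    refine ⟨C, fun k x => ?_⟩
    have h := (L k).iteratedFDeriv_comp_right hf x (i := m) (by exact_mod_cast le_top)
    have hC0 : 0 ≤ C := (norm_nonneg _).trans (hC 0)
    change ‖iteratedFDeriv ℝ m (f ∘ L k) x‖ ≤ _
    rw [h]
    refine (ContinuousMultilinearMap.norm_compContinuousLinearMap_le _ _).trans ?_
    rw [Finset.prod_const, Finset.card_univ, Fintype.card_fin, Real.exp_nat_mul]
    exact mul_le_mul (hC _) (pow_le_pow_left₀ (norm_nonneg _) (hLn k) m) (by positivity) hC0
  · intro x hx
    have key : ∀ k : ℤ, f (L k x) =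
        A (Real.exp ((k + 1 : ℤ) : ℝ) * x 0) - A (Real.exp (k : ℝ) * x 0) := fun k => by
      simp only [f, hL]
      rw [← mul_assoc, ← Real.exp_add]
      push_cast
      rw [add_comm (1 : ℝ)]
    simp only [key]
    set B : ℤ → ℝ := fun k => A (Real.exp (k : ℝ) * x 0) with hB
    have htop : Tendsto (fun n : ℕ => B n) atTop (𝓝 1) := by
      have : Tendsto (fun n : ℕ => Real.exp (((n : ℤ) : ℝ)) * x 0) atTop atTop := by
        refine Tendsto.atTop_mul_const hx (Real.tendsto_exp_atTop.comp ?_)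
        simpa using tendsto_natCast_atTop_atTop
      refine tendsto_const_nhds.congr' ?_
      filter_upwards [this.eventually_ge_atTop 2] with n hn
      exact (hA1 _ hn).symm
    have hbot : Tendsto (fun n : ℕ => B (-(n : ℤ))) atTop (𝓝 0) := by
      have : Tendsto (fun n : ℕ => Real.exp (((-(n : ℤ) : ℤ) : ℝ)) * x 0) atTop (𝓝 (0 * x 0)) := by
        refine Tendsto.mul_const _ (Real.tendsto_exp_neg_atTop_nhds_zero.comp
          (tendsto_natCast_atTop_atTop (R := ℝ)) |>.congr fun n => ?_)
        simp
      rw [zero_mul] at this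
      refine tendsto_const_nhds.congr' ?_
      filter_upwards [this.eventually_le_const zero_lt_one] with n hn
      exact (hA0 _ hn).symm
    have hmono : ∀ k : ℤ, 0 ≤ B (k + 1) - B k := fun k => by
      refine sub_nonneg.2 (hAm ?_)
      gcongr
      linarith
    have h1 : HasSum (fun n : ℕ => B ((n : ℤ) + 1) - B n) (1 - B 0) := by
      rw [hasSum_iff_tendsto_nat_of_nonneg fun n => hmono n]
      have := htop.sub_const (B 0)
      refine this.congr fun n => ?_
      have := Finset.sum_range_sub (fun n : ℕ => B n) n
      simpa using this.symm
    have h2 : HasSum (fun n : ℕ => B (-((n : ℤ) + 1) + 1) - B (-((n : ℤ) + 1))) (B 0 - 0) := by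
      rw [hasSum_iff_tendsto_nat_of_nonneg fun n => hmono _]
      have := hbot.const_sub (B 0)
      refine this.congr fun n => ?_
      have := Finset.sum_range_sub' (fun n : ℕ => B (-(n : ℤ))) n
      simpa [neg_add_rev, add_comm] using this.symm
    have h3 := HasSum.of_nat_of_neg_add_one (f := fun k : ℤ => B (k + 1) - B k) h1 h2
    rw [sub_zero, sub_add_cancel] at h3
    exact h3

/-- The test function `y ↦ ζ_{-k}(y) φ(e^{-k} y)` on the half-space. -/
def WeightPartition.pull {d : ℕ} (P : WeightPartition d) (k : ℤ) (φ : 𝓓((⊤ : Opens (Space d)), ℝ)) :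
    𝓓(halfSpace d, ℝ) where
  toFun y := P.ζ (-k) y * φ (Real.exp (-(k : ℝ)) • y)
  contDiff' := by
    have h1 : ContDiff ℝ ∞ (P.ζ (-k)) := P.contDiff (-k)
    have h2 : ContDiff ℝ ∞ (φ : Space d → ℝ) := φ.contDiff
    exact h1.mul (h2.comp (contDiff_const_smul _))
  hasCompactSupport' :=
    (φ.hasCompactSupport.comp_smul (Real.exp_ne_zero _)).mul_left
  tsupport_subset' := by
    refine (tsupport_mul_subset_left).trans ((P.tsupport_subset (-k)).trans ?_)
    intro x hx
    exact lt_trans (Real.exp_pos _) hx.1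

/-- A (real) test function on `ℝⁿ` as a complex-valued Schwartz function. -/
def toSchwartz {d : ℕ} (φ : 𝓓((⊤ : Opens (Space d)), ℝ)) : 𝓢(Space d, ℂ) :=
  HasCompactSupport.toSchwartzMap (f := fun x => (φ x : ℂ))
    (φ.hasCompactSupport.comp_left Complex.ofReal_zero)
    (Complex.ofRealCLM.contDiff.comp φ.contDiff)

/-- The tempered distribution `T` is the distribution `ζ_{-k}(e^k ·) u(e^k ·)` on `ℝⁿ`
(extended by zero), that is, `(T, φ) = e^{-kn} (u, ζ_{-k} φ(e^{-k} ·))` for all test functions. -/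
def WeightPartition.IsPiece {d : ℕ} (P : WeightPartition d) (k : ℤ) (u : 𝓓'(halfSpace d, ℂ))
    (T : 𝓢'(Space d, ℂ)) : Prop :=
  ∀ φ : 𝓓((⊤ : Opens (Space d)), ℝ),
    T (toSchwartz φ) = (Real.exp (-(k : ℝ) * ((d : ℝ) + 1)) : ℂ) * u (P.pull k φ)

/-- The norm of the Bessel potential space `H^γ_p(ℝⁿ)`: the `L_p`-norm of the function which
represents the Bessel potential of order `γ` of `T`, and `∞` if there is no such function. -/
def besselNorm {d : ℕ} (γ p : ℝ) (T : 𝓢'(Space d, ℂ)) : ℝ≥0∞ :=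
  ⨅ (h : Space d → ℂ) (_ : MemLp h (ENNReal.ofReal p) volume)
    (_ : ∀ φ : 𝓢(Space d, ℂ),
      TemperedDistribution.besselPotential (Space d) ℂ γ T φ = ∫ x, φ x * h x),
    eLpNorm h (ENNReal.ofReal p) volume

/-- The norm of `H^γ_{p,θ}(ℝⁿ₊)`:
`‖u‖^p = ∑_k e^{kθ} ‖ζ_{-k}(e^k ·) u(e^k ·)‖_{H^γ_p}^p`, with value `∞` outside of the space. -/
def hNorm {d : ℕ} (P : WeightPartition d) (γ θ p : ℝ) (u : 𝓓'(halfSpace d, ℂ)) : ℝ≥0∞ :=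
  (∑' k : ℤ, ENNReal.ofReal (Real.exp (k * θ)) *
    (⨅ (T : 𝓢'(Space d, ℂ)) (_ : P.IsPiece k u T), besselNorm γ p T) ^ p) ^ (1 / p)

/-! ### The parabolic spaces -/

/-- Measurability of a map from time to distributions, tested against `C_c^∞(ℝⁿ₊)`. As `H^γ_{p,θ}`
is separable and its norm is determined by test functions, this is strong measurability for maps
with values in `H^γ_{p,θ}` (Pettis). -/
def TimeMeasurable {d : ℕ} (u : ℝ → 𝓓'(halfSpace d, ℂ)) : Prop :=
  ∀ φ : 𝓓(halfSpace d, ℝ), AEMeasurable (fun t => u t φ) volume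

/-- The norm of `ℍ^γ_{p,θ}(ℝ) = L_p(ℝ; H^γ_{p,θ}(ℝⁿ₊))`. -/
def bigHNorm {d : ℕ} (P : WeightPartition d) (γ θ p : ℝ) (u : ℝ → 𝓓'(halfSpace d, ℂ)) : ℝ≥0∞ :=
  (∫⁻ t, hNorm P γ θ p (u t) ^ p) ^ (1 / p)

/-- `w = u_t`: for almost all `s, t` and all test functions `φ`,
`(u(t), φ) = (u(s), φ) + ∫_s^t (w(r), φ) dr`. -/
def IsTimeDeriv {d : ℕ} (u w : ℝ → 𝓓'(halfSpace d, ℂ)) : Prop :=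
  TimeMeasurable w ∧
  (∀ (φ : 𝓓(halfSpace d, ℝ)) (s t : ℝ), IntervalIntegrable (fun r => w r φ) volume s t) ∧
  ∀ᵐ s : ℝ, ∀ᵐ t : ℝ, ∀ φ : 𝓓(halfSpace d, ℝ), u t φ = u s φ + ∫ r in s..t, w r φ

/-- The norm of the solution space,
`‖u‖_{ℍ^{γ-1}_{p,θ}} + ‖Du‖_{ℍ^{γ-1}_{p,θ}} + ‖u_t‖_{ℍ^{γ-2}_{p,θ+p}}`. The derivative `u_t` is
unique up to null sets of times, so the infimum is over at most one class; it is `∞` if there is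
no `u_t`. -/
def solNorm {d : ℕ} (P : WeightPartition d) (γ θ p : ℝ) (u : ℝ → 𝓓'(halfSpace d, ℂ)) : ℝ≥0∞ :=
  bigHNorm P (γ - 1) θ p u
    + ∑ i : Fin (d + 1), bigHNorm P (γ - 1) θ p (fun t => ∂_{stdVec i} (u t))
    + ⨅ (w : ℝ → 𝓓'(halfSpace d, ℂ)) (_ : IsTimeDeriv u w), bigHNorm P (γ - 2) (θ + p) p w

/-- Membership in the solution space on `ℝ × ℝⁿ₊`. -/
def MemSol {d : ℕ} (P : WeightPartition d) (γ θ p : ℝ) (u : ℝ → 𝓓'(halfSpace d, ℂ)) : Prop :=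
  TimeMeasurable u ∧ solNorm P γ θ p u < ⊤

/-! ### Parabolic Slobodeckij spaces and traces -/

/-- The seminorm `[g]_{W_p^{s/2,0}}` on `ℝ × ℝⁿ⁻¹`. -/
def slobTime {d : ℕ} (s p : ℝ) (g : ℝ × Bdry d → ℂ) : ℝ≥0∞ :=
  (∫⁻ t : ℝ, ∫⁻ r : ℝ, (∫⁻ y : Bdry d, ‖g (r, y) - g (t, y)‖ₑ ^ p)
    / ‖t - r‖ₑ ^ (1 + s * p / 2)) ^ (1 / p)

/-- The seminorm `[g]_{W_p^{0,s}}` on `ℝ × ℝⁿ⁻¹`. -/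
def slobSpace {d : ℕ} (s p : ℝ) (g : ℝ × Bdry d → ℂ) : ℝ≥0∞ :=
  (∫⁻ t : ℝ, ∫⁻ y : Bdry d, ∫⁻ z : Bdry d,
    ‖g (t, y) - g (t, z)‖ₑ ^ p / ‖y - z‖ₑ ^ ((d : ℝ) + s * p)) ^ (1 / p)

/-- The norm of `W_p^{s/2,s}(ℝ × ℝⁿ⁻¹)`. -/
def slobNorm {d : ℕ} (s p : ℝ) (g : ℝ × Bdry d → ℂ) : ℝ≥0∞ :=
  eLpNorm g (ENNReal.ofReal p) volume + slobTime s p g + slobSpace s p g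

/-- Membership in `W_p^{s/2,s}(ℝ × ℝⁿ⁻¹)`. -/
def MemSlob {d : ℕ} (s p : ℝ) (g : ℝ × Bdry d → ℂ) : Prop :=
  AEStronglyMeasurable g volume ∧ slobNorm s p g < ⊤

/-- A function on space, restricted to the half-space, as a distribution
`φ ↦ ∫ φ f` (for `f` locally integrable on the half-space). -/
def distOf {d : ℕ} (f : Space d → ℂ) : 𝓓'(halfSpace d, ℂ) :=
  ContinuousLinearMap.toUniformConvergenceCLM _ _ _
    (TestFunction.integralAgainstBilinCLM (ContinuousLinearMap.lsmul ℝ ℝ) volume f)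

/-- `𝒯 u = g`. The trace operator is the extension by continuity, from the space of order `γ = 1` to
`W_p^{s/2,s}`, of the restriction `φ ↦ φ|_{x₁ = 0}` of the functions that are smooth and compactly
supported on the closed half-space-time: some such `φ_m` converge to `u` with `φ_m|_{x₁ = 0}`
converging to `g`. -/
def HasTrace {d : ℕ} (P : WeightPartition d) (θ s p : ℝ) (u : ℝ → 𝓓'(halfSpace d, ℂ))
    (g : ℝ × Bdry d → ℂ) : Prop :=
  MemSol P 1 θ p u ∧ MemSlob s p g ∧
  ∃ φ : ℕ → ℝ × Space d → ℂ, (∀ m, ContDiff ℝ ∞ (φ m) ∧ HasCompactSupport (φ m)) ∧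
    Tendsto (fun m => solNorm P 1 θ p (fun t => u t - distOf (fun x => φ m (t, x))))
      atTop (𝓝 0) ∧
    Tendsto (fun m => slobNorm s p (fun q => g q - φ m (q.1, mkPoint 0 q.2))) atTop (𝓝 0)

/-! ### The extension by the boundary Poisson kernel of the heat equation -/

/-- `p(t, x) = 1_{t>0} (4πt)^{-n/2} (x₁/t) e^{-|x|²/(4t)}`. -/
def poissonKernel {d : ℕ} (t : ℝ) (x : Space d) : ℝ :=
  if 0 < t then
    1 / (4 * Real.pi * t) ^ (((d : ℝ) + 1) / 2) * (x 0 / t) * Real.exp (-‖x‖ ^ 2 / (4 * t))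
  else 0

/-- The integrand `p(t - s, x₁, x' - y') g(s, y')` at `(s, y')`. -/
def poissonIntegrand {d : ℕ} (g : ℝ × Bdry d → ℂ) (t : ℝ) (x : Space d) (q : ℝ × Bdry d) : ℂ :=
  (poissonKernel (t - q.1) (mkPoint (x 0) (tang x - q.2)) : ℂ) * g q

/-- `v(t, x) = ∫∫ p(t - s, x₁, x' - y') g(s, y') dy' ds`. -/
def poissonExt {d : ℕ} (g : ℝ × Bdry d → ℂ) (t : ℝ) (x : Space d) : ℂ :=
  ∫ q : ℝ × Bdry d, poissonIntegrand g t x q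

/-- A smooth cut-off in `x₁`, equal to `1` for `x₁ ≤ 1` and to `0` for `x₁ ≥ 2`. -/
def IsCutoff (η : ℝ → ℝ) : Prop :=
  ContDiff ℝ ∞ η ∧ (∀ r ≤ 1, η r = 1) ∧ ∀ r, 2 ≤ r → η r = 0

/-- `u(t, x) = η(x₁) v(t, x)`. -/
def cutExt {d : ℕ} (η : ℝ → ℝ) (g : ℝ × Bdry d → ℂ) (t : ℝ) (x : Space d) : ℂ :=
  (η (x 0) : ℂ) * poissonExt g t x

/-- The partial derivative `D_{J 0} ⋯ D_{J (m-1)} f`; as `J` varies these are the `D^α f`,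
`|α| = m`. -/
def partialD {d m : ℕ} (J : Fin m → Fin (d + 1)) (f : Space d → ℂ) (x : Space d) : ℂ :=
  iteratedFDeriv ℝ m f x (fun i => stdVec (J i))

/-- The norm `(∫_ℝ ∫_{ℝⁿ₊} |f(t,x)|^p x₁^{θ-n} dx dt)^{1/p}` of `𝕃_{p,θ}(ℝ)`. -/
def weightedLp {d : ℕ} (θ p : ℝ) (f : ℝ → Space d → ℂ) : ℝ≥0∞ :=
  (∫⁻ t : ℝ, ∫⁻ x in (halfSpace d : Set (Space d)),
    ‖f t x‖ₑ ^ p * ENNReal.ofReal ((x 0) ^ (θ - ((d : ℝ) + 1)))) ^ (1 / p)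

/-- `f` is infinitely differentiable in `ℝ × ℝⁿ₊`. -/
def SmoothInside {d : ℕ} (f : ℝ → Space d → ℂ) : Prop :=
  ContDiffOn ℝ ∞ (fun q : ℝ × Space d => f q.1 q.2) {q | 0 < q.2 0}

end WeightedTrace

end

open WeightedTrace

noncomputable section

namespace WeightedTrace

/-! The Poisson kernel is smooth away from the space-time origin and homogeneous of degree `-(d +
2)` under `(t, x) ↦ (l² t, l x)`. A derivative in space therefore costs one power of the parabolic
distance `gauge`, a derivative in time two (`IsHomogKer.exists_bound`). The kernel has mass one on
every layer `x₁ = const` (`lintegral_bdKer`), so in each derivative of `v` at `(t, x)` the data may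
be replaced by `g - g (t, x')`. Since `x₁ ≤ gauge`, all the scaled derivatives `x₁ ^ m D ^ (m + 1)
v` and `x₁ ^ (m + 1) D ^ m v_t` are bounded by one function, the `majorant` of exponent `d + 3`,
which integrates the increments of `g` against `gauge ^ (-(d + 3))` (`djet_conv_le`).

The weighted `L_p` norm of the majorant is controlled by the Slobodeckij seminorms
(`exists_lintegral_majorant_le`). Hölder's inequality brings the `p`-th power inside, and
integration in the normal variable leaves the increments of `g` against the parabolic distance of
two boundary points to the power `-(d + 2 + s p)`. The relation between `s` and `θ` is what makes
the exponents match. The function `v` itself is estimated only where `x₁ ≤ 2`, which is the purpose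
of the cut-off: each layer is an `L_p` contraction of `g`, and `θ > d` makes the weight integrable
at the boundary.

For an arbitrary `γ` the Bessel norm is dominated by a classical Sobolev norm of even order `2k >
γ`: even potentials are differential operators, and a potential of negative order is convolution
with a probability measure. Rescaling the pieces of the partition of unity turns `D ^ j` into `x₁ ^
j D ^ j`, so the norm of the solution space is bounded by the weighted integral of the scaled
derivatives (`exists_solNorm_le`).

For the trace, `u` is approximated by `χ(ε z) η(x₁) v(t, x + ε e₁)`, continued smoothly to `x₁ < 0`.
The scaled derivatives of the difference tend to 0 pointwise and have a bound independent of `ε`,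
the one already known to be integrable. On the boundary the approximation is `χ(ε ·)` times the
layer of `v` at height `ε`, an approximate identity applied to `g`. The `L_p` increments of a layer
do not exceed those of `g`, so dominated convergence applies to both seminorms
(`tendsto_slobNorm_remainder`). -/

/-! ### The heat kernel away from the origin -/

/-- The flat function `w ↦ 1_{w > 0} w ^ (-r) e ^ (-1 / w)`. -/
def flat (r w : ℝ) : ℝ := if 0 < w then w ^ (-r) * Real.exp (-w⁻¹) else 0

theorem flat_of_pos {r w : ℝ} (hw : 0 < w) : flat r w = w ^ (-r) * Real.exp (-w⁻¹) := if_pos hw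

theorem flat_of_nonpos {r w : ℝ} (hw : w ≤ 0) : flat r w = 0 := if_neg hw.not_gt

theorem tendsto_flat_zero (r : ℝ) : Tendsto (flat r) (𝓝 0) (𝓝 0) := by
  rw [show 𝓝 (0 : ℝ) = 𝓝[≤] 0 ⊔ 𝓝[>] 0 from nhdsLE_sup_nhdsGT 0 |>.symm,
    tendsto_sup, nhdsLE_sup_nhdsGT]
  refine ⟨?_, ?_⟩
  · refine tendsto_const_nhds.congr' ?_
    filter_upwards [self_mem_nhdsWithin] with w hw
    exact (flat_of_nonpos hw).symm
  · refine ((tendsto_rpow_mul_exp_neg_mul_atTop_nhds_zero r 1 one_pos).comp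
      tendsto_inv_nhdsGT_zero).congr' ?_
    filter_upwards [self_mem_nhdsWithin] with w hw
    have hw : 0 < w := hw
    rw [flat_of_pos hw, Function.comp_apply, Real.inv_rpow hw.le, Real.rpow_neg hw.le]
    simp

/-- The family is closed under differentiation, which makes every member smooth at 0. The difference
quotient of `flat r` at 0 is `flat (r + 1)`, and this tends to 0. -/
theorem hasDerivAt_flat (r w : ℝ) :
    HasDerivAt (flat r) (flat (r + 2) w - r * flat (r + 1) w) w := by
  rcases lt_trichotomy w 0 with hw | rfl | hw
  · have : flat r =ᶠ[𝓝 w] fun _ => 0 := by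
      filter_upwards [gt_mem_nhds hw] with y hy using flat_of_nonpos hy.le
    rw [flat_of_nonpos hw.le, flat_of_nonpos hw.le]
    simpa using (hasDerivAt_const w (0 : ℝ)).congr_of_eventuallyEq this
  · rw [hasDerivAt_iff_tendsto_slope_zero, flat_of_nonpos le_rfl, flat_of_nonpos le_rfl,
      flat_of_nonpos le_rfl]
    have h := (tendsto_flat_zero (r + 1)).mono_left (nhdsWithin_le_nhds (s := {0}ᶜ))
    simp only [mul_zero, sub_zero, zero_add, smul_eq_mul]
    refine h.congr' ?_
    filter_upwards [self_mem_nhdsWithin] with t ht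
    rcases lt_or_gt_of_ne ht with ht | ht
    · simp [flat_of_nonpos ht.le]
    · rw [flat_of_pos ht, flat_of_pos ht, neg_add, Real.rpow_add ht, Real.rpow_neg_one]
      ring
  · have h1 : HasDerivAt (fun w : ℝ => w ^ (-r) * Real.exp (-w⁻¹))
        ((-r * w ^ (-r - 1)) * Real.exp (-w⁻¹)
          + w ^ (-r) * (Real.exp (-w⁻¹) * -(-(w ^ 2)⁻¹))) w :=
      (Real.hasDerivAt_rpow_const (Or.inl hw.ne')).mul
        ((hasDerivAt_inv hw.ne').neg.exp)
    have : flat r =ᶠ[𝓝 w] fun w => w ^ (-r) * Real.exp (-w⁻¹) := by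
      filter_upwards [lt_mem_nhds hw] with y hy using flat_of_pos hy
    refine (h1.congr_of_eventuallyEq this).congr_deriv ?_
    rw [flat_of_pos hw, flat_of_pos hw, neg_add, neg_add, Real.rpow_add hw, Real.rpow_add hw,
      Real.rpow_neg_one, Real.rpow_sub hw, Real.rpow_neg hw.le 2, Real.rpow_one, Real.rpow_two]
    ring

theorem contDiff_flat (r : ℝ) : ContDiff ℝ ∞ (flat r) := by
  rw [contDiff_infty]
  intro n
  -- The exponent has to vary, as the derivative of `flat r` involves `flat (r + 1)` and `flat (r +
  -- 2)`.
  induction n generalizing r with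
  | zero =>
    exact contDiff_zero.2 (continuous_iff_continuousAt.2 fun w => (hasDerivAt_flat r w).continuousAt)
  | succ n ih =>
    push_cast
    refine contDiff_succ_iff_deriv.2 ⟨fun w => (hasDerivAt_flat r w).differentiableAt, by simp, ?_⟩
    rw [show deriv (flat r) = fun w => flat (r + 2) w - r * flat (r + 1) w from
      funext fun w => (hasDerivAt_flat r w).deriv]
    exact (ih _).sub (contDiff_const.mul (ih _))

/-- The parabolic dilation `(t, x) ↦ (l² t, l x)`. -/
def dil {d : ℕ} (l : ℝ) (hl : l ≠ 0) : (ℝ × Space d) ≃L[ℝ] (ℝ × Space d) :=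
  (ContinuousLinearEquiv.smulLeft (Units.mk0 (l ^ 2) (pow_ne_zero 2 hl))).prodCongr
    (ContinuousLinearEquiv.smulLeft (Units.mk0 l hl))

theorem dil_apply {d : ℕ} (l : ℝ) (hl : l ≠ 0) (z : ℝ × Space d) :
    dil l hl z = (l ^ 2 * z.1, l • z.2) := rfl

/-- The kernel `1_{t > 0} (4πt) ^ (-n/2) t⁻¹ e ^ (-|x|² / (4t))`. -/
def heatKer {d : ℕ} (z : ℝ × Space d) : ℝ :=
  if 0 < z.1 then
    1 / (4 * Real.pi * z.1) ^ (((d : ℝ) + 1) / 2) * (1 / z.1) * Real.exp (-‖z.2‖ ^ 2 / (4 * z.1))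
  else 0

theorem poissonKernel_eq {d : ℕ} (t : ℝ) (x : Space d) :
    poissonKernel t x = x 0 * heatKer (t, x) := by
  unfold poissonKernel heatKer
  split_ifs <;> ring

theorem heatKer_nonneg {d : ℕ} (z : ℝ × Space d) : 0 ≤ heatKer z := by
  unfold heatKer
  split_ifs <;> positivity

/-- The prefactor scales with `l ^ (-(d + 1))` and `1 / t` with `l ^ (-2)`; the argument of the
exponential is invariant. -/
theorem heatKer_dil {d : ℕ} (l : ℝ) (hl : 0 < l) (z : ℝ × Space d) :
    heatKer (dil l hl.ne' z) = (l ^ (d + 3))⁻¹ * heatKer z := by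
  rw [dil_apply]
  unfold heatKer
  have h : 0 < l ^ 2 * z.1 ↔ 0 < z.1 := by constructor <;> intro h <;> [skip; positivity]
                                           exact pos_of_mul_pos_right h (by positivity)
  simp only [h]
  split_ifs with hz
  · rw [norm_smul, Real.norm_of_nonneg hl.le,
      show 4 * Real.pi * (l ^ 2 * z.1) = l ^ 2 * (4 * Real.pi * z.1) by ring,
      Real.mul_rpow (by positivity) (by positivity), ← Real.rpow_natCast l 2, ← Real.rpow_mul hl.le]
    have e1 : l ^ (((2 : ℕ) : ℝ) * (((d : ℝ) + 1) / 2)) = l ^ (d + 1) := by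
      rw [← Real.rpow_natCast]; congr 1; push_cast; ring
    have e2 : -(l * ‖z.2‖) ^ 2 / (4 * (l ^ (((2 : ℕ) : ℝ)) * z.1)) = -‖z.2‖ ^ 2 / (4 * z.1) := by
      rw [Real.rpow_natCast]; field_simp
    rw [e1, e2, Real.rpow_natCast]
    field_simp
    ring
  · simp

/-- With `A = ‖x‖² / 4` the exponential is `e ^ (-A / t)`, so the kernel is a power of `A` times a
flat function of `t / A`. This form shows the smoothness across `t = 0` for `x ≠ 0`, which the
defining formula hides. -/
theorem heatKer_eq_flat {d : ℕ} {z : ℝ × Space d} (hz : z.2 ≠ 0) :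
    heatKer z = (4 * Real.pi) ^ (-(((d : ℝ) + 1) / 2)) *
      ((‖z.2‖ ^ 2 / 4) ^ (-(((d : ℝ) + 3) / 2)) *
        flat (((d : ℝ) + 3) / 2) (z.1 / (‖z.2‖ ^ 2 / 4))) := by
  have hA : 0 < ‖z.2‖ ^ 2 / 4 := by have := norm_pos_iff.2 hz; positivity
  set A := ‖z.2‖ ^ 2 / 4 with hAdef
  by_cases h : 0 < z.1
  · rw [flat_of_pos (by positivity), heatKer, if_pos h, ← mul_assoc (A ^ _),
      ← Real.mul_rpow hA.le (by positivity), mul_div_cancel₀ _ hA.ne',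
      Real.mul_rpow (by positivity) h.le, Real.rpow_neg (by positivity), Real.rpow_neg h.le,
      show ((d : ℝ) + 3) / 2 = (d + 1) / 2 + 1 by ring, Real.rpow_add h, Real.rpow_one,
      show -‖z.2‖ ^ 2 / (4 * z.1) = -(z.1 / A)⁻¹ by rw [hAdef]; field_simp]
    field_simp
  · rw [flat_of_nonpos (div_nonpos_of_nonpos_of_nonneg (not_lt.1 h) hA.le), heatKer, if_neg h]
    simp

/-- If `x = 0` and `t ≠ 0`, the kernel is locally zero or locally given by its formula; if `x ≠ 0`,
`heatKer_eq_flat` passes through `t = 0`. -/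
theorem contDiffOn_heatKer {d : ℕ} : ContDiffOn ℝ ∞ (heatKer (d := d)) {0}ᶜ := by
  intro z hz
  refine ContDiffAt.contDiffWithinAt ?_
  by_cases h2 : z.2 = 0
  · have h1 : z.1 ≠ 0 := fun h1 => hz (Prod.ext h1 h2)
    rcases lt_or_gt_of_ne h1 with h1 | h1
    · have : heatKer =ᶠ[𝓝 z] fun _ => 0 := by
        filter_upwards [(continuous_fst.tendsto z).eventually (gt_mem_nhds h1)] with y hy
        exact if_neg hy.not_gt
      exact contDiffAt_const.congr_of_eventuallyEq this
    · have : heatKer =ᶠ[𝓝 z] fun z : ℝ × Space d => 1 / (4 * Real.pi * z.1) ^ (((d : ℝ) + 1) / 2)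
          * (1 / z.1) * Real.exp (-‖z.2‖ ^ 2 / (4 * z.1)) := by
        filter_upwards [(continuous_fst.tendsto z).eventually (lt_mem_nhds h1)] with y hy
        exact if_pos hy
      refine ContDiffAt.congr_of_eventuallyEq ?_ this
      have hne : 4 * Real.pi * z.1 ≠ 0 := by positivity
      refine ((contDiffAt_const.div ((contDiffAt_const.mul contDiffAt_fst).rpow_const_of_ne hne)
        ?_).mul (contDiffAt_const.div contDiffAt_fst h1.ne')).mul ?_
      · positivity
      · refine (ContDiffAt.div ?_ (contDiffAt_const.mul contDiffAt_fst) (by positivity)).exp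
        exact (contDiffAt_snd.norm_sq ℝ).neg
  · have : heatKer =ᶠ[𝓝 z] fun z : ℝ × Space d => (4 * Real.pi) ^ (-(((d : ℝ) + 1) / 2)) *
      ((‖z.2‖ ^ 2 / 4) ^ (-(((d : ℝ) + 3) / 2)) *
        flat (((d : ℝ) + 3) / 2) (z.1 / (‖z.2‖ ^ 2 / 4))) := by
      filter_upwards [(continuous_snd.tendsto z).eventually (isOpen_ne.mem_nhds h2)] with y hy
      exact heatKer_eq_flat hy
    refine ContDiffAt.congr_of_eventuallyEq ?_ this
    have hA : ContDiffAt ℝ ∞ (fun z : ℝ × Space d => ‖z.2‖ ^ 2 / 4) z :=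
      (contDiffAt_snd.norm_sq ℝ).div_const _
    have hA0 : ‖z.2‖ ^ 2 / 4 ≠ 0 := by have := norm_pos_iff.2 h2; positivity
    exact contDiffAt_const.mul ((hA.rpow_const_of_ne hA0).mul
      ((contDiff_flat _).contDiffAt.comp z (contDiffAt_fst.div hA hA0)))

/-! ### Parabolically homogeneous kernels -/

/-- The parabolic distance to the origin. -/
def gauge {d : ℕ} (z : ℝ × Space d) : ℝ := |z.2 0| + ‖tang z.2‖ + √|z.1|

/-- Functions that are smooth away from the origin and parabolically homogeneous of degree `-a`. -/
structure IsHomogKer {d : ℕ} (a : ℕ) (K : ℝ × Space d → ℂ) : Prop where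
  smooth : ContDiffOn ℝ ∞ K {0}ᶜ
  hom : ∀ (l : ℝ) (hl : 0 < l) (z : ℝ × Space d), K (dil l hl.ne' z) = ((l ^ a)⁻¹ : ℝ) • K z

theorem isHomogKer_heatKer {d : ℕ} : IsHomogKer (d + 3) fun z : ℝ × Space d => (heatKer z : ℂ) where
  smooth := Complex.ofRealCLM.contDiff.comp_contDiffOn contDiffOn_heatKer
  hom l hl z := by rw [heatKer_dil _ hl]; simp

/-- The Poisson kernel as a function on space-time. -/
def poisKer {d : ℕ} (z : ℝ × Space d) : ℂ := (poissonKernel z.1 z.2 : ℂ)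

theorem poisKer_eq {d : ℕ} (z : ℝ × Space d) : poisKer z = ((z.2 0 : ℝ) : ℂ) * (heatKer z : ℂ) := by
  rw [poisKer, poissonKernel_eq]; push_cast; rfl

theorem isHomogKer_poisKer {d : ℕ} : IsHomogKer (d + 2) (poisKer (d := d)) where
  smooth := by
    rw [show poisKer (d := d) = fun z => ((z.2 0 : ℝ) : ℂ) * (heatKer z : ℂ) from funext poisKer_eq]
    refine ContDiffOn.mul ?_ isHomogKer_heatKer.smooth
    exact (Complex.ofRealCLM.contDiff.comp (by fun_prop)).contDiffOn
  hom l hl z := by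
    rw [poisKer_eq, poisKer_eq, heatKer_dil _ hl, dil_apply]
    have : (l : ℂ) ≠ 0 := by exact_mod_cast hl.ne'
    simp
    field_simp
    ring

/-- The time derivative of a homogeneous kernel. -/
def timeDeriv {d : ℕ} (K : ℝ × Space d → ℂ) (z : ℝ × Space d) : ℂ := fderiv ℝ K z (1, 0)

/-- The dilation multiplies the direction `(1, 0)` by `l ^ 2`, so the chain rule yields two more
powers. -/
theorem IsHomogKer.timeDeriv {d a : ℕ} {K : ℝ × Space d → ℂ} (h : IsHomogKer a K) :
    IsHomogKer (a + 2) (timeDeriv K) where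
  smooth := by
    have : ContDiffOn ℝ ∞ (fderiv ℝ K) {0}ᶜ :=
      h.smooth.fderiv_of_isOpen isOpen_compl_singleton (by simp)
    exact this.clm_apply contDiffOn_const
  hom l hl z := by
    have h1 : (fun z => K (dil l hl.ne' z)) = fun z => ((l ^ a)⁻¹ : ℝ) • K z := funext (h.hom l hl)
    have h2 : fderiv ℝ (K ∘ dil l hl.ne') z = _ := (dil l hl.ne').comp_right_fderiv
    have h3 : fderiv ℝ (K ∘ dil l hl.ne') z = ((l ^ a)⁻¹ : ℝ) • fderiv ℝ K z := by
      change fderiv ℝ (fun z => K (dil l hl.ne' z)) z = _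
      rw [h1]
      exact congrFun (fderiv_const_smul_field (𝕜 := ℝ) (f := K) ((l ^ a)⁻¹ : ℝ)) z
    rw [h3] at h2
    have h4 := congr($h2 (1, 0))
    simp only [_root_.smul_apply, ContinuousLinearMap.comp_apply,
      ContinuousLinearEquiv.coe_coe] at h4
    have h5 : dil (d := d) l hl.ne' (1, 0) = (l ^ 2) • ((1 : ℝ), (0 : Space d)) := by
      rw [dil_apply]; simp
    rw [h5, map_smul] at h4
    unfold WeightedTrace.timeDeriv
    rw [pow_add, mul_inv, mul_comm, mul_smul, h4, smul_smul, inv_mul_cancel₀ (by positivity),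
      one_smul]

theorem IsHomogKer.iteratedFDeriv_dil {d a : ℕ} {K : ℝ × Space d → ℂ} (h : IsHomogKer a K) (m : ℕ)
    (l : ℝ) (hl : 0 < l) (z : ℝ × Space d) (hz : z ≠ 0) (v : Fin m → ℝ × Space d) :
    iteratedFDeriv ℝ m K (dil l hl.ne' z) (fun i => dil l hl.ne' (v i))
      = ((l ^ a)⁻¹ : ℝ) • iteratedFDeriv ℝ m K z v := by
  have h1 : (K ∘ dil l hl.ne') = fun z => ((l ^ a)⁻¹ : ℝ) • K z := funext (h.hom l hl)
  have h2 := (dil (d := d) l hl.ne').iteratedFDerivWithin_comp_right K uniqueDiffOn_univ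
    (x := z) (Set.mem_univ _) m
  simp only [Set.preimage_univ, iteratedFDerivWithin_univ] at h2
  have h3 : ContDiffAt ℝ m K z := (h.smooth.contDiffAt
    (isOpen_compl_singleton.mem_nhds hz)).of_le (by exact_mod_cast le_top)
  rw [h1, iteratedFDeriv_const_smul_apply' h3] at h2
  exact congr($h2 v).symm

theorem gauge_nonneg {d : ℕ} (z : ℝ × Space d) : 0 ≤ gauge z := by unfold gauge; positivity

theorem tang_add {d : ℕ} (x y : Space d) : tang (x + y) = tang x + tang y := rfl

theorem tang_sub {d : ℕ} (x y : Space d) : tang (x - y) = tang x - tang y := rfl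

theorem tang_smul {d : ℕ} (c : ℝ) (x : Space d) : tang (c • x) = c • tang x := rfl

@[simp] theorem tang_mkPoint {d : ℕ} (r : ℝ) (y : Bdry d) : tang (mkPoint r y) = y := rfl

@[simp] theorem mkPoint_zero {d : ℕ} (r : ℝ) (y : Bdry d) : mkPoint r y 0 = r := rfl

@[simp] theorem mkPoint_tang {d : ℕ} (x : Space d) : mkPoint (x 0) (tang x) = x := by
  ext i
  refine Fin.cases rfl (fun i => rfl) i

@[fun_prop] theorem continuous_tang {d : ℕ} : Continuous (tang (d := d)) := by
  unfold tang; fun_prop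

@[fun_prop] theorem continuous_gauge {d : ℕ} : Continuous (gauge (d := d)) := by
  unfold gauge; fun_prop

theorem norm_sq_eq {d : ℕ} (x : Space d) : ‖x‖ ^ 2 = (x 0) ^ 2 + ‖tang x‖ ^ 2 := by
  rw [EuclideanSpace.norm_sq_eq, EuclideanSpace.norm_sq_eq, Fin.sum_univ_succ]
  simp [tang]

theorem norm_le_add {d : ℕ} (x : Space d) : ‖x‖ ≤ |x 0| + ‖tang x‖ := by
  have := norm_sq_eq x
  refine (sq_le_sq₀ (norm_nonneg _) (by positivity)).1 ?_
  nlinarith [sq_abs (x 0), mul_nonneg (abs_nonneg (x 0)) (norm_nonneg (tang x))]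

theorem gauge_dil {d : ℕ} (l : ℝ) (hl : 0 < l) (z : ℝ × Space d) :
    gauge (dil l hl.ne' z) = l * gauge z := by
  rw [dil_apply]
  simp only [gauge, tang_smul, norm_smul, PiLp.smul_apply, smul_eq_mul, abs_mul, abs_of_pos hl,
    Real.norm_eq_abs, abs_pow]
  rw [Real.sqrt_mul (by positivity), Real.sqrt_sq hl.le]
  ring

theorem gauge_neg {d : ℕ} (z : ℝ × Space d) : gauge (-z) = gauge z := by
  have : tang (-z.2) = -tang z.2 := rfl
  simp [gauge, this]

theorem gauge_add_le {d : ℕ} (z w : ℝ × Space d) : gauge (z + w) ≤ gauge z + gauge w := by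
  have h1 : |z.2 0 + w.2 0| ≤ |z.2 0| + |w.2 0| := abs_add_le _ _
  have h2 : ‖tang z.2 + tang w.2‖ ≤ ‖tang z.2‖ + ‖tang w.2‖ := norm_add_le _ _
  have h3 : √|z.1 + w.1| ≤ √|z.1| + √|w.1| :=
    by
    refine Real.sqrt_le_iff.2 ⟨by positivity, ?_⟩
    have := abs_add_le z.1 w.1
    nlinarith [Real.sq_sqrt (abs_nonneg z.1), Real.sq_sqrt (abs_nonneg w.1),
      mul_nonneg (Real.sqrt_nonneg |z.1|) (Real.sqrt_nonneg |w.1|)]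
  simp only [gauge, Prod.fst_add, Prod.snd_add, PiLp.add_apply, tang_add]
  linarith

theorem gauge_zero {d : ℕ} : gauge (0 : ℝ × Space d) = 0 := by
  have : tang (0 : Space d) = 0 := rfl
  simp [gauge, this]

theorem isCompact_gauge_sphere {d : ℕ} : IsCompact {z : ℝ × Space d | gauge z = 1} := by
  refine Metric.isCompact_of_isClosed_isBounded (isClosed_eq continuous_gauge continuous_const) ?_
  refine (Metric.isBounded_closedBall (x := (0 : ℝ × Space d)) (r := 1)).subset fun z hz => ?_
  have hz : |z.2 0| + ‖tang z.2‖ + √|z.1| = 1 := hz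
  have h1 := Real.sqrt_nonneg |z.1|
  rw [mem_closedBall_zero_iff, Prod.norm_def, max_le_iff]
  constructor
  · rw [Real.norm_eq_abs]
    exact Real.sqrt_le_one.1 (by linarith [abs_nonneg (z.2 0), norm_nonneg (tang z.2)])
  · exact (norm_le_add _).trans (by linarith)

/-- Dilating by `gauge z` moves `z` to the unit sphere of the gauge, which is compact and avoids the
origin. The directions are kept in dilated form, so that time and space can be weighed separately
afterwards. -/
theorem IsHomogKer.exists_bound {d a : ℕ} {K : ℝ × Space d → ℂ} (h : IsHomogKer a K) (m : ℕ) :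
    ∃ C : ℝ, 0 ≤ C ∧ ∀ z : ℝ × Space d, ∀ hz : 0 < gauge z, ∀ v : Fin m → ℝ × Space d,
      ‖iteratedFDeriv ℝ m K z v‖ ≤
        C * (gauge z ^ a)⁻¹ * ∏ i, ‖(dil (gauge z) hz.ne').symm (v i)‖ := by
  have hsub : {z : ℝ × Space d | gauge z = 1} ⊆ {0}ᶜ := by
    intro z hz h0
    rw [Set.mem_singleton_iff] at h0
    rw [h0, Set.mem_ofPred_eq, gauge_zero] at hz
    exact zero_ne_one hz
  have hc : ContinuousOn (iteratedFDeriv ℝ m K) {0}ᶜ := by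
    refine (h.smooth.continuousOn_iteratedFDerivWithin (m := m) (by exact_mod_cast le_top)
      isOpen_compl_singleton.uniqueDiffOn).congr fun z hz => ?_
    exact (iteratedFDerivWithin_of_isOpen m isOpen_compl_singleton hz).symm
  obtain ⟨C, hC⟩ := isCompact_gauge_sphere.exists_bound_of_continuousOn (hc.mono hsub)
  refine ⟨max C 0, le_max_right _ _, fun z hz v => ?_⟩
  set l := gauge z
  set w := (dil l hz.ne').symm z
  have hw : dil l hz.ne' w = z := (dil l hz.ne').apply_symm_apply z
  have hw1 : gauge w = 1 := by
    have h1 := gauge_dil l hz w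
    rw [hw] at h1
    exact mul_left_cancel₀ hz.ne' (by rw [← h1, mul_one])
  have key := h.iteratedFDeriv_dil m l hz w (hsub hw1) fun i => (dil l hz.ne').symm (v i)
  simp only [ContinuousLinearEquiv.apply_symm_apply, hw] at key
  rw [key, norm_smul, Real.norm_of_nonneg (by positivity), mul_comm (max C 0), mul_assoc]
  gcongr
  refine (ContinuousMultilinearMap.le_opNorm _ _).trans ?_
  gcongr
  exact (hC w hw1).trans (le_max_left _ _)

theorem dil_symm_apply {d : ℕ} (l : ℝ) (hl : l ≠ 0) (z : ℝ × Space d) :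
    (dil l hl).symm z = ((l ^ 2)⁻¹ * z.1, l⁻¹ • z.2) := by
  rw [ContinuousLinearEquiv.symm_apply_eq, dil_apply]
  ext <;> simp [hl]

/-- A spatial direction scales exactly with `(gauge z)⁻¹`, so the constant needs no lower bound of
the gauge. -/
theorem IsHomogKer.exists_spatial_bound {d a : ℕ} {K : ℝ × Space d → ℂ} (h : IsHomogKer a K)
    (m : ℕ) : ∃ C : ℝ, 0 ≤ C ∧ ∀ z : ℝ × Space d, 0 < gauge z →
      ‖(iteratedFDeriv ℝ m K z).compContinuousLinearMap
        (fun _ => ContinuousLinearMap.inr ℝ ℝ (Space d))‖ ≤ C * (gauge z ^ (a + m))⁻¹ := by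
  obtain ⟨C, hC0, hC⟩ := h.exists_bound m
  refine ⟨C, hC0, fun z hz => ContinuousMultilinearMap.opNorm_le_bound (by positivity) fun v => ?_⟩
  rw [ContinuousMultilinearMap.compContinuousLinearMap_apply]
  refine (hC z hz _).trans (le_of_eq ?_)
  have : ∀ i, ‖(dil (gauge z) hz.ne').symm (ContinuousLinearMap.inr ℝ ℝ (Space d) (v i))‖
      = (gauge z)⁻¹ * ‖v i‖ := fun i => by
    rw [dil_symm_apply]
    have : 0 ≤ (gauge z)⁻¹ * ‖v i‖ := mul_nonneg (inv_nonneg.2 hz.le) (norm_nonneg _)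
    simpa [Prod.norm_def, norm_smul, abs_of_pos hz] using this
  simp_rw [this, Finset.prod_mul_distrib, Finset.prod_const, Finset.card_univ, Fintype.card_fin]
  rw [pow_add, mul_inv, inv_pow]
  ring

/-- A time direction scales with `(gauge z)⁻²`. One of these two powers is estimated by `δ⁻¹`,
whence the factor `(max δ⁻¹ 1) ^ m`. -/
theorem IsHomogKer.exists_joint_bound {d a : ℕ} {K : ℝ × Space d → ℂ} (h : IsHomogKer a K)
    (m : ℕ) {δ : ℝ} (hδ : 0 < δ) : ∃ C : ℝ, 0 ≤ C ∧ ∀ z : ℝ × Space d, δ ≤ gauge z →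
      ‖iteratedFDeriv ℝ m K z‖ ≤ C * (gauge z ^ (a + m))⁻¹ := by
  obtain ⟨C, hC0, hC⟩ := h.exists_bound m
  refine ⟨C * (max δ⁻¹ 1) ^ m, by positivity, fun z hz' =>
    ContinuousMultilinearMap.opNorm_le_bound
      (by have := gauge_nonneg z; positivity) fun v => ?_⟩
  have hz : 0 < gauge z := hδ.trans_le hz'
  refine (hC z hz _).trans ?_
  have : ∀ i, ‖(dil (gauge z) hz.ne').symm (v i)‖
      ≤ (max δ⁻¹ 1 * (gauge z)⁻¹) * ‖v i‖ := fun i => by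
    rw [dil_symm_apply, Prod.norm_def, max_le_iff]
    simp only [norm_mul, norm_smul, norm_inv, norm_pow, Real.norm_of_nonneg hz.le]
    constructor
    · rw [pow_two, mul_inv]
      gcongr
      · exact (inv_anti₀ hδ hz').trans (le_max_left _ _)
      · exact norm_fst_le _
    · rw [mul_assoc]
      refine (le_mul_of_one_le_left (by positivity) (le_max_right _ _)).trans' ?_
      gcongr
      exact norm_snd_le _
  calc _ ≤ C * (gauge z ^ a)⁻¹ * ∏ i, ((max δ⁻¹ 1 * (gauge z)⁻¹) * ‖v i‖) := by
        gcongr with i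
        exact this i
    _ = _ := by
        simp_rw [Finset.prod_mul_distrib, Finset.prod_const, Finset.card_univ, Fintype.card_fin]
        rw [pow_add, mul_inv, inv_pow]
        ring

/-! ### Integrals of powers of the parabolic distance -/

theorem lintegral_eq_scale {E : Type*} [NormedAddCommGroup E] [NormedSpace ℝ E]
    [FiniteDimensional ℝ E] [MeasurableSpace E] [BorelSpace E] (μ : Measure E) [μ.IsAddHaarMeasure]
    {c : ℝ} (hc : 0 < c) (f : E → ℝ≥0∞) :
    ∫⁻ x, f x ∂μ = ENNReal.ofReal (c ^ Module.finrank ℝ E) * ∫⁻ x, f (c • x) ∂μ := by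
  have h1 : ∫⁻ x, f (c • x) ∂μ = ∫⁻ x, f x ∂(Measure.map (c • ·) μ) :=
    ((Homeomorph.smulOfNeZero c hc.ne').measurableEmbedding.lintegral_map f).symm
  rw [h1, Measure.map_addHaar_smul μ hc.ne', lintegral_smul_measure, smul_eq_mul, ← mul_assoc,
    ← ENNReal.ofReal_mul (by positivity), abs_of_pos (by positivity),
    mul_inv_cancel₀ (by positivity), ENNReal.ofReal_one, one_mul]

theorem lintegral_add_norm {E : Type*} [NormedAddCommGroup E] [NormedSpace ℝ E]
    [FiniteDimensional ℝ E] [MeasurableSpace E] [BorelSpace E] (μ : Measure E) [μ.IsAddHaarMeasure]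
    {b X : ℝ} (hX : 0 < X) :
    ∫⁻ y, ENNReal.ofReal ((X + ‖y‖) ^ (-b)) ∂μ =
      ENNReal.ofReal (X ^ (Module.finrank ℝ E - b)) *
        ∫⁻ y, ENNReal.ofReal ((1 + ‖y‖) ^ (-b)) ∂μ := by
  rw [lintegral_eq_scale μ hX]
  have : ∀ y : E, ENNReal.ofReal ((X + ‖X • y‖) ^ (-b))
      = ENNReal.ofReal (X ^ (-b)) * ENNReal.ofReal ((1 + ‖y‖) ^ (-b)) := fun y => by
    rw [norm_smul, Real.norm_of_nonneg hX.le, ← ENNReal.ofReal_mul (by positivity),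
      ← Real.mul_rpow hX.le (by positivity)]
    ring_nf
  simp_rw [this]
  rw [lintegral_const_mul _ (by fun_prop), ← mul_assoc, ← ENNReal.ofReal_mul (by positivity),
    sub_eq_add_neg, Real.rpow_add hX, Real.rpow_natCast]

/-- The substitution is `t ↦ X² t`: time counts as two dimensions. -/
theorem lintegral_add_sqrt {b X : ℝ} (hX : 0 < X) :
    ∫⁻ t : ℝ, ENNReal.ofReal ((X + √|t|) ^ (-b)) =
      ENNReal.ofReal (X ^ (2 - b)) * ∫⁻ t : ℝ, ENNReal.ofReal ((1 + √|t|) ^ (-b)) := by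
  rw [lintegral_eq_scale volume (pow_pos hX 2)]
  have : ∀ y : ℝ, ENNReal.ofReal ((X + √|X ^ 2 • y|) ^ (-b))
      = ENNReal.ofReal (X ^ (-b)) * ENNReal.ofReal ((1 + √|y|) ^ (-b)) := fun y => by
    rw [smul_eq_mul, abs_mul, abs_of_pos (pow_pos hX 2), Real.sqrt_mul (by positivity),
      Real.sqrt_sq hX.le, ← ENNReal.ofReal_mul (by positivity),
      ← Real.mul_rpow hX.le (by positivity)]
    ring_nf
  simp_rw [this]
  rw [lintegral_const_mul _ (by fun_prop), ← mul_assoc, ← ENNReal.ofReal_mul (by positivity),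
    sub_eq_add_neg, Real.rpow_add hX, Module.finrank_self, pow_one, Real.rpow_two]

/-- As `1 + |t| ≤ (1 + √|t|)²`, the integrand is at most `(1 + |t|) ^ (-b / 2)` with `b / 2 > 1`. -/
theorem lintegral_one_add_sqrt_lt_top {b : ℝ} (hb : 2 < b) :
    ∫⁻ t : ℝ, ENNReal.ofReal ((1 + √|t|) ^ (-b)) < ⊤ := by
  refine lt_of_le_of_lt (lintegral_mono fun t => ENNReal.ofReal_le_ofReal ?_)
    (finite_integral_one_add_norm (μ := (volume : Measure ℝ)) (r := b / 2)
      (by rw [Module.finrank_self]; push_cast; linarith))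
  have h1 : 1 + ‖t‖ ≤ (1 + √|t|) ^ (2 : ℝ) := by
    rw [Real.rpow_two, Real.norm_eq_abs]
    nlinarith [Real.sq_sqrt (abs_nonneg t), Real.sqrt_nonneg |t|]
  calc (1 + √|t|) ^ (-b) = ((1 + √|t|) ^ (2 : ℝ)) ^ (-(b / 2)) := by
        rw [← Real.rpow_mul (by positivity)]; ring_nf
    _ ≤ _ := Real.rpow_le_rpow_of_nonpos (by positivity) h1 (by linarith)

theorem lintegral_rpow_mul_add_rpow {e B σ : ℝ} (hσ : 0 < σ) :
    ∫⁻ r in Set.Ioi (0 : ℝ), ENNReal.ofReal (r ^ e * (r + σ) ^ (-B)) =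
      ENNReal.ofReal (σ ^ (e + 1 - B)) *
        ∫⁻ r in Set.Ioi (0 : ℝ), ENNReal.ofReal (r ^ e * (r + 1) ^ (-B)) := by
  rw [← lintegral_indicator measurableSet_Ioi, ← lintegral_indicator measurableSet_Ioi,
    lintegral_eq_scale volume hσ]
  have : ∀ r : ℝ, (Set.Ioi (0 : ℝ)).indicator
      (fun r => ENNReal.ofReal (r ^ e * (r + σ) ^ (-B))) (σ • r) = ENNReal.ofReal (σ ^ (e - B)) *
      (Set.Ioi (0 : ℝ)).indicator (fun r => ENNReal.ofReal (r ^ e * (r + 1) ^ (-B))) r := by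
    intro r
    by_cases hr : 0 < r
    · rw [Set.indicator_of_mem (by simpa using mul_pos hσ hr), Set.indicator_of_mem (by exact hr),
        smul_eq_mul, ← ENNReal.ofReal_mul (by positivity), Real.mul_rpow hσ.le hr.le,
        show σ * r + σ = σ * (r + 1) by ring, Real.mul_rpow hσ.le (by positivity),
        sub_eq_add_neg, Real.rpow_add hσ]
      ring_nf
    · rw [Set.indicator_of_notMem, Set.indicator_of_notMem, mul_zero]
      · exact hr
      · simp only [smul_eq_mul, Set.mem_Ioi, not_lt]
        exact mul_nonpos_of_nonneg_of_nonpos hσ.le (not_lt.1 hr)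
  simp_rw [this]
  rw [lintegral_const_mul _ (Measurable.indicator (by fun_prop) measurableSet_Ioi), ← mul_assoc,
    ← ENNReal.ofReal_mul (by positivity), Module.finrank_self, pow_one,
    show e + 1 - B = 1 + (e - B) by ring, Real.rpow_add hσ, Real.rpow_one]

/-- The condition `e > -1` is integrability at 0, and `e - B < -1` is integrability at infinity. -/
theorem lintegral_rpow_mul_one_add_rpow_lt_top {e B : ℝ} (he : -1 < e) (hB : e + 1 < B) :
    ∫⁻ r in Set.Ioi (0 : ℝ), ENNReal.ofReal (r ^ e * (r + 1) ^ (-B)) < ⊤ := by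
  have h1 : ∫⁻ r in Set.Ioc (0 : ℝ) 1, ENNReal.ofReal (r ^ e * (r + 1) ^ (-B)) < ⊤ := by
    have hi : IntegrableOn (fun r : ℝ => r ^ e) (Set.Ioc 0 1) := by
      rw [← intervalIntegrable_iff_integrableOn_Ioc_of_le zero_le_one]
      exact intervalIntegral.intervalIntegrable_rpow' he
    refine lt_of_le_of_lt (setLIntegral_mono (g := fun r => ENNReal.ofReal (r ^ e))
      (by fun_prop) fun r hr => ?_) hi.lintegral_lt_top
    refine ENNReal.ofReal_le_ofReal (mul_le_of_le_one_right (Real.rpow_nonneg hr.1.le _) ?_)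
    exact Real.rpow_le_one_of_one_le_of_nonpos (by linarith [hr.1]) (by linarith)
  have h2 : ∫⁻ r in Set.Ioi (1 : ℝ), ENNReal.ofReal (r ^ e * (r + 1) ^ (-B)) < ⊤ := by
    have hi : IntegrableOn (fun r : ℝ => r ^ (e - B)) (Set.Ioi 1) :=
      integrableOn_Ioi_rpow_of_lt (by linarith) one_pos
    refine lt_of_le_of_lt (setLIntegral_mono (g := fun r => ENNReal.ofReal (r ^ (e - B)))
      (by fun_prop) fun r hr => ?_) hi.lintegral_lt_top
    have hr : 1 < r := hr
    rw [sub_eq_add_neg, Real.rpow_add (by linarith)]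
    refine ENNReal.ofReal_le_ofReal ?_
    gcongr ?_ * ?_
    exact Real.rpow_le_rpow_of_nonpos (by linarith) (by linarith) (by linarith)
  rw [← Set.Ioc_union_Ioi_eq_Ioi zero_le_one]
  exact (lintegral_union_le _ _ _).trans_lt (ENNReal.add_lt_top.2 ⟨h1, h2⟩)

/-- Hölder's inequality for a kernel that is split into two powers. -/
theorem lintegral_mul_rpow_le {α : Type*} [MeasurableSpace α] {μ : Measure α} {p : ℝ} (hp : 1 < p)
    {k₁ k₂ f : α → ℝ≥0∞} (h₁ : AEMeasurable k₁ μ) (h₂ : AEMeasurable k₂ μ)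
    (hf : AEMeasurable f μ) :
    (∫⁻ a, k₁ a ^ ((p - 1) / p) * k₂ a ^ (1 / p) * f a ∂μ) ^ p
      ≤ (∫⁻ a, k₁ a ∂μ) ^ (p - 1) * ∫⁻ a, k₂ a * f a ^ p ∂μ := by
  have hp0 : 0 < p := by linarith
  have hq : (p / (p - 1)).HolderConjugate p := (Real.HolderConjugate.conjExponent hp).symm
  have h := ENNReal.lintegral_mul_le_Lp_mul_Lq μ hq (h₁.pow_const ((p - 1) / p))
    ((h₂.pow_const (1 / p)).mul hf)
  have hp1 : p - 1 ≠ 0 := by linarith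
  simp only [Pi.mul_apply, ENNReal.mul_rpow_of_nonneg _ _ hp0.le, ← ENNReal.rpow_mul] at h
  rw [show (p - 1) / p * (p / (p - 1)) = 1 by field_simp, show 1 / p * p = 1 by field_simp,
    show 1 / (p / (p - 1)) = (p - 1) / p by field_simp] at h
  simp only [ENNReal.rpow_one] at h
  simp_rw [← mul_assoc] at h
  refine (ENNReal.rpow_le_rpow h hp0.le).trans (le_of_eq ?_)
  rw [ENNReal.mul_rpow_of_nonneg _ _ hp0.le, ← ENNReal.rpow_mul, ← ENNReal.rpow_mul,
    show (p - 1) / p * p = p - 1 by field_simp, show 1 / p * p = 1 by field_simp, ENNReal.rpow_one]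

/-- Jensen's inequality for a kernel of finite mass. -/
theorem lintegral_kernel_rpow_le {α : Type*} [MeasurableSpace α] {μ : Measure α} {p : ℝ}
    (hp : 1 < p) {k f : α → ℝ≥0∞} (hk : AEMeasurable k μ) (hf : AEMeasurable f μ) :
    (∫⁻ a, k a * f a ∂μ) ^ p ≤ (∫⁻ a, k a ∂μ) ^ (p - 1) * ∫⁻ a, k a * f a ^ p ∂μ := by
  have h := lintegral_mul_rpow_le hp hk hk hf
  have : ∀ a, k a ^ ((p - 1) / p) * k a ^ (1 / p) = k a := fun a => by
    rw [← ENNReal.rpow_add_of_nonneg _ _ (div_nonneg (by linarith) (by linarith)) (by positivity),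
      show (p - 1) / p + 1 / p = 1 by field_simp; ring, ENNReal.rpow_one]
  simpa only [this] using h

/-! ### Coordinates on the half-space -/

/-- The identification of `ℝ × ℝⁿ⁻¹` with `ℝⁿ`. -/
def pointEquiv (d : ℕ) : ℝ × Bdry d ≃ᵐ Space d :=
  ((MeasurableEquiv.refl ℝ).prodCongr (MeasurableEquiv.toLp 2 (Fin d → ℝ)).symm).trans
    ((MeasurableEquiv.piFinSuccAbove (fun _ => ℝ) 0).symm.trans
      (MeasurableEquiv.toLp 2 (Fin (d + 1) → ℝ)))

theorem pointEquiv_apply {d : ℕ} (q : ℝ × Bdry d) : pointEquiv d q = mkPoint q.1 q.2 := by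
  simp [pointEquiv, mkPoint, MeasurableEquiv.piFinSuccAbove]
  rfl

theorem measurePreserving_pointEquiv (d : ℕ) :
    MeasurePreserving (pointEquiv d) (volume.prod volume) volume := by
  have h1 : MeasurePreserving ((MeasurableEquiv.refl ℝ).prodCongr
      (MeasurableEquiv.toLp 2 (Fin d → ℝ)).symm) (volume.prod volume) (volume.prod volume) :=
    (MeasurePreserving.id volume).prod (PiLp.volume_preserving_ofLp (Fin d))
  exact ((PiLp.volume_preserving_toLp (Fin (d + 1))).comp
    (volume_preserving_piFinSuccAbove (fun _ => ℝ) 0).symm).comp h1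

theorem lintegral_space {d : ℕ} {f : Space d → ℝ≥0∞} (hf : Measurable f) :
    ∫⁻ x, f x = ∫⁻ r : ℝ, ∫⁻ y : Bdry d, f (mkPoint r y) := by
  rw [← (measurePreserving_pointEquiv d).lintegral_comp hf, lintegral_prod]
  · simp_rw [pointEquiv_apply]
  · exact (hf.comp (pointEquiv d).measurable).aemeasurable

@[fun_prop] theorem measurable_mkPoint {d : ℕ} :
    Measurable fun q : ℝ × Bdry d => mkPoint q.1 q.2 := by
  simpa only [← pointEquiv_apply] using (pointEquiv d).measurable

theorem measurableSet_halfSpace (d : ℕ) : MeasurableSet (halfSpace d : Set (Space d)) :=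
  (halfSpace d).isOpen.measurableSet

theorem mem_halfSpace {d : ℕ} {x : Space d} : x ∈ (halfSpace d : Set (Space d)) ↔ 0 < x 0 := Iff.rfl

theorem setLIntegral_halfSpace {d : ℕ} {f : Space d → ℝ≥0∞} (hf : Measurable f) :
    ∫⁻ x in (halfSpace d : Set (Space d)), f x =
      ∫⁻ r in Set.Ioi (0 : ℝ), ∫⁻ y : Bdry d, f (mkPoint r y) := by
  rw [← lintegral_indicator (measurableSet_halfSpace d), lintegral_space
    (hf.indicator (measurableSet_halfSpace d)), ← lintegral_indicator measurableSet_Ioi]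
  refine lintegral_congr fun r => ?_
  by_cases hr : 0 < r
  · rw [Set.indicator_of_mem (show r ∈ Set.Ioi (0 : ℝ) from hr)]
    exact lintegral_congr fun y => Set.indicator_of_mem (mem_halfSpace.2 hr) _
  · rw [Set.indicator_of_notMem (show r ∉ Set.Ioi (0 : ℝ) from hr)]
    refine (lintegral_congr fun y => Set.indicator_of_notMem (fun h => hr ?_) _).trans lintegral_zero
    exact mem_halfSpace.1 h

/-- The boundary point `(s, 0, y')`. -/
def bd {d : ℕ} (q : ℝ × Bdry d) : ℝ × Space d := (q.1, mkPoint 0 q.2)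

theorem gauge_sub_bd {d : ℕ} (z : ℝ × Space d) (q : ℝ × Bdry d) :
    gauge (z - bd q) = |z.2 0| + ‖tang z.2 - q.2‖ + √|z.1 - q.1| := by
  simp [gauge, bd, tang_sub]

/-- The powers of the parabolic distance to a boundary point are integrable. -/
theorem exists_lintegral_gauge_le (d : ℕ) {A : ℝ} (hA : (d : ℝ) + 2 < A) :
    ∃ C : ℝ≥0∞, C ≠ ⊤ ∧ ∀ z : ℝ × Space d, 0 < z.2 0 →
      ∫⁻ q : ℝ × Bdry d, ENNReal.ofReal (gauge (z - bd q) ^ (-A))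
        = ENNReal.ofReal (z.2 0 ^ (d + 2 - A)) * C := by
  refine ⟨(∫⁻ y : Bdry d, ENNReal.ofReal ((1 + ‖y‖) ^ (-(A - 2)))) *
    ∫⁻ t : ℝ, ENNReal.ofReal ((1 + √|t|) ^ (-A)), (ENNReal.mul_lt_top ?_ ?_).ne, fun z hz => ?_⟩
  · exact finite_integral_one_add_norm (by rw [finrank_euclideanSpace_fin]; linarith)
  · exact lintegral_one_add_sqrt_lt_top (by linarith [Nat.cast_nonneg (α := ℝ) d])
  simp_rw [gauge_sub_bd, abs_of_pos hz]
  -- The integral in time lowers the exponent by 2, the one over `Bdry d` then lowers it by `d`.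
  rw [Measure.volume_eq_prod, lintegral_prod_symm' _ (by fun_prop)]
  have h1 : ∀ y : Bdry d, ∫⁻ s : ℝ,
      ENNReal.ofReal ((z.2 0 + ‖tang z.2 - y‖ + √|z.1 - s|) ^ (-A)) =
      ENNReal.ofReal ((z.2 0 + ‖tang z.2 - y‖) ^ (-(A - 2))) *
        ∫⁻ t : ℝ, ENNReal.ofReal ((1 + √|t|) ^ (-A)) := fun y => by
    rw [lintegral_sub_left_eq_self
      (fun s => ENNReal.ofReal ((z.2 0 + ‖tang z.2 - y‖ + √|s|) ^ (-A))) z.1,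
      lintegral_add_sqrt (by positivity), neg_sub]
  simp_rw [h1]
  rw [lintegral_mul_const _ (by fun_prop),
    lintegral_sub_left_eq_self (fun y => ENNReal.ofReal ((z.2 0 + ‖y‖) ^ (-(A - 2)))) (tang z.2),
    lintegral_add_norm volume hz, finrank_euclideanSpace_fin, mul_assoc]
  congr 3
  ring

/-! ### The weighted estimate of the majorant -/

theorem lintegral_prod_volume {α β : Type*} [MeasureSpace α] [MeasureSpace β]
    [SFinite (volume : Measure α)] [SFinite (volume : Measure β)] {f : α × β → ℝ≥0∞}
    (hf : Measurable f) : ∫⁻ z, f z = ∫⁻ x, ∫⁻ y, f (x, y) :=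
  lintegral_prod _ hf.aemeasurable

/-- The kernel `gauge ^ (-a)` applied to the increments of `g`. -/
def majorant {d : ℕ} (g : ℝ × Bdry d → ℂ) (a : ℝ) (t : ℝ) (x : Space d) : ℝ≥0∞ :=
  ∫⁻ q : ℝ × Bdry d, ENNReal.ofReal (gauge ((t, x) - bd q) ^ (-a)) * ‖g q - g (t, tang x)‖ₑ

theorem bd_measurable {d : ℕ} : Measurable (bd (d := d)) := by
  unfold bd
  exact measurable_fst.prodMk (measurable_mkPoint.comp (measurable_const.prodMk measurable_snd))

theorem gauge_measurable {d : ℕ} : Measurable (gauge (d := d)) := continuous_gauge.measurable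

theorem measurable_majorant {d : ℕ} {g : ℝ × Bdry d → ℂ} (hg : Measurable g) (a : ℝ) :
    Measurable fun z : ℝ × Space d => majorant g a z.1 z.2 := by
  have h1 : Measurable fun w : (ℝ × Space d) × (ℝ × Bdry d) => gauge (w.1 - bd w.2) :=
    gauge_measurable.comp (measurable_fst.sub (bd_measurable.comp measurable_snd))
  have h2 : Measurable fun w : (ℝ × Space d) × (ℝ × Bdry d) => g (w.1.1, tang w.1.2) :=
    hg.comp (by fun_prop)
  exact Measurable.lintegral_prod_right' (f := fun w : (ℝ × Space d) × (ℝ × Bdry d) =>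
    ENNReal.ofReal (gauge (w.1 - bd w.2) ^ (-a)) * ‖g w.2 - g (w.1.1, tang w.1.2)‖ₑ)
    ((ENNReal.measurable_ofReal.comp (h1.pow_const _)).mul ((hg.comp measurable_snd).sub h2).enorm)

theorem measurable_majorant_right {d : ℕ} {g : ℝ × Bdry d → ℂ} (hg : Measurable g) (a t : ℝ) :
    Measurable fun x : Space d => majorant g a t x := by
  exact Measurable.comp (g := fun z : ℝ × Space d => majorant g a z.1 z.2) (f := fun x => (t, x))
    (measurable_majorant hg a) measurable_prodMk_left

/-- Hölder's inequality in the definition of the majorant. -/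
theorem exists_majorant_rpow_le (d : ℕ) {p a A : ℝ} (hp : 1 < p) (hA : (d : ℝ) + 2 < A) :
    ∃ C : ℝ≥0∞, C ≠ ⊤ ∧ ∀ (g : ℝ × Bdry d → ℂ), Measurable g → ∀ (t : ℝ) (x : Space d), 0 < x 0 →
      majorant g a t x ^ p ≤ C * ENNReal.ofReal (x 0 ^ ((d + 2 - A) * (p - 1))) *
        ∫⁻ q : ℝ × Bdry d, ENNReal.ofReal (gauge ((t, x) - bd q) ^ (-(p * a - A * (p - 1)))) *
          ‖g q - g (t, tang x)‖ₑ ^ p := by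
  obtain ⟨C, hC, hCe⟩ := exists_lintegral_gauge_le d hA
  have hp1 : 0 ≤ p - 1 := by linarith
  refine ⟨C ^ (p - 1), ENNReal.rpow_ne_top_of_nonneg hp1 hC, fun g hg t x hx => ?_⟩
  have hm : Measurable fun q : ℝ × Bdry d => gauge ((t, x) - bd q) :=
    gauge_measurable.comp (measurable_const.sub bd_measurable)
  have hpos : ∀ q : ℝ × Bdry d, 0 < gauge ((t, x) - bd q) := fun q => by
    rw [gauge_sub_bd]
    have : 0 < |x 0| := abs_pos.2 hx.ne'
    positivity
  have h := lintegral_mul_rpow_le (μ := (volume : Measure (ℝ × Bdry d))) hp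
    (k₁ := fun q => ENNReal.ofReal (gauge ((t, x) - bd q) ^ (-A)))
    (k₂ := fun q => ENNReal.ofReal (gauge ((t, x) - bd q) ^ (-(p * a - A * (p - 1)))))
    (f := fun q => ‖g q - g (t, tang x)‖ₑ)
    (ENNReal.measurable_ofReal.comp (hm.pow_const _)).aemeasurable
    (ENNReal.measurable_ofReal.comp (hm.pow_const _)).aemeasurable
    (hg.sub_const _).enorm.aemeasurable
  -- The exponent is split as `a = A (p - 1) / p + (p a - A (p - 1)) / p`. The part with `A > d + 2`
  -- has finite mass and is integrated out; the other part stays with the increments.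
  have hk : ∀ q : ℝ × Bdry d, ENNReal.ofReal (gauge ((t, x) - bd q) ^ (-A)) ^ ((p - 1) / p) *
      ENNReal.ofReal (gauge ((t, x) - bd q) ^ (-(p * a - A * (p - 1)))) ^ (1 / p) =
      ENNReal.ofReal (gauge ((t, x) - bd q) ^ (-a)) := fun q => by
    have := hpos q
    rw [ENNReal.ofReal_rpow_of_nonneg (by positivity) (by positivity),
      ENNReal.ofReal_rpow_of_nonneg (by positivity) (by positivity),
      ← ENNReal.ofReal_mul (by positivity), ← Real.rpow_mul this.le, ← Real.rpow_mul this.le,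
      ← Real.rpow_add this]
    congr 2
    field_simp
    ring
  simp only [hk] at h
  refine h.trans (le_of_eq ?_)
  rw [hCe (t, x) hx, ENNReal.mul_rpow_of_nonneg _ _ hp1,
    ENNReal.ofReal_rpow_of_nonneg (by positivity) hp1, ← Real.rpow_mul hx.le,
    mul_comm (ENNReal.ofReal _) (C ^ _)]

/-- The increments of `g` in all directions are controlled by those in time and in space. -/
theorem exists_lintegral_increment_le (d : ℕ) {p s : ℝ} (hp : 1 < p) (hs : 0 < s) :
    ∃ C : ℝ≥0∞, C ≠ ⊤ ∧ ∀ (g : ℝ × Bdry d → ℂ), Measurable g →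
      ∫⁻ w : ℝ × Bdry d, ∫⁻ q : ℝ × Bdry d,
        ENNReal.ofReal ((‖w.2 - q.2‖ + √|w.1 - q.1|) ^ (-((d : ℝ) + 2 + s * p))) *
          ‖g q - g w‖ₑ ^ p ≤ C * (slobTime s p g ^ p + slobSpace s p g ^ p) := by
  have hsp : 0 < s * p := by positivity
  have hp0 : 0 < p := by linarith
  set b : ℝ := (d : ℝ) + 2 + s * p with hb
  set C1 := ∫⁻ y : Bdry d, ENNReal.ofReal ((1 + ‖y‖) ^ (-b)) with hC1
  set C2 := ∫⁻ t : ℝ, ENNReal.ofReal ((1 + √|t|) ^ (-b)) with hC2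
  have hC1t : C1 < ⊤ := finite_integral_one_add_norm
    (by rw [finrank_euclideanSpace_fin, hb]; linarith)
  have hC2t : C2 < ⊤ := lintegral_one_add_sqrt_lt_top
    (by rw [hb]; linarith [Nat.cast_nonneg (α := ℝ) d])
  refine ⟨2 ^ (p - 1) * (C1 + C2), ENNReal.mul_ne_top (by finiteness) (by finiteness),
    fun g hg => ?_⟩
  set k : ℝ × Bdry d → ℝ × Bdry d → ℝ≥0∞ := fun w q =>
    ENNReal.ofReal ((‖w.2 - q.2‖ + √|w.1 - q.1|) ^ (-b)) with hk
  have hkm : Measurable (Function.uncurry k) := by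
    simp only [hk, Function.uncurry_def]; fun_prop
  -- the two parts
  set f1 : ℝ × Bdry d → ℝ × Bdry d → ℝ≥0∞ := fun w q =>
    k w q * ‖g (q.1, q.2) - g (w.1, q.2)‖ₑ ^ p with hf1
  set f2 : ℝ × Bdry d → ℝ × Bdry d → ℝ≥0∞ := fun w q =>
    k w q * ‖g (w.1, q.2) - g (w.1, w.2)‖ₑ ^ p with hf2
  have hf1m : Measurable (Function.uncurry f1) := by
    simp only [hf1, Function.uncurry_def]
    exact hkm.mul (by fun_prop)
  have hf2m : Measurable (Function.uncurry f2) := by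
    simp only [hf2, Function.uncurry_def]
    exact hkm.mul (by fun_prop)
  have hf1i : Measurable fun w => ∫⁻ q, f1 w q := Measurable.lintegral_prod_right' hf1m
  have hf2i : Measurable fun w => ∫⁻ q, f2 w q := Measurable.lintegral_prod_right' hf2m
  -- The intermediate point has the time of `w` and the spatial coordinate of `q`, so that each
  -- increment is in one variable only.
  have hsplit : ∀ w q, k w q * ‖g q - g w‖ₑ ^ p ≤ 2 ^ (p - 1) * (f1 w q + f2 w q) := fun w q => by
    have h1 : ‖g q - g w‖ₑ ≤ ‖g (q.1, q.2) - g (w.1, q.2)‖ₑ + ‖g (w.1, q.2) - g (w.1, w.2)‖ₑ := by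
      refine le_trans (le_of_eq ?_) (enorm_add_le _ _)
      congr 1
      simp
    calc k w q * ‖g q - g w‖ₑ ^ p
        ≤ k w q * (2 ^ (p - 1) * (‖g (q.1, q.2) - g (w.1, q.2)‖ₑ ^ p
            + ‖g (w.1, q.2) - g (w.1, w.2)‖ₑ ^ p)) := by
          gcongr
          exact (ENNReal.rpow_le_rpow h1 hp0.le).trans
            (ENNReal.rpow_add_le_mul_rpow_add_rpow _ _ hp.le)
      _ = _ := by simp only [hf1, hf2]; ring
  -- The time increment does not depend on the spatial coordinate of `w`. Integrating the kernel
  -- over it leaves `√|t - r| ^ (d - b) = |t - r| ^ (-(1 + s p / 2))`.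
  have hI1 : ∫⁻ w, ∫⁻ q, f1 w q ≤ C1 * slobTime s p g ^ p := by
    rw [slobTime, ← ENNReal.rpow_mul, one_div_mul_cancel hp0.ne', ENNReal.rpow_one,
      lintegral_prod_volume hf1i,
      ← lintegral_const_mul' _ _ hC1t.ne]
    refine lintegral_mono fun t => ?_
    simp only
    have hm1 : Measurable (Function.uncurry fun (y : Bdry d) (q : ℝ × Bdry d) => f1 (t, y) q) :=
      hf1m.comp (f := fun v : Bdry d × (ℝ × Bdry d) => ((t, v.1), v.2)) (by fun_prop)
    have hm1' : Measurable fun q => ∫⁻ y, f1 (t, y) q := Measurable.lintegral_prod_left' hm1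
    rw [lintegral_lintegral_swap hm1.aemeasurable, lintegral_prod_volume hm1',
      ← lintegral_const_mul' _ _ hC1t.ne]
    refine lintegral_mono fun r => ?_
    -- On the diagonal the increment is 0; the scaling formula needs a positive distance.
    rcases eq_or_ne t r with rfl | htr
    · simp [hf1, hp0]
    have htr' : 0 < |t - r| := abs_pos.2 (sub_ne_zero.2 htr)
    have hin : ∀ z : Bdry d, ∫⁻ y : Bdry d, f1 (t, y) (r, z)
        = C1 * ENNReal.ofReal (√|t - r| ^ ((d : ℝ) - b)) * ‖g (r, z) - g (t, z)‖ₑ ^ p := fun z => by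
      simp only [hf1, hk]
      rw [lintegral_mul_const _ (by fun_prop)]
      simp_rw [add_comm _ √|t - r|]
      rw [lintegral_sub_right_eq_self
        (fun y : Bdry d => ENNReal.ofReal ((√|t - r| + ‖y‖) ^ (-b))) z,
        lintegral_add_norm volume (Real.sqrt_pos.2 htr'), finrank_euclideanSpace_fin,
        mul_comm C1]
    simp_rw [hin]
    have hfin : C1 * ENNReal.ofReal (√|t - r| ^ ((d : ℝ) - b)) ≠ ⊤ :=
      ENNReal.mul_ne_top hC1t.ne ENNReal.ofReal_ne_top
    rw [lintegral_const_mul' _ _ hfin, mul_assoc, mul_comm (ENNReal.ofReal _), div_eq_mul_inv]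
    gcongr
    rw [← ofReal_norm, Real.norm_eq_abs, ENNReal.ofReal_rpow_of_pos htr',
      ← ENNReal.ofReal_inv_of_pos (by positivity), ← Real.rpow_neg htr'.le,
      Real.sqrt_eq_rpow, ← Real.rpow_mul htr'.le]
    refine le_of_eq ?_
    congr 2
    rw [hb]; ring
  -- The spatial increment does not depend on the time of `q`. Integrating the kernel over it leaves
  -- `‖y - z‖ ^ (2 - b) = ‖y - z‖ ^ (-(d + s p))`.
  have hI2 : ∫⁻ w, ∫⁻ q, f2 w q ≤ C2 * slobSpace s p g ^ p := by
    rw [slobSpace, ← ENNReal.rpow_mul, one_div_mul_cancel hp0.ne', ENNReal.rpow_one,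
      lintegral_prod_volume hf2i,
      ← lintegral_const_mul' _ _ hC2t.ne]
    refine lintegral_mono fun t => ?_
    simp only
    rw [← lintegral_const_mul' _ _ hC2t.ne]
    refine lintegral_mono fun y => ?_
    have hm2 : Measurable fun q : ℝ × Bdry d => f2 (t, y) q :=
      hf2m.comp (f := fun v : ℝ × Bdry d => ((t, y), v)) (by fun_prop)
    rw [show ∫⁻ q, f2 (t, y) q = ∫⁻ z, ∫⁻ r, f2 (t, y) (r, z) from lintegral_prod_symm' _ hm2, ← lintegral_const_mul' _ _ hC2t.ne]
    refine lintegral_mono fun z => ?_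
    rcases eq_or_ne y z with rfl | hyz
    · simp [hf2, hp0]
    have hyz' : 0 < ‖y - z‖ := norm_pos_iff.2 (sub_ne_zero.2 hyz)
    simp only [hf2, hk]
    rw [lintegral_mul_const _ (by fun_prop), lintegral_sub_left_eq_self
      (fun r : ℝ => ENNReal.ofReal ((‖y - z‖ + √|r|) ^ (-b))) t, lintegral_add_sqrt hyz',
      div_eq_mul_inv, mul_comm (ENNReal.ofReal _), mul_assoc]
    refine mul_le_mul_right (le_of_eq ?_) _
    rw [mul_comm, ← enorm_neg, neg_sub, ← ofReal_norm (y - z), ENNReal.ofReal_rpow_of_pos hyz',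
      ← ENNReal.ofReal_inv_of_pos (by positivity), ← Real.rpow_neg hyz'.le]
    congr 3
    rw [hb]; ring
  calc ∫⁻ w, ∫⁻ q, k w q * ‖g q - g w‖ₑ ^ p
      ≤ ∫⁻ w, ∫⁻ q, 2 ^ (p - 1) * (f1 w q + f2 w q) :=
        lintegral_mono fun w => lintegral_mono fun q => hsplit w q
    _ = 2 ^ (p - 1) * ((∫⁻ w, ∫⁻ q, f1 w q) + ∫⁻ w, ∫⁻ q, f2 w q) := by
        rw [← lintegral_add_left hf1i,
          ← lintegral_const_mul' _ _ (by finiteness)]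
        refine lintegral_congr fun w => ?_
        rw [lintegral_const_mul' _ _ (by finiteness), lintegral_add_left]
        exact hf1m.comp (f := fun v : ℝ × Bdry d => (w, v)) (by fun_prop)
    _ ≤ 2 ^ (p - 1) * (C1 * slobTime s p g ^ p + C2 * slobSpace s p g ^ p) := by gcongr
    _ ≤ 2 ^ (p - 1) * ((C1 + C2) * slobTime s p g ^ p + (C1 + C2) * slobSpace s p g ^ p) := by
        gcongr
        · exact le_self_add
        · exact le_add_self
    _ = _ := by ring

/-- The central estimate. Hölder's inequality uses a kernel with exponent `A` slightly above the
critical `d + 2`. At height `r` the remaining kernel is a power of `r + σ`, where `σ` is the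
parabolic distance of the two boundary points, and integrating it in `r` gives the double integral
of `exists_lintegral_increment_le`. The condition `s < m` leaves room for the loss in `A`. -/
theorem exists_lintegral_majorant_le (d : ℕ) {p s : ℝ} (hp : 1 < p) (hs : 0 < s) {m : ℝ}
    (hm : s < m) : ∃ C : ℝ≥0∞, C ≠ ⊤ ∧ ∀ (g : ℝ × Bdry d → ℂ), Measurable g →
      ∫⁻ t : ℝ, ∫⁻ x in (halfSpace d : Set (Space d)), majorant g (d + 2 + m) t x ^ p *
        ENNReal.ofReal (x 0 ^ (m * p - 1 - s * p)) ≤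
          C * (slobTime s p g ^ p + slobSpace s p g ^ p) := by
  have hp0 : 0 < p := by linarith
  have hp1 : 0 < p - 1 := by linarith
  -- a small loss
  obtain ⟨ε, hε⟩ : ∃ ε : ℝ, ε = (m - s) * p / (2 * (p - 1)) := ⟨_, rfl⟩
  have hε0 : 0 < ε := by rw [hε]; exact div_pos (mul_pos (by linarith) hp0) (by linarith)
  have hεp : ε * (p - 1) = (m - s) * p / 2 := by rw [hε]; field_simp
  have hmsp : 0 < (m - s) * p := mul_pos (by linarith) hp0
  obtain ⟨A, hA⟩ : ∃ A : ℝ, A = d + 2 + ε := ⟨_, rfl⟩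
  obtain ⟨B, hB⟩ : ∃ B : ℝ, B = p * (d + 2 + m) - A * (p - 1) := ⟨_, rfl⟩
  obtain ⟨e, he⟩ : ∃ e : ℝ, e = m * p - 1 - s * p + (d + 2 - A) * (p - 1) := ⟨_, rfl⟩
  -- The loss consumes half of `(m - s) p`. What is left makes `e > -1`, so the integral in `r`
  -- converges at 0, and `B - (e + 1)` is the exponent of the parabolic kernel of the increments.
  have he1 : e = (m - s) * p / 2 - 1 := by rw [he, hA]; linear_combination -hεp
  have hB1 : B = e + 1 + (d + 2 + s * p) := by rw [he, hB, hA]; ring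
  obtain ⟨C1, hC1, hC1e⟩ := exists_majorant_rpow_le d hp (a := (d : ℝ) + 2 + m)
    (show (d : ℝ) + 2 < A by linarith)
  obtain ⟨C2, hC2, hC2e⟩ := exists_lintegral_increment_le d hp hs
  set C3 := ∫⁻ r in Set.Ioi (0 : ℝ), ENNReal.ofReal (r ^ e * (r + 1) ^ (-B)) with hC3
  have hC3t : C3 < ⊤ := lintegral_rpow_mul_one_add_rpow_lt_top (by linarith)
    (by rw [hB1]; have := mul_pos hs hp0; linarith [Nat.cast_nonneg (α := ℝ) d])
  refine ⟨C1 * (C3 * C2), by finiteness, fun g hg => ?_⟩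
  set σ : ℝ × Bdry d → ℝ × Bdry d → ℝ := fun w q => ‖w.2 - q.2‖ + √|w.1 - q.1| with hσ
  set F : ℝ → ℝ × Bdry d → ℝ × Bdry d → ℝ≥0∞ := fun r w q =>
    ENNReal.ofReal (r ^ e * (r + σ w q) ^ (-B)) * ‖g q - g w‖ₑ ^ p with hF
  have hFm : Measurable fun v : (ℝ × (ℝ × Bdry d)) × (ℝ × Bdry d) => F v.1.1 v.1.2 v.2 := by
    simp only [hF, hσ]; fun_prop
  have h1 : ∀ t : ℝ, ∫⁻ x in (halfSpace d : Set (Space d)), majorant g (d + 2 + m) t x ^ p *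
        ENNReal.ofReal (x 0 ^ (m * p - 1 - s * p)) ≤
      C1 * ∫⁻ r in Set.Ioi (0 : ℝ), ∫⁻ y : Bdry d, ∫⁻ q, F r (t, y) q := fun t => by
    have hmt : Measurable fun x : Space d => majorant g (d + 2 + m) t x ^ p *
        ENNReal.ofReal (x 0 ^ (m * p - 1 - s * p)) :=
      ((measurable_majorant_right hg _ _).pow_const _).mul (by fun_prop)
    rw [setLIntegral_halfSpace hmt,
      ← lintegral_const_mul' C1 _ hC1]
    refine setLIntegral_mono' measurableSet_Ioi fun r hr => ?_
    have hr : 0 < r := hr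
    rw [← lintegral_const_mul' _ _ hC1]
    refine lintegral_mono fun y => ?_
    have h := hC1e g hg t (mkPoint r y) (by simpa using hr)
    simp only [mkPoint_zero, tang_mkPoint] at h ⊢
    refine (mul_le_mul_left h _).trans (le_of_eq ?_)
    rw [mul_assoc, mul_assoc, mul_comm (lintegral _ _), ← mul_assoc (ENNReal.ofReal _),
      ← ENNReal.ofReal_mul (by positivity), ← Real.rpow_add hr,
      ← lintegral_const_mul' _ _ ENNReal.ofReal_ne_top]
    congr 1
    refine lintegral_congr fun q => ?_
    have hg0 : 0 ≤ gauge ((t, mkPoint r y) - bd q) := gauge_nonneg _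
    rw [← mul_assoc, ← ENNReal.ofReal_mul (by positivity)]
    simp only [hF, hσ, gauge_sub_bd, mkPoint_zero, tang_mkPoint, abs_of_pos hr]
    congr 3
    · rw [he]; ring_nf
    · rw [hB, add_assoc]
  -- By Tonelli's theorem the integral in `r` moves to the inside and `(t, y)` becomes one boundary
  -- point `w`.
  have h2 : ∫⁻ t : ℝ, ∫⁻ r in Set.Ioi (0 : ℝ), ∫⁻ y : Bdry d, ∫⁻ q, F r (t, y) q =
      ∫⁻ w : ℝ × Bdry d, ∫⁻ q, ∫⁻ r in Set.Ioi (0 : ℝ), F r w q := by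
    have hm1 : Measurable fun v : ℝ × (ℝ × Bdry d) => ∫⁻ q, F v.1 v.2 q :=
      Measurable.lintegral_prod_right' hFm
    have hm2 : Measurable fun v : (ℝ × ℝ) × Bdry d => ∫⁻ q, F v.1.2 (v.1.1, v.2) q :=
      hm1.comp (f := fun v : (ℝ × ℝ) × Bdry d => (v.1.2, (v.1.1, v.2))) (by fun_prop)
    rw [lintegral_lintegral_swap (Measurable.lintegral_prod_right' hm2).aemeasurable]
    have hm3 : ∀ r : ℝ, Measurable fun w : ℝ × Bdry d => ∫⁻ q, F r w q := fun r =>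
      hm1.comp (f := fun v : ℝ × Bdry d => (r, v)) (by fun_prop)
    have : ∀ r : ℝ, ∫⁻ t : ℝ, ∫⁻ y : Bdry d, ∫⁻ q, F r (t, y) q
        = ∫⁻ w : ℝ × Bdry d, ∫⁻ q, F r w q := fun r => by
      rw [lintegral_prod_volume (hm3 r)]
    simp_rw [this]
    rw [lintegral_lintegral_swap hm1.aemeasurable]
    refine lintegral_congr fun w => lintegral_lintegral_swap ?_
    exact (hFm.comp (f := fun v : ℝ × (ℝ × Bdry d) => ((v.1, w), v.2))
      (by fun_prop)).aemeasurable
  have h3 : ∀ w q, ∫⁻ r in Set.Ioi (0 : ℝ), F r w q ≤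
      C3 * (ENNReal.ofReal (σ w q ^ (-((d : ℝ) + 2 + s * p))) * ‖g q - g w‖ₑ ^ p) := fun w q => by
    rcases eq_or_ne w q with rfl | hwq
    · simp [hF, hp0]
    have hσ0 : 0 < σ w q := by
      refine lt_of_le_of_ne (by positivity) fun h => hwq ?_
      have h1 : ‖w.2 - q.2‖ = 0 := by
        have := Real.sqrt_nonneg |w.1 - q.1|
        exact le_antisymm (by linarith [h.symm.le]) (norm_nonneg _)
      have h2 : √|w.1 - q.1| = 0 := by
        have : ‖w.2 - q.2‖ + √|w.1 - q.1| = 0 := h.symm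
        rwa [h1, zero_add] at this
      rw [norm_eq_zero, sub_eq_zero] at h1
      rw [Real.sqrt_eq_zero (abs_nonneg _), abs_eq_zero, sub_eq_zero] at h2
      exact Prod.ext h2 h1
    simp only [hF]
    rw [lintegral_mul_const _ (by fun_prop), lintegral_rpow_mul_add_rpow hσ0, mul_comm _ C3,
      mul_assoc, show e + 1 - B = -((d : ℝ) + 2 + s * p) by rw [hB1]; ring]
  calc _ ≤ ∫⁻ t : ℝ, C1 * ∫⁻ r in Set.Ioi (0 : ℝ), ∫⁻ y : Bdry d, ∫⁻ q, F r (t, y) q :=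
        lintegral_mono h1
    _ = C1 * ∫⁻ w : ℝ × Bdry d, ∫⁻ q, ∫⁻ r in Set.Ioi (0 : ℝ), F r w q := by
        rw [lintegral_const_mul' _ _ hC1, h2]
    _ ≤ C1 * ∫⁻ w : ℝ × Bdry d, ∫⁻ q,
          C3 * (ENNReal.ofReal (σ w q ^ (-((d : ℝ) + 2 + s * p))) * ‖g q - g w‖ₑ ^ p) := by
        gcongr with w q
        exact h3 w q
    _ = C1 * (C3 * ∫⁻ w : ℝ × Bdry d, ∫⁻ q,
          ENNReal.ofReal (σ w q ^ (-((d : ℝ) + 2 + s * p))) * ‖g q - g w‖ₑ ^ p) := by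
        simp_rw [lintegral_const_mul' _ _ hC3t.ne]
    _ ≤ C1 * (C3 * (C2 * (slobTime s p g ^ p + slobSpace s p g ^ p))) := by
        gcongr
        exact hC2e g hg
    _ = _ := by ring

/-! ### Convolution over the boundary with a homogeneous kernel -/

/-- The open half of space-time. -/
def upper (d : ℕ) : Set (ℝ × Space d) := {z | 0 < z.2 0}

theorem isOpen_upper (d : ℕ) : IsOpen (upper d) :=
  isOpen_lt continuous_const (by fun_prop)

theorem mem_upper {d : ℕ} {z : ℝ × Space d} : z ∈ upper d ↔ 0 < z.2 0 := Iff.rfl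

@[simp] theorem sub_bd_zero {d : ℕ} (z : ℝ × Space d) (q : ℝ × Bdry d) :
    (z - bd q).2 0 = z.2 0 := by simp [bd]

theorem sub_bd_mem {d : ℕ} {z : ℝ × Space d} (hz : z ∈ upper d) (q : ℝ × Bdry d) :
    z - bd q ∈ upper d := by rw [mem_upper, sub_bd_zero]; exact hz

theorem gauge_ge {d : ℕ} (z : ℝ × Space d) : z.2 0 ≤ gauge z := by
  unfold gauge
  have := le_abs_self (z.2 0)
  linarith [norm_nonneg (tang z.2), Real.sqrt_nonneg |z.1|]

theorem continuous_bd {d : ℕ} : Continuous (bd (d := d)) := by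
  have : Continuous fun q : ℝ × Bdry d => mkPoint 0 q.2 := by
    refine (PiLp.continuous_toLp 2 _).comp (continuous_pi fun i => ?_)
    refine Fin.cases continuous_const (fun i => ?_) i
    simp only [Fin.cons_succ]
    fun_prop
  exact continuous_fst.prodMk this

/-- The weight against which boundary data have to be integrable. -/
def decay {d : ℕ} (z : ℝ × Space d) : ℝ := ((1 + gauge z) ^ (d + 3))⁻¹

theorem decay_nonneg {d : ℕ} (z : ℝ × Space d) : 0 ≤ decay z := by
  have := gauge_nonneg z; unfold decay; positivity

/-- By the triangle inequality `1 + gauge w ≤ (1 + gauge z) (1 + gauge (z - w))`, so a translation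
costs only a factor that is locally bounded in `z`. -/
theorem decay_sub_le {d : ℕ} (z w : ℝ × Space d) :
    decay (z - w) ≤ (1 + gauge z) ^ (d + 3) * decay w := by
  have h1 := gauge_nonneg z
  have h2 := gauge_nonneg w
  have h3 := gauge_nonneg (z - w)
  have h4 : gauge w ≤ gauge z + gauge (z - w) := by
    have := gauge_add_le z (-(z - w))
    rwa [gauge_neg, ← sub_eq_add_neg, sub_sub_cancel] at this
  unfold decay
  rw [← div_eq_mul_inv, le_div_iff₀ (by positivity), inv_mul_le_iff₀ (by positivity), ← mul_pow]
  gcongr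
  nlinarith

/-- Kernels whose convolution with boundary data is smooth. -/
structure ConvKer {d : ℕ} (K : ℝ × Space d → ℂ) : Prop where
  smooth : ContDiffOn ℝ ∞ K (upper d)
  bound : ∀ (m : ℕ) (δ R : ℝ), 0 < δ → ∃ C : ℝ, 0 ≤ C ∧ ∀ z : ℝ × Space d, δ ≤ z.2 0 → z.2 0 ≤ R →
    ‖iteratedFDeriv ℝ m K z‖ ≤ C * decay z

/-- Boundary data with enough integrability at infinity. -/
structure Tame {d : ℕ} (g : ℝ × Bdry d → ℂ) : Prop where
  meas : AEStronglyMeasurable g volume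
  int : Integrable (fun q => ‖g q‖ * decay (bd q)) volume

/-- The convolution of the kernel `K` with the boundary data `g`. -/
def conv {d : ℕ} (K : ℝ × Space d → ℂ) (g : ℝ × Bdry d → ℂ) (z : ℝ × Space d) : ℂ :=
  ∫ q, g q * K (z - bd q)

theorem ConvKer.continuousOn {d : ℕ} {K : ℝ × Space d → ℂ} (hK : ConvKer K) (m : ℕ) :
    ContinuousOn (iteratedFDeriv ℝ m K) (upper d) :=
  (hK.smooth.continuousOn_iteratedFDerivWithin (m := m) (by exact_mod_cast le_top)
    (isOpen_upper d).uniqueDiffOn).congr fun _ hz =>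
      (iteratedFDerivWithin_of_isOpen m (isOpen_upper d) hz).symm

theorem ConvKer.differentiableAt {d : ℕ} {K : ℝ × Space d → ℂ} (hK : ConvKer K) (m : ℕ)
    {z : ℝ × Space d} (hz : z ∈ upper d) : DifferentiableAt ℝ (iteratedFDeriv ℝ m K) z := by
  have h := hK.smooth.differentiableOn_iteratedFDerivWithin (m := m)
    (by exact_mod_cast ENat.natCast_lt_top m) (isOpen_upper d).uniqueDiffOn
  refine ((h z hz).differentiableAt ((isOpen_upper d).mem_nhds hz)).congr_of_eventuallyEq ?_
  filter_upwards [(isOpen_upper d).mem_nhds hz] with w hw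
  exact (iteratedFDerivWithin_of_isOpen m (isOpen_upper d) hw).symm

theorem ConvKer.aestronglyMeasurable {d : ℕ} {K : ℝ × Space d → ℂ} (hK : ConvKer K)
    {g : ℝ × Bdry d → ℂ} (hg : Tame g) (m : ℕ) {z : ℝ × Space d} (hz : z ∈ upper d) :
    AEStronglyMeasurable (fun q => g q • iteratedFDeriv ℝ m K (z - bd q)) volume := by
  refine hg.meas.smul (Continuous.aestronglyMeasurable ?_)
  exact (hK.continuousOn m).comp_continuous (continuous_const.sub continuous_bd)
    fun q => sub_bd_mem hz q

/-- Near `z` the height stays between two positive numbers and the gauge is bounded, so one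
integrable function dominates all the integrands. This justifies differentiation under the integral
sign. -/
theorem ConvKer.exists_local_bound {d : ℕ} {K : ℝ × Space d → ℂ} (hK : ConvKer K)
    (g : ℝ × Bdry d → ℂ) (m : ℕ) {z : ℝ × Space d} (hz : z ∈ upper d) :
    ∃ s ∈ 𝓝 z, s ⊆ upper d ∧ ∃ C : ℝ, ∀ w ∈ s, ∀ q,
      ‖g q • iteratedFDeriv ℝ m K (w - bd q)‖ ≤ C * (‖g q‖ * decay (bd q)) := by
  have hz : 0 < z.2 0 := hz
  have hcont : Continuous fun w : ℝ × Space d => w.2 0 := by fun_prop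
  obtain ⟨C, hC0, hC⟩ := hK.bound m (z.2 0 / 2) (z.2 0 + 1) (by positivity)
  refine ⟨{w | z.2 0 / 2 < w.2 0} ∩ {w | w.2 0 < z.2 0 + 1} ∩ {w | gauge w < gauge z + 1},
    inter_mem (inter_mem ?_ ?_) ?_, fun w hw => ?_, C * (1 + (gauge z + 1)) ^ (d + 3), ?_⟩
  · exact (isOpen_lt continuous_const hcont).mem_nhds (by simpa using hz)
  · exact (isOpen_lt hcont continuous_const).mem_nhds (by simp)
  · exact (isOpen_lt continuous_gauge continuous_const).mem_nhds (by simp)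
  · exact lt_trans (half_pos hz) hw.1.1
  · rintro w ⟨⟨h1, h2⟩, h3⟩ q
    have h1 : z.2 0 / 2 < w.2 0 := h1
    have h2 : w.2 0 < z.2 0 + 1 := h2
    have h3 : gauge w < gauge z + 1 := h3
    have h4 := hC (w - bd q) (by rw [sub_bd_zero]; exact h1.le) (by rw [sub_bd_zero]; exact h2.le)
    have h5 := decay_sub_le w (bd q)
    have h6 := gauge_nonneg w
    have h7 := decay_nonneg (bd q)
    rw [norm_smul]
    calc ‖g q‖ * ‖iteratedFDeriv ℝ m K (w - bd q)‖
        ≤ ‖g q‖ * (C * ((1 + (gauge z + 1)) ^ (d + 3) * decay (bd q))) := by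
          gcongr
          refine h4.trans ?_
          gcongr
          refine h5.trans ?_
          gcongr
      _ = _ := by ring

theorem ConvKer.integrable {d : ℕ} {K : ℝ × Space d → ℂ} (hK : ConvKer K)
    {g : ℝ × Bdry d → ℂ} (hg : Tame g) (m : ℕ) {z : ℝ × Space d} (hz : z ∈ upper d) :
    Integrable (fun q => g q • iteratedFDeriv ℝ m K (z - bd q)) volume := by
  obtain ⟨s, hs, -, C, hC⟩ := hK.exists_local_bound g m hz
  exact (hg.int.const_mul C).mono' (hK.aestronglyMeasurable hg m hz)
    (Eventually.of_forall fun q => hC z (mem_of_mem_nhds hs) q)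

theorem ConvKer.integrable_mul {d : ℕ} {K : ℝ × Space d → ℂ} (hK : ConvKer K)
    {g : ℝ × Bdry d → ℂ} (hg : Tame g) {z : ℝ × Space d} (hz : z ∈ upper d) :
    Integrable (fun q => g q * K (z - bd q)) volume := by
  have := (ContinuousMultilinearMap.apply ℝ (fun _ : Fin 0 => ℝ × Space d) ℂ
    0).integrable_comp (hK.integrable hg 0 hz)
  simpa using this

theorem ConvKer.hasFDerivAt {d : ℕ} {K : ℝ × Space d → ℂ} (hK : ConvKer K)
    {g : ℝ × Bdry d → ℂ} (hg : Tame g) (m : ℕ) {z : ℝ × Space d} (hz : z ∈ upper d) :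
    HasFDerivAt (fun w => ∫ q, g q • iteratedFDeriv ℝ m K (w - bd q))
      (∫ q, g q • iteratedFDeriv ℝ (m + 1) K (z - bd q)).curryLeft z := by
  obtain ⟨s, hs, hsu, C, hC⟩ := hK.exists_local_bound g (m + 1) hz
  have h := hasFDerivAt_integral_of_dominated_of_fderiv_le (𝕜 := ℝ) (μ := volume) (x₀ := z)
    (F := fun w q => g q • iteratedFDeriv ℝ m K (w - bd q))
    (F' := fun w q => g q • (iteratedFDeriv ℝ (m + 1) K (w - bd q)).curryLeft)
    (bound := fun q => C * (‖g q‖ * decay (bd q))) hs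
    (by filter_upwards [(isOpen_upper d).mem_nhds hz] with w hw
        exact hK.aestronglyMeasurable hg m hw)
    (hK.integrable hg m hz) ?_ ?_ (hg.int.const_mul C) ?_
  · refine h.congr_fderiv ?_
    let L : ((ℝ × Space d) [×(m + 1)]→L[ℝ] ℂ) →L[ℝ]
        ((ℝ × Space d) →L[ℝ] ((ℝ × Space d) [×m]→L[ℝ] ℂ)) :=
      (continuousMultilinearCurryLeftEquiv ℝ (fun _ : Fin (m + 1) => ℝ × Space d)
        ℂ).toContinuousLinearEquiv.toContinuousLinearMap
    exact ContinuousLinearMap.integral_comp_comm (𝕜 := ℝ)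
      (Fₗ := (ℝ × Space d) →L[ℝ] ((ℝ × Space d) [×m]→L[ℝ] ℂ)) L (hK.integrable hg (m + 1) hz)
  · exact (continuousMultilinearCurryLeftEquiv ℝ (fun _ : Fin (m + 1) => ℝ × Space d) ℂ).continuous
      |>.comp_aestronglyMeasurable (hK.aestronglyMeasurable hg (m + 1) hz)
  · refine Eventually.of_forall fun q w hw => le_trans (le_of_eq ?_) (hC w hw q)
    exact (continuousMultilinearCurryLeftEquiv ℝ (fun _ : Fin (m + 1) => ℝ × Space d) ℂ).norm_map
      (g q • iteratedFDeriv ℝ (m + 1) K (w - bd q))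
  · refine Eventually.of_forall fun q w hw => ?_
    have h1 := (hK.differentiableAt m (sub_bd_mem (hsu hw) q)).hasFDerivAt
    rw [fderiv_iteratedFDeriv] at h1
    exact (h1.comp w ((hasFDerivAt_id w).sub_const (bd q))).const_smul (g q)

/-- Exhibiting the whole Taylor series gives smoothness and the formula for derivatives of every
order at the same time. -/
theorem ConvKer.hasFTaylorSeriesUpToOn {d : ℕ} {K : ℝ × Space d → ℂ} (hK : ConvKer K)
    {g : ℝ × Bdry d → ℂ} (hg : Tame g) : HasFTaylorSeriesUpToOn ∞ (conv K g)
      (fun z m => ∫ q, g q • iteratedFDeriv ℝ m K (z - bd q)) (upper d) where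
  zero_eq z hz := by
    change (∫ q, g q • iteratedFDeriv ℝ 0 K (z - bd q)) 0 = _
    rw [ContinuousMultilinearMap.integral_apply (hK.integrable hg 0 hz)]
    simp [conv]
  fderivWithin m _ z hz := (hK.hasFDerivAt hg m hz).hasFDerivWithinAt
  cont m _ z hz := (hK.hasFDerivAt hg m hz).continuousAt.continuousWithinAt

theorem ConvKer.contDiffOn_conv {d : ℕ} {K : ℝ × Space d → ℂ} (hK : ConvKer K)
    {g : ℝ × Bdry d → ℂ} (hg : Tame g) : ContDiffOn ℝ ∞ (conv K g) (upper d) :=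
  (hK.hasFTaylorSeriesUpToOn hg).contDiffOn

theorem ConvKer.iteratedFDeriv_conv {d : ℕ} {K : ℝ × Space d → ℂ} (hK : ConvKer K)
    {g : ℝ × Bdry d → ℂ} (hg : Tame g) (m : ℕ) {z : ℝ × Space d} (hz : z ∈ upper d) :
    iteratedFDeriv ℝ m (conv K g) z = ∫ q, g q • iteratedFDeriv ℝ m K (z - bd q) := by
  rw [← iteratedFDerivWithin_of_isOpen m (isOpen_upper d) hz]
  exact ((hK.hasFTaylorSeriesUpToOn hg).eq_iteratedFDerivWithin_of_uniqueDiffOn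
    (by exact_mod_cast le_top) (isOpen_upper d).uniqueDiffOn hz).symm

theorem ConvKer.timeDeriv_conv {d : ℕ} {K : ℝ × Space d → ℂ} (hK : ConvKer K)
    {g : ℝ × Bdry d → ℂ} (hg : Tame g) {z : ℝ × Space d} (hz : z ∈ upper d) :
    timeDeriv (conv K g) z = conv (timeDeriv K) g z := by
  have h := hK.iteratedFDeriv_conv hg 1 hz
  have h2 := congr($h fun _ => (1, 0))
  rw [ContinuousMultilinearMap.integral_apply (hK.integrable hg 1 hz)] at h2
  simpa [timeDeriv, conv] using h2

/-- The spatial derivatives of a function on space-time. -/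
theorem iteratedFDeriv_slice {d : ℕ} {f : ℝ × Space d → ℂ} (hf : ContDiffOn ℝ ∞ f (upper d)) (m : ℕ)
    (t : ℝ) {x : Space d} (hx : 0 < x 0) : iteratedFDeriv ℝ m (fun x => f (t, x)) x =
      (iteratedFDeriv ℝ m f (t, x)).compContinuousLinearMap
        fun _ => ContinuousLinearMap.inr ℝ ℝ (Space d) := by
  have hf' : ContDiffOn ℝ ∞ (fun w => f ((t, 0) + w)) (upper d) :=
    hf.comp (contDiff_const.add contDiff_id).contDiffOn fun w hw => by
      simpa [mem_upper] using hw
  have hpre : (ContinuousLinearMap.inr ℝ ℝ (Space d)) ⁻¹' (upper d) = halfSpace d := by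
    ext y; simp [mem_upper]; rfl
  have hop : IsOpen ((ContinuousLinearMap.inr ℝ ℝ (Space d)) ⁻¹' (upper d)) :=
    (isOpen_upper d).preimage (ContinuousLinearMap.inr ℝ ℝ (Space d)).continuous
  have hxm : x ∈ (ContinuousLinearMap.inr ℝ ℝ (Space d)) ⁻¹' (upper d) := by
    rw [hpre]; exact hx
  have h := (ContinuousLinearMap.inr ℝ ℝ (Space d)).iteratedFDerivWithin_comp_right hf'
    (isOpen_upper d).uniqueDiffOn hop.uniqueDiffOn hxm (i := m) (by exact_mod_cast le_top)
  rw [iteratedFDerivWithin_of_isOpen m hop hxm, iteratedFDerivWithin_of_isOpen m (isOpen_upper d)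
    hxm, iteratedFDeriv_comp_add_left] at h
  have e1 : (t, (0 : Space d)) + (ContinuousLinearMap.inr ℝ ℝ (Space d)) x = (t, x) := by simp
  have e2 : (fun w => f ((t, 0) + w)) ∘ (ContinuousLinearMap.inr ℝ ℝ (Space d))
      = fun x => f (t, x) := by ext y; simp
  rwa [e1, e2] at h

/-- Only spatial directions are differentiated, so `exists_spatial_bound` applies with a constant
independent of `x₁`. -/
theorem enorm_iteratedFDeriv_conv_le {d a : ℕ} {K : ℝ × Space d → ℂ} (hK : ConvKer K)
    (hh : IsHomogKer a K) (m : ℕ) : ∃ C : ℝ≥0, ∀ g : ℝ × Bdry d → ℂ, Tame g →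
      ∀ (t : ℝ) (x : Space d), 0 < x 0 →
      ‖iteratedFDeriv ℝ m (fun x => conv K g (t, x)) x‖ₑ ≤ C * ∫⁻ q : ℝ × Bdry d,
        ENNReal.ofReal (gauge ((t, x) - bd q) ^ (-((a : ℝ) + m))) * ‖g q‖ₑ := by
  obtain ⟨C, hC0, hC⟩ := hh.exists_spatial_bound m
  refine ⟨C.toNNReal, fun g hg t x hx => ?_⟩
  have hz : (t, x) ∈ upper d := hx
  rw [iteratedFDeriv_slice (hK.contDiffOn_conv hg) m t hx, hK.iteratedFDeriv_conv hg m hz]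
  have hcomm : (∫ q, g q • iteratedFDeriv ℝ m K ((t, x) - bd q)).compContinuousLinearMap
      (fun _ => ContinuousLinearMap.inr ℝ ℝ (Space d)) =
      ∫ q, (g q • iteratedFDeriv ℝ m K ((t, x) - bd q)).compContinuousLinearMap
        (fun _ => ContinuousLinearMap.inr ℝ ℝ (Space d)) :=
    ((ContinuousMultilinearMap.compContinuousLinearMapL (F := ℂ)
      (fun _ : Fin m => ContinuousLinearMap.inr ℝ ℝ (Space d))).integral_comp_comm
        (hK.integrable hg m hz)).symm
  rw [hcomm, ← lintegral_const_mul' _ _ ENNReal.coe_ne_top]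
  refine (enorm_integral_le_lintegral_enorm _).trans (lintegral_mono fun q => ?_)
  have hpos : 0 < gauge ((t, x) - bd q) := lt_of_lt_of_le (by rw [sub_bd_zero]; exact hx) (gauge_ge _)
  have e : (g q • iteratedFDeriv ℝ m K ((t, x) - bd q)).compContinuousLinearMap
        (fun _ => ContinuousLinearMap.inr ℝ ℝ (Space d)) =
      g q • (iteratedFDeriv ℝ m K ((t, x) - bd q)).compContinuousLinearMap
        (fun _ => ContinuousLinearMap.inr ℝ ℝ (Space d)) := rfl
  rw [e, enorm_smul, mul_comm, ← mul_assoc]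
  gcongr
  have h1 := hC _ hpos
  change _ ≤ ENNReal.ofReal C * _
  rw [← ofReal_norm, ← ENNReal.ofReal_mul hC0]
  refine ENNReal.ofReal_le_ofReal (h1.trans (le_of_eq ?_))
  rw [Real.rpow_neg hpos.le, ← Nat.cast_add, Real.rpow_natCast]

/-! ### Homogeneous kernels as convolution kernels -/

theorem upper_subset_compl {d : ℕ} : upper d ⊆ {0}ᶜ := by
  rintro z hz rfl
  exact lt_irrefl _ (mem_upper.1 hz)

/-- For `gauge z ≥ δ` the numbers `gauge z` and `1 + gauge z` are comparable, and the `k` surplus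
powers are bounded by `δ ^ (-k)`. -/
theorem inv_gauge_pow_le {d : ℕ} {δ : ℝ} (hδ : 0 < δ) (k : ℕ) : ∃ C : ℝ, 0 ≤ C ∧
    ∀ z : ℝ × Space d, δ ≤ z.2 0 → (gauge z ^ (d + 3 + k))⁻¹ ≤ C * decay z := by
  refine ⟨(δ⁻¹ + 1) ^ (d + 3) * (δ ^ k)⁻¹, by positivity, fun z hz => ?_⟩
  have h1 : δ ≤ gauge z := hz.trans (gauge_ge z)
  have h2 : 0 < gauge z := hδ.trans_le h1
  have h3 : 1 + gauge z ≤ (δ⁻¹ + 1) * gauge z := by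
    have : 1 ≤ δ⁻¹ * gauge z := by rw [← div_eq_inv_mul, one_le_div hδ]; exact h1
    linarith
  unfold decay
  rw [pow_add, mul_inv, mul_right_comm]
  gcongr
  rw [← div_eq_mul_inv, le_div_iff₀ (by positivity), inv_mul_le_iff₀ (by positivity), mul_comm,
    ← mul_pow, mul_comm]
  gcongr
  linarith

theorem IsHomogKer.exists_decay_bound {d a : ℕ} {K : ℝ × Space d → ℂ} (h : IsHomogKer a K) (m : ℕ)
    (ham : d + 3 ≤ a + m) {δ : ℝ} (hδ : 0 < δ) : ∃ C : ℝ, 0 ≤ C ∧ ∀ z : ℝ × Space d, δ ≤ z.2 0 →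
      ‖iteratedFDeriv ℝ m K z‖ ≤ C * decay z := by
  obtain ⟨C, hC0, hC⟩ := h.exists_joint_bound m hδ
  obtain ⟨k, hk⟩ := Nat.exists_eq_add_of_le ham
  obtain ⟨C', hC'0, hC'⟩ := inv_gauge_pow_le (d := d) hδ k
  refine ⟨C * C', by positivity, fun z hz => (hC z (hz.trans (gauge_ge z))).trans ?_⟩
  rw [hk, mul_assoc]
  gcongr
  exact hC' z hz

theorem IsHomogKer.convKer {d a : ℕ} {K : ℝ × Space d → ℂ} (h : IsHomogKer a K)
    (ha : d + 3 ≤ a) : ConvKer K where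
  smooth := h.smooth.mono upper_subset_compl
  bound m δ R hδ := by
    obtain ⟨C, hC0, hC⟩ := h.exists_decay_bound m (by omega) hδ
    exact ⟨C, hC0, fun z hz _ => hC z hz⟩

/-- At order 0 the degree `d + 2` is one short of the decay `d + 3`, so the kernel is written as
`x₁` times the heat kernel and `x₁ ≤ R` is used; this is why `ConvKer` has the upper bound `R`. From
the first derivative on homogeneity suffices. -/
theorem convKer_poisKer {d : ℕ} : ConvKer (poisKer (d := d)) where
  smooth := isHomogKer_poisKer.smooth.mono upper_subset_compl
  bound m δ R hδ := by
    rcases m with _ | m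
    · obtain ⟨C, hC0, hC⟩ := (isHomogKer_heatKer (d := d)).exists_decay_bound 0 (by omega) hδ
      refine ⟨|R| * C, by positivity, fun z hz hR => ?_⟩
      have := hC z hz
      rw [norm_iteratedFDeriv_zero] at this ⊢
      rw [poisKer_eq, norm_mul, mul_assoc]
      refine mul_le_mul ?_ this (norm_nonneg _) (abs_nonneg _)
      rw [Complex.norm_real, Real.norm_eq_abs]
      exact abs_le_abs_of_nonneg (hδ.le.trans hz) hR
    · obtain ⟨C, hC0, hC⟩ := (isHomogKer_poisKer (d := d)).exists_decay_bound (m + 1) (by omega) hδ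
      exact ⟨C, hC0, fun z hz _ => hC z hz⟩

theorem convKer_timeDeriv_poisKer {d : ℕ} : ConvKer (timeDeriv (poisKer (d := d))) :=
  isHomogKer_poisKer.timeDeriv.convKer (by omega)

theorem poissonIntegrand_eq {d : ℕ} (g : ℝ × Bdry d → ℂ) (t : ℝ) (x : Space d) (q : ℝ × Bdry d) :
    poissonIntegrand g t x q = g q * poisKer ((t, x) - bd q) := by
  have : mkPoint (x 0) (tang x - q.2) = x - mkPoint 0 q.2 := by
    ext i
    refine Fin.cases ?_ (fun i => ?_) i
    · simp
    · simp [mkPoint, tang]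
  rw [poissonIntegrand, this, mul_comm]
  rfl

theorem poissonExt_eq {d : ℕ} (g : ℝ × Bdry d → ℂ) (t : ℝ) (x : Space d) :
    poissonExt g t x = conv poisKer g (t, x) := by
  simp only [poissonExt, conv, poissonIntegrand_eq]

/-! ### The mass of the Poisson kernel and pointwise bounds of the extension -/

instance isAddHaarMeasure_volume_prod {E F : Type*} [NormedAddCommGroup E] [NormedAddCommGroup F]
    [MeasureSpace E] [MeasureSpace F] [BorelSpace E] [BorelSpace F] [SecondCountableTopology E]
    [SecondCountableTopology F] [(volume : Measure E).IsAddHaarMeasure]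
    [(volume : Measure F).IsAddHaarMeasure] [SFinite (volume : Measure E)]
    [SFinite (volume : Measure F)] : (volume : Measure (E × F)).IsAddHaarMeasure :=
  inferInstanceAs ((volume : Measure E).prod (volume : Measure F)).IsAddHaarMeasure

instance isNegInvariant_volume_prod {d : ℕ} : (volume : Measure (ℝ × Bdry d)).IsNegInvariant :=
  Measure.IsAddHaarMeasure.isNegInvariant_of_regular _

/-- The Poisson kernel at height `r`, as a function on the boundary. -/
def bdKer {d : ℕ} (r : ℝ) (w : ℝ × Bdry d) : ℝ := poissonKernel w.1 (mkPoint r w.2)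

theorem bdKer_nonneg {d : ℕ} {r : ℝ} (hr : 0 ≤ r) (w : ℝ × Bdry d) : 0 ≤ bdKer r w := by
  rw [bdKer, poissonKernel_eq]
  exact mul_nonneg hr (heatKer_nonneg _)

theorem measurable_bdKer {d : ℕ} :
    Measurable fun v : ℝ × (ℝ × Bdry d) => bdKer v.1 v.2 := by
  have h1 : Measurable fun v : ℝ × (ℝ × Bdry d) => (mkPoint v.1 v.2.2 : Space d) :=
    measurable_mkPoint.comp (f := fun v : ℝ × (ℝ × Bdry d) => (v.1, v.2.2)) (by fun_prop)
  unfold bdKer poissonKernel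
  refine Measurable.ite (measurableSet_lt measurable_const (by fun_prop)) ?_ measurable_const
  simp only [mkPoint_zero]
  have h2 : Measurable fun v : ℝ × (ℝ × Bdry d) => ‖(mkPoint v.1 v.2.2 : Space d)‖ := h1.norm
  fun_prop

theorem measurable_bdKer_right {d : ℕ} (r : ℝ) : Measurable (bdKer (d := d) r) :=
  measurable_bdKer.comp (g := fun v : ℝ × (ℝ × Bdry d) => bdKer v.1 v.2) (f := fun w => (r, w))
    measurable_prodMk_left

/-- The substitution `u = 1 / t` leads to the Gamma integral with `Γ(1/2) = √π`. -/
theorem integral_inv_gaussian {r : ℝ} (hr : 0 < r) :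
    ∫ t in Set.Ioi (0 : ℝ), 1 / (4 * Real.pi * t) ^ ((1 : ℝ) / 2) * (r / t) *
      Real.exp (-r ^ 2 / (4 * t)) = 1 := by
  have h1 := integral_comp_rpow_Ioi (fun u : ℝ => (4 * Real.pi) ^ (-(1 : ℝ) / 2) * r *
    (u ^ ((1 : ℝ) / 2 - 1) * Real.exp (-(r ^ 2 / 4 * u)))) (p := -1) (by norm_num)
  rw [integral_const_mul, Real.integral_rpow_mul_exp_neg_mul_Ioi (by norm_num) (by positivity),
    Real.Gamma_one_half_eq] at h1
  have h2 : ∫ t in Set.Ioi (0 : ℝ), 1 / (4 * Real.pi * t) ^ ((1 : ℝ) / 2) * (r / t) *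
      Real.exp (-r ^ 2 / (4 * t)) = (4 * Real.pi) ^ (-(1 : ℝ) / 2) * r *
        ((1 / (r ^ 2 / 4)) ^ ((1 : ℝ) / 2) * √Real.pi) := by
    rw [← h1]
    refine setIntegral_congr_fun measurableSet_Ioi fun t ht => ?_
    have ht : 0 < t := ht
    simp only [smul_eq_mul, abs_neg, abs_one, one_mul]
    rw [show -r ^ 2 / (4 * t) = -(r ^ 2 / 4 * t ^ (-1 : ℝ)) by
        rw [Real.rpow_neg_one]; field_simp, Real.mul_rpow (by positivity) ht.le,
      ← Real.rpow_mul ht.le, show (-1 : ℝ) * (1 / 2 - 1) = 1 / 2 by norm_num,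
      show (-1 : ℝ) - 1 = -2 by norm_num, show -(1 : ℝ) / 2 = -(1 / 2) by norm_num,
      Real.rpow_neg (by positivity), Real.rpow_neg ht.le, Real.rpow_two]
    have e : t ^ ((1 : ℝ) / 2) * t ^ ((1 : ℝ) / 2) = t := by
      rw [← Real.rpow_add ht]; norm_num
    have e0 : t ^ ((1 : ℝ) / 2) ≠ 0 := (Real.rpow_pos_of_pos ht _).ne'
    field_simp
    rw [pow_two, e, mul_right_comm, ← Real.rpow_add (by positivity)]
    norm_num
  rw [h2, ← Real.sqrt_eq_rpow, show 1 / (r ^ 2 / 4) = (2 / r) ^ 2 by field_simp; norm_num,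
    Real.sqrt_sq (by positivity), show -(1 : ℝ) / 2 = -(1 / 2) by norm_num,
    Real.rpow_neg (by positivity), ← Real.sqrt_eq_rpow, show 4 * Real.pi = 2 ^ 2 * Real.pi by norm_num,
    Real.sqrt_mul (by positivity), Real.sqrt_sq (by norm_num)]
  have : 0 < √Real.pi := Real.sqrt_pos.2 Real.pi_pos
  field_simp

/-- The tangential Gaussian integral cancels a factor `(4πt) ^ (d / 2)` and leaves the
one-dimensional `integral_inv_gaussian`. -/
theorem lintegral_bdKer {d : ℕ} {r : ℝ} (hr : 0 < r) :
    ∫⁻ w : ℝ × Bdry d, ENNReal.ofReal (bdKer r w) = 1 := by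
  have hm : Measurable fun w : ℝ × Bdry d => ENNReal.ofReal (bdKer r w) :=
    ENNReal.measurable_ofReal.comp (measurable_bdKer_right r)
  rw [lintegral_prod_volume hm]
  have h0 : ∀ t : ℝ, ∫⁻ y : Bdry d, ENNReal.ofReal (bdKer r (t, y)) =
      (Set.Ioi (0 : ℝ)).indicator (fun t => ENNReal.ofReal (1 / (4 * Real.pi * t) ^ ((1 : ℝ) / 2)
        * (r / t) * Real.exp (-r ^ 2 / (4 * t)))) t := fun t => by
    by_cases ht : 0 < t
    · rw [Set.indicator_of_mem (show t ∈ Set.Ioi (0 : ℝ) from ht)]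
      set c : ℝ := 1 / (4 * Real.pi * t) ^ (((d : ℝ) + 1) / 2) * (r / t) * Real.exp (-r ^ 2 / (4 * t))
        with hc
      have e1 : ∀ y : Bdry d, bdKer r (t, y) = c * Real.exp (-(1 / (4 * t)) * ‖y‖ ^ 2) := fun y => by
        have : ‖(mkPoint r y : Space d)‖ ^ 2 = r ^ 2 + ‖y‖ ^ 2 := norm_sq_eq _
        rw [bdKer, poissonKernel, if_pos ht, this, hc, mul_assoc _ (Real.exp _), ← Real.exp_add]
        simp only [mkPoint_zero]
        congr 2
        field_simp
        ring
      have e2 := GaussianFourier.integral_rexp_neg_mul_sq_norm (V := Bdry d)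
        (show 0 < 1 / (4 * t) by positivity)
      have e3 : Integrable fun y : Bdry d => Real.exp (-(1 / (4 * t)) * ‖y‖ ^ 2) := by
        refine Integrable.of_integral_ne_zero ?_
        rw [e2]
        positivity
      simp_rw [e1]
      rw [← ofReal_integral_eq_lintegral_ofReal (e3.const_mul c)
        (Eventually.of_forall fun y => by positivity), integral_const_mul, e2,
        finrank_euclideanSpace_fin, hc, show Real.pi / (1 / (4 * t)) = 4 * Real.pi * t by
          field_simp]
      congr 1
      rw [show ((d : ℝ) + 1) / 2 = d / 2 + 1 / 2 by ring, Real.rpow_add (by positivity)]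
      have : (4 * Real.pi * t) ^ ((d : ℝ) / 2) ≠ 0 := by positivity
      field_simp
    · rw [Set.indicator_of_notMem (show t ∉ Set.Ioi (0 : ℝ) from ht)]
      simp [bdKer, poissonKernel, ht]
  simp_rw [h0]
  have hi := integral_inv_gaussian hr
  rw [lintegral_indicator measurableSet_Ioi, ← ofReal_integral_eq_lintegral_ofReal, hi,
    ENNReal.ofReal_one]
  · exact Integrable.of_integral_ne_zero (by rw [hi]; exact one_ne_zero)
  · filter_upwards [ae_restrict_mem measurableSet_Ioi] with t ht
    have ht : 0 < t := ht
    positivity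

theorem poisKer_sub_bd {d : ℕ} (w : ℝ × Bdry d) (r : ℝ) (q : ℝ × Bdry d) :
    poisKer ((w.1, mkPoint r w.2) - bd q) = (bdKer r (w - q) : ℂ) := by
  have : mkPoint r w.2 - mkPoint 0 q.2 = mkPoint r (w.2 - q.2) := by
    ext i
    refine Fin.cases ?_ (fun i => ?_) i
    · simp
    · simp [mkPoint]
  simp only [poisKer, bdKer, bd, Prod.fst_sub, Prod.snd_sub, this]

/-- The weight is `gauge ^ (-(d + 3))` as seen from the point at height 1 above the origin, so
`exists_lintegral_gauge_le` applies with `A = d + 3`. -/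
theorem integrable_decay_bd (d : ℕ) : Integrable fun q : ℝ × Bdry d => decay (bd q) := by
  obtain ⟨C, hC, h⟩ := exists_lintegral_gauge_le d (A := (d : ℝ) + 3) (by linarith)
  have h1 := h (0, mkPoint 1 0) (by simp)
  have h2 : ∀ q : ℝ × Bdry d, gauge ((0, mkPoint 1 0) - bd q) ^ (-((d : ℝ) + 3)) = decay (bd q) := by
    intro q
    have h3 : gauge ((0, mkPoint 1 0) - bd q) = 1 + gauge (bd q) := by
      rw [gauge_sub_bd]
      simp [gauge, bd]
      ring
    have := gauge_nonneg (bd q)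
    rw [h3, decay, Real.rpow_neg (by positivity)]
    congr 1
    exact_mod_cast Real.rpow_natCast _ _
  simp_rw [h2] at h1
  refine ⟨?_, ?_⟩
  · have : Continuous fun q : ℝ × Bdry d => decay (bd q) := by
      unfold decay
      refine Continuous.inv₀ ?_ fun q => ?_
      · exact (continuous_const.add (continuous_gauge.comp continuous_bd)).pow _
      · have := gauge_nonneg (bd q); positivity
    exact this.aestronglyMeasurable
  · rw [hasFiniteIntegral_iff_ofReal (Eventually.of_forall fun q => decay_nonneg _), h1]
    simpa using hC.lt_top

theorem decay_le_one {d : ℕ} (z : ℝ × Space d) : decay z ≤ 1 := by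
  have := gauge_nonneg z
  exact inv_le_one_of_one_le₀ (one_le_pow₀ (by linarith))

theorem tame_const {d : ℕ} (c : ℂ) : Tame fun _ : ℝ × Bdry d => c :=
  ⟨aestronglyMeasurable_const, (integrable_decay_bd d).const_mul _⟩

theorem Tame.sub {d : ℕ} {f g : ℝ × Bdry d → ℂ} (hf : Tame f) (hg : Tame g) :
    Tame fun q => f q - g q where
  meas := hf.meas.sub hg.meas
  int := by
    refine (hf.int.add hg.int).mono' ((hf.meas.sub hg.meas).norm.mul
      (integrable_decay_bd d).aestronglyMeasurable) (Eventually.of_forall fun q => ?_)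
    rw [norm_mul, norm_norm, Real.norm_of_nonneg (decay_nonneg _), Pi.add_apply, ← add_mul]
    exact mul_le_mul_of_nonneg_right (norm_sub_le _ _) (decay_nonneg _)

theorem tame_of_memLp {d : ℕ} {p : ℝ} (hp : 1 < p) {g : ℝ × Bdry d → ℂ}
    (hg : MemLp g (ENNReal.ofReal p) volume) : Tame g where
  meas := hg.1
  int := by
    have h1 := hg.integrable_norm_rpow (by simp; linarith) ENNReal.ofReal_ne_top
    rw [ENNReal.toReal_ofReal (by linarith)] at h1
    refine ((integrable_decay_bd d).add h1).mono' (hg.1.norm.mul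
      (integrable_decay_bd d).aestronglyMeasurable) (Eventually.of_forall fun q => ?_)
    rw [norm_mul, norm_norm, Real.norm_of_nonneg (decay_nonneg _), Pi.add_apply]
    have h2 := decay_nonneg (bd q)
    have h3 := decay_le_one (bd q)
    -- Where `‖g‖ ≤ 1` the weight dominates; elsewhere `‖g‖ ≤ ‖g‖ ^ p` and the weight is at most 1.
    rcases le_total ‖g q‖ 1 with h | h
    · have : 0 ≤ ‖g q‖ ^ p := by positivity
      nlinarith
    · have : ‖g q‖ ≤ ‖g q‖ ^ p := Real.self_le_rpow_of_one_le h hp.le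
      nlinarith

theorem MemSlob.memLp {d : ℕ} {s p : ℝ} {g : ℝ × Bdry d → ℂ} (hg : MemSlob s p g) :
    MemLp g (ENNReal.ofReal p) volume := by
  refine ⟨hg.1, lt_of_le_of_lt ?_ hg.2⟩
  rw [slobNorm, add_assoc]
  exact le_self_add

theorem conv_poisKer_const {d : ℕ} (c : ℂ) {z : ℝ × Space d} (hz : z ∈ upper d) :
    conv poisKer (fun _ => c) z = c := by
  have hz : 0 < z.2 0 := hz
  have e : ∀ q : ℝ × Bdry d, poisKer (z - bd q) = (bdKer (z.2 0) ((z.1, tang z.2) - q) : ℂ) :=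
    fun q => by
      rw [← poisKer_sub_bd]
      simp
  have h1 : ∫ q : ℝ × Bdry d, bdKer (z.2 0) ((z.1, tang z.2) - q) = 1 := by
    rw [integral_sub_left_eq_self (bdKer (z.2 0)) volume, integral_eq_lintegral_of_nonneg_ae
      (Eventually.of_forall fun q => bdKer_nonneg hz.le q)
      (measurable_bdKer_right _).aestronglyMeasurable, lintegral_bdKer hz, ENNReal.toReal_one]
  simp_rw [conv, e]
  rw [integral_const_mul, integral_complex_ofReal, h1]
  simp

/-- Unit mass of the kernel in the form in which it is used: derivatives of the extension see only
increments of `g`. -/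
theorem conv_sub_const {d : ℕ} {g : ℝ × Bdry d → ℂ} (hg : Tame g) (c : ℂ) {z : ℝ × Space d}
    (hz : z ∈ upper d) : conv poisKer (fun q => g q - c) z = conv poisKer g z - c := by
  nth_rewrite 2 [← conv_poisKer_const c hz]
  rw [conv, conv, conv, ← integral_sub (convKer_poisKer.integrable_mul hg hz)
    (convKer_poisKer.integrable_mul (tame_const c) hz)]
  simp_rw [sub_mul]

theorem iteratedFDeriv_conv_sub_const {d : ℕ} {g : ℝ × Bdry d → ℂ} (hg : Tame g) (c : ℂ) {m : ℕ}
    (hm : m ≠ 0) (t : ℝ) {x : Space d} (hx : 0 < x 0) :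
    iteratedFDeriv ℝ m (fun x => conv poisKer g (t, x)) x =
      iteratedFDeriv ℝ m (fun x => conv poisKer (fun q => g q - c) (t, x)) x := by
  have hmem : (halfSpace d : Set (Space d)) ∈ 𝓝 x := (halfSpace d).isOpen.mem_nhds hx
  have h1 : (fun x => conv poisKer g (t, x)) =ᶠ[𝓝 x]
      ((fun x => conv poisKer (fun q => g q - c) (t, x)) + fun _ => c) := by
    filter_upwards [hmem] with y hy
    rw [Pi.add_apply, conv_sub_const hg c hy, sub_add_cancel]
  rw [(h1.iteratedFDeriv ℝ m).self_of_nhds, iteratedFDeriv_add_apply, iteratedFDeriv_const_of_ne hm,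
    Pi.zero_apply, add_zero]
  · have h2 := (convKer_poisKer.contDiffOn_conv (hg.sub (tame_const c))).contDiffAt
      ((isOpen_upper d).mem_nhds (show (t, x) ∈ upper d from hx))
    have h3 : ContDiffAt ℝ ∞ (fun y : Space d => (t, y)) x := contDiffAt_const.prodMk contDiffAt_id
    exact (h2.comp x h3).of_le (by exact_mod_cast le_top)
  · exact contDiffAt_const

/-- The constant subtracted from the data is their value `g (t, x')` below the point of evaluation,
which produces the increments in `majorant`. Order 0 is excluded because the constant survives
there. -/
theorem exists_enorm_iteratedFDeriv_le (d : ℕ) {m : ℕ} (hm : m ≠ 0) :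
    ∃ C : ℝ≥0, ∀ g : ℝ × Bdry d → ℂ, Tame g → ∀ (t : ℝ) (x : Space d), 0 < x 0 →
      ‖iteratedFDeriv ℝ m (fun x => conv poisKer g (t, x)) x‖ₑ ≤ C * majorant g (d + 2 + m) t x := by
  obtain ⟨C, hC⟩ := enorm_iteratedFDeriv_conv_le (d := d) convKer_poisKer isHomogKer_poisKer m
  refine ⟨C, fun g hg t x hx => ?_⟩
  rw [iteratedFDeriv_conv_sub_const hg (g (t, tang x)) hm t hx]
  refine (hC _ (hg.sub (tame_const _)) t x hx).trans (le_of_eq ?_)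
  rw [majorant]
  push_cast
  rfl

/-- The value `g (t, x')` is frozen before differentiation, so it is a constant for all the
derivatives taken at the point. The time derivative accounts for the 2 in the exponent. -/
theorem exists_enorm_iteratedFDeriv_timeDeriv_le (d : ℕ) (m : ℕ) :
    ∃ C : ℝ≥0, ∀ g : ℝ × Bdry d → ℂ, Tame g → ∀ (t : ℝ) (x : Space d), 0 < x 0 →
      ‖iteratedFDeriv ℝ m (fun x => timeDeriv (conv poisKer g) (t, x)) x‖ₑ
        ≤ C * majorant g (d + 2 + (m + 2)) t x := by
  obtain ⟨C, hC⟩ := enorm_iteratedFDeriv_conv_le (d := d) convKer_timeDeriv_poisKer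
    isHomogKer_poisKer.timeDeriv m
  refine ⟨C, fun g hg t x hx => ?_⟩
  have hmem : (halfSpace d : Set (Space d)) ∈ 𝓝 x := (halfSpace d).isOpen.mem_nhds hx
  have hc := hg.sub (tame_const (g (t, tang x)))
  have h1 : (fun x => timeDeriv (conv poisKer g) (t, x)) =ᶠ[𝓝 x]
      fun x' => conv (timeDeriv poisKer) (fun q => g q - g (t, tang x)) (t, x') := by
    filter_upwards [hmem] with y hy
    have hy : (t, y) ∈ upper d := hy
    rw [← convKer_poisKer.timeDeriv_conv hc hy]
    have h2 : conv poisKer (fun q => g q - g (t, tang x)) =ᶠ[𝓝 (t, y)]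
        fun z => conv poisKer g z - g (t, tang x) := by
      filter_upwards [(isOpen_upper d).mem_nhds hy] with z hz using conv_sub_const hg _ hz
    rw [timeDeriv, timeDeriv, h2.fderiv_eq, fderiv_sub_const]
  rw [(h1.iteratedFDeriv ℝ m).self_of_nhds]
  refine (hC _ hc t x hx).trans (le_of_eq ?_)
  rw [majorant]
  congr 1
  refine lintegral_congr fun q => ?_
  congr 4
  push_cast
  ring

/-- The extension is a contraction from the boundary to every height. -/
theorem lintegral_conv_rpow_le {d : ℕ} {p : ℝ} (hp : 1 < p) {g : ℝ × Bdry d → ℂ}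
    (hg : Measurable g) {r : ℝ} (hr : 0 < r) :
    ∫⁻ w : ℝ × Bdry d, ‖conv poisKer g (w.1, mkPoint r w.2)‖ₑ ^ p ≤ ∫⁻ q, ‖g q‖ₑ ^ p := by
  have hk : Measurable fun v : (ℝ × Bdry d) × (ℝ × Bdry d) =>
      ENNReal.ofReal (bdKer r (v.1 - v.2)) :=
    ENNReal.measurable_ofReal.comp ((measurable_bdKer_right r).comp (by fun_prop))
  have h1 : ∀ w : ℝ × Bdry d, ‖conv poisKer g (w.1, mkPoint r w.2)‖ₑ ^ p ≤
      ∫⁻ q, ENNReal.ofReal (bdKer r (w - q)) * ‖g q‖ₑ ^ p := fun w => by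
    have hkw : Measurable fun q => ENNReal.ofReal (bdKer r (w - q)) :=
      ENNReal.measurable_ofReal.comp ((measurable_bdKer_right r).comp (by fun_prop))
    have h2 : ‖conv poisKer g (w.1, mkPoint r w.2)‖ₑ ≤
        ∫⁻ q, ENNReal.ofReal (bdKer r (w - q)) * ‖g q‖ₑ := by
      refine (enorm_integral_le_lintegral_enorm _).trans (le_of_eq (lintegral_congr fun q => ?_))
      rw [poisKer_sub_bd, enorm_mul, mul_comm, ← ofReal_norm (_ : ℂ), Complex.norm_real,
        Real.norm_of_nonneg (bdKer_nonneg hr.le _)]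
    -- Mass one in `q` removes the factor from Jensen's inequality; after the exchange of integrals,
    -- mass one in `w` removes the kernel.
    refine (ENNReal.rpow_le_rpow h2 (by linarith)).trans ((lintegral_kernel_rpow_le hp
      hkw.aemeasurable hg.enorm.aemeasurable).trans (le_of_eq ?_))
    rw [lintegral_sub_left_eq_self (fun q => ENNReal.ofReal (bdKer r q)) w, lintegral_bdKer hr,
      ENNReal.one_rpow, one_mul]
  refine (lintegral_mono h1).trans (le_of_eq ?_)
  rw [lintegral_lintegral_swap
    (hk.mul ((hg.comp measurable_snd).enorm.pow_const p)).aemeasurable]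
  refine lintegral_congr fun q => ?_
  have hkq : Measurable fun w => ENNReal.ofReal (bdKer r (w - q)) :=
    ENNReal.measurable_ofReal.comp ((measurable_bdKer_right r).comp (by fun_prop))
  rw [lintegral_mul_const _ hkq, lintegral_sub_right_eq_self
    (fun w => ENNReal.ofReal (bdKer r w)) q, lintegral_bdKer hr, one_mul]

/-! ### The pointwise size of a function and its scaled derivatives -/

/-- The sum of `x₁ ^ j |D ^ (j + 1) F|` and `x₁ ^ (j + 1) |D ^ j F_t|`, `j ≤ M`. -/
def djet {d : ℕ} (M : ℕ) (F : ℝ × Space d → ℂ) (z : ℝ × Space d) : ℝ≥0∞ :=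
  ∑ j ∈ Finset.range (M + 1),
    (ENNReal.ofReal (z.2 0) ^ j * ‖iteratedFDeriv ℝ (j + 1) (fun x => F (z.1, x)) z.2‖ₑ +
      ENNReal.ofReal (z.2 0) ^ (j + 1) * ‖iteratedFDeriv ℝ j (fun x => timeDeriv F (z.1, x)) z.2‖ₑ)

/-- The sum of `|F|`, `x₁ ^ j |D ^ (j + 1) F|` and `x₁ ^ (j + 1) |D ^ j F_t|`, `j ≤ M`. -/
def jet {d : ℕ} (M : ℕ) (F : ℝ × Space d → ℂ) (z : ℝ × Space d) : ℝ≥0∞ := ‖F z‖ₑ + djet M F z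

theorem enorm_le_jet {d : ℕ} (M : ℕ) (F : ℝ × Space d → ℂ) (z : ℝ × Space d) :
    ‖F z‖ₑ ≤ jet M F z := le_self_add

theorem space_le_djet {d : ℕ} {M j : ℕ} (hj : j ≤ M) (F : ℝ × Space d → ℂ) (z : ℝ × Space d) :
    ENNReal.ofReal (z.2 0) ^ j * ‖iteratedFDeriv ℝ (j + 1) (fun x => F (z.1, x)) z.2‖ₑ
      ≤ djet M F z :=
  le_self_add.trans (Finset.single_le_sum (f := fun j =>
    (ENNReal.ofReal (z.2 0) ^ j * ‖iteratedFDeriv ℝ (j + 1) (fun x => F (z.1, x)) z.2‖ₑ +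
      ENNReal.ofReal (z.2 0) ^ (j + 1) *
        ‖iteratedFDeriv ℝ j (fun x => timeDeriv F (z.1, x)) z.2‖ₑ))
    (fun _ _ => zero_le) (Finset.mem_range.2 (Nat.lt_succ_of_le hj)))

theorem space_le_jet {d : ℕ} {M j : ℕ} (hj : j ≤ M) (F : ℝ × Space d → ℂ) (z : ℝ × Space d) :
    ENNReal.ofReal (z.2 0) ^ j * ‖iteratedFDeriv ℝ (j + 1) (fun x => F (z.1, x)) z.2‖ₑ
      ≤ jet M F z :=
  (space_le_djet hj F z).trans le_add_self

theorem time_le_djet {d : ℕ} {M j : ℕ} (hj : j ≤ M) (F : ℝ × Space d → ℂ) (z : ℝ × Space d) :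
    ENNReal.ofReal (z.2 0) ^ (j + 1) * ‖iteratedFDeriv ℝ j (fun x => timeDeriv F (z.1, x)) z.2‖ₑ
      ≤ djet M F z :=
  le_add_self.trans (Finset.single_le_sum (f := fun j =>
    (ENNReal.ofReal (z.2 0) ^ j * ‖iteratedFDeriv ℝ (j + 1) (fun x => F (z.1, x)) z.2‖ₑ +
      ENNReal.ofReal (z.2 0) ^ (j + 1) *
        ‖iteratedFDeriv ℝ j (fun x => timeDeriv F (z.1, x)) z.2‖ₑ))
    (fun _ _ => zero_le) (Finset.mem_range.2 (Nat.lt_succ_of_le hj)))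

theorem time_le_jet {d : ℕ} {M j : ℕ} (hj : j ≤ M) (F : ℝ × Space d → ℂ) (z : ℝ × Space d) :
    ENNReal.ofReal (z.2 0) ^ (j + 1) * ‖iteratedFDeriv ℝ j (fun x => timeDeriv F (z.1, x)) z.2‖ₑ
      ≤ jet M F z :=
  (time_le_djet hj F z).trans le_add_self

theorem contDiffAt_slice {d : ℕ} {f : ℝ × Space d → ℂ} (hf : ContDiffOn ℝ ∞ f (upper d))
    {z : ℝ × Space d} (hz : z ∈ upper d) : ContDiffAt ℝ ∞ (fun x => f (z.1, x)) z.2 := by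
  have h2 := hf.contDiffAt ((isOpen_upper d).mem_nhds hz)
  have h3 : ContDiffAt ℝ ∞ (fun y : Space d => (z.1, y)) z.2 :=
    contDiffAt_const.prodMk contDiffAt_id
  exact h2.comp z.2 h3

theorem contDiffOn_timeDeriv {d : ℕ} {f : ℝ × Space d → ℂ} (hf : ContDiffOn ℝ ∞ f (upper d)) :
    ContDiffOn ℝ ∞ (timeDeriv f) (upper d) := by
  have := hf.fderiv_of_isOpen (isOpen_upper d) (m := ∞) (by simp)
  exact this.clm_apply contDiffOn_const

theorem iteratedFDeriv_slice_congr {d : ℕ} {f g : ℝ × Space d → ℂ} {z : ℝ × Space d}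
    (h : f =ᶠ[𝓝 z] g) (m : ℕ) : iteratedFDeriv ℝ m (fun x => f (z.1, x)) z.2 =
      iteratedFDeriv ℝ m (fun x => g (z.1, x)) z.2 := by
  have h1 : (fun x => f (z.1, x)) =ᶠ[𝓝 z.2] fun x => g (z.1, x) :=
    (Continuous.prodMk_right z.1).continuousAt.eventually h
  exact (h1.iteratedFDeriv ℝ m).self_of_nhds

theorem timeDeriv_eventuallyEq {d : ℕ} {f g : ℝ × Space d → ℂ} {z : ℝ × Space d}
    (h : f =ᶠ[𝓝 z] g) : timeDeriv f =ᶠ[𝓝 z] timeDeriv g := by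
  filter_upwards [h.eventuallyEq_nhds] with w hw
  rw [timeDeriv, timeDeriv, hw.fderiv_eq]

theorem jet_congr {d : ℕ} {f g : ℝ × Space d → ℂ} {z : ℝ × Space d} (h : f =ᶠ[𝓝 z] g) (M : ℕ) :
    jet M f z = jet M g z := by
  simp only [jet, djet, iteratedFDeriv_slice_congr h, iteratedFDeriv_slice_congr (timeDeriv_eventuallyEq h),
    h.self_of_nhds]

theorem timeDeriv_sub {d : ℕ} {f g : ℝ × Space d → ℂ} (hf : ContDiffOn ℝ ∞ f (upper d))
    (hg : ContDiffOn ℝ ∞ g (upper d)) {z : ℝ × Space d} (hz : z ∈ upper d) :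
    timeDeriv (fun z => f z - g z) z = timeDeriv f z - timeDeriv g z := by
  have h1 := (hf.contDiffAt ((isOpen_upper d).mem_nhds hz)).differentiableAt (by simp)
  have h2 := (hg.contDiffAt ((isOpen_upper d).mem_nhds hz)).differentiableAt (by simp)
  rw [timeDeriv, fderiv_fun_sub h1 h2]
  rfl

theorem timeDeriv_mul {d : ℕ} {f g : ℝ × Space d → ℂ} (hf : ContDiffOn ℝ ∞ f (upper d))
    (hg : ContDiffOn ℝ ∞ g (upper d)) {z : ℝ × Space d} (hz : z ∈ upper d) :
    timeDeriv (fun z => f z * g z) z = timeDeriv f z * g z + f z * timeDeriv g z := by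
  have h1 := (hf.contDiffAt ((isOpen_upper d).mem_nhds hz)).differentiableAt (by simp)
  have h2 := (hg.contDiffAt ((isOpen_upper d).mem_nhds hz)).differentiableAt (by simp)
  rw [timeDeriv, fderiv_fun_mul h1 h2]
  simp [timeDeriv]
  ring

theorem jet_sub_le {d : ℕ} {f g : ℝ × Space d → ℂ} (hf : ContDiffOn ℝ ∞ f (upper d))
    (hg : ContDiffOn ℝ ∞ g (upper d)) {z : ℝ × Space d} (hz : z ∈ upper d) (M : ℕ) :
    jet M (fun z => f z - g z) z ≤ jet M f z + jet M g z := by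
  have ht : timeDeriv (fun z => f z - g z) =ᶠ[𝓝 z] fun z => timeDeriv f z - timeDeriv g z := by
    filter_upwards [(isOpen_upper d).mem_nhds hz] with w hw using timeDeriv_sub hf hg hw
  have e1 : ∀ j : ℕ, iteratedFDeriv ℝ j (fun x => f (z.1, x) - g (z.1, x)) z.2 =
      iteratedFDeriv ℝ j (fun x => f (z.1, x)) z.2 - iteratedFDeriv ℝ j (fun x => g (z.1, x)) z.2 :=
    fun j => iteratedFDeriv_sub_apply ((contDiffAt_slice hf hz).of_le (by exact_mod_cast le_top))
      ((contDiffAt_slice hg hz).of_le (by exact_mod_cast le_top))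
  have e2 : ∀ j : ℕ, iteratedFDeriv ℝ j (fun x => timeDeriv f (z.1, x) - timeDeriv g (z.1, x)) z.2 =
      iteratedFDeriv ℝ j (fun x => timeDeriv f (z.1, x)) z.2 -
        iteratedFDeriv ℝ j (fun x => timeDeriv g (z.1, x)) z.2 :=
    fun j => iteratedFDeriv_sub_apply
      ((contDiffAt_slice (contDiffOn_timeDeriv hf) hz).of_le (by exact_mod_cast le_top))
      ((contDiffAt_slice (contDiffOn_timeDeriv hg) hz).of_le (by exact_mod_cast le_top))
  simp only [jet, djet, iteratedFDeriv_slice_congr ht, e1, e2]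
  calc _ ≤ (‖f z‖ₑ + ‖g z‖ₑ) + ∑ j ∈ Finset.range (M + 1),
        ((ENNReal.ofReal (z.2 0) ^ j * ‖iteratedFDeriv ℝ (j + 1) (fun x => f (z.1, x)) z.2‖ₑ +
          ENNReal.ofReal (z.2 0) ^ (j + 1) *
            ‖iteratedFDeriv ℝ j (fun x => timeDeriv f (z.1, x)) z.2‖ₑ) +
        (ENNReal.ofReal (z.2 0) ^ j * ‖iteratedFDeriv ℝ (j + 1) (fun x => g (z.1, x)) z.2‖ₑ +
          ENNReal.ofReal (z.2 0) ^ (j + 1) *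
            ‖iteratedFDeriv ℝ j (fun x => timeDeriv g (z.1, x)) z.2‖ₑ)) := by
        refine add_le_add enorm_sub_le (Finset.sum_le_sum fun j _ => ?_)
        refine (add_le_add (mul_le_mul_right enorm_sub_le _)
          (mul_le_mul_right enorm_sub_le _)).trans (le_of_eq ?_)
        ring
    _ = _ := by rw [Finset.sum_add_distrib]; ring

/-- The Leibniz formula with every binomial coefficient replaced by `2 ^ n`. A common open
neighbourhood is chosen because the Leibniz bound is used for derivatives within a set. -/
theorem enorm_iteratedFDeriv_mul_le {E : Type*} [NormedAddCommGroup E] [NormedSpace ℝ E]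
    {f g : E → ℂ} {x : E} (hf : ContDiffAt ℝ ∞ f x) (hg : ContDiffAt ℝ ∞ g x) {n : ℕ} {A : ℝ≥0∞}
    (hA : ∀ i ≤ n, ‖iteratedFDeriv ℝ i f x‖ₑ ≤ A) :
    ‖iteratedFDeriv ℝ n (fun y => f y * g y) x‖ₑ ≤
      2 ^ n * A * ∑ k ∈ Finset.range (n + 1), ‖iteratedFDeriv ℝ k g x‖ₑ := by
  obtain ⟨u, huo, hxu, hfu⟩ : ∃ u, IsOpen u ∧ x ∈ u ∧ ContDiffOn ℝ n f u ∧ ContDiffOn ℝ n g u := by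
    obtain ⟨u, hu, h1⟩ := (hf.of_le (m := n) (by exact_mod_cast le_top)).contDiffOn le_rfl (by simp)
    obtain ⟨v, hv, h2⟩ := (hg.of_le (m := n) (by exact_mod_cast le_top)).contDiffOn le_rfl (by simp)
    obtain ⟨w, hw, hwo, hxw⟩ := mem_nhds_iff.1 (Filter.inter_mem hu hv)
    exact ⟨w, hwo, hxw, h1.mono fun y hy => (hw hy).1, h2.mono fun y hy => (hw hy).2⟩
  have h := norm_iteratedFDerivWithin_mul_le hfu.1 hfu.2 huo.uniqueDiffOn hxu (n := n) le_rfl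
  simp only [iteratedFDerivWithin_of_isOpen _ huo hxu] at h
  rw [← ofReal_norm]
  refine (ENNReal.ofReal_le_ofReal h).trans ?_
  rw [ENNReal.ofReal_sum_of_nonneg fun i _ => by positivity]
  calc _ ≤ ∑ i ∈ Finset.range (n + 1), 2 ^ n * A * ‖iteratedFDeriv ℝ (n - i) g x‖ₑ := by
        refine Finset.sum_le_sum fun i hi => ?_
        rw [ENNReal.ofReal_mul (by positivity), ENNReal.ofReal_mul (by positivity), ofReal_norm,
          ofReal_norm, ENNReal.ofReal_natCast]
        gcongr
        · exact_mod_cast Nat.choose_le_two_pow n i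
        · exact hA i (Nat.lt_succ_iff.1 (Finset.mem_range.1 hi))
    _ = _ := by
        rw [← Finset.mul_sum]
        congr 1
        exact Finset.sum_range_reflect (fun k => ‖iteratedFDeriv ℝ k g x‖ₑ) (n + 1) ▸ by
          refine Finset.sum_congr rfl fun i hi => ?_
          congr 2

/-- On `x₁ ≤ 2` one has `x₁ ^ j ≤ 2 ^ j x₁ ^ k` for `k ≤ j`, so the lower-order terms of the Leibniz
formula are absorbed by the jet. Derivatives falling on `ψ` leave `F` undifferentiated, which is why
the jet must contain `F` itself. -/
theorem jet_mul_le (d M : ℕ) : ∃ C : ℝ≥0, ∀ (A : ℝ≥0∞) (ψ F : ℝ × Space d → ℂ) (z : ℝ × Space d),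
    ContDiffOn ℝ ∞ ψ (upper d) → ContDiffOn ℝ ∞ F (upper d) → z ∈ upper d → z.2 0 ≤ 2 →
    (∀ i ≤ M + 1, ‖iteratedFDeriv ℝ i (fun x => ψ (z.1, x)) z.2‖ₑ ≤ A) →
    (∀ i ≤ M, ‖iteratedFDeriv ℝ i (fun x => timeDeriv ψ (z.1, x)) z.2‖ₑ ≤ A) →
    jet M (fun z => ψ z * F z) z ≤ C * A * jet M F z := by
  refine ⟨1 + (M + 1) * (3 * 4 ^ (M + 1)), fun A ψ F z hψ hF hz hz2 h1 h2 => ?_⟩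
  set X := ENNReal.ofReal (z.2 0) with hX
  have hX2 : X ≤ 2 := by
    have := ENNReal.ofReal_le_ofReal hz2
    rwa [ENNReal.ofReal_ofNat] at this
  have h2p : ∀ a ≤ M + 1, (2 : ℝ≥0∞) ^ a ≤ 2 ^ (M + 1) := fun a h =>
    pow_le_pow_right₀ one_le_two h
  set S := jet M F z with hS
  have hP : ∀ j : ℕ, X ^ j ≤ 2 ^ j := fun j => pow_le_pow_left₀ zero_le hX2 j
  have hmono : ∀ {j k : ℕ}, k ≤ j → X ^ j ≤ 2 ^ j * X ^ k := fun {j k} hk => by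
    calc X ^ j = X ^ (j - k) * X ^ k := by rw [← pow_add, Nat.sub_add_cancel hk]
      _ ≤ 2 ^ (j - k) * X ^ k := by gcongr
      _ ≤ 2 ^ j * X ^ k := by
        gcongr
        · norm_num
        · omega
  have ha : ∀ j ≤ M, X ^ j * ∑ k ∈ Finset.range (j + 2),
      ‖iteratedFDeriv ℝ k (fun x => F (z.1, x)) z.2‖ₑ ≤ 2 ^ j * S := fun j hj => by
    rw [Finset.sum_range_succ', mul_add, Finset.mul_sum, hS, jet, djet, mul_add, Finset.mul_sum, add_comm]
    refine add_le_add (mul_le_mul' (hP j) (le_of_eq (by simp [← ofReal_norm]))) ?_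
    refine (Finset.sum_le_sum fun k hk => ?_).trans
      (Finset.sum_le_sum_of_subset (Finset.range_mono (Nat.succ_le_succ hj)))
    rw [mul_add]
    refine le_add_right ?_
    rw [← mul_assoc]
    gcongr
    exact hmono (Nat.lt_succ_iff.1 (Finset.mem_range.1 hk))
  have hb : ∀ j ≤ M, X ^ (j + 1) * ∑ k ∈ Finset.range (j + 1),
      ‖iteratedFDeriv ℝ k (fun x => timeDeriv F (z.1, x)) z.2‖ₑ ≤ 2 ^ (j + 1) * S := fun j hj => by
    rw [Finset.mul_sum, hS, jet, djet, mul_add, Finset.mul_sum]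
    refine le_add_left ((Finset.sum_le_sum fun k hk => ?_).trans
      (Finset.sum_le_sum_of_subset (Finset.range_mono (Nat.succ_le_succ hj))))
    rw [mul_add]
    refine le_add_left ?_
    rw [← mul_assoc]
    gcongr
    exact hmono (Nat.succ_le_succ (Nat.lt_succ_iff.1 (Finset.mem_range.1 hk)))
  have ht : timeDeriv (fun z => ψ z * F z) =ᶠ[𝓝 z]
      fun z => timeDeriv ψ z * F z + ψ z * timeDeriv F z := by
    filter_upwards [(isOpen_upper d).mem_nhds hz] with w hw using timeDeriv_mul hψ hF hw
  have sψ := contDiffAt_slice hψ hz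
  have sF := contDiffAt_slice hF hz
  have sψ' := contDiffAt_slice (contDiffOn_timeDeriv hψ) hz
  have sF' := contDiffAt_slice (contDiffOn_timeDeriv hF) hz
  have e1 : ∀ j ≤ M, X ^ j * ‖iteratedFDeriv ℝ (j + 1) (fun x => ψ (z.1, x) * F (z.1, x)) z.2‖ₑ ≤
      4 ^ (M + 1) * A * S := fun j hj => by
    calc _ ≤ X ^ j * (2 ^ (j + 1) * A * ∑ k ∈ Finset.range (j + 2),
          ‖iteratedFDeriv ℝ k (fun x => F (z.1, x)) z.2‖ₑ) := by
          gcongr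
          exact enorm_iteratedFDeriv_mul_le sψ sF fun i hi => h1 i (by omega)
      _ = 2 ^ (j + 1) * A * (X ^ j * ∑ k ∈ Finset.range (j + 2),
          ‖iteratedFDeriv ℝ k (fun x => F (z.1, x)) z.2‖ₑ) := by ring
      _ ≤ 2 ^ (M + 1) * A * (2 ^ (M + 1) * S) := by
          exact mul_le_mul' (mul_le_mul' (h2p _ (by omega)) le_rfl)
            ((ha j hj).trans (mul_le_mul' (h2p _ (by omega)) le_rfl))
      _ = _ := by rw [show (4 : ℝ≥0∞) = 2 * 2 by norm_num, mul_pow]; ring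
  have e2 : ∀ j ≤ M, X ^ (j + 1) *
      ‖iteratedFDeriv ℝ j (fun x => timeDeriv ψ (z.1, x) * F (z.1, x)) z.2‖ₑ ≤
      4 ^ (M + 1) * A * S := fun j hj => by
    calc _ ≤ X ^ (j + 1) * (2 ^ j * A * ∑ k ∈ Finset.range (j + 1),
          ‖iteratedFDeriv ℝ k (fun x => F (z.1, x)) z.2‖ₑ) := by
          gcongr
          exact enorm_iteratedFDeriv_mul_le sψ' sF fun i hi => h2 i (by omega)
      -- One more term is admitted to the sum so that `ha` applies; the surplus factor `X` is at
      -- most 2.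
      _ ≤ X ^ (j + 1) * (2 ^ j * A * ∑ k ∈ Finset.range (j + 2),
          ‖iteratedFDeriv ℝ k (fun x => F (z.1, x)) z.2‖ₑ) := by
          gcongr
          omega
      _ = X * 2 ^ j * A * (X ^ j * ∑ k ∈ Finset.range (j + 2),
          ‖iteratedFDeriv ℝ k (fun x => F (z.1, x)) z.2‖ₑ) := by ring
      _ ≤ 2 * 2 ^ j * A * (2 ^ j * S) :=
          mul_le_mul' (by gcongr) (ha j hj)
      _ = 2 ^ (j + 1) * A * (2 ^ j * S) := by ring
      _ ≤ 2 ^ (M + 1) * A * (2 ^ (M + 1) * S) := by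
          gcongr
          · norm_num
          · norm_num
          · omega
      _ = _ := by rw [show (4 : ℝ≥0∞) = 2 * 2 by norm_num, mul_pow]; ring
  have e3 : ∀ j ≤ M, X ^ (j + 1) *
      ‖iteratedFDeriv ℝ j (fun x => ψ (z.1, x) * timeDeriv F (z.1, x)) z.2‖ₑ ≤
      4 ^ (M + 1) * A * S := fun j hj => by
    calc _ ≤ X ^ (j + 1) * (2 ^ j * A * ∑ k ∈ Finset.range (j + 1),
          ‖iteratedFDeriv ℝ k (fun x => timeDeriv F (z.1, x)) z.2‖ₑ) := by
          gcongr
          exact enorm_iteratedFDeriv_mul_le sψ sF' fun i hi => h1 i (by omega)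
      _ = 2 ^ j * A * (X ^ (j + 1) * ∑ k ∈ Finset.range (j + 1),
          ‖iteratedFDeriv ℝ k (fun x => timeDeriv F (z.1, x)) z.2‖ₑ) := by ring
      _ ≤ 2 ^ (M + 1) * A * (2 ^ (M + 1) * S) := by
          exact mul_le_mul' (mul_le_mul' (h2p _ (by omega)) le_rfl)
            ((hb j hj).trans (mul_le_mul' (h2p _ (by omega)) le_rfl))
      _ = _ := by rw [show (4 : ℝ≥0∞) = 2 * 2 by norm_num, mul_pow]; ring
  have e4 : ∀ j : ℕ, iteratedFDeriv ℝ j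
      (fun x => timeDeriv ψ (z.1, x) * F (z.1, x) + ψ (z.1, x) * timeDeriv F (z.1, x)) z.2 =
      iteratedFDeriv ℝ j (fun x => timeDeriv ψ (z.1, x) * F (z.1, x)) z.2 +
      iteratedFDeriv ℝ j (fun x => ψ (z.1, x) * timeDeriv F (z.1, x)) z.2 := fun j =>
    iteratedFDeriv_add_apply ((sψ'.mul sF).of_le (by exact_mod_cast le_top))
      ((sψ.mul sF').of_le (by exact_mod_cast le_top))
  have e0 : ‖ψ z * F z‖ₑ ≤ 1 * A * S := by
    rw [enorm_mul, one_mul]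
    refine mul_le_mul' ?_ (enorm_le_jet M F z)
    have := h1 0 (by omega)
    simpa [← ofReal_norm] using this
  have e5 : jet M (fun z => ψ z * F z) z ≤ 1 * A * S + ∑ j ∈ Finset.range (M + 1),
      (4 ^ (M + 1) * A * S + (4 ^ (M + 1) * A * S + 4 ^ (M + 1) * A * S)) := by
    rw [jet, djet]
    simp only [iteratedFDeriv_slice_congr ht, e4]
    refine add_le_add e0 (Finset.sum_le_sum fun j hj => ?_)
    have hj : j ≤ M := Nat.lt_succ_iff.1 (Finset.mem_range.1 hj)
    refine add_le_add (e1 j hj) ((mul_le_mul_right (enorm_add_le _ _) _).trans ?_)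
    rw [mul_add]
    exact add_le_add (e2 j hj) (e3 j hj)
  refine e5.trans (le_of_eq ?_)
  rw [Finset.sum_const, Finset.card_range, nsmul_eq_mul]
  push_cast
  ring

/-- Because `x₁ ≤ gauge`, the weight `x₁ ^ j` is paid for by `j` powers of the gauge. Scaled
derivatives of all orders are thus bounded by a majorant with the single exponent `d + 3`. -/
theorem djet_conv_le (d M : ℕ) : ∃ C : ℝ≥0, ∀ g : ℝ × Bdry d → ℂ, Tame g → ∀ z ∈ upper d,
    djet M (conv poisKer g) z ≤ C * majorant g (d + 3) z.1 z.2 := by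
  choose C₁ h₁ using fun j : ℕ => exists_enorm_iteratedFDeriv_le d (m := j + 1) (by omega)
  choose C₂ h₂ using fun j : ℕ => exists_enorm_iteratedFDeriv_timeDeriv_le d j
  refine ⟨∑ j ∈ Finset.range (M + 1), (C₁ j + C₂ j), fun g hg z hz => ?_⟩
  have hmaj : ∀ j : ℕ, ∀ a : ℝ, a = d + 3 + j →
      ENNReal.ofReal (z.2 0) ^ j * majorant g a z.1 z.2 ≤ majorant g (d + 3) z.1 z.2 := by
    rintro j a rfl
    have hz0 : 0 < z.2 0 := hz
    rw [majorant, ← lintegral_const_mul' _ _ (by simp)]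
    refine lintegral_mono fun q => ?_
    rw [← mul_assoc, ← ENNReal.ofReal_pow hz0.le, ← ENNReal.ofReal_mul (by positivity)]
    gcongr
    have hg0 : z.2 0 ≤ gauge (z - bd q) := by
      have := gauge_ge (z - bd q)
      rwa [sub_bd_zero] at this
    have hgp : 0 < gauge (z - bd q) := hz0.trans_le hg0
    calc z.2 0 ^ j * gauge (z - bd q) ^ (-((d : ℝ) + 3 + j))
        ≤ gauge (z - bd q) ^ j * gauge (z - bd q) ^ (-((d : ℝ) + 3 + j)) := by gcongr
      _ = gauge (z - bd q) ^ (-((d : ℝ) + 3)) := by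
        rw [← Real.rpow_natCast, ← Real.rpow_add hgp]
        congr 1
        ring
  rw [djet]
  push_cast
  rw [Finset.sum_mul]
  refine Finset.sum_le_sum fun j _ => ?_
  rw [add_mul]
  refine add_le_add ?_ ?_
  · refine (mul_le_mul_right (h₁ j g hg z.1 z.2 hz) _).trans ?_
    rw [mul_left_comm]
    exact mul_le_mul_right (hmaj j _ (by push_cast; ring)) _
  · refine (mul_le_mul_right (h₂ j g hg z.1 z.2 hz) _).trans ?_
    rw [mul_left_comm]
    exact mul_le_mul_right (hmaj (j + 1) _ (by push_cast; ring)) _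

theorem jet_conv_le (d M : ℕ) : ∃ C : ℝ≥0, ∀ g : ℝ × Bdry d → ℂ, Tame g → ∀ z ∈ upper d,
    jet M (conv poisKer g) z ≤ ‖conv poisKer g z‖ₑ + C * majorant g (d + 3) z.1 z.2 := by
  obtain ⟨C, hC⟩ := djet_conv_le d M
  exact ⟨C, fun g hg z hz => add_le_add le_rfl (hC g hg z hz)⟩

/-! ### Weighted integrals over the half-space-time -/

/-- The weighted integral `∫_ℝ ∫_{ℝⁿ₊} f ^ p x₁ ^ (θ - n) dx dt`. -/
def wInt {d : ℕ} (θ p : ℝ) (f : ℝ × Space d → ℝ≥0∞) : ℝ≥0∞ :=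
  ∫⁻ t : ℝ, ∫⁻ x in (halfSpace d : Set (Space d)),
    f (t, x) ^ p * ENNReal.ofReal (x 0 ^ (θ - ((d : ℝ) + 1)))

theorem wInt_mono {d : ℕ} {θ p : ℝ} (hp : 0 ≤ p) {f g : ℝ × Space d → ℝ≥0∞}
    (h : ∀ z ∈ upper d, f z ≤ g z) : wInt θ p f ≤ wInt θ p g := by
  refine lintegral_mono fun t => setLIntegral_mono' (measurableSet_halfSpace d) fun x hx => ?_
  gcongr
  exact h (t, x) hx

theorem wInt_const_mul {d : ℕ} {θ p : ℝ} (hp : 0 ≤ p) (C : ℝ≥0) (f : ℝ × Space d → ℝ≥0∞) :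
    wInt θ p (fun z => C * f z) = (C : ℝ≥0∞) ^ p * wInt θ p f := by
  have hC : (C : ℝ≥0∞) ^ p ≠ ⊤ := ENNReal.rpow_ne_top_of_nonneg hp ENNReal.coe_ne_top
  simp only [wInt, ENNReal.mul_rpow_of_nonneg _ _ hp, mul_assoc]
  simp_rw [lintegral_const_mul' _ _ hC]

theorem measurable_weight {d : ℕ} (e : ℝ) :
    Measurable fun z : ℝ × Space d => ENNReal.ofReal (z.2 0 ^ e) := by
  have : Measurable fun z : ℝ × Space d => z.2 0 :=
    Continuous.measurable (by fun_prop)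
  exact ENNReal.measurable_ofReal.comp (this.pow_const e)

/-- Additivity of the lower integral requires measurability of only one summand. -/
theorem wInt_add_le {d : ℕ} {θ p : ℝ} (hp : 1 ≤ p) (f : ℝ × Space d → ℝ≥0∞)
    {g : ℝ × Space d → ℝ≥0∞} (hg : Measurable g) :
    wInt θ p (fun z => f z + g z) ≤ 2 ^ (p - 1) * (wInt θ p f + wInt θ p g) := by
  have h2 : (2 : ℝ≥0∞) ^ (p - 1) ≠ ⊤ :=
    ENNReal.rpow_ne_top_of_nonneg (by linarith) (by norm_num)
  have hm : Measurable fun z : ℝ × Space d =>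
      g z ^ p * ENNReal.ofReal (z.2 0 ^ (θ - ((d : ℝ) + 1))) :=
    (hg.pow_const p).mul (measurable_weight _)
  calc wInt θ p (fun z => f z + g z)
      ≤ ∫⁻ t : ℝ, ∫⁻ x in (halfSpace d : Set (Space d)), 2 ^ (p - 1) *
        (f (t, x) ^ p * ENNReal.ofReal (x 0 ^ (θ - ((d : ℝ) + 1))) +
          g (t, x) ^ p * ENNReal.ofReal (x 0 ^ (θ - ((d : ℝ) + 1)))) := by
        refine lintegral_mono fun t => lintegral_mono fun x => ?_
        rw [← add_mul, ← mul_assoc]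
        gcongr
        exact ENNReal.rpow_add_le_mul_rpow_add_rpow _ _ hp
    _ = _ := by
        simp_rw [lintegral_const_mul' _ _ h2]
        congr 1
        rw [wInt, wInt, ← lintegral_add_right]
        · refine lintegral_congr fun t => ?_
          rw [lintegral_add_right]
          exact hm.comp measurable_prodMk_left
        · exact hm.lintegral_prod_right'

theorem measurable_poisKer {d : ℕ} : Measurable (poisKer (d := d)) := by
  have h : Measurable fun z : ℝ × Space d => bdKer (z.2 0) (z.1, tang z.2) := by
    refine measurable_bdKer.comp (f := fun z : ℝ × Space d => (z.2 0, (z.1, tang z.2))) ?_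
    have h1 : Measurable fun z : ℝ × Space d => z.2 0 := Continuous.measurable (by fun_prop)
    exact h1.prodMk (measurable_fst.prodMk (continuous_tang.measurable.comp measurable_snd))
  have e : ∀ z : ℝ × Space d, poisKer z = (bdKer (z.2 0) (z.1, tang z.2) : ℂ) := fun z => by
    rw [poisKer, bdKer, mkPoint_tang]
  simp_rw [funext e]
  exact Complex.measurable_ofReal.comp h

theorem measurable_conv {d : ℕ} {g : ℝ × Bdry d → ℂ} (hg : Measurable g) :
    Measurable (conv poisKer g) := by
  have h : Measurable fun v : (ℝ × Space d) × (ℝ × Bdry d) => g v.2 * poisKer (v.1 - bd v.2) :=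
    (hg.comp measurable_snd).mul (measurable_poisKer.comp
      (measurable_fst.sub (bd_measurable.comp measurable_snd)))
  exact (h.stronglyMeasurable.integral_prod_right' (ν := volume)).measurable

theorem eLpNorm_rpow {d : ℕ} {p : ℝ} (hp : 1 < p) (g : ℝ × Bdry d → ℂ) :
    eLpNorm g (ENNReal.ofReal p) volume ^ p = ∫⁻ q, ‖g q‖ₑ ^ p := by
  have h0 : 0 < p := by linarith
  rw [eLpNorm_eq_lintegral_rpow_enorm_toReal (by simpa using h0) (by simp),
    ENNReal.toReal_ofReal h0.le, ← ENNReal.rpow_mul, one_div_mul_cancel h0.ne', ENNReal.rpow_one]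

/-- On each layer the extension is a contraction in `L_p`, and `θ > d` makes the weight `r ^ (θ - d
- 1)` integrable on `(0, 2]`. -/
theorem exists_wInt_conv_le (d : ℕ) {p θ : ℝ} (hp : 1 < p) (hθ : (d : ℝ) < θ) :
    ∃ C : ℝ≥0∞, C ≠ ⊤ ∧ ∀ g : ℝ × Bdry d → ℂ, Measurable g →
      wInt θ p (fun z => if z.2 0 ≤ 2 then ‖conv poisKer g z‖ₑ else 0) ≤
        C * ∫⁻ q, ‖g q‖ₑ ^ p := by
  set e := θ - ((d : ℝ) + 1) with he
  have hp0 : 0 < p := by linarith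
  refine ⟨∫⁻ r in Set.Ioc (0 : ℝ) 2, ENNReal.ofReal (r ^ e), ?_, fun g hg => ?_⟩
  · have h := (intervalIntegral.intervalIntegrable_rpow' (a := 0) (b := 2) (r := e)
      (by rw [he]; linarith)).1
    exact (Integrable.lintegral_lt_top h).ne
  have hm : Measurable fun z : ℝ × Space d =>
      (if z.2 0 ≤ 2 then ‖conv poisKer g z‖ₑ else 0) ^ p * ENNReal.ofReal (z.2 0 ^ e) := by
    have h1 : Measurable fun z : ℝ × Space d => z.2 0 := Continuous.measurable (by fun_prop)
    exact ((Measurable.ite (measurableSet_le h1 measurable_const) (measurable_conv hg).enorm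
      measurable_const).pow_const p).mul (measurable_weight e)
  have hm3 : Measurable fun v : (ℝ × ℝ) × Bdry d =>
      (if v.1.2 ≤ 2 then ‖conv poisKer g (v.1.1, mkPoint v.1.2 v.2)‖ₑ else 0) ^ p *
        ENNReal.ofReal (v.1.2 ^ e) := by
    have h2 : Measurable fun v : (ℝ × ℝ) × Bdry d => (v.1.1, (mkPoint v.1.2 v.2 : Space d)) :=
      (measurable_fst.comp measurable_fst).prodMk
        (measurable_mkPoint.comp (f := fun v : (ℝ × ℝ) × Bdry d => (v.1.2, v.2)) (by fun_prop))
    exact hm.comp h2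
  calc wInt θ p (fun z => if z.2 0 ≤ 2 then ‖conv poisKer g z‖ₑ else 0)
      = ∫⁻ t : ℝ, ∫⁻ r in Set.Ioi (0 : ℝ), ∫⁻ y : Bdry d,
        (if r ≤ 2 then ‖conv poisKer g (t, mkPoint r y)‖ₑ else 0) ^ p *
          ENNReal.ofReal (r ^ e) := by
        refine lintegral_congr fun t => ?_
        exact setLIntegral_halfSpace (hm.comp (measurable_prodMk_left (x := t)))
    _ = ∫⁻ r in Set.Ioi (0 : ℝ), ∫⁻ t : ℝ, ∫⁻ y : Bdry d,
        (if r ≤ 2 then ‖conv poisKer g (t, mkPoint r y)‖ₑ else 0) ^ p *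
          ENNReal.ofReal (r ^ e) := by
        rw [lintegral_lintegral_swap]
        exact (hm3.lintegral_prod_right').aemeasurable
    _ ≤ ∫⁻ r in Set.Ioi (0 : ℝ), (Set.Iic (2 : ℝ)).indicator (fun r => ENNReal.ofReal (r ^ e)) r *
        ∫⁻ q, ‖g q‖ₑ ^ p := by
        refine setLIntegral_mono' measurableSet_Ioi fun r hr => ?_
        by_cases h : r ≤ 2
        · have hv : Measurable fun w : ℝ × Bdry d => ‖conv poisKer g (w.1, mkPoint r w.2)‖ₑ ^ p :=
            ((measurable_conv hg).comp (measurable_fst.prodMk (measurable_mkPoint.comp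
              (f := fun w : ℝ × Bdry d => (r, w.2)) (by fun_prop)))).enorm.pow_const p
          rw [Set.indicator_of_mem (Set.mem_Iic.2 h), mul_comm]
          simp_rw [if_pos h, lintegral_mul_const' _ _ (ENNReal.ofReal_ne_top)]
          gcongr
          rw [← lintegral_prod_volume hv]
          exact lintegral_conv_rpow_le hp hg hr
        · simp [if_neg h, ENNReal.zero_rpow_of_pos hp0]
    _ = _ := by
        have hi : Measurable ((Set.Iic (2 : ℝ)).indicator fun r => ENNReal.ofReal (r ^ e)) :=
          (ENNReal.measurable_ofReal.comp (measurable_id.pow_const e)).indicator measurableSet_Iic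
        rw [lintegral_mul_const _ hi, setLIntegral_indicator measurableSet_Iic,
          Set.inter_comm, Set.Ioi_inter_Iic]

/-- This is `exists_lintegral_majorant_le` with `m = 1`: the definition of `s` says that `p - 1 - s
p = θ - (d + 1)`, and the range of `θ` says that `0 < s < 1`. -/
theorem exists_wInt_majorant_le (d : ℕ) {p θ s : ℝ} (hp : 1 < p) (hθ₁ : (d : ℝ) < θ)
    (hθ₂ : θ < d + p) (hs : s = (d + p - θ) / p) : ∃ C : ℝ≥0∞, C ≠ ⊤ ∧
      ∀ g : ℝ × Bdry d → ℂ, Measurable g → wInt θ p (fun z => majorant g (d + 3) z.1 z.2) ≤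
        C * (slobTime s p g + slobSpace s p g) ^ p := by
  have hp0 : 0 < p := by linarith
  have hs0 : 0 < s := by rw [hs]; apply div_pos _ hp0; linarith
  have hs1 : s < 1 := by rw [hs, div_lt_one hp0]; linarith
  obtain ⟨C, hC, h⟩ := exists_lintegral_majorant_le d hp hs0 hs1
  refine ⟨C, hC, fun g hg => ?_⟩
  have he : (1 : ℝ) * p - 1 - s * p = θ - (d + 1) := by
    rw [hs]
    field_simp
    ring
  have ha : (d : ℝ) + 2 + 1 = d + 3 := by ring
  have := h g hg
  rw [he, ha] at this
  exact this.trans (mul_le_mul_right (ENNReal.add_rpow_le_rpow_add _ _ hp.le) _)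

theorem exists_wInt_conv_add_majorant_le (d : ℕ) {p θ s : ℝ} (hp : 1 < p) (hθ₁ : (d : ℝ) < θ)
    (hθ₂ : θ < d + p) (hs : s = (d + p - θ) / p) : ∃ C : ℝ≥0∞, C ≠ ⊤ ∧
      ∀ g : ℝ × Bdry d → ℂ, Measurable g →
        wInt θ p (fun z => (if z.2 0 ≤ 2 then ‖conv poisKer g z‖ₑ else 0) +
          majorant g (d + 3) z.1 z.2) ≤ C * slobNorm s p g ^ p := by
  obtain ⟨C₁, hC₁, h₁⟩ := exists_wInt_conv_le d hp hθ₁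
  obtain ⟨C₂, hC₂, h₂⟩ := exists_wInt_majorant_le d hp hθ₁ hθ₂ hs
  refine ⟨2 ^ (p - 1) * (C₁ + C₂), by finiteness, fun g hg => ?_⟩
  refine (wInt_add_le hp.le _ (measurable_majorant hg _)).trans ?_
  rw [mul_assoc, add_mul]
  gcongr
  · refine (h₁ g hg).trans ?_
    rw [← eLpNorm_rpow hp]
    gcongr
    rw [slobNorm, add_assoc]
    exact le_self_add
  · refine (h₂ g hg).trans ?_
    gcongr
    rw [slobNorm, add_assoc]
    exact le_add_self

/-! ### Replacing boundary data by a measurable representative -/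

theorem slobTime_congr {d : ℕ} {s p : ℝ} {g h : ℝ × Bdry d → ℂ} (e : g =ᵐ[volume] h) :
    slobTime s p g = slobTime s p h := by
  have e1 : ∀ᵐ t : ℝ, ∀ᵐ y : Bdry d, g (t, y) = h (t, y) := Measure.ae_ae_of_ae_prod e
  rw [slobTime, slobTime]
  congr 1
  refine lintegral_congr_ae ?_
  filter_upwards [e1] with t ht
  refine lintegral_congr_ae ?_
  filter_upwards [e1] with r hr
  congr 1
  refine lintegral_congr_ae ?_
  filter_upwards [ht, hr] with y h1 h2
  rw [h1, h2]

theorem slobSpace_congr {d : ℕ} {s p : ℝ} {g h : ℝ × Bdry d → ℂ} (e : g =ᵐ[volume] h) :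
    slobSpace s p g = slobSpace s p h := by
  have e1 : ∀ᵐ t : ℝ, ∀ᵐ y : Bdry d, g (t, y) = h (t, y) := Measure.ae_ae_of_ae_prod e
  rw [slobSpace, slobSpace]
  congr 1
  refine lintegral_congr_ae ?_
  filter_upwards [e1] with t ht
  refine lintegral_congr_ae ?_
  filter_upwards [ht] with y hy
  refine lintegral_congr_ae ?_
  filter_upwards [ht] with z hz
  rw [hy, hz]

theorem slobNorm_congr {d : ℕ} {s p : ℝ} {g h : ℝ × Bdry d → ℂ} (e : g =ᵐ[volume] h) :
    slobNorm s p g = slobNorm s p h := by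
  rw [slobNorm, slobNorm, eLpNorm_congr_ae e, slobTime_congr e, slobSpace_congr e]

theorem conv_congr {d : ℕ} {K : ℝ × Space d → ℂ} {g h : ℝ × Bdry d → ℂ} (e : g =ᵐ[volume] h) :
    conv K g = conv K h := by
  funext z
  refine integral_congr_ae ?_
  filter_upwards [e] with q hq
  rw [hq]

theorem poissonExt_congr {d : ℕ} {g h : ℝ × Bdry d → ℂ} (e : g =ᵐ[volume] h) :
    poissonExt g = poissonExt h := by
  funext t x
  rw [poissonExt_eq, poissonExt_eq, conv_congr e]

/-- The estimates rearrange iterated integrals by Tonelli's theorem and are proved for Borel data;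
neither the norms nor the extension see the change of representative. -/
theorem MemSlob.exists_measurable {d : ℕ} {s p : ℝ} {g : ℝ × Bdry d → ℂ} (hg : MemSlob s p g) :
    ∃ h : ℝ × Bdry d → ℂ, g =ᵐ[volume] h ∧ Measurable h ∧ MemSlob s p h := by
  refine ⟨hg.1.mk g, hg.1.ae_eq_mk, hg.1.stronglyMeasurable_mk.measurable,
    hg.1.stronglyMeasurable_mk.aestronglyMeasurable, ?_⟩
  rw [← slobNorm_congr hg.1.ae_eq_mk]
  exact hg.2

/-! ### The cut-off and the weighted estimates -/

/-- The product of `F` with a cut-off in `x₁`. -/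
def cut {d : ℕ} (η : ℝ → ℝ) (F : ℝ × Space d → ℂ) (z : ℝ × Space d) : ℂ := (η (z.2 0) : ℂ) * F z

theorem cutExt_eq {d : ℕ} (η : ℝ → ℝ) (g : ℝ × Bdry d → ℂ) (t : ℝ) (x : Space d) :
    cutExt η g t x = cut η (conv poisKer g) (t, x) := by
  rw [cutExt, cut, poissonExt_eq]

theorem exists_isCutoff : ∃ η : ℝ → ℝ, IsCutoff η :=
  ⟨fun r => Real.smoothTransition (2 - r),
    Real.smoothTransition.contDiff.comp (contDiff_const.sub contDiff_id),
    fun _ h => Real.smoothTransition.one_of_one_le (by linarith),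
    fun _ h => Real.smoothTransition.zero_of_nonpos (by linarith)⟩

theorem contDiff_cutFactor {d : ℕ} {η : ℝ → ℝ} (hη : ContDiff ℝ ∞ η) :
    ContDiff ℝ ∞ fun z : ℝ × Space d => (η (z.2 0) : ℂ) := by
  have h : ContDiff ℝ ∞ fun z : ℝ × Space d => z.2 0 := by fun_prop
  exact Complex.ofRealCLM.contDiff.comp (hη.comp h)

theorem contDiffOn_cut {d : ℕ} {η : ℝ → ℝ} (hη : ContDiff ℝ ∞ η) {F : ℝ × Space d → ℂ}
    (hF : ContDiffOn ℝ ∞ F (upper d)) : ContDiffOn ℝ ∞ (cut η F) (upper d) :=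
  (contDiff_cutFactor hη).contDiffOn.mul hF

theorem timeDeriv_cutFactor {d : ℕ} {η : ℝ → ℝ} (hη : ContDiff ℝ ∞ η) (z : ℝ × Space d) :
    timeDeriv (fun z : ℝ × Space d => (η (z.2 0) : ℂ)) z = 0 := by
  have h1 : DifferentiableAt ℝ (fun z : ℝ × Space d => (η (z.2 0) : ℂ)) z :=
    ((contDiff_cutFactor hη).differentiable (by simp)) z
  have h2 : HasDerivAt (fun τ : ℝ => z + τ • ((1, 0) : ℝ × Space d)) (1, 0) 0 := by
    simpa using ((hasDerivAt_id (0 : ℝ)).smul_const ((1, 0) : ℝ × Space d)).const_add z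
  have h3 := (show HasFDerivAt (fun z : ℝ × Space d => (η (z.2 0) : ℂ)) _
    (z + (0 : ℝ) • ((1, 0) : ℝ × Space d)) by simpa using h1.hasFDerivAt).comp_hasDerivAt 0 h2
  have h4 : ((fun z : ℝ × Space d => (η (z.2 0) : ℂ)) ∘
      fun τ : ℝ => z + τ • ((1, 0) : ℝ × Space d)) = fun _ => (η (z.2 0) : ℂ) := by
    funext τ
    simp
  rw [h4] at h3
  exact h3.unique (hasDerivAt_const _ _)

theorem jet_eq_zero {d M : ℕ} {F : ℝ × Space d → ℂ} {z : ℝ × Space d}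
    (h : F =ᶠ[𝓝 z] fun _ => 0) : jet M F z = 0 := by
  rw [jet_congr h]
  have : timeDeriv (fun _ : ℝ × Space d => (0 : ℂ)) = fun _ => 0 := by
    funext w
    simp [timeDeriv]
  simp only [jet, djet, this, iteratedFDeriv_fun_zero]
  simp

/-- Where `x₁ > 2` the product vanishes near the point; where `x₁ ≤ 2` the derivatives of `η` are
bounded by compactness of `[0, 2]`, and its time derivative is 0. -/
theorem jet_cut_le (d M : ℕ) {η : ℝ → ℝ} (hη : IsCutoff η) : ∃ C : ℝ≥0,
    ∀ F : ℝ × Space d → ℂ, ContDiffOn ℝ ∞ F (upper d) → ∀ z ∈ upper d,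
      jet M (cut η F) z ≤ C * (if z.2 0 ≤ 2 then jet M F z else 0) := by
  obtain ⟨C, hC⟩ := jet_mul_le d M
  have hηC : ContDiff ℝ ∞ fun r : ℝ => (η r : ℂ) := Complex.ofRealCLM.contDiff.comp hη.1
  have hb : ∀ i : ℕ, ∃ A : ℝ≥0, ∀ z : ℝ × Space d, z ∈ upper d → z.2 0 ≤ 2 →
      ‖iteratedFDeriv ℝ i (fun x : Space d => (η (x 0) : ℂ)) z.2‖ₑ ≤ A := fun i => by
    obtain ⟨A, hA⟩ := (isCompact_Icc (a := (0 : ℝ)) (b := 2)).exists_bound_of_continuousOn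
      (hηC.continuous_iteratedFDeriv (m := i) (by exact_mod_cast le_top)).continuousOn
    refine ⟨A.toNNReal, fun z hz hz2 => ?_⟩
    have hA0 := hA (z.2 0) ⟨le_of_lt hz, hz2⟩
    have h := (EuclideanSpace.proj (0 : Fin (d + 1)) :
      Space d →L[ℝ] ℝ).iteratedFDeriv_comp_right hηC z.2 (i := i) (by exact_mod_cast le_top)
    change ‖iteratedFDeriv ℝ i ((fun r : ℝ => (η r : ℂ)) ∘ (EuclideanSpace.proj (0 : Fin (d + 1)) :
      Space d →L[ℝ] ℝ)) z.2‖ₑ ≤ _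
    rw [h, ← ofReal_norm]
    refine ENNReal.ofReal_le_ofReal ?_
    refine (ContinuousMultilinearMap.norm_compContinuousLinearMap_le _ _).trans ?_
    have hp1 : ‖(EuclideanSpace.proj (0 : Fin (d + 1)) : Space d →L[ℝ] ℝ)‖ ≤ 1 :=
      ContinuousLinearMap.opNorm_le_bound _ zero_le_one fun x => by
        simpa using PiLp.norm_apply_le x 0
    refine (mul_le_of_le_one_right (norm_nonneg _) ?_).trans hA0
    exact Finset.prod_le_one (fun _ _ => norm_nonneg _) fun _ _ => hp1
  choose A hA using hb
  refine ⟨C * ∑ i ∈ Finset.range (M + 2), A i, fun F hF z hz => ?_⟩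
  split_ifs with h
  · have := hC (∑ i ∈ Finset.range (M + 2), (A i : ℝ≥0∞)) _ F z
      (contDiff_cutFactor hη.1).contDiffOn hF hz h (fun i hi => (hA i z hz h).trans
        (Finset.single_le_sum (f := fun i => (A i : ℝ≥0∞)) (fun _ _ => zero_le)
          (Finset.mem_range.2 (by omega)))) (fun i hi => by
        have : (fun x => timeDeriv (fun z : ℝ × Space d => (η (z.2 0) : ℂ)) (z.1, x)) =
          fun _ => 0 := funext fun x => timeDeriv_cutFactor hη.1 _
        rw [this, iteratedFDeriv_fun_zero]
        simp)
    refine this.trans (le_of_eq ?_)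
    push_cast
    rfl
  · rw [jet_eq_zero]
    · exact zero_le
    · have hc : Continuous fun z : ℝ × Space d => z.2 0 := by fun_prop
      filter_upwards [hc.continuousAt.eventually (lt_mem_nhds (not_le.1 h))] with w hw
      rw [cut, hη.2.2 _ (le_of_lt hw)]
      simp

theorem jet_cut_conv_le (d M : ℕ) {η : ℝ → ℝ} (hη : IsCutoff η) : ∃ C : ℝ≥0,
    ∀ g : ℝ × Bdry d → ℂ, Tame g → ∀ z ∈ upper d, jet M (cut η (conv poisKer g)) z ≤
      C * ((if z.2 0 ≤ 2 then ‖conv poisKer g z‖ₑ else 0) + majorant g (d + 3) z.1 z.2) := by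
  obtain ⟨C₁, h₁⟩ := jet_cut_le d M hη
  obtain ⟨C₂, h₂⟩ := jet_conv_le d M
  refine ⟨C₁ * (1 + C₂), fun g hg z hz => (h₁ _ (convKer_poisKer.contDiffOn_conv hg) z hz).trans ?_⟩
  push_cast
  rw [mul_assoc]
  gcongr
  split_ifs
  · refine (h₂ g hg z hz).trans ?_
    rw [mul_add]
    gcongr
    · exact le_mul_of_one_le_left' le_self_add
    · exact le_add_self
  · exact zero_le

theorem exists_wInt_jet_le (d M : ℕ) {p θ s : ℝ} (hp : 1 < p) (hθ₁ : (d : ℝ) < θ)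
    (hθ₂ : θ < d + p) (hs : s = (d + p - θ) / p) {η : ℝ → ℝ} (hη : IsCutoff η) : ∃ C : ℝ≥0,
      ∀ g : ℝ × Bdry d → ℂ, MemSlob s p g →
        wInt θ p (jet M (cut η (conv poisKer g))) ≤ (C * slobNorm s p g) ^ p := by
  have hp0 : 0 < p := by linarith
  obtain ⟨C₁, h₁⟩ := jet_cut_conv_le d M hη
  obtain ⟨C₂, hC₂, h₂⟩ := exists_wInt_conv_add_majorant_le d hp hθ₁ hθ₂ hs
  refine ⟨C₁ * (C₂ ^ (1 / p)).toNNReal, fun g hg => ?_⟩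
  obtain ⟨h, hgh, hm, hh⟩ := hg.exists_measurable
  rw [conv_congr hgh, slobNorm_congr hgh]
  refine (wInt_mono hp0.le (h₁ h (tame_of_memLp hp hh.memLp))).trans ?_
  rw [wInt_const_mul hp0.le]
  push_cast
  rw [ENNReal.coe_toNNReal (ENNReal.rpow_ne_top_of_nonneg (by positivity) hC₂), mul_assoc,
    ENNReal.mul_rpow_of_nonneg _ _ hp0.le, ENNReal.mul_rpow_of_nonneg _ _ hp0.le, ← ENNReal.rpow_mul,
    one_div_mul_cancel hp0.ne', ENNReal.rpow_one]
  gcongr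
  exact h₂ h hm

/-- The `k` powers of `x₁` in front of `f` shift the exponent of the weight by `k p`. -/
theorem wInt_le_of_jet {d : ℕ} {p θ : ℝ} (hp : 1 < p) {k : ℕ} {f : ℝ → Space d → ℂ}
    {J : ℝ × Space d → ℝ≥0∞} (h : ∀ z ∈ upper d, ENNReal.ofReal (z.2 0) ^ k * ‖f z.1 z.2‖ₑ ≤ J z) :
    weightedLp (θ + k * p) p f ≤ wInt θ p J ^ (1 / p) := by
  have hp0 : 0 < p := by linarith
  rw [weightedLp]
  gcongr
  refine lintegral_mono fun t => setLIntegral_mono' (measurableSet_halfSpace d) fun x hx => ?_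
  have hx : 0 < x 0 := hx
  have e : x 0 ^ (θ + k * p - ((d : ℝ) + 1)) = (x 0 ^ k) ^ p * x 0 ^ (θ - ((d : ℝ) + 1)) := by
    rw [← Real.rpow_natCast, ← Real.rpow_mul hx.le, ← Real.rpow_add hx]
    congr 1
    ring
  rw [e, ENNReal.ofReal_mul (by positivity), ← ENNReal.ofReal_rpow_of_nonneg (by positivity) hp0.le,
    ENNReal.ofReal_pow hx.le, ← mul_assoc, ← ENNReal.mul_rpow_of_nonneg _ _ hp0.le, mul_comm ‖_‖ₑ]
  gcongr
  exact h (t, x) hx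

theorem enorm_partialD_le {d m : ℕ} (J : Fin m → Fin (d + 1)) (f : Space d → ℂ) (x : Space d) :
    ‖partialD J f x‖ₑ ≤ ‖iteratedFDeriv ℝ m f x‖ₑ := by
  rw [← ofReal_norm, ← ofReal_norm]
  refine ENNReal.ofReal_le_ofReal ((ContinuousMultilinearMap.le_opNorm _ _).trans ?_)
  simp

theorem deriv_eq_timeDeriv {d : ℕ} {F : ℝ × Space d → ℂ} (hF : ContDiffOn ℝ ∞ F (upper d))
    {z : ℝ × Space d} (hz : z ∈ upper d) :
    HasDerivAt (fun τ => F (τ, z.2)) (timeDeriv F z) z.1 := by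
  have h1 := ((hF.contDiffAt ((isOpen_upper d).mem_nhds hz)).differentiableAt
    (by simp)).hasFDerivAt
  have h2 : HasDerivAt (fun τ : ℝ => (τ, z.2)) (1, 0) z.1 :=
    (hasDerivAt_id _).prodMk (hasDerivAt_const _ _)
  exact HasFDerivAt.comp_hasDerivAt z.1 (f := fun τ : ℝ => (τ, z.2)) h1 h2

theorem partialD_deriv {d m : ℕ} (J : Fin m → Fin (d + 1)) {F : ℝ × Space d → ℂ}
    (hF : ContDiffOn ℝ ∞ F (upper d)) {z : ℝ × Space d} (hz : z ∈ upper d) :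
    partialD J (fun x => deriv (fun τ => F (τ, x)) z.1) z.2 =
      partialD J (fun x => timeDeriv F (z.1, x)) z.2 := by
  have h : (fun x => deriv (fun τ => F (τ, x)) z.1) =ᶠ[𝓝 z.2] fun x => timeDeriv F (z.1, x) := by
    filter_upwards [(halfSpace d).isOpen.mem_nhds (show z.2 ∈ halfSpace d from hz)] with x hx
    exact (deriv_eq_timeDeriv hF (z := (z.1, x)) hx).deriv
  rw [partialD, (h.iteratedFDeriv ℝ m).self_of_nhds, partialD]

theorem exists_weightedLp_cut_le (d m : ℕ) {p θ s : ℝ} (hp : 1 < p) (hθ₁ : (d : ℝ) < θ)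
    (hθ₂ : θ < d + p) (hs : s = (d + p - θ) / p) {η : ℝ → ℝ} (hη : IsCutoff η) : ∃ C : ℝ≥0,
      ∀ g : ℝ × Bdry d → ℂ, MemSlob s p g →
        (∀ J : Fin (m + 1) → Fin (d + 1),
          weightedLp (θ + m * p) p (fun t => partialD J (cutExt η g t)) ≤ C * slobNorm s p g) ∧
        (∀ J : Fin m → Fin (d + 1), weightedLp (θ + (m + 1) * p) p
            (fun t => partialD J (fun x => deriv (fun τ => cutExt η g τ x) t))
              ≤ C * slobNorm s p g) ∧
        weightedLp θ p (cutExt η g) ≤ C * slobNorm s p g := by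
  have hp0 : 0 < p := by linarith
  obtain ⟨C, hC⟩ := exists_wInt_jet_le d m hp hθ₁ hθ₂ hs hη
  refine ⟨C, fun g hg => ?_⟩
  have h1 : wInt θ p (jet m (cut η (conv poisKer g))) ^ (1 / p) ≤ C * slobNorm s p g := by
    refine (ENNReal.rpow_le_rpow (hC g hg) (by positivity)).trans (le_of_eq ?_)
    rw [← ENNReal.rpow_mul, mul_one_div_cancel hp0.ne', ENNReal.rpow_one]
  have hF := contDiffOn_cut (d := d) hη.1 (convKer_poisKer.contDiffOn_conv
    (tame_of_memLp hp hg.memLp))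
  refine ⟨fun J => (wInt_le_of_jet hp fun z hz => ?_).trans h1, fun J => ?_, ?_⟩
  · refine (mul_le_mul_right (enorm_partialD_le J _ _) _).trans ?_
    simp_rw [funext (cutExt_eq η g z.1)]
    exact space_le_jet le_rfl _ z
  · refine le_trans ?_ h1
    have e : θ + ((m : ℝ) + 1) * p = θ + (m + 1 : ℕ) * p := by push_cast; ring
    rw [e]
    refine wInt_le_of_jet hp fun z hz => ?_
    simp_rw [cutExt_eq]
    rw [partialD_deriv J hF hz]
    exact (mul_le_mul_right (enorm_partialD_le J _ _) _).trans (time_le_jet le_rfl _ z)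
  · have e : θ = θ + (0 : ℕ) * p := by simp
    rw [e]
    refine (wInt_le_of_jet hp fun z hz => ?_).trans h1
    simp_rw [cutExt_eq]
    simpa using enorm_le_jet m _ z

/-- No cut-off is needed and only seminorms appear, since `djet` has no undifferentiated term and
the bound of the majorant holds at all heights. -/
theorem exists_weightedLp_poissonExt_le (d m : ℕ) {p θ s : ℝ} (hp : 1 < p) (hθ₁ : (d : ℝ) < θ)
    (hθ₂ : θ < d + p) (hs : s = (d + p - θ) / p) : ∃ C : ℝ≥0,
      ∀ g : ℝ × Bdry d → ℂ, MemSlob s p g →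
        (∀ J : Fin (m + 1) → Fin (d + 1),
          weightedLp (θ + m * p) p (fun t => partialD J (poissonExt g t))
            ≤ C * (slobTime s p g + slobSpace s p g)) ∧
        (∀ J : Fin m → Fin (d + 1), weightedLp (θ + (m + 1) * p) p
            (fun t => partialD J (fun x => deriv (fun τ => poissonExt g τ x) t))
              ≤ C * (slobTime s p g + slobSpace s p g)) := by
  have hp0 : 0 < p := by linarith
  obtain ⟨C₁, h₁⟩ := djet_conv_le d m
  obtain ⟨C₂, hC₂, h₂⟩ := exists_wInt_majorant_le d hp hθ₁ hθ₂ hs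
  refine ⟨C₁ * (C₂ ^ (1 / p)).toNNReal, fun g hg => ?_⟩
  obtain ⟨h, hgh, hm, hh⟩ := hg.exists_measurable
  rw [poissonExt_congr hgh, slobTime_congr hgh, slobSpace_congr hgh]
  have ht := tame_of_memLp hp hh.memLp
  have h3 : wInt θ p (djet m (conv poisKer h)) ^ (1 / p) ≤
      (C₁ * (C₂ ^ (1 / p)).toNNReal : ℝ≥0) * (slobTime s p h + slobSpace s p h) := by
    refine (ENNReal.rpow_le_rpow ((wInt_mono hp0.le (h₁ h ht)).trans (le_of_eq
      (wInt_const_mul hp0.le _ _))) (by positivity)).trans ?_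
    refine (ENNReal.rpow_le_rpow (mul_le_mul_right (h₂ h hm) _) (by positivity)).trans
      (le_of_eq ?_)
    rw [ENNReal.mul_rpow_of_nonneg _ _ (by positivity), ENNReal.mul_rpow_of_nonneg _ _
      (by positivity), ← ENNReal.rpow_mul, ← ENNReal.rpow_mul, mul_one_div_cancel hp0.ne',
      ENNReal.rpow_one, ENNReal.rpow_one]
    push_cast
    rw [ENNReal.coe_toNNReal (ENNReal.rpow_ne_top_of_nonneg (by positivity) hC₂), mul_assoc]
  refine ⟨fun J => (wInt_le_of_jet hp fun z hz => ?_).trans h3, fun J => ?_⟩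
  · refine (mul_le_mul_right (enorm_partialD_le J _ _) _).trans ?_
    simp_rw [funext (poissonExt_eq h z.1)]
    exact space_le_djet le_rfl _ z
  · refine le_trans ?_ h3
    have e : θ + ((m : ℝ) + 1) * p = θ + (m + 1 : ℕ) * p := by push_cast; ring
    rw [e]
    refine wInt_le_of_jet hp fun z hz => ?_
    simp_rw [poissonExt_eq]
    rw [partialD_deriv J (convKer_poisKer.contDiffOn_conv ht) hz]
    exact (mul_le_mul_right (enorm_partialD_le J _ _) _).trans (time_le_djet le_rfl _ z)

theorem integrable_poissonIntegrand {d : ℕ} {g : ℝ × Bdry d → ℂ} (hg : Tame g) (t : ℝ) {x : Space d}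
    (hx : 0 < x 0) : Integrable (poissonIntegrand g t x) volume := by
  rw [funext (poissonIntegrand_eq g t x)]
  exact convKer_poisKer.integrable_mul hg (z := (t, x)) hx

theorem smoothInside_poissonExt {d : ℕ} {g : ℝ × Bdry d → ℂ} (hg : Tame g) :
    SmoothInside (poissonExt g) :=
  (convKer_poisKer.contDiffOn_conv hg).congr fun q _ => poissonExt_eq g q.1 q.2

theorem smoothInside_cutExt {d : ℕ} {η : ℝ → ℝ} (hη : ContDiff ℝ ∞ η) {g : ℝ × Bdry d → ℂ}
    (hg : Tame g) : SmoothInside (cutExt η g) :=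
  (contDiffOn_cut hη (convKer_poisKer.contDiffOn_conv hg)).congr fun q _ => cutExt_eq η g q.1 q.2

/-! ### Bessel potentials of smooth functions -/

section BesselMeasure

open ProbabilityTheory FourierTransform

variable {V : Type*} [NormedAddCommGroup V] [InnerProductSpace ℝ V] [FiniteDimensional ℝ V]
  [MeasurableSpace V] [BorelSpace V]

/-- The Laplace transform of the Gamma distribution, which will represent a power of `1 + ‖ξ‖²` as a
mixture of Gaussians. -/
theorem integral_exp_gammaMeasure {a b : ℝ} (ha : 0 < a) (hb : 0 ≤ b) :
    ∫ τ, Real.exp (-(τ * b)) ∂gammaMeasure a 1 = (1 + b) ^ (-a) := by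
  have h1 : ∀ x, (gammaPDF a 1 x).toReal = gammaPDFReal a 1 x := fun x =>
    ENNReal.toReal_ofReal (gammaPDFReal_nonneg ha one_pos x)
  have hm : Measurable (gammaPDF a 1) := (measurable_gammaPDFReal a 1).ennreal_ofReal
  rw [gammaMeasure, integral_withDensity_eq_integral_toReal_smul hm
    (Eventually.of_forall fun x => ENNReal.ofReal_lt_top)]
  simp_rw [h1, smul_eq_mul]
  have h2 : ∀ x, gammaPDFReal a 1 x * Real.exp (-(x * b)) = (Set.Ici (0 : ℝ)).indicator
      (fun x => (Real.Gamma a)⁻¹ * (x ^ (a - 1) * Real.exp (-((1 + b) * x)))) x := fun x => by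
    by_cases hx : 0 ≤ x
    · rw [gammaPDFReal, if_pos hx, Set.indicator_of_mem (Set.mem_Ici.2 hx), Real.one_rpow, mul_assoc,
        mul_assoc, ← Real.exp_add, one_div]
      ring_nf
    · rw [gammaPDFReal, if_neg hx, Set.indicator_of_notMem (by simpa using hx), zero_mul]
  simp_rw [h2]
  rw [integral_indicator measurableSet_Ici, integral_Ici_eq_integral_Ioi, integral_const_mul,
    Real.integral_rpow_mul_exp_neg_mul_Ioi ha (by positivity), one_div,
    Real.inv_rpow (by positivity), Real.rpow_neg (by positivity)]
  field_simp [(Real.Gamma_pos_of_pos ha).ne']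

theorem ae_nonneg_gammaMeasure (a : ℝ) : ∀ᵐ τ ∂gammaMeasure a 1, 0 ≤ τ := by
  have hm : Measurable (gammaPDF a 1) := (measurable_gammaPDFReal a 1).ennreal_ofReal
  rw [gammaMeasure, ae_withDensity_iff hm]
  refine Eventually.of_forall fun x hx => ?_
  by_contra h
  exact hx (gammaPDF_of_neg (not_le.1 h))

/-- The Bessel potential of negative order is the convolution with a probability measure. -/
theorem exists_besselMeasure {σ : ℝ} (hσ : 0 < σ) : ∃ μ : Measure V, IsProbabilityMeasure μ ∧
    ∀ ξ : V, ∫ y, Complex.exp (2 * Real.pi * inner ℝ y ξ * Complex.I) ∂μ =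
      ((1 + ‖ξ‖ ^ 2) ^ (-σ / 2) : ℝ) := by
  have hp := isProbabilityMeasure_gammaMeasure (half_pos hσ) one_pos
  -- A Gaussian vector run for a random time `τ` with Gamma distribution of shape `σ / 2`. The
  -- factor `√(2τ) / (2π)` is fitted to the Fourier convention: for fixed `τ` the transform is `exp
  -- (-τ ‖ξ‖²)`.
  let Φ : ℝ × V → V := fun q => (√(2 * q.1) / (2 * Real.pi)) • q.2
  have hΦ : Measurable Φ := by
    have : Continuous Φ := by fun_prop
    exact this.measurable
  refine ⟨((gammaMeasure (σ / 2) 1).prod (stdGaussian V)).map Φ,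
    Measure.isProbabilityMeasure_map hΦ.aemeasurable, fun ξ => ?_⟩
  have hc : Continuous fun y : V => Complex.exp (2 * Real.pi * inner ℝ y ξ * Complex.I) := by
    fun_prop
  rw [integral_map hΦ.aemeasurable hc.aestronglyMeasurable, integral_prod]
  · have h1 : ∀ τ : ℝ, 0 ≤ τ → ∫ z, Complex.exp (2 * Real.pi * inner ℝ (Φ (τ, z)) ξ * Complex.I)
        ∂stdGaussian V = (Real.exp (-(τ * ‖ξ‖ ^ 2)) : ℝ) := fun τ hτ => by
      have h2 := charFun_stdGaussian (√(2 * τ) • ξ)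
      rw [charFun_apply] at h2
      have h3 : ∀ z : V, (2 * Real.pi * inner ℝ (Φ (τ, z)) ξ * Complex.I : ℂ) =
          (inner ℝ z (√(2 * τ) • ξ) : ℝ) * Complex.I := fun z => by
        simp only [Φ, real_inner_smul_left, real_inner_smul_right]
        push_cast
        field_simp
      simp_rw [h3]
      rw [h2, norm_smul, Real.norm_of_nonneg (Real.sqrt_nonneg _)]
      push_cast
      congr 1
      have h4 : ((√(2 * τ) : ℝ) : ℂ) ^ 2 = 2 * τ := by
        rw [← Complex.ofReal_pow, Real.sq_sqrt (by positivity)]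
        push_cast
        ring
      rw [mul_pow, h4]
      ring
    have h5 : ∀ᵐ τ ∂gammaMeasure (σ / 2) 1,
        ∫ z, Complex.exp (2 * Real.pi * inner ℝ (Φ (τ, z)) ξ * Complex.I) ∂stdGaussian V =
          (Real.exp (-(τ * ‖ξ‖ ^ 2)) : ℝ) := by
      filter_upwards [ae_nonneg_gammaMeasure (σ / 2)] with τ hτ using h1 τ hτ
    rw [integral_congr_ae h5, integral_complex_ofReal,
      integral_exp_gammaMeasure (half_pos hσ) (by positivity), neg_div]
  · refine Integrable.of_bound (hc.measurable.comp hΦ).aestronglyMeasurable 1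
      (Eventually.of_forall fun q => le_of_eq ?_)
    have : (2 * Real.pi * inner ℝ (Φ q) ξ * Complex.I : ℂ) =
      ((2 * Real.pi * inner ℝ (Φ q) ξ : ℝ) : ℂ) * Complex.I := by push_cast; ring
    rw [this, Complex.norm_exp_ofReal_mul_I]

/-- By Fubini's theorem, a multiplier that is the Fourier transform of a finite measure acts as
convolution with this measure. -/
theorem fourier_smulLeftCLM_fourierInv {m : V → ℝ} (hm : m.HasTemperateGrowth) {μ : Measure V}
    [IsFiniteMeasure μ]
    (hμ : ∀ ξ : V, ∫ y, Complex.exp (2 * Real.pi * inner ℝ y ξ * Complex.I) ∂μ = (m ξ : ℂ))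
    (φ : 𝓢(V, ℂ)) (x : V) :
    (𝓕 (SchwartzMap.smulLeftCLM ℂ (fun ξ => (m ξ : ℂ)) (𝓕⁻ φ)) : 𝓢(V, ℂ)) x =
      ∫ y, φ (x - y) ∂μ := by
  set ψ : 𝓢(V, ℂ) := 𝓕⁻ φ with hψ
  have hφ : φ = 𝓕 ψ := by simp [hψ]
  have hm' : (fun ξ => (m ξ : ℂ)).HasTemperateGrowth := by fun_prop
  have e : ∀ z : V, φ z = ∫ ξ, Complex.exp (-2 * Real.pi * inner ℝ ξ z * Complex.I) * ψ ξ := by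
    intro z
    rw [hφ, SchwartzMap.fourier_coe, Real.fourier_eq']
    refine integral_congr_ae (Eventually.of_forall fun ξ => ?_)
    simp
  rw [SchwartzMap.fourier_coe, Real.fourier_eq']
  simp_rw [e, SchwartzMap.smulLeftCLM_apply_apply hm', smul_eq_mul, ← hμ]
  rw [integral_integral_swap]
  · refine integral_congr_ae (Eventually.of_forall fun ξ => ?_)
    simp only
    rw [integral_mul_const, ← mul_assoc, ← integral_const_mul]
    congr 1
    refine integral_congr_ae (Eventually.of_forall fun y => ?_)
    simp only
    rw [← Complex.exp_add, inner_sub_right, real_inner_comm]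
    congr 1
    push_cast
    rw [real_inner_comm y ξ]
    ring
  · have h1 : Integrable (fun q : V × V => (1 : ℂ) * ψ q.2) (μ.prod volume) :=
      (integrable_const (1 : ℂ)).mul_prod ψ.integrable
    refine (h1.norm).mono ?_ ?_
    · have : Continuous fun q : V × V =>
        Complex.exp (-2 * Real.pi * inner ℝ q.2 (x - q.1) * Complex.I) * ψ q.2 := by
        have := ψ.continuous
        fun_prop
      exact this.aestronglyMeasurable
    · refine Eventually.of_forall fun q => ?_
      have : (-2 * Real.pi * inner ℝ q.2 (x - q.1) * Complex.I : ℂ) =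
        ((-2 * Real.pi * inner ℝ q.2 (x - q.1) : ℝ) : ℂ) * Complex.I := by push_cast; ring
      simp only [Function.uncurry, norm_mul, this, Complex.norm_exp_ofReal_mul_I]
      simp

end BesselMeasure

/-! ### Distributions given by functions, and potentials of even order -/

/-- The tempered distribution `T` is the function `f`. -/
def Represents {d : ℕ} (T : 𝓢'(Space d, ℂ)) (f : Space d → ℂ) : Prop :=
  ∀ φ : 𝓢(Space d, ℂ), T φ = ∫ x, φ x * f x

theorem exists_represents {d : ℕ} {p : ℝ} (hp : 1 < p) {f : Space d → ℂ}
    (hf : MemLp f (ENNReal.ofReal p) volume) : ∃ T : 𝓢'(Space d, ℂ), Represents T f := by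
  have : Fact ((1 : ℝ≥0∞) ≤ ENNReal.ofReal p) := ⟨by simpa using hp.le⟩
  refine ⟨Lp.toTemperedDistribution (hf.toLp f), fun φ => ?_⟩
  rw [Lp.toTemperedDistribution_apply]
  refine integral_congr_ae ?_
  filter_upwards [hf.coeFn_toLp] with x hx
  rw [hx, smul_eq_mul]

theorem integrable_schwartz_mul {d : ℕ} {p : ℝ} (hp : 1 < p) {f : Space d → ℂ}
    (hf : MemLp f (ENNReal.ofReal p) volume) (φ : 𝓢(Space d, ℂ)) :
    Integrable (fun x => φ x * f x) volume := by
  have hpq := Real.HolderConjugate.conjExponent hp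
  have : ENNReal.HolderConjugate (ENNReal.ofReal p) (ENNReal.ofReal (p.conjExponent)) :=
    hpq.ennrealOfReal
  have := (φ.memLp (ENNReal.ofReal p.conjExponent) volume).integrable_mul hf
  exact this

/-- By Hölder's inequality all products with Schwartz functions are integrable, which is all that
integration by parts on the whole space asks for. -/
theorem Represents.lineDerivOp {d : ℕ} {p : ℝ} (hp : 1 < p) {T : 𝓢'(Space d, ℂ)} {f : Space d → ℂ}
    (hT : Represents T f) (hd : Differentiable ℝ f) (hf : MemLp f (ENNReal.ofReal p) volume)
    (m : Space d) (hf' : MemLp (fun x => fderiv ℝ f x m) (ENNReal.ofReal p) volume) :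
    Represents (∂_{m} T) fun x => fderiv ℝ f x m := fun φ => by
  have e : ∀ x, (∂_{m} φ : 𝓢(Space d, ℂ)) x = fderiv ℝ φ x m := fun x =>
    SchwartzMap.lineDerivOp_apply_eq_fderiv m φ x
  rw [TemperedDistribution.lineDerivOp_apply_apply, map_neg, hT]
  simp_rw [e]
  rw [integral_mul_fderiv_eq_neg_fderiv_mul_of_integrable]
  · have := integrable_schwartz_mul hp hf (∂_{m} φ)
    simp_rw [e] at this
    exact this
  · exact integrable_schwartz_mul hp hf' φ
  · exact integrable_schwartz_mul hp hf φ
  · exact fun x _ => φ.differentiableAt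
  · exact fun x _ => hd x

/-- The sum of the sizes of the derivatives of order at most `M`. -/
def dsum {d : ℕ} (M : ℕ) (f : Space d → ℂ) (x : Space d) : ℝ≥0∞ :=
  ∑ j ∈ Finset.range (M + 1), ‖iteratedFDeriv ℝ j f x‖ₑ

theorem enorm_iteratedFDeriv_le_dsum {d M j : ℕ} (hj : j ≤ M) (f : Space d → ℂ) (x : Space d) :
    ‖iteratedFDeriv ℝ j f x‖ₑ ≤ dsum M f x :=
  Finset.single_le_sum (f := fun j => ‖iteratedFDeriv ℝ j f x‖ₑ) (fun _ _ => zero_le)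
    (Finset.mem_range.2 (by omega))

theorem dsum_mono {d M M' : ℕ} (h : M ≤ M') (f : Space d → ℂ) (x : Space d) :
    dsum M f x ≤ dsum M' f x :=
  Finset.sum_le_sum_of_subset (Finset.range_mono (by omega))

/-- The function `f - (2π)⁻² Δf`. -/
def besselLap {d : ℕ} (f : Space d → ℂ) (x : Space d) : ℂ :=
  f x - ((((2 * Real.pi) ^ 2)⁻¹ : ℝ) : ℂ) * ∑ i : Fin (d + 1),
    fderiv ℝ (fun y => fderiv ℝ f y (stdVec i)) x (stdVec i)

theorem contDiff_fderiv_apply {d : ℕ} {f : Space d → ℂ} (hf : ContDiff ℝ ∞ f) (m : Space d) :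
    ContDiff ℝ ∞ fun x => fderiv ℝ f x m :=
  (hf.fderiv_right (m := ∞) (by simp)).clm_apply contDiff_const

theorem contDiff_besselLap {d : ℕ} {f : Space d → ℂ} (hf : ContDiff ℝ ∞ f) :
    ContDiff ℝ ∞ (besselLap f) :=
  hf.sub (contDiff_const.mul (ContDiff.sum fun _ _ =>
    contDiff_fderiv_apply (contDiff_fderiv_apply hf _) _))

theorem enorm_iteratedFDeriv_fderiv_apply_le {d : ℕ} {f : Space d → ℂ} {x : Space d}
    (hf : ContDiffAt ℝ ∞ f x) (i : Fin (d + 1)) (j : ℕ) :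
    ‖iteratedFDeriv ℝ j (fun x => fderiv ℝ f x (stdVec i)) x‖ₑ ≤ ‖iteratedFDeriv ℝ (j + 1) f x‖ₑ := by
  have h1 : ContDiffAt ℝ ∞ (fderiv ℝ f) x := hf.fderiv_right (m := ∞) (by simp)
  have h := (ContinuousLinearMap.apply ℝ ℂ (stdVec i : Space d)).norm_iteratedFDeriv_comp_left
    h1 (n := j) (by exact_mod_cast le_top)
  rw [← ofReal_norm, ← ofReal_norm]
  refine ENNReal.ofReal_le_ofReal (h.trans ?_)
  rw [norm_iteratedFDeriv_fderiv]
  refine mul_le_of_le_one_left (norm_nonneg _) ?_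
  refine ContinuousLinearMap.opNorm_le_bound _ zero_le_one fun L => ?_
  refine (L.le_opNorm _).trans ?_
  simp

theorem dsum_besselLap_le (d : ℕ) : ∃ C : ℝ≥0, ∀ (M : ℕ) (f : Space d → ℂ), ContDiff ℝ ∞ f →
    ∀ x, dsum M (besselLap f) x ≤ C * dsum (M + 2) f x := by
  set c : ℝ := ((2 * Real.pi) ^ 2)⁻¹ with hc
  refine ⟨1 + ‖c‖₊ * (d + 1), fun M f hf x => ?_⟩
  have hof : ∀ j : ℕ, (j : WithTop ℕ∞) ≤ ((⊤ : ℕ∞) : WithTop ℕ∞) := fun j => by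
    exact_mod_cast le_top
  have hpd := fun i : Fin (d + 1) =>
    contDiff_fderiv_apply (contDiff_fderiv_apply hf (stdVec i)) (stdVec i)
  have h1 : ∀ j : ℕ, ‖iteratedFDeriv ℝ j (besselLap f) x‖ₑ ≤
      ‖iteratedFDeriv ℝ j f x‖ₑ + ‖c‖ₑ * ∑ i : Fin (d + 1), ‖iteratedFDeriv ℝ (j + 2) f x‖ₑ := by
    intro j
    have e : besselLap f = f - (c • fun x => ∑ i : Fin (d + 1),
        fderiv ℝ (fun y => fderiv ℝ f y (stdVec i)) x (stdVec i)) := by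
      funext x
      simp [besselLap, hc]
    have hs : ContDiff ℝ ∞ fun x => ∑ i : Fin (d + 1),
        fderiv ℝ (fun y => fderiv ℝ f y (stdVec i)) x (stdVec i) := ContDiff.sum fun i _ => hpd i
    have hcs : ContDiff ℝ ∞ (c • fun x => ∑ i : Fin (d + 1),
        fderiv ℝ (fun y => fderiv ℝ f y (stdVec i)) x (stdVec i)) := hs.const_smul c
    rw [e, iteratedFDeriv_sub_apply (hf.contDiffAt.of_le (hof j))
      (hcs.contDiffAt.of_le (hof j)),
      iteratedFDeriv_const_smul_apply (hs.contDiffAt.of_le (hof j))]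
    refine enorm_sub_le.trans (add_le_add le_rfl ?_)
    rw [enorm_smul]
    gcongr
    rw [iteratedFDeriv_sum fun i _ => (hpd i).of_le (hof j)]
    simp only [Finset.sum_apply]
    refine (enorm_sum_le _ _).trans (Finset.sum_le_sum fun i _ => ?_)
    exact (enorm_iteratedFDeriv_fderiv_apply_le (contDiff_fderiv_apply hf _).contDiffAt i j).trans
      (enorm_iteratedFDeriv_fderiv_apply_le hf.contDiffAt i (j + 1))
  refine (Finset.sum_le_sum fun j _ => h1 j).trans ?_
  rw [Finset.sum_add_distrib]
  push_cast
  rw [add_mul, one_mul]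
  refine add_le_add (dsum_mono (by omega) f x) ?_
  simp only [Finset.sum_const, Finset.card_univ, Fintype.card_fin, nsmul_eq_mul]
  rw [← Finset.mul_sum, ← Finset.mul_sum, mul_assoc]
  push_cast
  refine mul_le_mul' le_rfl (mul_le_mul' le_rfl ?_)
  rw [dsum, Finset.sum_range_succ' (n := M + 2), Finset.sum_range_succ' (n := M + 1)]
  refine le_add_right (le_add_right le_rfl)

theorem memLp_of_enorm_le {d : ℕ} {p : ℝ} (hp : 1 < p) {f : Space d → ℂ} (hf : Continuous f)
    {F : Space d → ℝ≥0∞} (h : ∀ x, ‖f x‖ₑ ≤ F x) (hF : ∫⁻ x, F x ^ p < ⊤) :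
    MemLp f (ENNReal.ofReal p) volume := by
  have h0 : 0 < p := by linarith
  refine ⟨hf.aestronglyMeasurable, ?_⟩
  rw [eLpNorm_lt_top_iff_lintegral_rpow_enorm_lt_top (by simpa using h0) (by simp),
    ENNReal.toReal_ofReal h0.le]
  exact (lintegral_mono fun x => ENNReal.rpow_le_rpow (h x) h0.le).trans_lt hF

/-- In this Fourier convention the Laplacian has the symbol `-(2π)² ‖ξ‖²`, so the symbol `1 + ‖ξ‖²`
belongs to `1 - (2π)⁻² Δ`. -/
theorem besselPotential_two_apply {d : ℕ} (T : 𝓢'(Space d, ℂ)) (φ : 𝓢(Space d, ℂ)) :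
    TemperedDistribution.besselPotential (Space d) ℂ 2 T φ = T φ -
      ((((2 * Real.pi) ^ 2)⁻¹ : ℝ) : ℂ) * ∑ i : Fin (d + 1), (∂_{stdVec i} (∂_{stdVec i} T)) φ := by
  have h1 : (fun x : Space d => (((1 + ‖x‖ ^ 2) ^ ((2 : ℝ) / 2) : ℝ) : ℂ)) =
      (fun _ => (1 : ℂ)) + fun x => Complex.ofReal (‖x‖ ^ 2) := by
    funext x
    simp
  have h2 : (Laplacian.laplacian T) φ = ((-(2 * Real.pi) ^ 2 : ℝ) : ℂ) *
      T (FourierTransform.fourier (SchwartzMap.smulLeftCLM ℂ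
        (fun x : Space d => Complex.ofReal (‖x‖ ^ 2)) (FourierTransformInv.fourierInv φ))) :=
    congrArg (fun S : 𝓢'(Space d, ℂ) => S φ)
      (TemperedDistribution.laplacian_eq_fourierMultiplierCLM T)
  have h3 : (Laplacian.laplacian T) φ = ∑ i : Fin (d + 1), (∂_{stdVec i} (∂_{stdVec i} T)) φ := by
    rw [TemperedDistribution.laplacian_eq_sum (EuclideanSpace.basisFun (Fin (d + 1)) ℝ) T]
    simp
  rw [← h3, h2, TemperedDistribution.besselPotential, h1,
    TemperedDistribution.fourierMultiplierCLM_apply_apply,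
    SchwartzMap.smulLeftCLM_add (by fun_prop) (by fun_prop), ← mul_assoc, ← Complex.ofReal_mul,
    mul_neg, inv_mul_cancel₀ (by positivity)]
  simp

theorem Represents.besselPotential_two {d : ℕ} {p : ℝ} (hp : 1 < p) {T : 𝓢'(Space d, ℂ)}
    {f : Space d → ℂ} (hT : Represents T f) (hf : ContDiff ℝ ∞ f)
    (hfin : ∫⁻ x, dsum 2 f x ^ p < ⊤) :
    Represents (TemperedDistribution.besselPotential (Space d) ℂ 2 T) (besselLap f) := fun φ => by
  have h0 : MemLp f (ENNReal.ofReal p) volume := memLp_of_enorm_le hp hf.continuous (fun x => by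
    have := enorm_iteratedFDeriv_le_dsum (M := 2) (j := 0) (by omega) f x
    simpa [← ofReal_norm] using this) hfin
  have h1 : ∀ i : Fin (d + 1), MemLp (fun x => fderiv ℝ f x (stdVec i)) (ENNReal.ofReal p) volume :=
    fun i => memLp_of_enorm_le hp (contDiff_fderiv_apply hf _).continuous (fun x => by
      have := (enorm_iteratedFDeriv_fderiv_apply_le (hf.contDiffAt (x := x)) i 0).trans
        (enorm_iteratedFDeriv_le_dsum (M := 2) (by omega) f x)
      simpa [← ofReal_norm] using this) hfin
  have h2 : ∀ i : Fin (d + 1), MemLp (fun x => fderiv ℝ (fun y => fderiv ℝ f y (stdVec i)) x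
      (stdVec i)) (ENNReal.ofReal p) volume :=
    fun i => memLp_of_enorm_le hp
      (contDiff_fderiv_apply (contDiff_fderiv_apply hf _) _).continuous (fun x => by
      have := ((enorm_iteratedFDeriv_fderiv_apply_le ((contDiff_fderiv_apply hf
        (stdVec i)).contDiffAt (x := x)) i 0).trans (enorm_iteratedFDeriv_fderiv_apply_le
          (hf.contDiffAt (x := x)) i 1)).trans
        (enorm_iteratedFDeriv_le_dsum (M := 2) (by omega) f x)
      simpa [← ofReal_norm] using this) hfin
  have h3 : ∀ i : Fin (d + 1), Represents (∂_{stdVec i} (∂_{stdVec i} T))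
      (fun x => fderiv ℝ (fun y => fderiv ℝ f y (stdVec i)) x (stdVec i)) := fun i =>
    (hT.lineDerivOp hp (hf.differentiable (by simp)) h0 _ (h1 i)).lineDerivOp hp
      ((contDiff_fderiv_apply hf _).differentiable (by simp)) (h1 i) _ (h2 i)
  rw [besselPotential_two_apply, hT φ]
  simp_rw [h3 _ φ, besselLap, mul_sub, mul_left_comm, Finset.mul_sum]
  rw [integral_sub (integrable_schwartz_mul hp h0 φ), integral_finsetSum]
  · simp_rw [integral_const_mul]
  · exact fun i _ => (integrable_schwartz_mul hp (h2 i) φ).const_mul _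
  · exact integrable_finsetSum _ fun i _ => (integrable_schwartz_mul hp (h2 i) φ).const_mul _

/-- Iteration of `besselLap`. The bound on `W` is pointwise and for every `M`, so that the induction
can call for two more derivatives at each step. -/
theorem exists_represents_besselPotential_even (d k : ℕ) {p : ℝ} (hp : 1 < p) : ∃ C : ℝ≥0,
    ∀ f : Space d → ℂ, ContDiff ℝ ∞ f → ∃ W : Space d → ℂ, ContDiff ℝ ∞ W ∧
      (∀ (M : ℕ) (x), dsum M W x ≤ C * dsum (M + 2 * k) f x) ∧
      ∀ T, Represents T f → ∫⁻ x, dsum (2 * k) f x ^ p < ⊤ →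
        Represents (TemperedDistribution.besselPotential (Space d) ℂ (2 * k) T) W := by
  obtain ⟨C₀, hC₀⟩ := dsum_besselLap_le d
  induction k with
  | zero =>
    refine ⟨1, fun f hf => ⟨f, hf, fun M x => by simp, fun T hT _ => ?_⟩⟩
    simpa using hT
  | succ k ih =>
    obtain ⟨C, hC⟩ := ih
    refine ⟨C₀ * C, fun f hf => ?_⟩
    obtain ⟨W, hW, hWM, hWT⟩ := hC f hf
    refine ⟨besselLap W, contDiff_besselLap hW, fun M x => ?_, fun T hT hfin => ?_⟩
    · refine (hC₀ M W hW x).trans ?_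
      push_cast
      rw [mul_assoc]
      gcongr
      have := hWM (M + 2) x
      rwa [show M + 2 + 2 * k = M + 2 * (k + 1) by ring] at this
    · have h1 : ∫⁻ x, dsum (2 * k) f x ^ p < ⊤ :=
        (lintegral_mono fun x => ENNReal.rpow_le_rpow (dsum_mono (by omega) f x)
          (by linarith)).trans_lt hfin
      have h2 : ∫⁻ x, dsum 2 W x ^ p < ⊤ := by
        refine (lintegral_mono fun x => ENNReal.rpow_le_rpow (hWM 2 x) (by linarith)).trans_lt ?_
        have hCp : (C : ℝ≥0∞) ^ p ≠ ⊤ :=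
          ENNReal.rpow_ne_top_of_nonneg (by linarith) ENNReal.coe_ne_top
        simp_rw [ENNReal.mul_rpow_of_nonneg _ _ (by linarith : (0 : ℝ) ≤ p)]
        rw [lintegral_const_mul' _ _ hCp, show 2 + 2 * k = 2 * (k + 1) by ring]
        exact ENNReal.mul_lt_top hCp.lt_top hfin
      have := (hWT T hT h1).besselPotential_two hp hW h2
      rw [TemperedDistribution.besselPotential_besselPotential_apply] at this
      rwa [show 2 * ((k + 1 : ℕ) : ℝ) = 2 * k + 2 by push_cast; ring]

/-- Young's inequality bounds the integral over each slice uniformly in `y`, and `μ` is finite. -/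
theorem integrable_mul_of_slices {d : ℕ} {p q : ℝ} (hpq : p.HolderConjugate q)
    {μ : Measure (Space d)} [IsFiniteMeasure μ] {a b : Space d × Space d → ℂ} (ha : Continuous a)
    (hb : Continuous b) {A B : ℝ≥0∞} (hA : A ≠ ⊤) (hB : B ≠ ⊤)
    (hAa : ∀ y, ∫⁻ x, ‖a (x, y)‖ₑ ^ q ≤ A) (hBb : ∀ y, ∫⁻ x, ‖b (x, y)‖ₑ ^ p ≤ B) :
    Integrable (fun z => a z * b z) (volume.prod μ) := by
  refine ⟨(ha.mul hb).aestronglyMeasurable, ?_⟩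
  have hm : Measurable fun z => ‖a z * b z‖ₑ := (ha.mul hb).measurable.enorm
  rw [hasFiniteIntegral_iff_enorm, lintegral_prod_symm _ hm.aemeasurable]
  have hp : ENNReal.ofReal q ≠ 0 := by simpa using hpq.symm.pos
  have hq : ENNReal.ofReal p ≠ 0 := by simpa using hpq.pos
  have h1 : ∀ y, ∫⁻ x, ‖a (x, y) * b (x, y)‖ₑ ≤ A / ENNReal.ofReal q + B / ENNReal.ofReal p := by
    intro y
    have hma : Measurable fun x => ‖a (x, y)‖ₑ ^ q / ENNReal.ofReal q :=
      ((ha.measurable.comp measurable_prodMk_right).enorm.pow_const q).div_const _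
    calc _ ≤ ∫⁻ x, (‖a (x, y)‖ₑ ^ q / ENNReal.ofReal q + ‖b (x, y)‖ₑ ^ p / ENNReal.ofReal p) := by
          refine lintegral_mono fun x => ?_
          rw [enorm_mul]
          exact ENNReal.young_inequality _ _ hpq.symm
      _ ≤ _ := by
          rw [lintegral_add_left hma]
          simp_rw [div_eq_mul_inv]
          rw [lintegral_mul_const' _ _ (by simpa using hpq.symm.pos),
            lintegral_mul_const' _ _ (by simpa using hpq.pos)]
          gcongr
          · exact hAa y
          · exact hBb y
  refine (lintegral_mono h1).trans_lt ?_
  rw [lintegral_const]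
  exact ENNReal.mul_lt_top (ENNReal.add_lt_top.2 ⟨ENNReal.div_lt_top hA hp,
    ENNReal.div_lt_top hB hq⟩) (measure_lt_top _ _)

/-- Bessel potentials of negative order are bounded in `L_p`. -/
theorem exists_represents_besselPotential_neg {d : ℕ} {p σ : ℝ} (hp : 1 < p) (hσ : 0 < σ)
    {W : Space d → ℂ} (hW : Continuous W) (hfin : ∫⁻ x, ‖W x‖ₑ ^ p < ⊤) {T : 𝓢'(Space d, ℂ)}
    (hT : Represents T W) : ∃ h : Space d → ℂ, MemLp h (ENNReal.ofReal p) volume ∧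
      Represents (TemperedDistribution.besselPotential (Space d) ℂ (-σ) T) h ∧
      ∫⁻ x, ‖h x‖ₑ ^ p ≤ ∫⁻ x, ‖W x‖ₑ ^ p := by
  have h0 : 0 < p := by linarith
  obtain ⟨μ, hμp, hμ⟩ := exists_besselMeasure (V := Space d) hσ
  have hWp : MemLp W (ENNReal.ofReal p) volume := memLp_of_enorm_le hp hW (fun x => le_rfl) hfin
  have hcont : Continuous fun q : Space d × Space d => W (q.1 + q.2) := by fun_prop
  set h : Space d → ℂ := fun x => ∫ y, W (x + y) ∂μ with hh
  -- Jensen's inequality for the probability measure `μ`, followed by translation invariance.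
  have hle : ∫⁻ x, ‖h x‖ₑ ^ p ≤ ∫⁻ x, ‖W x‖ₑ ^ p := by
    have h1 : ∀ x, ‖h x‖ₑ ^ p ≤ ∫⁻ y, ‖W (x + y)‖ₑ ^ p ∂μ := fun x => by
      have hm : Measurable fun y => ‖W (x + y)‖ₑ := by
        have : Continuous fun y => W (x + y) := by fun_prop
        exact this.measurable.enorm
      refine (ENNReal.rpow_le_rpow (enorm_integral_le_lintegral_enorm _) h0.le).trans ?_
      have := lintegral_kernel_rpow_le (μ := μ) hp (k := fun _ => 1) aemeasurable_const
        hm.aemeasurable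
      simpa using this
    refine (lintegral_mono h1).trans (le_of_eq ?_)
    rw [lintegral_lintegral_swap (hcont.measurable.enorm.pow_const p).aemeasurable]
    simp_rw [lintegral_add_right_eq_self (fun x => ‖W x‖ₑ ^ p)]
    simp
  have hmeas : StronglyMeasurable h := hcont.stronglyMeasurable.integral_prod_right
  refine ⟨h, ⟨hmeas.aestronglyMeasurable, ?_⟩, fun φ => ?_, hle⟩
  · rw [eLpNorm_lt_top_iff_lintegral_rpow_enorm_lt_top (by simpa using h0) (by simp),
      ENNReal.toReal_ofReal h0.le]
    exact hle.trans_lt hfin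
  · have hm : (fun x : Space d => (1 + ‖x‖ ^ 2) ^ (-σ / 2)).HasTemperateGrowth := by fun_prop
    rw [TemperedDistribution.besselPotential,
      TemperedDistribution.fourierMultiplierCLM_apply_apply, hT]
    simp_rw [fourier_smulLeftCLM_fourierInv hm hμ]
    have hpq := Real.HolderConjugate.conjExponent hp
    have hφ : ∫⁻ x, ‖φ x‖ₑ ^ p.conjExponent ≠ ⊤ := by
      have := (φ.memLp (ENNReal.ofReal p.conjExponent) volume).2
      rw [eLpNorm_lt_top_iff_lintegral_rpow_enorm_lt_top (by simpa using hpq.symm.pos) (by simp),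
        ENNReal.toReal_ofReal hpq.symm.nonneg] at this
      exact this.ne
    have hint : Integrable (fun q : Space d × Space d => φ (q.1 - q.2) * W q.1)
        (volume.prod μ) := by
      refine integrable_mul_of_slices hpq (by have := φ.continuous; fun_prop) (by fun_prop) hφ
        hfin.ne (fun y => ?_) fun y => le_rfl
      rw [lintegral_sub_right_eq_self (fun x => ‖φ x‖ₑ ^ p.conjExponent)]
    -- The convolution passes from the test function to `W`: Fubini's theorem, translation by `y`,
    -- and Fubini's theorem again.
    calc ∫ x, (∫ y, φ (x - y) ∂μ) * W x = ∫ x, ∫ y, φ (x - y) * W x ∂μ := by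
          simp_rw [integral_mul_const]
      _ = ∫ y, ∫ x, φ (x - y) * W x ∂volume ∂μ := integral_integral_swap hint
      _ = ∫ y, ∫ x, φ x * W (x + y) ∂volume ∂μ := by
          refine integral_congr_ae (Eventually.of_forall fun y => ?_)
          simp only
          rw [← integral_add_right_eq_self (fun x => φ (x - y) * W x) y]
          simp
      _ = ∫ x, ∫ y, φ x * W (x + y) ∂μ := by
          refine (integral_integral_swap (f := fun x y => φ x * W (x + y)) ?_).symm
          refine integrable_mul_of_slices hpq (a := fun q => φ q.1)
            (b := fun q => W (q.1 + q.2)) (by have := φ.continuous; fun_prop) hcont hφ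
            hfin.ne (fun y => le_rfl) fun y => ?_
          rw [lintegral_add_right_eq_self (fun x => ‖W x‖ₑ ^ p)]
      _ = ∫ x, φ x * h x := by simp_rw [integral_const_mul, hh]

/-- The Bessel norm of order `γ` is bounded by the classical Sobolev norm of some order. -/
theorem exists_besselNorm_le (d : ℕ) (γ : ℝ) {p : ℝ} (hp : 1 < p) : ∃ (M : ℕ) (C : ℝ≥0),
    ∀ f : Space d → ℂ, ContDiff ℝ ∞ f → ∫⁻ x, dsum M f x ^ p < ⊤ →
      ∃ T : 𝓢'(Space d, ℂ), Represents T f ∧ besselNorm γ p T ^ p ≤ C * ∫⁻ x, dsum M f x ^ p := by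
  have h0 : 0 < p := by linarith
  -- With `2k > γ`, the potential of order `γ` is the even one of order `2k`, computed by
  -- differentiation, followed by one of negative order `-(2k - γ)`, which does not increase the
  -- `L_p` norm.
  obtain ⟨k, hk⟩ := exists_nat_gt (γ / 2)
  obtain ⟨C, hC⟩ := exists_represents_besselPotential_even d k hp
  refine ⟨2 * k, C ^ p, fun f hf hfin => ?_⟩
  have hfp : MemLp f (ENNReal.ofReal p) volume := memLp_of_enorm_le hp hf.continuous (fun x => by
    have := enorm_iteratedFDeriv_le_dsum (M := 2 * k) (j := 0) (by omega) f x
    simpa [← ofReal_norm] using this) hfin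
  obtain ⟨T, hT⟩ := exists_represents hp hfp
  obtain ⟨W, hW, hWM, hWT⟩ := hC f hf
  have hWle : ∫⁻ x, ‖W x‖ₑ ^ p ≤ (C : ℝ≥0∞) ^ p * ∫⁻ x, dsum (2 * k) f x ^ p := by
    have hCp : (C : ℝ≥0∞) ^ p ≠ ⊤ := ENNReal.rpow_ne_top_of_nonneg h0.le ENNReal.coe_ne_top
    rw [← lintegral_const_mul' _ _ hCp]
    refine lintegral_mono fun x => ?_
    rw [← ENNReal.mul_rpow_of_nonneg _ _ h0.le]
    refine ENNReal.rpow_le_rpow ?_ h0.le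
    have := hWM 0 x
    simpa [dsum, ← ofReal_norm] using this
  have hWfin : ∫⁻ x, ‖W x‖ₑ ^ p < ⊤ := hWle.trans_lt (ENNReal.mul_lt_top
    (ENNReal.rpow_lt_top_of_nonneg h0.le ENNReal.coe_ne_top) hfin)
  obtain ⟨h, hh, hhT, hhle⟩ := exists_represents_besselPotential_neg hp
    (σ := 2 * k - γ) (by linarith) hW.continuous hWfin (hWT T hT hfin)
  rw [TemperedDistribution.besselPotential_besselPotential_apply,
    show (2 * k + -(2 * k - γ) : ℝ) = γ by ring] at hhT
  refine ⟨T, hT, ?_⟩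
  have h1 : besselNorm γ p T ≤ eLpNorm h (ENNReal.ofReal p) volume :=
    iInf_le_of_le h (iInf_le_of_le hh (iInf_le_of_le hhT le_rfl))
  have h2 : eLpNorm h (ENNReal.ofReal p) volume ^ p = ∫⁻ x, ‖h x‖ₑ ^ p := by
    rw [eLpNorm_eq_lintegral_rpow_enorm_toReal (by simpa using h0) (by simp),
      ENNReal.toReal_ofReal h0.le, ← ENNReal.rpow_mul, one_div_mul_cancel h0.ne', ENNReal.rpow_one]
  refine (ENNReal.rpow_le_rpow h1 h0.le).trans ?_
  rw [h2, ENNReal.coe_rpow_of_nonneg _ h0.le]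
  exact hhle.trans hWle

/-! ### The norm of `H^γ_{p,θ}` of a smooth function -/

theorem distOf_apply {d : ℕ} {f : Space d → ℂ}
    (hf : ContinuousOn f (halfSpace d : Set (Space d))) (φ : 𝓓(halfSpace d, ℝ)) :
    distOf f φ = ∫ x, (φ x : ℂ) * f x := by
  have h := hf.locallyIntegrableOn (μ := volume) (measurableSet_halfSpace d)
  refine (TestFunction.integralAgainstBilinCLM_eq_integral h).trans ?_
  refine integral_congr_ae (Eventually.of_forall fun x => ?_)
  simp

theorem enorm_iteratedFDeriv_comp_smul_le {d : ℕ} (f : Space d → ℂ) {c : ℝ} (hc : 0 < c) (j : ℕ)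
    (y : Space d) : ‖iteratedFDeriv ℝ j (fun y => f (c • y)) y‖ₑ ≤
      ENNReal.ofReal c ^ j * ‖iteratedFDeriv ℝ j f (c • y)‖ₑ := by
  let L : Space d ≃L[ℝ] Space d := ContinuousLinearEquiv.smulLeft (Units.mk0 c hc.ne')
  have hL : ∀ y, L y = c • y := fun y => rfl
  have h := L.iteratedFDerivWithin_comp_right f uniqueDiffOn_univ (x := y) (Set.mem_univ _) j
  rw [Set.preimage_univ, iteratedFDerivWithin_univ, iteratedFDerivWithin_univ, hL] at h
  change ‖iteratedFDeriv ℝ j (f ∘ L) y‖ₑ ≤ _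
  rw [h, ← ofReal_norm, ← ofReal_norm, ← ENNReal.ofReal_pow hc.le,
    ← ENNReal.ofReal_mul (by positivity)]
  refine ENNReal.ofReal_le_ofReal
    ((ContinuousMultilinearMap.norm_compContinuousLinearMap_le _ _).trans ?_)
  rw [Finset.prod_const, Finset.card_univ, Fintype.card_fin, mul_comm]
  have hn : ‖(L : Space d →L[ℝ] Space d)‖ ≤ c :=
    ContinuousLinearMap.opNorm_le_bound _ hc.le fun x => by
      change ‖c • x‖ ≤ _
      rw [norm_smul, Real.norm_of_nonneg hc.le]
  gcongr

/-- The function `ζ_{-k}(e^k ·) f(e^k ·)`. -/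
def pieceFn {d : ℕ} (P : WeightPartition d) (k : ℤ) (f : Space d → ℂ) (y : Space d) : ℂ :=
  (P.ζ (-k) (Real.exp k • y) : ℂ) * f (Real.exp k • y)

/-- The strip that contains the support of `ζ_{-k}`. -/
def WeightPartition.strip {d : ℕ} (P : WeightPartition d) (k : ℤ) : Set (Space d) :=
  {x | Real.exp ((k : ℝ) - P.k₀) < x 0 ∧ x 0 < Real.exp ((k : ℝ) + P.k₀)}

theorem WeightPartition.tsupport_subset_strip {d : ℕ} (P : WeightPartition d) (k : ℤ) :
    tsupport (P.ζ (-k)) ⊆ P.strip k := by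
  have := P.tsupport_subset (-k)
  simpa [strip] using this

theorem WeightPartition.strip_subset {d : ℕ} (P : WeightPartition d) (k : ℤ) :
    P.strip k ⊆ halfSpace d := fun _ hx => (Real.exp_pos _).trans hx.1

theorem pieceFn_eventuallyEq_zero {d : ℕ} (P : WeightPartition d) (k : ℤ) (f : Space d → ℂ)
    {y : Space d} (hy : Real.exp k • y ∉ P.strip k) : pieceFn P k f =ᶠ[𝓝 y] fun _ => 0 := by
  have h1 : ∀ᶠ x in 𝓝 (Real.exp k • y), P.ζ (-k) x = 0 :=
    notMem_tsupport_iff_eventuallyEq.1 fun h => hy (P.tsupport_subset_strip k h)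
  have h2 : Continuous fun y : Space d => Real.exp k • y := by fun_prop
  filter_upwards [h2.continuousAt.eventually h1] with x hx
  simp [pieceFn, hx]

theorem contDiffAt_comp_smul {d : ℕ} {f : Space d → ℂ}
    (hf : ContDiffOn ℝ ∞ f (halfSpace d : Set (Space d))) {c : ℝ} {y : Space d}
    (hy : c • y ∈ (halfSpace d : Set (Space d))) : ContDiffAt ℝ ∞ (fun y => f (c • y)) y :=
  (hf.contDiffAt ((halfSpace d).isOpen.mem_nhds hy)).comp y (contDiff_const_smul c).contDiffAt

theorem contDiff_zeta {d : ℕ} (P : WeightPartition d) (k : ℤ) (c : ℝ) :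
    ContDiff ℝ ∞ fun y : Space d => (P.ζ k (c • y) : ℂ) :=
  Complex.ofRealCLM.contDiff.comp ((P.contDiff k).comp (contDiff_const_smul c))

theorem contDiff_pieceFn {d : ℕ} (P : WeightPartition d) (k : ℤ) {f : Space d → ℂ}
    (hf : ContDiffOn ℝ ∞ f (halfSpace d : Set (Space d))) : ContDiff ℝ ∞ (pieceFn P k f) := by
  refine contDiff_iff_contDiffAt.2 fun y => ?_
  by_cases hy : Real.exp k • y ∈ P.strip k
  · exact (contDiff_zeta P (-k) _).contDiffAt.mul (contDiffAt_comp_smul hf (P.strip_subset k hy))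
  · exact contDiffAt_const.congr_of_eventuallyEq (pieceFn_eventuallyEq_zero P k f hy)

/-- The Jacobian of the substitution `x = e ^ k y` is the factor `e ^ (-k (d + 1))` in `IsPiece`. -/
theorem isPiece_of_represents {d : ℕ} (P : WeightPartition d) (k : ℤ) {f : Space d → ℂ}
    (hf : ContinuousOn f (halfSpace d : Set (Space d))) {T : 𝓢'(Space d, ℂ)}
    (hT : Represents T (pieceFn P k f)) : P.IsPiece k (distOf f) T := fun φ => by
  rw [hT, distOf_apply hf]
  have h := Measure.integral_comp_smul (volume : Measure (Space d))
    (fun x => (P.pull k φ x : ℂ) * f x) (Real.exp k)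
  have e : ∀ y : Space d, (P.pull k φ (Real.exp k • y) : ℂ) * f (Real.exp k • y) =
      toSchwartz φ y * pieceFn P k f y := fun y => by
    have h1 : P.pull k φ (Real.exp k • y) = P.ζ (-k) (Real.exp k • y) * φ y := by
      change P.ζ (-k) (Real.exp k • y) * φ (Real.exp (-(k : ℝ)) • Real.exp k • y) = _
      rw [smul_smul, ← Real.exp_add, neg_add_cancel, Real.exp_zero, one_smul]
    have h2 : toSchwartz φ y = (φ y : ℂ) := rfl
    rw [h1, h2, pieceFn]
    push_cast
    ring
  simp_rw [e] at h
  rw [h, finrank_euclideanSpace, Fintype.card_fin, abs_of_nonneg (by positivity),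
    Complex.real_smul, ← Real.exp_nat_mul, ← Real.exp_neg]
  congr 3
  push_cast
  ring

/-- The sum of `x₁ ^ j |D ^ j f|`, `j ≤ M`. -/
def wsum {d : ℕ} (M : ℕ) (f : Space d → ℂ) (x : Space d) : ℝ≥0∞ :=
  ∑ j ∈ Finset.range (M + 1), ENNReal.ofReal (x 0) ^ j * ‖iteratedFDeriv ℝ j f x‖ₑ

/-- On the strip `e ^ k` is comparable with `x₁`, so the derivatives of the rescaled `f` are bounded
by multiples of `x₁ ^ j D ^ j f`. The bounds on `D ^ m ζ_k` are exactly those for which the rescaled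
`ζ_{-k}` has derivatives bounded uniformly in `k`. -/
theorem exists_dsum_pieceFn_le {d : ℕ} (P : WeightPartition d) (M : ℕ) : ∃ C : ℝ≥0,
    ∀ f : Space d → ℂ, ContDiffOn ℝ ∞ f (halfSpace d : Set (Space d)) → ∀ (k : ℤ) (y : Space d),
      dsum M (pieceFn P k f) y ≤ C * (P.strip k).indicator (wsum M f) (Real.exp k • y) := by
  choose N hN using P.bound
  set A : ℝ≥0∞ := ∑ i ∈ Finset.range (M + 1), ((N i).toNNReal : ℝ≥0∞) with hA
  set B : ℝ≥0∞ := ENNReal.ofReal (Real.exp P.k₀) with hB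
  have hB1 : 1 ≤ B := by
    rw [hB, ← ENNReal.ofReal_one]
    exact ENNReal.ofReal_le_ofReal (Real.one_le_exp (by positivity))
  have hAt : A ≠ ⊤ := by simp [hA]
  refine ⟨((M + 1) * (2 ^ M * A * B ^ M)).toNNReal, fun f hf k y => ?_⟩
  rw [ENNReal.coe_toNNReal (by finiteness)]
  by_cases hy : Real.exp k • y ∈ P.strip k
  · rw [Set.indicator_of_mem hy]
    set x := Real.exp k • y with hx
    have hxh : x ∈ (halfSpace d : Set (Space d)) := P.strip_subset k hy
    have hψ : ∀ i ≤ M, ‖iteratedFDeriv ℝ i (fun y => (P.ζ (-k) (Real.exp k • y) : ℂ)) y‖ₑ ≤ A := by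
      intro i hi
      have h1 := enorm_iteratedFDeriv_comp_smul_le (fun x => (P.ζ (-k) x : ℂ)) (Real.exp_pos k) i y
      have h2 : ‖iteratedFDeriv ℝ i (fun x => (P.ζ (-k) x : ℂ)) x‖ ≤
          N i * Real.exp (i * ((-k : ℤ) : ℝ)) :=
        (LinearIsometry.norm_iteratedFDeriv_comp_left Complex.ofRealLI
          ((P.contDiff (-k)).contDiffAt (x := x)) (i := i) (by exact_mod_cast le_top)).trans_le
          (hN i (-k) x)
      refine h1.trans ?_
      rw [← hx, ← ofReal_norm, ← ENNReal.ofReal_pow (Real.exp_pos _).le,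
        ← ENNReal.ofReal_mul (by positivity)]
      refine le_trans (ENNReal.ofReal_le_ofReal ?_) (Finset.single_le_sum
        (f := fun i => ((N i).toNNReal : ℝ≥0∞)) (fun _ _ => zero_le)
          (Finset.mem_range.2 (Nat.lt_succ_of_le hi)))
      refine (mul_le_mul_of_nonneg_left h2 (by positivity)).trans (le_of_eq ?_)
      rw [mul_left_comm, ← Real.exp_nat_mul, ← Real.exp_add]
      simp
    have hF : ∀ i ≤ M, ‖iteratedFDeriv ℝ i (fun y => f (Real.exp k • y)) y‖ₑ ≤
        B ^ M * (ENNReal.ofReal (x 0) ^ i * ‖iteratedFDeriv ℝ i f x‖ₑ) := by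
      intro i hi
      refine (enorm_iteratedFDeriv_comp_smul_le f (Real.exp_pos k) i y).trans ?_
      rw [← hx, ← mul_assoc]
      gcongr
      have h1 : ENNReal.ofReal (Real.exp k) ≤ B * ENNReal.ofReal (x 0) := by
        rw [hB, ← ENNReal.ofReal_mul (Real.exp_pos _).le]
        refine ENNReal.ofReal_le_ofReal ?_
        have h2 := hy.1
        rw [sub_eq_add_neg, Real.exp_add, Real.exp_neg] at h2
        have h3 := Real.exp_pos (P.k₀ : ℝ)
        rw [← div_eq_mul_inv, div_lt_iff₀ h3] at h2
        linarith
      calc ENNReal.ofReal (Real.exp k) ^ i ≤ (B * ENNReal.ofReal (x 0)) ^ i :=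
            pow_le_pow_left₀ zero_le h1 i
        _ = B ^ i * ENNReal.ofReal (x 0) ^ i := mul_pow _ _ _
        _ ≤ _ := mul_le_mul' (pow_le_pow_right₀ hB1 hi) le_rfl
    have hj : ∀ j ∈ Finset.range (M + 1), ‖iteratedFDeriv ℝ j (pieceFn P k f) y‖ₑ ≤
        2 ^ M * A * B ^ M * wsum M f x := by
      intro j hj
      have hjM := Nat.lt_succ_iff.1 (Finset.mem_range.1 hj)
      refine (enorm_iteratedFDeriv_mul_le (contDiff_zeta P (-k) _).contDiffAt
        (contDiffAt_comp_smul hf hxh) fun i hi => hψ i (hi.trans hjM)).trans ?_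
      rw [mul_assoc (2 ^ M * A)]
      refine mul_le_mul' (mul_le_mul' (pow_le_pow_right₀ one_le_two hjM) le_rfl) ?_
      rw [wsum, Finset.mul_sum]
      refine (Finset.sum_le_sum fun i hi => hF i ?_).trans
        (Finset.sum_le_sum_of_subset (Finset.range_mono (Nat.succ_le_succ hjM)))
      have := Finset.mem_range.1 hi
      omega
    refine (Finset.sum_le_sum hj).trans (le_of_eq ?_)
    rw [Finset.sum_const, Finset.card_range, nsmul_eq_mul]
    push_cast
    ring
  · have h0 : dsum M (pieceFn P k f) y = 0 := by
      refine Finset.sum_eq_zero fun j _ => ?_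
      rw [((pieceFn_eventuallyEq_zero P k f hy).iteratedFDeriv ℝ j).self_of_nhds,
        iteratedFDeriv_fun_zero]
      simp
    rw [h0]
    exact zero_le

/-- The strips through `x` belong to integers `k` with `|k - log x₁| ≤ k₀`, and there are at most `2
k₀ + 1` of these. -/
theorem WeightPartition.tsum_indicator_le {d : ℕ} (P : WeightPartition d) {x : Space d}
    (hx : 0 < x 0) (c : ℝ≥0∞) :
    ∑' k : ℤ, (P.strip k).indicator (fun _ => c) x ≤ (2 * P.k₀ + 1) * c := by
  set L := Real.log (x 0) with hL
  have hs : ∀ k ∉ Finset.Icc ⌈L - P.k₀⌉ ⌊L + P.k₀⌋, (P.strip k).indicator (fun _ => c) x = 0 := by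
    intro k hk
    refine Set.indicator_of_notMem (fun h => hk ?_) _
    have h1 := (Real.lt_log_iff_exp_lt hx).2 h.1
    have h2 := (Real.log_lt_iff_lt_exp hx).2 h.2
    rw [Finset.mem_Icc, Int.ceil_le, Int.le_floor]
    constructor <;> linarith
  rw [tsum_eq_sum hs]
  have h1 : ∀ k ∈ Finset.Icc ⌈L - P.k₀⌉ ⌊L + P.k₀⌋, (P.strip k).indicator (fun _ => c) x ≤ c :=
    fun k _ => Set.indicator_le_self _ _ _
  refine (Finset.sum_le_sum h1).trans ?_
  rw [Finset.sum_const, nsmul_eq_mul]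
  gcongr
  have h2 : (Finset.Icc ⌈L - P.k₀⌉ ⌊L + P.k₀⌋).card ≤ 2 * P.k₀ + 1 := by
    rw [Int.card_Icc, Int.toNat_le]
    have h3 := Int.le_ceil (L - P.k₀)
    have h4 := Int.floor_le (L + P.k₀)
    have h5 : ((⌊L + P.k₀⌋ + 1 - ⌈L - P.k₀⌉ : ℤ) : ℝ) ≤ ((2 * P.k₀ + 1 : ℕ) : ℤ) := by
      push_cast
      linarith
    exact_mod_cast h5
  exact_mod_cast h2

/-- This direction of the exchange holds without any measurability. -/
theorem tsum_lintegral_le {α ι : Type*} [MeasurableSpace α] {μ : Measure α} (f : ι → α → ℝ≥0∞) :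
    ∑' i, ∫⁻ a, f i a ∂μ ≤ ∫⁻ a, ∑' i, f i a ∂μ := by
  rw [ENNReal.tsum_eq_iSup_sum]
  refine iSup_le fun s => ?_
  refine le_trans ?_ (lintegral_mono fun a => ENNReal.sum_le_tsum s)
  classical
  induction s using Finset.induction_on with
  | empty => simp
  | insert i s hi ih =>
    simp_rw [Finset.sum_insert hi]
    exact (add_le_add le_rfl ih).trans (le_lintegral_add _ _)

/-- Each piece is estimated by its classical Sobolev norm and scaled back. The factor `e ^ (k θ)`
splits into the Jacobian `e ^ (k (d + 1))` and `e ^ (k a)`, which on the strip is comparable with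
the weight; the strips overlap boundedly often. -/
theorem exists_hNorm_distOf_le {d : ℕ} (P : WeightPartition d) (γ θ : ℝ) {p : ℝ} (hp : 1 < p) :
    ∃ (M : ℕ) (C : ℝ≥0), ∀ f : Space d → ℂ, ContDiffOn ℝ ∞ f (halfSpace d : Set (Space d)) →
      hNorm P γ θ p (distOf f) ^ p ≤ C * ∫⁻ x in (halfSpace d : Set (Space d)),
        wsum M f x ^ p * ENNReal.ofReal (x 0 ^ (θ - ((d : ℝ) + 1))) := by
  have hp0 : 0 < p := by linarith
  obtain ⟨M, C₁, h₁⟩ := exists_besselNorm_le d γ hp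
  obtain ⟨C₂, h₂⟩ := exists_dsum_pieceFn_le P M
  set a := θ - ((d : ℝ) + 1) with ha
  set C₃ : ℝ≥0∞ := ENNReal.ofReal (Real.exp (|a| * P.k₀)) with hC₃
  refine ⟨M, ((C₁ + 1) * (C₂ ^ p * (C₃ * (2 * P.k₀ + 1)))).toNNReal, fun f hf => ?_⟩
  have hC₂p : (C₂ : ℝ≥0∞) ^ p ≠ ⊤ := ENNReal.rpow_ne_top_of_nonneg hp0.le ENNReal.coe_ne_top
  rw [ENNReal.coe_toNNReal (by finiteness), hNorm, ← ENNReal.rpow_mul, one_div_mul_cancel hp0.ne',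
    ENNReal.rpow_one]
  have hk : ∀ k : ℤ, ENNReal.ofReal (Real.exp (k * θ)) *
      (⨅ (T : 𝓢'(Space d, ℂ)) (_ : P.IsPiece k (distOf f) T), besselNorm γ p T) ^ p ≤
      (C₁ + 1) * (C₂ ^ p * ∫⁻ x, (P.strip k).indicator
        (fun _ => C₃ * (wsum M f x ^ p * ENNReal.ofReal (x 0 ^ a))) x) := by
    intro k
    have e1 : (⨅ (T : 𝓢'(Space d, ℂ)) (_ : P.IsPiece k (distOf f) T), besselNorm γ p T) ^ p ≤
        (C₁ + 1) * ∫⁻ y, dsum M (pieceFn P k f) y ^ p := by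
      -- If the Sobolev norm of the piece is infinite, so is the right-hand side, because `C₁ + 1 ≠
      -- 0`; the summand 1 is there for this case.
      by_cases hfin : ∫⁻ y, dsum M (pieceFn P k f) y ^ p < ⊤
      · obtain ⟨T, hT, hTn⟩ := h₁ _ (contDiff_pieceFn P k hf) hfin
        refine le_trans (ENNReal.rpow_le_rpow (iInf_le_of_le T (iInf_le_of_le
          (isPiece_of_represents P k hf.continuousOn hT) le_rfl)) hp0.le) (hTn.trans ?_)
        gcongr
        exact le_self_add
      · rw [not_lt, top_le_iff] at hfin
        rw [hfin, ENNReal.mul_top (by simp)]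
        exact le_top
    have e2 : ∫⁻ y, dsum M (pieceFn P k f) y ^ p ≤ C₂ ^ p *
        ∫⁻ y, (P.strip k).indicator (fun x => wsum M f x ^ p) (Real.exp k • y) := by
      rw [← lintegral_const_mul' _ _ hC₂p]
      refine lintegral_mono fun y => ?_
      refine (ENNReal.rpow_le_rpow (h₂ f hf k y) hp0.le).trans (le_of_eq ?_)
      rw [ENNReal.mul_rpow_of_nonneg _ _ hp0.le]
      congr 1
      by_cases hy : Real.exp k • y ∈ P.strip k
      · simp [Set.indicator_of_mem hy]
      · simp [Set.indicator_of_notMem hy, ENNReal.zero_rpow_of_pos hp0]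
    have e3 : ENNReal.ofReal (Real.exp (k * θ)) *
        ∫⁻ y, (P.strip k).indicator (fun x => wsum M f x ^ p) (Real.exp k • y) ≤
        ∫⁻ x, (P.strip k).indicator
          (fun _ => C₃ * (wsum M f x ^ p * ENNReal.ofReal (x 0 ^ a))) x := by
      have h3 : Real.exp (k * θ) = Real.exp (k * a) * Real.exp k ^ Module.finrank ℝ (Space d) := by
        rw [finrank_euclideanSpace, Fintype.card_fin, ← Real.exp_nat_mul, ← Real.exp_add, ha]
        congr 1
        push_cast
        ring
      rw [h3, ENNReal.ofReal_mul (Real.exp_pos _).le, mul_assoc, ← lintegral_eq_scale volume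
        (Real.exp_pos k) (fun x => (P.strip k).indicator (fun x => wsum M f x ^ p) x),
        ← lintegral_const_mul' _ _ ENNReal.ofReal_ne_top]
      refine lintegral_mono fun x => ?_
      by_cases hx : x ∈ P.strip k
      · simp only [Set.indicator_of_mem hx]
        rw [mul_left_comm C₃, mul_comm]
        gcongr
        have hx0 : 0 < x 0 := P.strip_subset k hx
        rw [hC₃, ← ENNReal.ofReal_mul (Real.exp_pos _).le]
        refine ENNReal.ofReal_le_ofReal ?_
        rw [Real.rpow_def_of_pos hx0, ← Real.exp_add, Real.exp_le_exp]
        have h4 := (Real.lt_log_iff_exp_lt hx0).2 hx.1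
        have h5 := (Real.log_lt_iff_lt_exp hx0).2 hx.2
        -- The strip is an interval of length `2 k₀` in `log x₁`, so `e ^ (k a)` and `x₁ ^ a` differ
        -- at most by the factor `C₃`.
        have h6 : |k - Real.log (x 0)| ≤ P.k₀ := abs_le.2 ⟨by linarith, by linarith⟩
        have h7 : (k - Real.log (x 0)) * a ≤ |a| * P.k₀ := by
          refine (le_abs_self _).trans ?_
          rw [abs_mul, mul_comm]
          gcongr
        linarith
      · simp [Set.indicator_of_notMem hx]
    calc _ ≤ ENNReal.ofReal (Real.exp (k * θ)) * ((C₁ + 1) * (C₂ ^ p *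
          ∫⁻ y, (P.strip k).indicator (fun x => wsum M f x ^ p) (Real.exp k • y))) := by
          gcongr
          exact e1.trans (mul_le_mul_right e2 _)
      _ = (C₁ + 1) * (C₂ ^ p * (ENNReal.ofReal (Real.exp (k * θ)) *
          ∫⁻ y, (P.strip k).indicator (fun x => wsum M f x ^ p) (Real.exp k • y))) := by ring
      _ ≤ _ := by gcongr
  refine (ENNReal.tsum_le_tsum hk).trans ?_
  rw [ENNReal.tsum_mul_left, ENNReal.tsum_mul_left]
  calc _ ≤ ((C₁ : ℝ≥0∞) + 1) * (C₂ ^ p * ∫⁻ x in (halfSpace d : Set (Space d)),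
        C₃ * (2 * P.k₀ + 1) * (wsum M f x ^ p * ENNReal.ofReal (x 0 ^ a))) := by
        gcongr
        refine (tsum_lintegral_le _).trans ?_
        rw [← lintegral_indicator (measurableSet_halfSpace d)]
        refine lintegral_mono fun x => ?_
        by_cases hx : x ∈ (halfSpace d : Set (Space d))
        · simp only
          rw [Set.indicator_of_mem hx]
          refine (P.tsum_indicator_le hx _).trans (le_of_eq ?_)
          ring
        · have : ∀ k, x ∉ P.strip k := fun k h => hx (P.strip_subset k h)
          simp [Set.indicator_of_notMem (this _)]
    _ = _ := by
        rw [lintegral_const_mul' _ _ (by finiteness)]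
        ring

/-! ### The norm of the solution space of a smooth function -/

theorem continuous_testFunction_mul {d : ℕ} (φ : 𝓓(halfSpace d, ℝ)) {G : ℝ × Space d → ℂ}
    (hG : ContinuousOn G (upper d)) : Continuous fun z : ℝ × Space d => (φ z.2 : ℂ) * G z := by
  have hφ : Continuous fun z : ℝ × Space d => (φ z.2 : ℂ) :=
    Complex.continuous_ofReal.comp (φ.continuous.comp continuous_snd)
  refine (hφ.continuousOn.mul hG).continuous_of_tsupport_subset (isOpen_upper d) ?_
  have hcl : IsClosed {z : ℝ × Space d | z.2 ∈ tsupport φ} :=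
    (isClosed_tsupport φ).preimage continuous_snd
  refine (closure_minimal (fun z hz => ?_) hcl).trans fun z hz => φ.tsupport_subset hz
  refine subset_tsupport _ fun h0 => hz ?_
  simp [h0]

theorem continuous_testFunction_mul_right {d : ℕ} (φ : 𝓓(halfSpace d, ℝ)) {f : Space d → ℂ}
    (hf : ContinuousOn f (halfSpace d : Set (Space d))) : Continuous fun x => (φ x : ℂ) * f x :=
  (continuous_testFunction_mul φ (G := fun z => f z.2)
    (hf.comp continuousOn_snd fun _ hz => hz)).comp (Continuous.prodMk_right (0 : ℝ))

theorem integrable_testFunction_mul {d : ℕ} (φ : 𝓓(halfSpace d, ℝ)) {f : Space d → ℂ}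
    (hf : ContinuousOn f (halfSpace d : Set (Space d))) :
    Integrable (fun x => (φ x : ℂ) * f x) volume := by
  refine (continuous_testFunction_mul_right φ hf).integrable_of_hasCompactSupport ?_
  exact HasCompactSupport.mul_right (φ.hasCompactSupport.comp_left Complex.ofReal_zero)

theorem continuous_integral_testFunction_mul {d : ℕ} (φ : 𝓓(halfSpace d, ℝ))
    {G : ℝ × Space d → ℂ} (hG : ContinuousOn G (upper d)) :
    Continuous fun t : ℝ => ∫ x, (φ x : ℂ) * G (t, x) := by
  have h := continuous_parametric_integral_of_continuous (μ := (volume : Measure (Space d)))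
    (f := fun (t : ℝ) (x : Space d) => (φ x : ℂ) * G (t, x)) (s := tsupport φ)
    (continuous_testFunction_mul φ hG) φ.hasCompactSupport
  refine h.congr fun t => ?_
  refine setIntegral_eq_integral_of_forall_compl_eq_zero fun x hx => ?_
  rw [image_eq_zero_of_notMem_tsupport hx]
  simp

theorem continuousOn_slice {d : ℕ} {G : ℝ × Space d → ℂ} (hG : ContinuousOn G (upper d)) (t : ℝ) :
    ContinuousOn (fun x => G (t, x)) (halfSpace d : Set (Space d)) :=
  hG.comp (Continuous.prodMk_right t).continuousOn fun _ hx => hx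

theorem distOf_slice_apply {d : ℕ} {G : ℝ × Space d → ℂ} (hG : ContinuousOn G (upper d)) (t : ℝ)
    (φ : 𝓓(halfSpace d, ℝ)) : distOf (fun x => G (t, x)) φ = ∫ x, (φ x : ℂ) * G (t, x) :=
  distOf_apply (continuousOn_slice hG t) φ

theorem timeMeasurable_distOf {d : ℕ} {G : ℝ × Space d → ℂ} (hG : ContinuousOn G (upper d)) :
    TimeMeasurable fun t => distOf fun x => G (t, x) := fun φ => by
  simp_rw [distOf_slice_apply hG]
  exact (continuous_integral_testFunction_mul φ hG).measurable.aemeasurable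

/-- The fundamental theorem of calculus at each point `x`, integrated against `φ`; Fubini's theorem
applies since the integrand is continuous with support over the compact `tsupport φ`. -/
theorem isTimeDeriv_distOf {d : ℕ} {F : ℝ × Space d → ℂ} (hF : ContDiffOn ℝ ∞ F (upper d)) :
    IsTimeDeriv (fun t => distOf fun x => F (t, x))
      (fun t => distOf fun x => timeDeriv F (t, x)) := by
  have hc := hF.continuousOn
  have hc' := (contDiffOn_timeDeriv hF).continuousOn
  refine ⟨timeMeasurable_distOf hc', fun φ s t => ?_, Eventually.of_forall fun s =>
    Eventually.of_forall fun t φ => ?_⟩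
  · simp_rw [distOf_slice_apply hc']
    exact (continuous_integral_testFunction_mul φ hc').intervalIntegrable s t
  · simp_rw [distOf_slice_apply hc', distOf_slice_apply hc]
    have hcont := continuous_testFunction_mul φ hc'
    have e : (fun x => ∫ r in s..t, (φ x : ℂ) * timeDeriv F (r, x)) =
        fun x => (φ x : ℂ) * F (t, x) - (φ x : ℂ) * F (s, x) := by
      funext x
      by_cases hx : x ∈ (halfSpace d : Set (Space d))
      · rw [intervalIntegral.integral_eq_sub_of_hasDerivAt (f := fun r => (φ x : ℂ) * F (r, x))]
        · intro r _
          exact (deriv_eq_timeDeriv hF (z := (r, x)) hx).const_mul _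
        · exact (hcont.comp (Continuous.prodMk_left x)).intervalIntegrable s t
      · have h0 : φ x = 0 :=
          image_eq_zero_of_notMem_tsupport fun h => hx (φ.tsupport_subset h)
        simp [h0]
    rw [intervalIntegral_integral_swap, e, integral_sub (integrable_testFunction_mul φ
      (continuousOn_slice hc t)) (integrable_testFunction_mul φ (continuousOn_slice hc s))]
    · ring
    · have hK : IsCompact (Set.uIcc s t ×ˢ tsupport φ) := isCompact_uIcc.prod φ.hasCompactSupport
      have h1 := hcont.continuousOn.integrableOn_compact (μ := volume) hK
      have h2 : IntegrableOn (fun z : ℝ × Space d => (φ z.2 : ℂ) * timeDeriv F z)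
          (Set.uIoc s t ×ˢ Set.univ) volume := by
        refine h1.of_forall_sdiff_eq_zero (measurableSet_uIoc.prod MeasurableSet.univ) ?_
        rintro ⟨r, x⟩ ⟨h3, h4⟩
        have h5 : x ∉ tsupport φ := fun h => h4 ⟨Set.uIoc_subset_uIcc h3.1, h⟩
        simp [image_eq_zero_of_notMem_tsupport h5]
      rw [IntegrableOn, Measure.volume_eq_prod, ← Measure.prod_restrict, Measure.restrict_univ] at h2
      exact h2

theorem lineDerivOp_distOf {d : ℕ} {f : Space d → ℂ}
    (hf : ContDiffOn ℝ ∞ f (halfSpace d : Set (Space d))) (m : Space d) :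
    ∂_{m} (distOf f) = distOf fun x => fderiv ℝ f x m := by
  have hf' : ContinuousOn (fun x => fderiv ℝ f x m) (halfSpace d : Set (Space d)) :=
    ((hf.fderiv_of_isOpen (halfSpace d).isOpen (m := ∞) (by simp)).clm_apply
      contDiffOn_const).continuousOn
  ext φ
  have hφ : ∀ x, HasFDerivAt (fun x => (φ x : ℂ)) (Complex.ofRealCLM ∘L fderiv ℝ φ x) x := fun x =>
    Complex.ofRealCLM.hasFDerivAt.comp x
      ((φ.contDiff.differentiable (by simp)) x).hasFDerivAt
  have e : ∀ x, ((∂_{m} φ : 𝓓(halfSpace d, ℝ)) x : ℂ) = fderiv ℝ (fun x => (φ x : ℂ)) x m := by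
    intro x
    have h := TestFunction.lineDerivCLM_apply_of_le (𝕜 := ℝ) (f := φ) (k := ⊤) (v := m) (x := x)
      (by simp)
    rw [(hφ x).fderiv]
    have h2 : (∂_{m} φ : 𝓓(halfSpace d, ℝ)) x = lineDeriv ℝ φ x m := h
    rw [h2, ((φ.contDiff.differentiable (by simp)) x).lineDeriv_eq_fderiv]
    rfl
  rw [Distribution.lineDerivOp_apply_apply, map_neg, distOf_apply hf.continuousOn,
    distOf_apply hf']
  simp_rw [e]
  rw [integral_mul_fderiv_eq_neg_fderiv_mul_of_integrable]
  · have := integrable_testFunction_mul (∂_{m} φ : 𝓓(halfSpace d, ℝ)) hf.continuousOn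
    simp_rw [e] at this
    exact this
  · exact integrable_testFunction_mul φ hf'
  · exact integrable_testFunction_mul φ hf.continuousOn
  · exact fun x _ => (hφ x).differentiableAt
  · intro x hx
    have hx' : x ∈ tsupport φ := by
      refine closure_mono ?_ hx
      intro y hy h0
      exact hy (by simp [h0])
    exact (hf.contDiffAt ((halfSpace d).isOpen.mem_nhds (φ.tsupport_subset hx'))).differentiableAt
      (by simp)

theorem contDiffOn_slice {d : ℕ} {F : ℝ × Space d → ℂ} (hF : ContDiffOn ℝ ∞ F (upper d)) (t : ℝ) :
    ContDiffOn ℝ ∞ (fun x => F (t, x)) (halfSpace d : Set (Space d)) := fun x hx =>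
  (contDiffAt_slice hF (z := (t, x)) hx).contDiffWithinAt

/-- In `wsum` the derivative of order `j` carries `x₁ ^ j`, one power more than in the jet. The
additional factor is at most 2, as `F` vanishes for `x₁ > 2`. -/
theorem wsum_le_jet {d M M' : ℕ} (h : M ≤ M') {F : ℝ × Space d → ℂ}
    (h2 : ∀ z : ℝ × Space d, 2 < z.2 0 → F z = 0) (z : ℝ × Space d) :
    wsum M (fun x => F (z.1, x)) z.2 ≤ 2 * jet M' F z := by
  by_cases hz2 : z.2 0 ≤ 2
  · have hX : ENNReal.ofReal (z.2 0) ≤ 2 := by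
      have := ENNReal.ofReal_le_ofReal hz2
      rwa [ENNReal.ofReal_ofNat] at this
    rw [wsum, Finset.sum_range_succ', jet, mul_add, add_comm]
    refine add_le_add ?_ ?_
    · rw [pow_zero, one_mul]
      refine le_trans (le_of_eq ?_) (le_mul_of_one_le_left' one_le_two)
      simp [← ofReal_norm]
    · rw [djet, Finset.mul_sum]
      refine (Finset.sum_le_sum fun j _ => ?_).trans
        (Finset.sum_le_sum_of_subset (Finset.range_mono (by omega)))
      rw [pow_succ', mul_assoc]
      exact mul_le_mul' hX le_self_add
  · have hc : Continuous fun z : ℝ × Space d => z.2 0 := by fun_prop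
    have h0 : F =ᶠ[𝓝 z] fun _ => 0 := by
      filter_upwards [hc.continuousAt.eventually (lt_mem_nhds (not_le.1 hz2))] with w hw using h2 w hw
    refine le_trans (le_of_eq (Finset.sum_eq_zero fun j _ => ?_)) zero_le
    rw [iteratedFDeriv_slice_congr h0, iteratedFDeriv_fun_zero]
    simp

theorem wsum_fderiv_le_jet {d M M' : ℕ} (h : M ≤ M') {F : ℝ × Space d → ℂ}
    (hF : ContDiffOn ℝ ∞ F (upper d)) (i : Fin (d + 1)) {z : ℝ × Space d} (hz : z ∈ upper d) :
    wsum M (fun x => fderiv ℝ (fun x => F (z.1, x)) x (stdVec i)) z.2 ≤ jet M' F z := by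
  rw [wsum, jet, djet]
  refine le_add_left ((Finset.sum_le_sum fun j _ => ?_).trans
    (Finset.sum_le_sum_of_subset (Finset.range_mono (by omega))))
  refine le_add_right (mul_le_mul' le_rfl ?_)
  exact enorm_iteratedFDeriv_fderiv_apply_le (contDiffAt_slice hF hz) i j

theorem wsum_timeDeriv_le_jet {d M M' : ℕ} (h : M ≤ M') (F : ℝ × Space d → ℂ) (z : ℝ × Space d) :
    ENNReal.ofReal (z.2 0) * wsum M (fun x => timeDeriv F (z.1, x)) z.2 ≤ jet M' F z := by
  rw [wsum, jet, djet, Finset.mul_sum]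
  refine le_add_left ((Finset.sum_le_sum fun j _ => ?_).trans
    (Finset.sum_le_sum_of_subset (Finset.range_mono (by omega))))
  rw [← mul_assoc, ← pow_succ']
  exact le_add_self

theorem bigHNorm_le {d : ℕ} {P : WeightPartition d} {γ θ p : ℝ} (hp : 1 < p) {C : ℝ≥0}
    {u : ℝ → 𝓓'(halfSpace d, ℂ)} {X : ℝ × Space d → ℝ≥0∞}
    (h : ∀ t, hNorm P γ θ p (u t) ^ p ≤ C * ∫⁻ x in (halfSpace d : Set (Space d)),
      X (t, x) ^ p * ENNReal.ofReal (x 0 ^ (θ - ((d : ℝ) + 1)))) :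
    bigHNorm P γ θ p u ≤ (C ^ (1 / p) : ℝ≥0) * wInt θ p X ^ (1 / p) := by
  have hp0 : 0 < p := by linarith
  rw [ENNReal.coe_rpow_of_nonneg _ (by positivity), ← ENNReal.mul_rpow_of_nonneg _ _ (by positivity)]
  refine ENNReal.rpow_le_rpow ((lintegral_mono h).trans (le_of_eq ?_)) (by positivity)
  rw [lintegral_const_mul' _ _ ENNReal.coe_ne_top, wInt]

theorem wInt_two_mul_rpow {d : ℕ} {θ p : ℝ} (hp : 1 < p) (f : ℝ × Space d → ℝ≥0∞) :
    wInt θ p (fun z => 2 * f z) ^ (1 / p) = 2 * wInt θ p f ^ (1 / p) := by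
  have hp0 : 0 < p := by linarith
  have := wInt_const_mul hp0.le (θ := θ) 2 f
  push_cast at this
  rw [this, ENNReal.mul_rpow_of_nonneg _ _ (by positivity), ← ENNReal.rpow_mul,
    mul_one_div_cancel hp0.ne', ENNReal.rpow_one]

/-- The norm of the solution space of a smooth function is bounded by a weighted norm of its
scaled derivatives. -/
theorem exists_solNorm_le {d : ℕ} (P : WeightPartition d) (γ θ : ℝ) {p : ℝ} (hp : 1 < p) :
    ∃ (M : ℕ) (C : ℝ≥0), ∀ F : ℝ × Space d → ℂ, ContDiffOn ℝ ∞ F (upper d) →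
      (∀ z : ℝ × Space d, 2 < z.2 0 → F z = 0) →
      solNorm P γ θ p (fun t => distOf fun x => F (t, x)) ≤ C * wInt θ p (jet M F) ^ (1 / p) := by
  have hp0 : 0 < p := by linarith
  obtain ⟨M₁, C₁, h₁⟩ := exists_hNorm_distOf_le P (γ - 1) θ hp
  obtain ⟨M₂, C₂, h₂⟩ := exists_hNorm_distOf_le P (γ - 2) (θ + p) hp
  refine ⟨max M₁ M₂, 2 * C₁ ^ (1 / p) + (d + 1) * C₁ ^ (1 / p) + C₂ ^ (1 / p), fun F hF hF2 => ?_⟩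
  set J := jet (max M₁ M₂) F with hJ
  have e1 : bigHNorm P (γ - 1) θ p (fun t => distOf fun x => F (t, x)) ≤
      2 * (C₁ ^ (1 / p) : ℝ≥0) * wInt θ p J ^ (1 / p) := by
    refine (bigHNorm_le hp (X := fun z => wsum M₁ (fun x => F (z.1, x)) z.2)
      fun t => h₁ (fun x => F (t, x)) (contDiffOn_slice hF t)).trans ?_
    rw [mul_comm (2 : ℝ≥0∞), mul_assoc, ← wInt_two_mul_rpow hp]
    gcongr
    exact wInt_mono hp0.le fun z _ => wsum_le_jet (le_max_left _ _) hF2 z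
  have e2 : ∀ i : Fin (d + 1), bigHNorm P (γ - 1) θ p
      (fun t => ∂_{stdVec i} (distOf fun x => F (t, x))) ≤
      (C₁ ^ (1 / p) : ℝ≥0) * wInt θ p J ^ (1 / p) := fun i => by
    simp_rw [lineDerivOp_distOf (contDiffOn_slice hF _)]
    refine (bigHNorm_le hp (X := fun z => wsum M₁ (fun x => fderiv ℝ (fun x => F (z.1, x)) x
      (stdVec i)) z.2) fun t => h₁ (fun x => fderiv ℝ (fun x => F (t, x)) x (stdVec i)) ?_).trans ?_
    · exact ((contDiffOn_slice hF t).fderiv_of_isOpen (halfSpace d).isOpen (m := ∞)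
        (by simp)).clm_apply contDiffOn_const
    · gcongr
      exact wInt_mono hp0.le fun z hz => wsum_fderiv_le_jet (le_max_left _ _) hF i hz
  have e3 : bigHNorm P (γ - 2) (θ + p) p (fun t => distOf fun x => timeDeriv F (t, x)) ≤
      (C₂ ^ (1 / p) : ℝ≥0) * wInt θ p J ^ (1 / p) := by
    refine (bigHNorm_le hp (X := fun z => wsum M₂ (fun x => timeDeriv F (z.1, x)) z.2)
      fun t => h₂ (fun x => timeDeriv F (t, x)) (contDiffOn_slice (contDiffOn_timeDeriv hF) t)).trans ?_
    gcongr
    refine lintegral_mono fun t => setLIntegral_mono' (measurableSet_halfSpace d) fun x hx => ?_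
    have hx : 0 < x 0 := hx
    -- The shift of the weight from `θ` to `θ + p` supplies the factor `x₁` required by
    -- `wsum_timeDeriv_le_jet`.
    have e : x 0 ^ (θ + p - ((d : ℝ) + 1)) = x 0 ^ p * x 0 ^ (θ - ((d : ℝ) + 1)) := by
      rw [← Real.rpow_add hx]
      congr 1
      ring
    rw [e, ENNReal.ofReal_mul (by positivity), ← ENNReal.ofReal_rpow_of_nonneg hx.le hp0.le,
      ← mul_assoc, ← ENNReal.mul_rpow_of_nonneg _ _ hp0.le, mul_comm (wsum _ _ _)]
    gcongr
    exact wsum_timeDeriv_le_jet (le_max_right _ _) F (t, x)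
  have e4 : (⨅ (w : ℝ → 𝓓'(halfSpace d, ℂ)) (_ : IsTimeDeriv (fun t => distOf fun x => F (t, x)) w),
      bigHNorm P (γ - 2) (θ + p) p w) ≤ (C₂ ^ (1 / p) : ℝ≥0) * wInt θ p J ^ (1 / p) :=
    iInf_le_of_le _ (iInf_le_of_le (isTimeDeriv_distOf hF) e3)
  refine (add_le_add (add_le_add e1 (Finset.sum_le_sum fun i _ => e2 i)) e4).trans (le_of_eq ?_)
  rw [Finset.sum_const, Finset.card_univ, Fintype.card_fin, nsmul_eq_mul]
  push_cast
  ring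

theorem distOf_sub {d : ℕ} {f g : Space d → ℂ} (hf : ContinuousOn f (halfSpace d : Set (Space d)))
    (hg : ContinuousOn g (halfSpace d : Set (Space d))) :
    distOf f - distOf g = distOf fun x => f x - g x := by
  ext φ
  change distOf f φ - distOf g φ = _
  rw [distOf_apply hf, distOf_apply hg, distOf_apply (f := fun x => f x - g x) (hf.sub hg), ← integral_sub
    (integrable_testFunction_mul φ hf) (integrable_testFunction_mul φ hg)]
  simp_rw [mul_sub]

theorem distOf_congr {d : ℕ} {f g : Space d → ℂ} (hf : ContinuousOn f (halfSpace d : Set (Space d)))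
    (h : ∀ x ∈ (halfSpace d : Set (Space d)), f x = g x) : distOf f = distOf g := by
  ext φ
  rw [distOf_apply hf, distOf_apply (hf.congr fun x hx => (h x hx).symm)]
  refine integral_congr_ae (Eventually.of_forall fun x => ?_)
  simp only
  by_cases hx : x ∈ (halfSpace d : Set (Space d))
  · rw [h x hx]
  · rw [image_eq_zero_of_notMem_tsupport fun h => hx (φ.tsupport_subset h)]
    simp

/-! ### Approximation of the extension by compactly supported smooth functions -/

theorem exists_spaceTime_cutoff (d : ℕ) : ∃ χ : ℝ × Space d → ℝ, ContDiff ℝ ∞ χ ∧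
    HasCompactSupport χ ∧ (∀ z, ‖z‖ ≤ 1 → χ z = 1) ∧ (∀ z, 0 ≤ χ z) ∧ ∀ z, χ z ≤ 1 := by
  let b : ContDiffBump (0 : ℝ × Space d) := ⟨1, 2, one_pos, one_lt_two⟩
  exact ⟨b, b.contDiff, b.hasCompactSupport, fun z hz => b.one_of_mem_closedBall
    (by simpa using hz), fun z => b.nonneg, fun z => b.le_one⟩

/-- The translate `F(t, x + ε e₁)`. -/
def shift {d : ℕ} (ε : ℝ) (F : ℝ × Space d → ℂ) (z : ℝ × Space d) : ℂ :=
  F (z.1, z.2 + ε • stdVec 0)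

theorem shift_mem {d : ℕ} {ε : ℝ} (hε : 0 ≤ ε) {z : ℝ × Space d} (hz : z ∈ upper d) :
    (z.1, z.2 + ε • stdVec 0) ∈ upper d := by
  have : 0 < z.2 0 := hz
  rw [mem_upper]
  simp
  linarith

theorem contDiffAt_shift {d : ℕ} {ε : ℝ} {F : ℝ × Space d → ℂ} (hF : ContDiffOn ℝ ∞ F (upper d))
    {z : ℝ × Space d} (hz : (z.1, z.2 + ε • stdVec 0) ∈ upper d) :
    ContDiffAt ℝ ∞ (shift ε F) z := by
  have h := hF.contDiffAt ((isOpen_upper d).mem_nhds hz)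
  have h2 : ContDiff ℝ ∞ fun z : ℝ × Space d => (z.1, z.2 + ε • stdVec 0) := by fun_prop
  exact h.comp z h2.contDiffAt

theorem contDiffOn_shift {d : ℕ} {ε : ℝ} (hε : 0 ≤ ε) {F : ℝ × Space d → ℂ}
    (hF : ContDiffOn ℝ ∞ F (upper d)) : ContDiffOn ℝ ∞ (shift ε F) (upper d) := fun _ hz =>
  (contDiffAt_shift hF (shift_mem hε hz)).contDiffWithinAt

theorem timeDeriv_shift {d : ℕ} (ε : ℝ) (F : ℝ × Space d → ℂ) :
    timeDeriv (shift ε F) = shift ε (timeDeriv F) := by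
  have e : ∀ z : ℝ × Space d, (z.1, z.2 + ε • stdVec 0) = z + ((0 : ℝ), ε • stdVec 0) := fun z => by
    ext <;> simp
  have h : shift ε F = fun z => F (z + ((0 : ℝ), ε • stdVec 0)) := by
    funext z
    rw [shift, e]
  funext z
  rw [timeDeriv, h, fderiv_comp_add_right, shift, timeDeriv, e]

theorem iteratedFDeriv_shift {d : ℕ} (ε : ℝ) (F : ℝ × Space d → ℂ) (j : ℕ) (z : ℝ × Space d) :
    iteratedFDeriv ℝ j (fun x => shift ε F (z.1, x)) z.2 =
      iteratedFDeriv ℝ j (fun x => F (z.1, x)) (z.2 + ε • stdVec 0) :=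
  iteratedFDeriv_comp_add_right (f := fun x => F (z.1, x)) j (ε • stdVec 0) z.2

theorem djet_shift_le {d M : ℕ} {ε : ℝ} (hε : 0 ≤ ε) (F : ℝ × Space d → ℂ) (z : ℝ × Space d) :
    djet M (shift ε F) z ≤ djet M F (z.1, z.2 + ε • stdVec 0) := by
  have h0 : ENNReal.ofReal (z.2 0) ≤ ENNReal.ofReal ((z.2 + ε • stdVec 0 : Space d) 0) :=
    ENNReal.ofReal_le_ofReal (by simp; linarith)
  rw [djet, djet, timeDeriv_shift]
  simp only [iteratedFDeriv_shift]
  gcongr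

/-- Moving away from the boundary enlarges the gauge and leaves the base point `(t, x')` unchanged.
-/
theorem majorant_shift_le {d : ℕ} {ε a : ℝ} (hε : 0 ≤ ε) (ha : 0 ≤ a) (g : ℝ × Bdry d → ℂ)
    {z : ℝ × Space d} (hz : z ∈ upper d) :
    majorant g a z.1 (z.2 + ε • stdVec 0) ≤ majorant g a z.1 z.2 := by
  have hz0 : 0 < z.2 0 := hz
  have e1 : (z.2 + ε • stdVec 0 : Space d) 0 = z.2 0 + ε := by simp
  have e2 : tang (z.2 + ε • stdVec 0) = tang z.2 := by
    rw [tang_add, tang_smul]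
    ext i
    simp [tang]
  refine lintegral_mono fun q => ?_
  rw [gauge_sub_bd, gauge_sub_bd]
  simp only [e1, e2]
  gcongr ENNReal.ofReal ?_ * _
  have h0 : |z.2 0| ≤ |z.2 0 + ε| := by
    rw [abs_of_pos hz0, abs_of_pos (by linarith)]
    linarith
  refine Real.rpow_le_rpow_of_nonpos (by positivity) ?_ (by linarith)
  gcongr

/-- The mean value inequality along a segment of length `ε ≤ 1`: the gradient there is bounded by
the majorant, which does not grow on moving upwards. The resulting bound is independent of `ε`. -/
theorem conv_shift_le (d : ℕ) : ∃ C : ℝ≥0, ∀ g : ℝ × Bdry d → ℂ, Tame g → ∀ ε : ℝ, 0 ≤ ε → ε ≤ 1 →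
    ∀ z ∈ upper d, ‖shift ε (conv poisKer g) z‖ₑ ≤
      ‖conv poisKer g z‖ₑ + C * majorant g (d + 3) z.1 z.2 := by
  obtain ⟨C, hC⟩ := djet_conv_le d 0
  -- With `C + 1` in place of `C` the factor is not 0, and the claim is trivial where the majorant
  -- is infinite.
  refine ⟨C + 1, fun g hg ε hε0 hε1 z hz => ?_⟩
  by_cases hM : majorant g (d + 3) z.1 z.2 = ⊤
  · rw [hM, ENNReal.mul_top (by simp)]
    simp
  set V := conv poisKer g with hV
  have hVs := convKer_poisKer.contDiffOn_conv hg
  set B := (C * majorant g (d + 3) z.1 z.2) with hB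
  have hBt : B ≠ ⊤ := ENNReal.mul_ne_top ENNReal.coe_ne_top hM
  have hd : ∀ τ ∈ Set.Icc (0 : ℝ) ε, HasDerivWithinAt (fun τ => V (z.1, z.2 + τ • stdVec 0))
      (fderiv ℝ (fun x => V (z.1, x)) (z.2 + τ • stdVec 0) (stdVec 0)) (Set.Icc 0 ε) τ := by
    intro τ hτ
    have h1 := ((contDiffAt_slice hVs (shift_mem hτ.1 hz)).differentiableAt
      (by simp)).hasFDerivAt
    have h2 : HasDerivAt (fun τ : ℝ => z.2 + τ • (stdVec 0 : Space d)) (stdVec 0) τ := by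
      simpa using ((hasDerivAt_id τ).smul_const (stdVec 0 : Space d)).const_add z.2
    exact (h1.comp_hasDerivAt τ h2).hasDerivWithinAt
  have hb : ∀ τ ∈ Set.Ico (0 : ℝ) ε,
      ‖fderiv ℝ (fun x => V (z.1, x)) (z.2 + τ • stdVec 0) (stdVec 0)‖ ≤ B.toReal := by
    intro τ hτ
    have h1 : ‖fderiv ℝ (fun x => V (z.1, x)) (z.2 + τ • stdVec 0) (stdVec 0)‖ₑ ≤ B := by
      have h2 := enorm_iteratedFDeriv_fderiv_apply_le
        (contDiffAt_slice hVs (shift_mem hτ.1 hz)) 0 0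
      have h3 := space_le_djet (M := 0) (j := 0) le_rfl V (z.1, z.2 + τ • stdVec 0)
      have h4 := hC g hg _ (shift_mem hτ.1 hz)
      have h5 := majorant_shift_le hτ.1 (a := d + 3) (by positivity) g hz
      rw [pow_zero, one_mul] at h3
      refine le_trans (le_of_eq ?_) (h2.trans (h3.trans (h4.trans (mul_le_mul_right h5 _))))
      simp [← ofReal_norm, hV]
    rw [← ofReal_norm, ENNReal.ofReal_le_iff_le_toReal hBt] at h1
    exact h1
  have h := norm_image_sub_le_of_norm_deriv_le_segment' hd hb ε ⟨hε0, le_rfl⟩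
  have h1 : ‖shift ε V z - V z‖ₑ ≤ B := by
    rw [← ofReal_norm]
    refine ENNReal.ofReal_le_of_le_toReal ?_
    have e : shift ε V z - V z = V (z.1, z.2 + ε • stdVec 0) - V (z.1, z.2 + (0 : ℝ) • stdVec 0) := by
      simp [shift]
    rw [e]
    refine h.trans ?_
    have : 0 ≤ B.toReal := ENNReal.toReal_nonneg
    nlinarith
  calc ‖shift ε V z‖ₑ = ‖V z + (shift ε V z - V z)‖ₑ := by congr 1; ring
    _ ≤ ‖V z‖ₑ + ‖shift ε V z - V z‖ₑ := enorm_add_le _ _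
    _ ≤ ‖V z‖ₑ + (C + 1 : ℝ≥0) * majorant g (d + 3) z.1 z.2 := by
      gcongr
      refine h1.trans ?_
      rw [hB]
      gcongr
      exact le_self_add

/-- A derivative of order `i` of `χ (l ·)` carries the factor `l ^ i ≤ 1`, so the bound is uniform
in `l`. -/
theorem exists_slice_bound {d : ℕ} {χ : ℝ × Space d → ℂ} (hχ : ContDiff ℝ ∞ χ)
    (hc : HasCompactSupport χ) (i : ℕ) : ∃ A : ℝ≥0, ∀ l : ℝ, 0 ≤ l → l ≤ 1 → ∀ z ∈ upper d,
      ‖iteratedFDeriv ℝ i (fun x => χ (l • (z.1, x))) z.2‖ₑ ≤ A := by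
  obtain ⟨A, hA⟩ := (hχ.continuous_iteratedFDeriv (m := i)
    (by exact_mod_cast le_top)).bounded_above_of_compact_support (hc.iteratedFDeriv i)
  refine ⟨A.toNNReal, fun l hl0 hl1 z hz => ?_⟩
  have hl : ContDiff ℝ ∞ fun z => χ (l • z) := hχ.comp (contDiff_const_smul l)
  rw [iteratedFDeriv_slice (f := fun z => χ (l • z)) hl.contDiffOn i z.1 hz, ← ofReal_norm]
  refine ENNReal.ofReal_le_ofReal ?_
  refine (ContinuousMultilinearMap.norm_compContinuousLinearMap_le _ _).trans ?_
  rw [iteratedFDeriv_comp_const_smul l (hχ.of_le (by exact_mod_cast le_top))]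
  have h1 : ‖l ^ i • iteratedFDeriv ℝ i χ (l • (z.1, z.2))‖ ≤ A := by
    rw [norm_smul, Real.norm_of_nonneg (by positivity)]
    exact (mul_le_of_le_one_left (norm_nonneg _) (pow_le_one₀ hl0 hl1)).trans (hA _)
  refine (mul_le_of_le_one_right (norm_nonneg _) ?_).trans h1
  exact Finset.prod_le_one (fun _ _ => norm_nonneg _) fun _ _ =>
    ContinuousLinearMap.norm_inr_le_one _ _ _

theorem jet_cutoff_mul_le {d : ℕ} (M : ℕ) {χ : ℝ × Space d → ℝ} (hχ : ContDiff ℝ ∞ χ)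
    (hc : HasCompactSupport χ) : ∃ C : ℝ≥0, ∀ l : ℝ, 0 ≤ l → l ≤ 1 → ∀ F : ℝ × Space d → ℂ,
      ContDiffOn ℝ ∞ F (upper d) → ∀ z ∈ upper d, z.2 0 ≤ 2 →
        jet M (fun z => (χ (l • z) : ℂ) * F z) z ≤ C * jet M F z := by
  obtain ⟨C, hC⟩ := jet_mul_le d M
  have hχC : ContDiff ℝ ∞ fun z => (χ z : ℂ) := Complex.ofRealCLM.contDiff.comp hχ
  have hcC : HasCompactSupport fun z => (χ z : ℂ) := hc.comp_left Complex.ofReal_zero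
  have hχ' : ContDiff ℝ ∞ (timeDeriv fun z => (χ z : ℂ)) :=
    (hχC.fderiv_right (m := ∞) (by simp)).clm_apply contDiff_const
  have hc' : HasCompactSupport (timeDeriv fun z => (χ z : ℂ)) :=
    (hcC.fderiv ℝ).comp_left (g := fun L : ℝ × Space d →L[ℝ] ℂ => L (1, 0)) rfl
  choose A₁ h₁ using exists_slice_bound hχC hcC
  choose A₂ h₂ using exists_slice_bound hχ' hc'
  refine ⟨C * ∑ i ∈ Finset.range (M + 2), (A₁ i + A₂ i), fun l hl0 hl1 F hF z hz hz2 => ?_⟩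
  have hl : ContDiff ℝ ∞ fun z => (χ (l • z) : ℂ) := hχC.comp (contDiff_const_smul l)
  have hsum : ∀ i ≤ M + 1, ((A₁ i : ℝ≥0∞) + A₂ i) ≤ ∑ i ∈ Finset.range (M + 2), (A₁ i + A₂ i : ℝ≥0∞) :=
    fun i hi => Finset.single_le_sum (f := fun i => (A₁ i + A₂ i : ℝ≥0∞)) (fun _ _ => zero_le)
      (Finset.mem_range.2 (by omega))
  have ht : ∀ w : ℝ × Space d, timeDeriv (fun z => (χ (l • z) : ℂ)) w =
      l • timeDeriv (fun z => (χ z : ℂ)) (l • w) := fun w => by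
    have h1 := ((hχC.differentiable (by simp)) (l • w)).hasFDerivAt
    have h2 : HasFDerivAt (fun w : ℝ × Space d => l • w)
        (l • ContinuousLinearMap.id ℝ (ℝ × Space d)) w := (hasFDerivAt_id w).const_smul l
    have h3 : HasFDerivAt (fun w => (χ (l • w) : ℂ)) _ w := h1.comp w h2
    rw [timeDeriv, h3.fderiv, timeDeriv]
    simp
  have := hC (∑ i ∈ Finset.range (M + 2), (A₁ i + A₂ i : ℝ≥0∞)) _ F z hl.contDiffOn hF hz hz2
    (fun i hi => (h₁ i l hl0 hl1 z hz).trans (le_self_add.trans (hsum i hi))) (fun i hi => by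
      simp only [ht]
      have h3 := h₂ i l hl0 hl1 z hz
      have h4 : ContDiffAt ℝ i (fun x => timeDeriv (fun z => (χ z : ℂ)) (l • (z.1, x))) z.2 := by
        have h5 : ContDiff ℝ ∞ fun x : Space d => l • (z.1, x) := by fun_prop
        exact (hχ'.comp h5).contDiffAt.of_le (by exact_mod_cast le_top)
      change ‖iteratedFDeriv ℝ i (l • fun x => timeDeriv (fun z => (χ z : ℂ)) (l • (z.1, x)))
        z.2‖ₑ ≤ _
      rw [iteratedFDeriv_const_smul_apply h4, enorm_smul]
      refine (mul_le_of_le_one_left' ?_).trans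
        (h3.trans (le_add_self.trans (hsum i (by omega))))
      rw [Real.enorm_eq_ofReal hl0]
      simpa using hl1)
  refine this.trans (le_of_eq ?_)
  push_cast
  rfl

theorem continuousOn_iteratedFDeriv_slice {d : ℕ} {F : ℝ × Space d → ℂ}
    (hF : ContDiffOn ℝ ∞ F (upper d)) (j : ℕ) :
    ContinuousOn (fun z : ℝ × Space d => iteratedFDeriv ℝ j (fun x => F (z.1, x)) z.2)
      (upper d) := by
  have h1 : ContinuousOn (fun z => (iteratedFDeriv ℝ j F z).compContinuousLinearMap
      fun _ => ContinuousLinearMap.inr ℝ ℝ (Space d)) (upper d) := by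
    have h2 : ContinuousOn (iteratedFDeriv ℝ j F) (upper d) := by
      refine (hF.continuousOn_iteratedFDerivWithin (m := j) (by exact_mod_cast le_top)
        (isOpen_upper d).uniqueDiffOn).congr fun z hz => ?_
      rw [iteratedFDerivWithin_of_isOpen j (isOpen_upper d) hz]
    exact (ContinuousMultilinearMap.compContinuousLinearMapL (F := ℂ)
      (fun _ => ContinuousLinearMap.inr ℝ ℝ (Space d))).continuous.comp_continuousOn h2
  exact h1.congr fun z hz => iteratedFDeriv_slice hF j z.1 hz

theorem continuousOn_jet {d : ℕ} {F : ℝ × Space d → ℂ} (hF : ContDiffOn ℝ ∞ F (upper d)) (M : ℕ) :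
    ContinuousOn (jet M F) (upper d) := by
  have h0 : ∀ (G : ℝ × Space d → ℂ), ContDiffOn ℝ ∞ G (upper d) → ∀ j k : ℕ,
      ContinuousOn (fun z : ℝ × Space d => ENNReal.ofReal (z.2 0) ^ k *
        ‖iteratedFDeriv ℝ j (fun x => G (z.1, x)) z.2‖ₑ) (upper d) := fun G hG j k => by
    have h1 : ContinuousOn (fun z : ℝ × Space d => ENNReal.ofReal ((max (z.2 0) 0) ^ k *
        ‖iteratedFDeriv ℝ j (fun x => G (z.1, x)) z.2‖)) (upper d) := by
      refine ENNReal.continuous_ofReal.comp_continuousOn (ContinuousOn.mul ?_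
        (continuousOn_iteratedFDeriv_slice hG j).norm)
      exact Continuous.continuousOn (by fun_prop)
    refine h1.congr fun z hz => ?_
    beta_reduce
    rw [ENNReal.ofReal_mul (by positivity), ENNReal.ofReal_pow (by positivity), ofReal_norm,
      max_eq_left (le_of_lt (show 0 < z.2 0 from hz))]
  unfold jet djet
  exact hF.continuousOn.enorm.add (continuousOn_finsetSum _ fun j _ =>
    (h0 F hF _ _).add (h0 _ (contDiffOn_timeDeriv hF) _ _))

theorem wInt_eq_setLIntegral {d : ℕ} {θ p : ℝ} {f : ℝ × Space d → ℝ≥0∞}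
    (hf : AEMeasurable f (volume.restrict (upper d))) :
    wInt θ p f = ∫⁻ z in upper d, f z ^ p * ENNReal.ofReal (z.2 0 ^ (θ - ((d : ℝ) + 1))) := by
  have h1 : (volume : Measure (ℝ × Space d)).restrict (upper d) =
      (volume : Measure ℝ).prod ((volume : Measure (Space d)).restrict (halfSpace d)) := by
    have : upper d = Set.univ ×ˢ (halfSpace d : Set (Space d)) := by
      ext z
      simp only [Set.mem_prod, Set.mem_univ, true_and]
      exact Iff.rfl
    rw [this, Measure.volume_eq_prod, ← Measure.prod_restrict, Measure.restrict_univ]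
  have h2 : AEMeasurable (fun z : ℝ × Space d => f z ^ p *
      ENNReal.ofReal (z.2 0 ^ (θ - ((d : ℝ) + 1)))) (volume.restrict (upper d)) :=
    (hf.pow_const p).mul
      (measurable_weight _).aemeasurable
  rw [h1] at h2 ⊢
  rw [lintegral_prod _ h2, wInt]

/-- The function `χ(εz) η(x₁) F(t, x + ε e₁)`, extended smoothly by zero to `x₁ < 0`. -/
def approx {d : ℕ} (η : ℝ → ℝ) (χ : ℝ × Space d → ℝ) (ε : ℝ) (F : ℝ × Space d → ℂ)
    (z : ℝ × Space d) : ℂ :=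
  (χ (ε • z) : ℂ) * ((Real.smoothTransition (1 + 2 * z.2 0 / ε) : ℂ) * cut η (shift ε F) z)

theorem approx_eq {d : ℕ} (η : ℝ → ℝ) (χ : ℝ × Space d → ℝ) {ε : ℝ} (hε : 0 < ε)
    (F : ℝ × Space d → ℂ) {z : ℝ × Space d} (hz : 0 ≤ z.2 0) :
    approx η χ ε F z = (χ (ε • z) : ℂ) * cut η (shift ε F) z := by
  have : 0 ≤ 2 * z.2 0 / ε := by positivity
  rw [approx, Real.smoothTransition.one_of_one_le (by linarith)]
  simp

theorem approx_boundary {d : ℕ} {η : ℝ → ℝ} (hη : IsCutoff η) (χ : ℝ × Space d → ℝ) {ε : ℝ}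
    (hε : 0 < ε) (F : ℝ × Space d → ℂ) (q : ℝ × Bdry d) :
    approx η χ ε F (q.1, mkPoint 0 q.2) =
      (χ (ε • bd q) : ℂ) * F (q.1, mkPoint ε q.2) := by
  have e : mkPoint 0 q.2 + ε • stdVec 0 = mkPoint ε q.2 := by
    ext i
    refine Fin.cases ?_ (fun i => ?_) i <;> simp [mkPoint]
  have e0 : (mkPoint 0 q.2 : Space d) 0 = 0 := by simp [mkPoint]
  rw [approx_eq η χ hε F (by simp [e0]), cut, shift]
  simp only [e, e0]
  rw [hη.2.1 0 zero_le_one]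
  simp [bd]

/-- For `x₁ > -ε` the shifted argument lies in the open half-space; for `x₁ < -ε / 2` the transition
factor vanishes. These two open sets cover the space. -/
theorem contDiff_approx {d : ℕ} {η : ℝ → ℝ} (hη : ContDiff ℝ ∞ η) {χ : ℝ × Space d → ℝ}
    (hχ : ContDiff ℝ ∞ χ) {ε : ℝ} (hε : 0 < ε) {F : ℝ × Space d → ℂ}
    (hF : ContDiffOn ℝ ∞ F (upper d)) : ContDiff ℝ ∞ (approx η χ ε F) := by
  have h1 : ContDiff ℝ ∞ fun z : ℝ × Space d => (χ (ε • z) : ℂ) :=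
    Complex.ofRealCLM.contDiff.comp (hχ.comp (contDiff_const_smul ε))
  have h2 : ContDiff ℝ ∞ fun z : ℝ × Space d =>
      (Real.smoothTransition (1 + 2 * z.2 0 / ε) : ℂ) := by
    refine Complex.ofRealCLM.contDiff.comp (Real.smoothTransition.contDiff.comp ?_)
    have : ContDiff ℝ ∞ fun z : ℝ × Space d => z.2 0 := by fun_prop
    exact contDiff_const.add ((contDiff_const.mul this).div_const ε)
  refine h1.mul (contDiff_iff_contDiffAt.2 fun z => ?_)
  rcases lt_or_ge (-ε) (z.2 0) with hz | hz
  · refine h2.contDiffAt.mul ((contDiff_cutFactor hη).contDiffAt.mul (contDiffAt_shift hF ?_))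
    rw [mem_upper]
    simp
    linarith
  · have hc : Continuous fun z : ℝ × Space d => z.2 0 := by fun_prop
    have h3 : ∀ᶠ w : ℝ × Space d in 𝓝 z, w.2 0 < -(ε / 2) :=
      (isOpen_Iio.preimage hc).mem_nhds (by simp; linarith)
    refine (contDiffAt_const (c := (0 : ℂ))).congr_of_eventuallyEq (h3.mono fun w hw => ?_)
    beta_reduce
    rw [Real.smoothTransition.zero_of_nonpos]
    · simp
    · have : 2 * w.2 0 / ε ≤ -1 := by
        rw [div_le_iff₀ hε]
        linarith
      linarith

theorem hasCompactSupport_approx {d : ℕ} (η : ℝ → ℝ) {χ : ℝ × Space d → ℝ}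
    (hχ : HasCompactSupport χ) {ε : ℝ} (hε : 0 < ε) (F : ℝ × Space d → ℂ) :
    HasCompactSupport (approx η χ ε F) :=
  HasCompactSupport.mul_right ((hχ.comp_smul hε.ne').comp_left (g := fun r : ℝ => (r : ℂ))
    Complex.ofReal_zero)

/-- The right-hand side does not depend on `ε`; it is the dominating function for the limit `ε → 0`.
-/
theorem exists_jet_sub_cutoff_le (d M : ℕ) {η : ℝ → ℝ} (hη : IsCutoff η) {χ : ℝ × Space d → ℝ}
    (hχ : ContDiff ℝ ∞ χ) (hc : HasCompactSupport χ) : ∃ C : ℝ≥0, ∀ g : ℝ × Bdry d → ℂ, Tame g →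
      ∀ ε : ℝ, 0 ≤ ε → ε ≤ 1 → ∀ z ∈ upper d,
        jet M (fun z => cut η (conv poisKer g) z -
          (χ (ε • z) : ℂ) * cut η (shift ε (conv poisKer g)) z) z ≤
        C * ((if z.2 0 ≤ 2 then ‖conv poisKer g z‖ₑ else 0) + majorant g (d + 3) z.1 z.2) := by
  obtain ⟨C₁, h₁⟩ := jet_cut_conv_le d M hη
  obtain ⟨C₂, h₂⟩ := jet_cutoff_mul_le M hχ hc
  obtain ⟨C₃, h₃⟩ := jet_cut_le d M hη
  obtain ⟨C₄, h₄⟩ := conv_shift_le d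
  obtain ⟨C₅, h₅⟩ := djet_conv_le d M
  refine ⟨C₁ + C₂ * (C₃ * (1 + C₄ + C₅)), fun g hg ε hε0 hε1 z hz => ?_⟩
  have hV := convKer_poisKer.contDiffOn_conv hg
  have hS := contDiffOn_shift hε0 hV
  have hS' := contDiffOn_cut hη.1 hS
  have hχC : ContDiff ℝ ∞ fun z : ℝ × Space d => (χ (ε • z) : ℂ) :=
    Complex.ofRealCLM.contDiff.comp (hχ.comp (contDiff_const_smul ε))
  refine (jet_sub_le (contDiffOn_cut hη.1 hV) (hχC.contDiffOn.mul hS') hz M).trans ?_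
  push_cast
  rw [add_mul]
  refine add_le_add (h₁ g hg z hz) ?_
  by_cases hz2 : z.2 0 ≤ 2
  · refine (h₂ ε hε0 hε1 _ hS' z hz hz2).trans ?_
    rw [mul_assoc, mul_assoc]
    gcongr
    refine (h₃ _ hS z hz).trans ?_
    gcongr
    rw [if_pos hz2, if_pos hz2, jet]
    have h6 := (djet_shift_le (M := M) hε0 (conv poisKer g) z).trans (h₅ g hg _ (shift_mem hε0 hz))
    have h7 := majorant_shift_le hε0 (a := d + 3) (by positivity) g hz
    refine (add_le_add (h₄ g hg ε hε0 hε1 z hz) (h6.trans (mul_le_mul_right h7 _))).trans ?_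
    set X := ‖conv poisKer g z‖ₑ
    set Y := majorant g (d + 3) z.1 z.2
    calc X + C₄ * Y + C₅ * Y ≤ X + C₄ * Y + C₅ * Y + (Y + (C₄ + C₅) * X) := le_self_add
      _ = (1 + C₄ + C₅) * (X + Y) := by ring
  · rw [jet_eq_zero]
    · exact zero_le
    · have hcn : Continuous fun z : ℝ × Space d => z.2 0 := by fun_prop
      filter_upwards [(isOpen_Ioi.preimage hcn).mem_nhds (show z.2 0 ∈ Set.Ioi 2 from not_le.1 hz2)]
        with w hw
      rw [cut, hη.2.2 _ (le_of_lt hw)]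
      simp

/-- The shift only moves the point at which the derivatives are evaluated, and these are continuous
at `z`. -/
theorem tendsto_jet_sub_shift {d : ℕ} (M : ℕ) {F : ℝ × Space d → ℂ}
    (hF : ContDiffOn ℝ ∞ F (upper d)) {z : ℝ × Space d} (hz : z ∈ upper d) :
    Tendsto (fun ε => jet M (fun w => F w - shift ε F w) z) (𝓝[>] 0) (𝓝 0) := by
  have key : ∀ G : ℝ × Space d → ℂ, ContDiffOn ℝ ∞ G (upper d) → ∀ j : ℕ,
      Tendsto (fun ε => ‖iteratedFDeriv ℝ j (fun x => G (z.1, x)) z.2 -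
        iteratedFDeriv ℝ j (fun x => shift ε G (z.1, x)) z.2‖ₑ) (𝓝[>] 0) (𝓝 0) := fun G hG j => by
    have h1 : ContinuousAt (fun z : ℝ × Space d =>
        iteratedFDeriv ℝ j (fun x => G (z.1, x)) z.2) z :=
      (continuousOn_iteratedFDeriv_slice hG j).continuousAt ((isOpen_upper d).mem_nhds hz)
    have h2 : Tendsto (fun ε : ℝ => (z.1, z.2 + ε • (stdVec 0 : Space d))) (𝓝[>] 0) (𝓝 z) := by
      have : Continuous fun ε : ℝ => (z.1, z.2 + ε • (stdVec 0 : Space d)) := by fun_prop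
      have := this.tendsto 0
      simp only [zero_smul, add_zero] at this
      exact this.mono_left nhdsWithin_le_nhds
    have h3 := ((h1.tendsto.comp h2).const_sub
      (iteratedFDeriv ℝ j (fun x => G (z.1, x)) z.2)).enorm
    simp only [sub_self, enorm_zero] at h3
    refine h3.congr fun ε => ?_
    rw [iteratedFDeriv_shift]
    rfl
  have hterm : ∀ᶠ ε : ℝ in 𝓝[>] 0, jet M (fun w => F w - shift ε F w) z =
      ‖iteratedFDeriv ℝ 0 (fun x => F (z.1, x)) z.2 -
        iteratedFDeriv ℝ 0 (fun x => shift ε F (z.1, x)) z.2‖ₑ +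
      ∑ j ∈ Finset.range (M + 1), (ENNReal.ofReal (z.2 0) ^ j *
        ‖iteratedFDeriv ℝ (j + 1) (fun x => F (z.1, x)) z.2 -
        iteratedFDeriv ℝ (j + 1) (fun x => shift ε F (z.1, x)) z.2‖ₑ +
        ENNReal.ofReal (z.2 0) ^ (j + 1) *
        ‖iteratedFDeriv ℝ j (fun x => timeDeriv F (z.1, x)) z.2 -
        iteratedFDeriv ℝ j (fun x => shift ε (timeDeriv F) (z.1, x)) z.2‖ₑ) := by
    filter_upwards [self_mem_nhdsWithin] with ε hε
    have hg := contDiffOn_shift (le_of_lt hε) hF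
    have ht : timeDeriv (fun z => F z - shift ε F z) =ᶠ[𝓝 z]
        fun z => timeDeriv F z - shift ε (timeDeriv F) z := by
      filter_upwards [(isOpen_upper d).mem_nhds hz] with w hw
      rw [timeDeriv_sub hF hg hw, timeDeriv_shift]
    have hF' := contDiffOn_timeDeriv hF
    have hg' := contDiffOn_shift (le_of_lt hε) hF'
    have e : ∀ G : ℝ × Space d → ℂ, ContDiffOn ℝ ∞ G (upper d) → ∀ j : ℕ,
        iteratedFDeriv ℝ j (fun x => G (z.1, x) - shift ε G (z.1, x)) z.2 =
        iteratedFDeriv ℝ j (fun x => G (z.1, x)) z.2 -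
          iteratedFDeriv ℝ j (fun x => shift ε G (z.1, x)) z.2 := fun G hG j =>
      iteratedFDeriv_sub_apply ((contDiffAt_slice hG hz).of_le (by exact_mod_cast le_top))
        ((contDiffAt_slice (contDiffOn_shift (le_of_lt hε) hG) hz).of_le
          (by exact_mod_cast le_top))
    rw [← e F hF, jet, djet]
    congr 1
    · rw [← ofReal_norm, ← ofReal_norm, norm_iteratedFDeriv_zero]
    · refine Finset.sum_congr rfl fun j _ => ?_
      rw [iteratedFDeriv_slice_congr ht, e F hF, e _ hF']
  refine Tendsto.congr' (EventuallyEq.symm hterm) ?_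
  have hs : Tendsto (fun ε => ∑ j ∈ Finset.range (M + 1), (ENNReal.ofReal (z.2 0) ^ j *
        ‖iteratedFDeriv ℝ (j + 1) (fun x => F (z.1, x)) z.2 -
        iteratedFDeriv ℝ (j + 1) (fun x => shift ε F (z.1, x)) z.2‖ₑ +
        ENNReal.ofReal (z.2 0) ^ (j + 1) *
        ‖iteratedFDeriv ℝ j (fun x => timeDeriv F (z.1, x)) z.2 -
        iteratedFDeriv ℝ j (fun x => shift ε (timeDeriv F) (z.1, x)) z.2‖ₑ)) (𝓝[>] 0)
        (𝓝 (∑ j ∈ Finset.range (M + 1), (ENNReal.ofReal (z.2 0) ^ j * 0 +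
          ENNReal.ofReal (z.2 0) ^ (j + 1) * 0))) :=
    tendsto_finsetSum _ fun j _ =>
      (ENNReal.Tendsto.const_mul (key F hF _) (.inr (by finiteness))).add
        (ENNReal.Tendsto.const_mul (key _ (contDiffOn_timeDeriv hF) _) (.inr (by finiteness)))
  simpa using (key F hF 0).add hs

/-- Once `ε (‖z‖ + 1) ≤ 1`, the factor `χ (ε ·)` is 1 on the unit ball around `z`, and only the
effect of the shift remains. -/
theorem tendsto_jet_sub_cutoff {d : ℕ} (M : ℕ) {η : ℝ → ℝ} (hη : IsCutoff η)
    {χ : ℝ × Space d → ℝ} (hχ1 : ∀ z, ‖z‖ ≤ 1 → χ z = 1) {F : ℝ × Space d → ℂ}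
    (hF : ContDiffOn ℝ ∞ F (upper d)) {z : ℝ × Space d} (hz : z ∈ upper d) :
    Tendsto (fun ε => jet M (fun z => cut η F z - (χ (ε • z) : ℂ) * cut η (shift ε F) z) z)
      (𝓝[>] 0) (𝓝 0) := by
  obtain ⟨C, hC⟩ := jet_cut_le d M hη
  have h1 := ENNReal.Tendsto.const_mul (a := (C : ℝ≥0∞)) (tendsto_jet_sub_shift M hF hz)
    (.inr ENNReal.coe_ne_top)
  rw [mul_zero] at h1
  have hsmall : ∀ᶠ ε : ℝ in 𝓝[>] 0, ε * (‖z‖ + 1) ≤ 1 := by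
    have : Tendsto (fun ε : ℝ => ε * (‖z‖ + 1)) (𝓝[>] 0) (𝓝 (0 * (‖z‖ + 1))) :=
      (tendsto_id.mono_left nhdsWithin_le_nhds).mul_const _
    rw [zero_mul] at this
    exact this.eventually_le_const zero_lt_one
  refine tendsto_of_tendsto_of_tendsto_of_le_of_le' tendsto_const_nhds h1
    (Eventually.of_forall fun _ => zero_le) ?_
  filter_upwards [hsmall, self_mem_nhdsWithin] with ε hε hε0
  have hε0 : 0 < ε := hε0
  have h2 : (fun z => cut η F z - (χ (ε • z) : ℂ) * cut η (shift ε F) z) =ᶠ[𝓝 z]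
      cut η (fun w => F w - shift ε F w) := by
    filter_upwards [Metric.ball_mem_nhds z one_pos] with w hw
    have hwz : ‖w‖ ≤ ‖z‖ + 1 := by
      have := norm_le_norm_add_norm_sub' w z
      have h3 : ‖w - z‖ < 1 := by simpa [dist_eq_norm] using hw
      linarith
    rw [hχ1]
    · simp only [cut]
      push_cast
      ring
    · rw [norm_smul, Real.norm_of_nonneg hε0.le]
      exact (mul_le_mul_of_nonneg_left hwz hε0.le).trans hε
  rw [jet_congr h2]
  refine (hC _ (hF.sub (contDiffOn_shift hε0.le hF)) z hz).trans ?_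
  gcongr
  split_ifs <;> simp

theorem tendsto_wInt_jet_sub_cutoff {d : ℕ} (M : ℕ) {p θ s : ℝ} (hp : 1 < p) (hθ₁ : (d : ℝ) < θ)
    (hθ₂ : θ < d + p) (hs : s = (d + p - θ) / p) {η : ℝ → ℝ} (hη : IsCutoff η)
    {χ : ℝ × Space d → ℝ} (hχ : ContDiff ℝ ∞ χ) (hc : HasCompactSupport χ)
    (hχ1 : ∀ z, ‖z‖ ≤ 1 → χ z = 1) {g : ℝ × Bdry d → ℂ} (hg : MemSlob s p g) (hm : Measurable g) :
    Tendsto (fun ε => wInt θ p (jet M (fun z => cut η (conv poisKer g) z -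
      (χ (ε • z) : ℂ) * cut η (shift ε (conv poisKer g)) z))) (𝓝[>] 0) (𝓝 0) := by
  have hp0 : 0 < p := by linarith
  have hT := tame_of_memLp hp hg.memLp
  have hV := convKer_poisKer.contDiffOn_conv hT
  obtain ⟨C, hC⟩ := exists_jet_sub_cutoff_le d M hη hχ hc
  obtain ⟨C', hC', h'⟩ := exists_wInt_conv_add_majorant_le d hp hθ₁ hθ₂ hs
  set D : ℝ × Space d → ℝ≥0∞ := fun z =>
    (if z.2 0 ≤ 2 then ‖conv poisKer g z‖ₑ else 0) + majorant g (d + 3) z.1 z.2 with hD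
  have hDm : Measurable D := by
    refine Measurable.add (Measurable.ite ?_ (measurable_conv hm).enorm measurable_const)
      (measurable_majorant hm _)
    exact measurableSet_le (by fun_prop) measurable_const
  set G : ℝ → ℝ × Space d → ℂ := fun ε z => cut η (conv poisKer g) z -
    (χ (ε • z) : ℂ) * cut η (shift ε (conv poisKer g)) z with hG
  have hGs : ∀ ε : ℝ, 0 < ε → ContDiffOn ℝ ∞ (G ε) (upper d) := fun ε hε => by
    have hχC : ContDiff ℝ ∞ fun z : ℝ × Space d => (χ (ε • z) : ℂ) :=
      Complex.ofRealCLM.contDiff.comp (hχ.comp (contDiff_const_smul ε))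
    exact (contDiffOn_cut hη.1 hV).sub
      (hχC.contDiffOn.mul (contDiffOn_cut hη.1 (contDiffOn_shift hε.le hV)))
  have hGm : ∀ ε : ℝ, 0 < ε → AEMeasurable (jet M (G ε)) (volume.restrict (upper d)) :=
    fun ε hε => (continuousOn_jet (hGs ε hε) M).aemeasurable (isOpen_upper d).measurableSet
  -- The indicator makes the integrand measurable everywhere; continuity of the jet is known only on
  -- `upper d`.
  have key : Tendsto (fun ε => ∫⁻ z in upper d, (upper d).indicator (jet M (G ε)) z ^ p *
      ENNReal.ofReal (z.2 0 ^ (θ - ((d : ℝ) + 1)))) (𝓝[>] 0)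
      (𝓝 (∫⁻ _ in upper d, 0)) := by
    refine tendsto_lintegral_filter_of_dominated_convergence
      (fun z => (C * D z) ^ p * ENNReal.ofReal (z.2 0 ^ (θ - ((d : ℝ) + 1)))) ?_ ?_ ?_ ?_
    · filter_upwards [self_mem_nhdsWithin] with ε hε
      refine Measurable.mul (Measurable.pow_const ?_ p) (measurable_weight _)
      classical
      rw [← Set.piecewise_eq_indicator]
      exact (continuousOn_jet (hGs ε hε) M).measurable_piecewise continuousOn_const
        (isOpen_upper d).measurableSet
    · filter_upwards [Ioc_mem_nhdsGT one_pos] with ε hε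
      refine (ae_restrict_mem (isOpen_upper d).measurableSet).mono fun z hz => ?_
      rw [Set.indicator_of_mem hz]
      gcongr
      exact hC g hT ε hε.1.le hε.2 z hz
    · rw [← wInt_eq_setLIntegral (f := fun z => C * D z) (hDm.const_mul _).aemeasurable,
        wInt_const_mul hp0.le]
      have := h' g hm
      have h3 := hg.2.ne
      exact ENNReal.mul_ne_top (by finiteness) (ne_top_of_le_ne_top (by finiteness) this)
    · refine (ae_restrict_mem (isOpen_upper d).measurableSet).mono fun z hz => ?_
      have h1 := (tendsto_jet_sub_cutoff M hη hχ1 hV hz).ennrpow_const p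
      rw [ENNReal.zero_rpow_of_pos hp0] at h1
      simp only [Set.indicator_of_mem hz]
      simpa using ENNReal.Tendsto.mul_const h1 (.inr ENNReal.ofReal_ne_top)
  rw [lintegral_zero] at key
  refine key.congr' ?_
  filter_upwards [self_mem_nhdsWithin] with ε hε
  rw [wInt_eq_setLIntegral (hGm ε hε)]
  exact setLIntegral_congr_fun (isOpen_upper d).measurableSet fun z hz => by
    simp only [Set.indicator_of_mem hz]

theorem tendsto_solNorm_sub_approx {d : ℕ} (P : WeightPartition d) (γ : ℝ) {p θ s : ℝ}
    (hp : 1 < p) (hθ₁ : (d : ℝ) < θ) (hθ₂ : θ < d + p) (hs : s = (d + p - θ) / p) {η : ℝ → ℝ}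
    (hη : IsCutoff η) {χ : ℝ × Space d → ℝ} (hχ : ContDiff ℝ ∞ χ) (hc : HasCompactSupport χ)
    (hχ1 : ∀ z, ‖z‖ ≤ 1 → χ z = 1) {g : ℝ × Bdry d → ℂ} (hg : MemSlob s p g) (hm : Measurable g) :
    Tendsto (fun ε => solNorm P γ θ p (fun t => distOf (cutExt η g t) -
      distOf fun x => approx η χ ε (conv poisKer g) (t, x))) (𝓝[>] 0) (𝓝 0) := by
  have hp0 : 0 < p := by linarith
  have hV := convKer_poisKer.contDiffOn_conv (tame_of_memLp hp hg.memLp)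
  obtain ⟨M, C, hC⟩ := exists_solNorm_le P γ θ hp
  have h1 := (tendsto_wInt_jet_sub_cutoff M hp hθ₁ hθ₂ hs hη hχ hc hχ1 hg hm).ennrpow_const (1 / p)
  rw [ENNReal.zero_rpow_of_pos (by positivity)] at h1
  have h2 := ENNReal.Tendsto.const_mul (a := (C : ℝ≥0∞)) h1 (.inr ENNReal.coe_ne_top)
  rw [mul_zero] at h2
  refine tendsto_of_tendsto_of_tendsto_of_le_of_le' tendsto_const_nhds h2
    (Eventually.of_forall fun _ => zero_le) ?_
  filter_upwards [self_mem_nhdsWithin] with ε hε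
  have hχC : ContDiff ℝ ∞ fun z : ℝ × Space d => (χ (ε • z) : ℂ) :=
    Complex.ofRealCLM.contDiff.comp (hχ.comp (contDiff_const_smul ε))
  have hA := (contDiff_approx hη.1 hχ hε hV).contDiffOn (s := upper d)
  have hU := contDiffOn_cut hη.1 hV
  have hB := hχC.contDiffOn.mul (contDiffOn_cut hη.1 (contDiffOn_shift (le_of_lt hε) hV))
  set G : ℝ × Space d → ℂ := fun z => cut η (conv poisKer g) z -
    (χ (ε • z) : ℂ) * cut η (shift ε (conv poisKer g)) z with hG
  -- The transition factor in `approx` is 1 on the half-space, so it does not change the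
  -- distribution.
  have e : (fun t => distOf (cutExt η g t) -
      distOf fun x => approx η χ ε (conv poisKer g) (t, x)) = fun t => distOf fun x => G (t, x) := by
    funext t
    have e1 : cutExt η g t = fun x => cut η (conv poisKer g) (t, x) := funext (cutExt_eq η g t)
    rw [e1, distOf_sub (continuousOn_slice hU.continuousOn t) (continuousOn_slice hA.continuousOn t)]
    refine distOf_congr ((continuousOn_slice hU.continuousOn t).sub
      (continuousOn_slice hA.continuousOn t)) fun x hx => ?_
    have hx0 : 0 < x 0 := hx
    rw [approx_eq η χ hε _ (show 0 ≤ (t, x).2 0 from hx0.le)]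
  rw [e]
  refine hC G (hU.sub hB) fun z hz => ?_
  simp only [hG, cut]
  rw [hη.2.2 _ hz.le]
  simp

/-! ### Convergence of the boundary values in `L_p` -/

/-- Continuity of translations in `L_p`, from the continuity of composition with measure-preserving
maps in the compact-open topology. -/
theorem tendsto_lintegral_translate {d : ℕ} {p : ℝ} (hp : 1 < p) {g : ℝ × Bdry d → ℂ}
    (hg : MemLp g (ENNReal.ofReal p) volume) :
    Tendsto (fun a => ∫⁻ w, ‖g (w - a) - g w‖ₑ ^ p) (𝓝 0) (𝓝 0) := by
  have hp0 : 0 < p := by linarith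
  have : Fact (1 ≤ ENNReal.ofReal p) := ⟨by simpa using hp.le⟩
  let T : ℝ × Bdry d → C(ℝ × Bdry d, ℝ × Bdry d) := fun a => ⟨fun w => w - a, by fun_prop⟩
  have hT : Continuous T := by
    refine ContinuousMap.continuous_of_continuous_uncurry _ ?_
    change Continuous fun v : (ℝ × Bdry d) × (ℝ × Bdry d) => v.2 - v.1
    fun_prop
  have hTm : ∀ a, MeasurePreserving (T a) (volume : Measure (ℝ × Bdry d)) volume := fun a =>
    measurePreserving_sub_right volume a
  have h1 : Tendsto (fun a => Lp.compMeasurePreserving (T a) (hTm a) (hg.toLp g)) (𝓝 0)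
      (𝓝 (Lp.compMeasurePreserving (T 0) (hTm 0) (hg.toLp g))) :=
    Tendsto.compMeasurePreservingLp tendsto_const_nhds (hT.tendsto 0) hTm (hTm 0)
      ENNReal.ofReal_ne_top
  have h2 := tendsto_iff_edist_tendsto_0.1 h1
  simp only [Lp.toLp_compMeasurePreserving, Lp.edist_toLp_toLp] at h2
  have h3 := h2.ennrpow_const p
  rw [ENNReal.zero_rpow_of_pos hp0] at h3
  refine h3.congr fun a => ?_
  rw [eLpNorm_rpow hp]
  simp [T]

/-- By homogeneity the kernel at height `ε` is a parabolic dilate of the kernel at height 1, and the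
Jacobian `ε ^ (d + 2)` cancels its degree. -/
theorem lintegral_bdKer_mul {d : ℕ} {ε : ℝ} (hε : 0 < ε) {f : ℝ × Bdry d → ℝ≥0∞}
    (hf : Measurable f) :
    ∫⁻ q, ENNReal.ofReal (bdKer ε q) * f q =
      ∫⁻ q, ENNReal.ofReal (bdKer 1 q) * f (ε ^ 2 * q.1, ε • q.2) := by
  have hm : ∀ r, Measurable fun q : ℝ × Bdry d => ENNReal.ofReal (bdKer r q) := fun r =>
    ENNReal.measurable_ofReal.comp (measurable_bdKer_right r)
  have e : ∀ t : ℝ, ∀ y : Bdry d, bdKer ε (ε ^ 2 * t, ε • y) = (ε ^ (d + 2))⁻¹ * bdKer 1 (t, y) :=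
    fun t y => by
      have h := isHomogKer_poisKer.hom ε hε (t, (mkPoint 1 y : Space d))
      have e1 : ε • (mkPoint 1 y : Space d) = mkPoint ε (ε • y) := by
        ext i
        refine Fin.cases ?_ (fun i => ?_) i <;> simp [mkPoint]
      rw [dil_apply] at h
      simp only [e1, poisKer, Complex.real_smul] at h
      exact_mod_cast h
  have h1 : Measurable fun q => ENNReal.ofReal (bdKer ε q) * f q := (hm ε).mul hf
  have h2 : Measurable fun q => ENNReal.ofReal (bdKer 1 q) * f (ε ^ 2 * q.1, ε • q.2) :=
    (hm 1).mul (hf.comp (by fun_prop))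
  rw [lintegral_prod_volume h1, lintegral_prod_volume h2, lintegral_eq_scale volume (pow_pos hε 2)]
  rw [← lintegral_const_mul' _ _ ENNReal.ofReal_ne_top]
  refine lintegral_congr fun t => ?_
  rw [lintegral_eq_scale volume hε, ← lintegral_const_mul' _ _ ENNReal.ofReal_ne_top,
    ← lintegral_const_mul' _ _ ENNReal.ofReal_ne_top]
  refine lintegral_congr fun y => ?_
  simp only [smul_eq_mul, e, Module.finrank_self, finrank_euclideanSpace_fin]
  rw [ENNReal.ofReal_mul (by positivity), ← mul_assoc, ← mul_assoc, ← mul_assoc,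
    ← ENNReal.ofReal_mul (by positivity), ← ENNReal.ofReal_mul (by positivity)]
  rw [show (ε ^ 2) ^ 1 * ε ^ d * (ε ^ (d + 2))⁻¹ = 1 by field_simp; ring, ENNReal.ofReal_one, one_mul]

/-- The values of the extension at the height `ε`. -/
def layer {d : ℕ} (g : ℝ × Bdry d → ℂ) (ε : ℝ) (w : ℝ × Bdry d) : ℂ :=
  conv poisKer g (w.1, mkPoint ε w.2)

theorem measurable_layer {d : ℕ} {g : ℝ × Bdry d → ℂ} (hg : Measurable g) (ε : ℝ) :
    Measurable (layer g ε) :=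
  (measurable_conv hg).comp (measurable_fst.prodMk
    (measurable_mkPoint.comp (f := fun w : ℝ × Bdry d => (ε, w.2)) (by fun_prop)))

theorem layer_eq {d : ℕ} (g : ℝ × Bdry d → ℂ) (ε : ℝ) (w : ℝ × Bdry d) :
    layer g ε w = ∫ q, g (w - q) * (bdKer ε q : ℂ) := by
  rw [layer, conv, ← integral_sub_left_eq_self _ volume w]
  refine integral_congr_ae (Eventually.of_forall fun q => ?_)
  beta_reduce
  rw [poisKer_sub_bd, sub_sub_cancel]

/-- Unit mass makes `layer g ε - g` an average of increments of `g`, to which Jensen's inequality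
applies. -/
theorem lintegral_layer_sub_le {d : ℕ} {p : ℝ} (hp : 1 < p) {g : ℝ × Bdry d → ℂ} (hT : Tame g)
    (hg : Measurable g) {ε : ℝ} (hε : 0 < ε) :
    ∫⁻ w, ‖layer g ε w - g w‖ₑ ^ p ≤
      ∫⁻ q, ENNReal.ofReal (bdKer ε q) * ∫⁻ w, ‖g (w - q) - g w‖ₑ ^ p := by
  have hk : Measurable fun q : ℝ × Bdry d => ENNReal.ofReal (bdKer ε q) :=
    ENNReal.measurable_ofReal.comp (measurable_bdKer_right ε)
  have h1 : ∀ w, ‖layer g ε w - g w‖ₑ ^ p ≤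
      ∫⁻ q, ENNReal.ofReal (bdKer ε q) * ‖g (w - q) - g w‖ₑ ^ p := fun w => by
    have hz : (w.1, (mkPoint ε w.2 : Space d)) ∈ upper d := by
      rw [mem_upper]
      simpa using hε
    have e : layer g ε w - g w = ∫ q, (g (w - q) - g w) * (bdKer ε q : ℂ) := by
      rw [layer, ← conv_sub_const hT (g w) hz, ← layer, layer_eq]
    have h2 : ‖layer g ε w - g w‖ₑ ≤ ∫⁻ q, ENNReal.ofReal (bdKer ε q) * ‖g (w - q) - g w‖ₑ := by
      rw [e]
      refine (enorm_integral_le_lintegral_enorm _).trans (le_of_eq (lintegral_congr fun q => ?_))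
      rw [enorm_mul, mul_comm, ← ofReal_norm (_ : ℂ), Complex.norm_real,
        Real.norm_of_nonneg (bdKer_nonneg hε.le _)]
    have hm : Measurable fun q => ‖g (w - q) - g w‖ₑ :=
      ((hg.comp (measurable_const.sub measurable_id)).sub_const _).enorm
    refine (ENNReal.rpow_le_rpow h2 (by linarith)).trans ((lintegral_kernel_rpow_le hp
      hk.aemeasurable hm.aemeasurable).trans (le_of_eq ?_))
    rw [lintegral_bdKer hε, ENNReal.one_rpow, one_mul]
  refine (lintegral_mono h1).trans (le_of_eq ?_)
  have hm : Measurable fun v : (ℝ × Bdry d) × (ℝ × Bdry d) => ‖g (v.1 - v.2) - g v.1‖ₑ ^ p :=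
    (((hg.comp (measurable_fst.sub measurable_snd)).sub (hg.comp measurable_fst)).enorm).pow_const _
  rw [lintegral_lintegral_swap ((hk.comp measurable_snd).mul hm).aemeasurable]
  refine lintegral_congr fun q => ?_
  have hmq : Measurable fun w => ‖g (w - q) - g w‖ₑ ^ p :=
    (((hg.comp (measurable_id.sub_const q)).sub hg).enorm).pow_const _
  rw [lintegral_const_mul _ hmq]

theorem lintegral_sub_rpow_le {α : Type*} [MeasurableSpace α] {μ : Measure α} {p : ℝ} (hp : 1 ≤ p)
    {f h : α → ℂ} (hf : Measurable f) :
    ∫⁻ w, ‖f w - h w‖ₑ ^ p ∂μ ≤ 2 ^ (p - 1) * (∫⁻ w, ‖f w‖ₑ ^ p ∂μ + ∫⁻ w, ‖h w‖ₑ ^ p ∂μ) := by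
  rw [← lintegral_add_left (hf.enorm.pow_const _), ← lintegral_const_mul' _ _ (by finiteness)]
  refine lintegral_mono fun w => ?_
  refine (ENNReal.rpow_le_rpow (enorm_sub_le) (by linarith)).trans ?_
  exact ENNReal.rpow_add_le_mul_rpow_add_rpow _ _ hp

/-- After rescaling to height 1 the kernel is fixed and the increments tend to 0 while staying below
a multiple of `∫ ‖g‖ ^ p`, so dominated convergence applies. -/
theorem tendsto_lintegral_layer_sub {d : ℕ} {p : ℝ} (hp : 1 < p) {g : ℝ × Bdry d → ℂ}
    (hg : MemLp g (ENNReal.ofReal p) volume) (hm : Measurable g) :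
    Tendsto (fun ε => ∫⁻ w, ‖layer g ε w - g w‖ₑ ^ p) (𝓝[>] 0) (𝓝 0) := by
  have hp0 : 0 < p := by linarith
  have hfin : ∫⁻ w, ‖g w‖ₑ ^ p ≠ ⊤ := by
    rw [← eLpNorm_rpow hp]
    have := hg.2.ne
    finiteness
  set W : ℝ × Bdry d → ℝ≥0∞ := fun q => ∫⁻ w, ‖g (w - q) - g w‖ₑ ^ p with hW
  have hWm : Measurable W := by
    have hm : Measurable fun v : (ℝ × Bdry d) × (ℝ × Bdry d) => ‖g (v.2 - v.1) - g v.2‖ₑ ^ p :=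
      (((hm.comp (measurable_snd.sub measurable_fst)).sub (hm.comp measurable_snd)).enorm).pow_const _
    exact hm.lintegral_prod_right'
  have hWb : ∀ q, W q ≤ 2 ^ (p - 1) * ((∫⁻ w, ‖g w‖ₑ ^ p) + ∫⁻ w, ‖g w‖ₑ ^ p) := fun q => by
    refine (lintegral_sub_rpow_le hp.le (hm.comp (measurable_id.sub_const q))).trans (le_of_eq ?_)
    congr 2
    exact lintegral_sub_right_eq_self (μ := volume) (fun w => ‖g w‖ₑ ^ p) q
  have hk : Measurable fun q : ℝ × Bdry d => ENNReal.ofReal (bdKer 1 q) :=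
    ENNReal.measurable_ofReal.comp (measurable_bdKer_right 1)
  have h1 : Tendsto (fun ε : ℝ => ∫⁻ q : ℝ × Bdry d, ENNReal.ofReal (bdKer 1 q) *
      W (ε ^ 2 * q.1, ε • q.2)) (𝓝[>] 0) (𝓝 (∫⁻ _ : ℝ × Bdry d, 0)) := by
    refine tendsto_lintegral_filter_of_dominated_convergence
      (fun q => ENNReal.ofReal (bdKer 1 q) *
        (2 ^ (p - 1) * ((∫⁻ w, ‖g w‖ₑ ^ p) + ∫⁻ w, ‖g w‖ₑ ^ p))) ?_ ?_ ?_ ?_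
    · exact Eventually.of_forall fun ε => hk.mul (hWm.comp (by fun_prop))
    · exact Eventually.of_forall fun ε => Eventually.of_forall fun q => by
        gcongr
        exact hWb _
    · rw [lintegral_mul_const _ hk, lintegral_bdKer one_pos]
      finiteness
    · refine Eventually.of_forall fun q => ?_
      have h2 : Tendsto (fun ε : ℝ => (ε ^ 2 * q.1, ε • q.2)) (𝓝[>] 0) (𝓝 0) := by
        have : Continuous fun ε : ℝ => (ε ^ 2 * q.1, ε • q.2) := by fun_prop
        have := this.tendsto 0
        simp only [zero_smul, ne_eq, OfNat.ofNat_ne_zero, not_false_eq_true, zero_pow, zero_mul] at this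
        exact this.mono_left nhdsWithin_le_nhds
      have h3 := (tendsto_lintegral_translate hp hg).comp h2
      simpa using ENNReal.Tendsto.const_mul (a := ENNReal.ofReal (bdKer 1 q)) h3
        (.inr ENNReal.ofReal_ne_top)
  rw [lintegral_zero] at h1
  refine tendsto_of_tendsto_of_tendsto_of_le_of_le' tendsto_const_nhds h1
    (Eventually.of_forall fun _ => zero_le) ?_
  filter_upwards [self_mem_nhdsWithin] with ε hε
  refine (lintegral_layer_sub_le hp (tame_of_memLp hp hg) hm hε).trans (le_of_eq ?_)
  exact lintegral_bdKer_mul hε hWm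

/-! ### Convergence of the boundary values in the Slobodeckij norm -/

/-- The `p`-th power of the `L_p`-norm of the increment `f(w + a) - f(w)`. -/
def incr {d : ℕ} (p : ℝ) (f : ℝ × Bdry d → ℂ) (a : ℝ × Bdry d) : ℝ≥0∞ :=
  ∫⁻ w, ‖f (w + a) - f w‖ₑ ^ p

theorem incr_zero {d : ℕ} {p : ℝ} (hp : 0 < p) (f : ℝ × Bdry d → ℂ) : incr p f 0 = 0 := by
  simp [incr, hp]

theorem measurable_incr_integrand {d : ℕ} {p : ℝ} {f : ℝ × Bdry d → ℂ} (hf : Measurable f) :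
    Measurable fun v : (ℝ × Bdry d) × (ℝ × Bdry d) => ‖f (v.2 + v.1) - f v.2‖ₑ ^ p :=
  (((hf.comp (measurable_snd.add measurable_fst)).sub (hf.comp measurable_snd)).enorm).pow_const _

theorem measurable_incr {d : ℕ} {p : ℝ} {f : ℝ × Bdry d → ℂ} (hf : Measurable f) :
    Measurable (incr p f) :=
  (measurable_incr_integrand hf).lintegral_prod_right'

theorem incr_le {d : ℕ} {p : ℝ} (hp : 1 ≤ p) {f : ℝ × Bdry d → ℂ} (hf : Measurable f)
    (a : ℝ × Bdry d) : incr p f a ≤ 2 ^ p * ∫⁻ w, ‖f w‖ₑ ^ p := by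
  refine (lintegral_sub_rpow_le hp (hf.comp (measurable_id.add_const a))).trans (le_of_eq ?_)
  have := lintegral_add_right_eq_self (μ := volume) (fun w => ‖f w‖ₑ ^ p) a
  simp only [Function.comp_def, id]
  rw [this, ← two_mul, ← mul_assoc]
  congr 1
  nth_rewrite 2 [← ENNReal.rpow_one 2]
  rw [← ENNReal.rpow_add _ _ two_ne_zero ENNReal.ofNat_ne_top, sub_add_cancel]

theorem integrable_layer {d : ℕ} {g : ℝ × Bdry d → ℂ} (hT : Tame g) {ε : ℝ} (hε : 0 < ε)
    (w : ℝ × Bdry d) : Integrable fun q => g (w - q) * (bdKer ε q : ℂ) := by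
  have hz : (w.1, (mkPoint ε w.2 : Space d)) ∈ upper d := by
    rw [mem_upper]
    simpa using hε
  have h := (convKer_poisKer.integrable_mul hT hz).comp_sub_left w
  refine h.congr (Eventually.of_forall fun q => ?_)
  beta_reduce
  rw [poisKer_sub_bd, sub_sub_cancel]

/-- Passing to a layer commutes with translations, so the contraction property may be applied to the
increment of `g`. -/
theorem incr_layer_le {d : ℕ} {p : ℝ} (hp : 1 < p) {g : ℝ × Bdry d → ℂ} (hT : Tame g)
    (hg : Measurable g) {ε : ℝ} (hε : 0 < ε) (a : ℝ × Bdry d) :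
    incr p (layer g ε) a ≤ incr p g a := by
  have hm : Measurable fun w => g (w + a) - g w := (hg.comp (measurable_id.add_const a)).sub hg
  refine le_trans (le_of_eq (lintegral_congr fun w => ?_)) (lintegral_conv_rpow_le hp hm hε)
  change _ = ‖layer (fun w => g (w + a) - g w) ε w‖ₑ ^ p
  rw [layer_eq, layer_eq, layer_eq, ← integral_sub (integrable_layer hT hε _)
    (integrable_layer hT hε _)]
  congr 2
  refine integral_congr_ae (Eventually.of_forall fun q => ?_)
  beta_reduce
  rw [← sub_mul, add_sub_right_comm]

theorem norm_bd {d : ℕ} (q : ℝ × Bdry d) : ‖bd q‖ = ‖q‖ := by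
  have h : ‖(mkPoint 0 q.2 : Space d)‖ = ‖q.2‖ := by
    have := norm_sq_eq (mkPoint 0 q.2 : Space d)
    rw [tang_mkPoint, mkPoint_zero] at this
    rw [← abs_of_nonneg (norm_nonneg (mkPoint 0 q.2 : Space d)), ← abs_of_nonneg (norm_nonneg q.2),
      ← sq_eq_sq_iff_abs_eq_abs]
    linarith
  rw [Prod.norm_def, Prod.norm_def, bd, h]

theorem bd_add {d : ℕ} (q a : ℝ × Bdry d) : bd (q + a) = bd q + bd a := by
  ext i
  · rfl
  · refine Fin.cases ?_ (fun i => ?_) i <;> simp [bd, mkPoint]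

/-- The difference of `g` and the boundary values of the approximation of its extension. -/
def remainder {d : ℕ} (χ : ℝ × Space d → ℝ) (g : ℝ × Bdry d → ℂ) (ε : ℝ) (w : ℝ × Bdry d) : ℂ :=
  g w - (χ (ε • bd w) : ℂ) * layer g ε w

theorem continuous_bd_cutoff {d : ℕ} {χ : ℝ × Space d → ℝ} (hχ : Continuous χ) (ε : ℝ) :
    Continuous fun w : ℝ × Bdry d => (χ (ε • bd w) : ℂ) :=
  Complex.continuous_ofReal.comp (hχ.comp (continuous_bd.const_smul ε))

theorem measurable_remainder {d : ℕ} {χ : ℝ × Space d → ℝ} (hχ : Continuous χ)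
    {g : ℝ × Bdry d → ℂ} (hg : Measurable g) (ε : ℝ) : Measurable (remainder χ g ε) :=
  hg.sub ((continuous_bd_cutoff hχ ε).measurable.mul (measurable_layer hg ε))

theorem eventually_cutoff_eq_one {d : ℕ} {χ : ℝ × Space d → ℝ} (hχ1 : ∀ z, ‖z‖ ≤ 1 → χ z = 1)
    (z : ℝ × Space d) : ∀ᶠ ε : ℝ in 𝓝[>] 0, χ (ε • z) = 1 := by
  have : Tendsto (fun ε : ℝ => ‖ε • z‖) (𝓝[>] 0) (𝓝 ‖(0 : ℝ) • z‖) :=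
    ((tendsto_id.mono_left nhdsWithin_le_nhds).smul_const z).norm
  rw [zero_smul, norm_zero] at this
  exact (this.eventually_le_const zero_lt_one).mono fun ε h => hχ1 _ h

theorem tendsto_lintegral_remainder {d : ℕ} {p : ℝ} (hp : 1 < p) {χ : ℝ × Space d → ℝ}
    (hχ : Continuous χ) (hχ1 : ∀ z, ‖z‖ ≤ 1 → χ z = 1) (h0 : ∀ z, 0 ≤ χ z) (h1 : ∀ z, χ z ≤ 1)
    {g : ℝ × Bdry d → ℂ} (hg : MemLp g (ENNReal.ofReal p) volume) (hm : Measurable g) :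
    Tendsto (fun ε => ∫⁻ w, ‖remainder χ g ε w‖ₑ ^ p) (𝓝[>] 0) (𝓝 0) := by
  have hp0 : 0 < p := by linarith
  have hfin : ∫⁻ w, ‖g w‖ₑ ^ p ≠ ⊤ := by
    rw [← eLpNorm_rpow hp]
    have := hg.2.ne
    finiteness
  have hA : Tendsto (fun ε : ℝ => ∫⁻ w, ‖(1 - (χ (ε • bd w) : ℂ)) * g w‖ₑ ^ p) (𝓝[>] 0)
      (𝓝 (∫⁻ _ : ℝ × Bdry d, 0)) := by
    refine tendsto_lintegral_filter_of_dominated_convergence (fun w => ‖g w‖ₑ ^ p) ?_ ?_ hfin ?_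
    · exact Eventually.of_forall fun ε =>
        (((continuous_const.sub (continuous_bd_cutoff hχ ε)).measurable.mul hm).enorm).pow_const _
    · refine Eventually.of_forall fun ε => Eventually.of_forall fun w => ?_
      gcongr
      rw [enorm_mul]
      refine mul_le_of_le_one_left' ?_
      rw [← ofReal_norm, ← Complex.ofReal_one, ← Complex.ofReal_sub, Complex.norm_real,
        Real.norm_of_nonneg (by linarith [h1 (ε • bd w)])]
      exact ENNReal.ofReal_le_one.2 (by linarith [h0 (ε • bd w)])
    · refine Eventually.of_forall fun w => ?_
      refine tendsto_const_nhds.congr' ?_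
      filter_upwards [eventually_cutoff_eq_one hχ1 (bd w)] with ε hε
      simp [hε, hp0]
  rw [lintegral_zero] at hA
  have hB := tendsto_lintegral_layer_sub hp hg hm
  have hC := ENNReal.Tendsto.const_mul (a := 2 ^ (p - 1)) (hA.add hB) (.inr (by finiteness))
  rw [add_zero, mul_zero] at hC
  refine tendsto_of_tendsto_of_tendsto_of_le_of_le tendsto_const_nhds hC
    (fun _ => zero_le) fun ε => ?_
  have hm1 : Measurable fun w => (1 - (χ (ε • bd w) : ℂ)) * g w :=
    (continuous_const.sub (continuous_bd_cutoff hχ ε)).measurable.mul hm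
  -- The first term tends to 0 by dominated convergence, the second by the convergence of the
  -- layers.
  have e : ∀ w, remainder χ g ε w = (1 - (χ (ε • bd w) : ℂ)) * g w -
      (χ (ε • bd w) : ℂ) * (layer g ε w - g w) := fun w => by
    rw [remainder]
    ring
  simp_rw [e]
  refine (lintegral_sub_rpow_le hp.le hm1).trans ?_
  gcongr with w
  rw [enorm_mul]
  refine mul_le_of_le_one_left' ?_
  rw [← ofReal_norm, Complex.norm_real, Real.norm_of_nonneg (h0 _)]
  exact ENNReal.ofReal_le_one.2 (h1 _)

/-- A discrete product rule. The increment of the cut-off is bounded by a constant and, by the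
Lipschitz property, by a multiple of `‖a‖`, uniformly in `ε ≤ 1`. This yields the dominating
function for the Slobodeckij seminorms. -/
theorem exists_incr_remainder_le {d : ℕ} {p : ℝ} (hp : 1 < p) {χ : ℝ × Space d → ℝ}
    (hχ : ContDiff ℝ ∞ χ) (hc : HasCompactSupport χ) (h0 : ∀ z, 0 ≤ χ z) (h1 : ∀ z, χ z ≤ 1) :
    ∃ C : ℝ≥0∞, C ≠ ⊤ ∧ ∀ g : ℝ × Bdry d → ℂ, Tame g → Measurable g → ∀ ε : ℝ, 0 < ε → ε ≤ 1 →
      ∀ a : ℝ × Bdry d, incr p (remainder χ g ε) a ≤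
        C * (incr p g a + min 1 ‖a‖ₑ ^ p * ∫⁻ w, ‖g w‖ₑ ^ p) := by
  have hp0 : 0 < p := by linarith
  obtain ⟨L, hL⟩ := hχ.lipschitzWith_of_hasCompactSupport hc (by simp)
  refine ⟨2 ^ (p - 1) * (1 + 2 ^ (p - 1) * (1 + (1 + L : ℝ≥0) ^ p)), by finiteness,
    fun g hT hg ε hε0 hε1 a => ?_⟩
  set I := ∫⁻ w, ‖g w‖ₑ ^ p with hI
  set μ := min 1 ‖a‖ₑ with hμ
  have hχa : ∀ w, ‖(χ (ε • bd (w + a)) : ℂ) - (χ (ε • bd w) : ℂ)‖ₑ ≤ (1 + L : ℝ≥0) * μ := by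
    intro w
    rw [← Complex.ofReal_sub, ← ofReal_norm, Complex.norm_real, hμ, mul_min]
    refine le_min ?_ ?_
    · rw [mul_one]
      refine le_trans (ENNReal.ofReal_le_one.2 ?_) (by simp)
      rw [Real.norm_eq_abs, abs_le]
      constructor <;> linarith [h0 (ε • bd w), h1 (ε • bd w), h0 (ε • bd (w + a)),
        h1 (ε • bd (w + a))]
    · have h2 := hL.norm_sub_le (ε • bd (w + a)) (ε • bd w)
      rw [bd_add, smul_add, add_sub_cancel_left, norm_smul, Real.norm_of_nonneg hε0.le,
        norm_bd] at h2
      rw [bd_add, smul_add, ← ofReal_norm, ← ENNReal.ofReal_coe_nnreal,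
        ← ENNReal.ofReal_mul (by positivity)]
      refine ENNReal.ofReal_le_ofReal (h2.trans ?_)
      push_cast
      have : ε * ‖a‖ ≤ ‖a‖ := mul_le_of_le_one_left (norm_nonneg _) hε1
      have hL0 : (0 : ℝ) ≤ L := L.2
      nlinarith [norm_nonneg a]
  have e : ∀ w, remainder χ g ε (w + a) - remainder χ g ε w = (g (w + a) - g w) -
      ((χ (ε • bd (w + a)) : ℂ) * (layer g ε (w + a) - layer g ε w) -
        ((χ (ε • bd w) : ℂ) - (χ (ε • bd (w + a)) : ℂ)) * layer g ε w) := fun w => by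
    rw [remainder, remainder]
    ring
  have hadd : Measurable fun w : ℝ × Bdry d => w + a := measurable_id.add_const a
  have hl := measurable_layer hg ε
  have hχm := (continuous_bd_cutoff hχ.continuous ε).measurable
  have m1 : Measurable fun w => g (w + a) - g w := (hg.comp hadd).sub hg
  have m2 : Measurable fun w =>
      (χ (ε • bd (w + a)) : ℂ) * (layer g ε (w + a) - layer g ε w) :=
    (hχm.comp hadd).mul ((hl.comp hadd).sub hl)
  rw [incr]
  simp_rw [e]
  refine (lintegral_sub_rpow_le hp.le m1).trans ?_
  rw [mul_assoc]
  gcongr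
  have b1 : ∫⁻ w, ‖(χ (ε • bd (w + a)) : ℂ) * (layer g ε (w + a) - layer g ε w)‖ₑ ^ p ≤
      incr p g a := by
    refine le_trans (lintegral_mono fun w => ?_) (incr_layer_le hp hT hg hε0 a)
    gcongr
    rw [enorm_mul]
    refine mul_le_of_le_one_left' ?_
    rw [← ofReal_norm, Complex.norm_real, Real.norm_of_nonneg (h0 _)]
    exact ENNReal.ofReal_le_one.2 (h1 _)
  have b2 : ∫⁻ w, ‖((χ (ε • bd w) : ℂ) - (χ (ε • bd (w + a)) : ℂ)) * layer g ε w‖ₑ ^ p ≤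
      (1 + L : ℝ≥0) ^ p * (μ ^ p * I) := by
    rw [← mul_assoc, ← ENNReal.mul_rpow_of_nonneg _ _ hp0.le]
    refine le_trans (lintegral_mono fun w => ?_) (le_trans (le_of_eq
      (lintegral_const_mul _ (hl.enorm.pow_const p))) (mul_le_mul_right
        (lintegral_conv_rpow_le hp hg hε0) _))
    rw [enorm_mul, ENNReal.mul_rpow_of_nonneg _ _ hp0.le, enorm_sub_rev]
    gcongr
    exact hχa w
  have b3 := (lintegral_sub_rpow_le (μ := volume) hp.le
    (h := fun w => ((χ (ε • bd w) : ℂ) - (χ (ε • bd (w + a)) : ℂ)) * layer g ε w) m2).trans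
    (mul_le_mul_right (add_le_add b1 b2) _)
  refine (add_le_add le_rfl b3).trans ?_
  change incr p g a + _ ≤ _
  set X := incr p g a
  set Y := μ ^ p * I
  set K : ℝ≥0∞ := (1 + L : ℝ≥0) ^ p
  calc X + 2 ^ (p - 1) * (X + K * Y) ≤ X + 2 ^ (p - 1) * (X + K * Y) +
        (Y + 2 ^ (p - 1) * (Y + K * X)) := le_self_add
    _ = (1 + 2 ^ (p - 1) * (1 + K)) * (X + Y) := by ring

/-- In polar coordinates the integrand is `r ^ (p - 1 - σ)` near 0 and `r ^ (-1 - σ)` at infinity.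
-/
theorem lintegral_min_norm_lt_top {E : Type*} [NormedAddCommGroup E] [NormedSpace ℝ E]
    [FiniteDimensional ℝ E] [MeasurableSpace E] [BorelSpace E] (μ : Measure E) [μ.IsAddHaarMeasure]
    {σ p : ℝ} (hσ : 0 < σ) (hp : σ < p) :
    ∫⁻ y, min 1 ‖y‖ₑ ^ p / ‖y‖ₑ ^ ((Module.finrank ℝ E : ℝ) + σ) ∂μ < ⊤ := by
  have hp0 : 0 < p := hσ.trans hp
  -- The case of boundary dimension 0: at the only point the integrand is `0 / 0`, which is 0 by
  -- convention.
  rcases subsingleton_or_nontrivial E with hE | hE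
  · have : ∀ y : E, min 1 ‖y‖ₑ ^ p / ‖y‖ₑ ^ ((Module.finrank ℝ E : ℝ) + σ) = 0 := fun y => by
      rw [Subsingleton.elim y 0]
      simp [hp0]
    simp [this]
  set n := Module.finrank ℝ E with hn
  have hn1 : 1 ≤ n := Module.finrank_pos
  set f : ℝ → ℝ := fun r => min 1 r ^ p * r ^ (-((n : ℝ) + σ)) with hf
  have h1 : ∀ r : ℝ, 0 < r → r ^ (n - 1) • f r = min 1 r ^ p * r ^ (-1 - σ) := fun r hr => by
    rw [smul_eq_mul, hf]
    beta_reduce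
    rw [mul_left_comm, ← Real.rpow_natCast, ← Real.rpow_add hr, Nat.cast_sub hn1]
    congr 2
    push_cast
    ring
  have hint : Integrable (fun y : E => f ‖y‖) μ := by
    rw [integrable_fun_norm_addHaar μ (f := f), ← Set.Ioo_union_Ici_eq_Ioi zero_lt_one]
    refine IntegrableOn.union ?_ ?_
    · refine IntegrableOn.congr_fun ((intervalIntegral.integrableOn_Ioo_rpow_iff
        (s := p + (-1 - σ)) zero_lt_one).2 (by linarith)) (fun r hr => ?_) measurableSet_Ioo
      rw [h1 r hr.1, min_eq_right hr.2.le, Real.rpow_add hr.1]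
    · rw [integrableOn_Ici_iff_integrableOn_Ioi]
      refine IntegrableOn.congr_fun (integrableOn_Ioi_rpow_of_lt
        (a := -1 - σ) (by linarith) zero_lt_one) (fun r hr => ?_) measurableSet_Ioi
      have hr : 1 < r := hr
      rw [h1 r (by linarith), min_eq_left hr.le, Real.one_rpow, one_mul]
  refine lt_of_le_of_lt (lintegral_mono fun y => ?_) hint.lintegral_lt_top
  by_cases hy : y = 0
  · rw [hy]
    simp [hp0]
  have hy0 : 0 < ‖y‖ := norm_pos_iff.2 hy
  rw [hf]
  beta_reduce
  rw [Real.rpow_neg hy0.le, ← div_eq_mul_inv, ENNReal.ofReal_div_of_pos (by positivity),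
    ← ENNReal.ofReal_rpow_of_nonneg (by positivity) hp0.le,
    ← ENNReal.ofReal_rpow_of_pos hy0, ofReal_norm]
  gcongr
  rw [← ofReal_norm, ← ENNReal.ofReal_one, ENNReal.ofReal_min]

/-- In terms of the increment variable the seminorm is one integral against a fixed kernel, the form
in which dominated convergence is applied. -/
theorem slobTime_rpow {d : ℕ} {s p : ℝ} (hp : 0 < p) {f : ℝ × Bdry d → ℂ} (hf : Measurable f) :
    slobTime s p f ^ p = ∫⁻ r : ℝ, incr p f (r, 0) / ‖r‖ₑ ^ (1 + s * p / 2) := by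
  have hm : ∀ r : ℝ, Measurable fun w : ℝ × Bdry d => ‖f (w + (r, 0)) - f w‖ₑ ^ p := fun r =>
    (((hf.comp (measurable_id.add_const _)).sub hf).enorm).pow_const _
  rw [slobTime, ← ENNReal.rpow_mul, one_div_mul_cancel hp.ne', ENNReal.rpow_one]
  have e1 : ∀ t : ℝ, ∫⁻ r : ℝ, (∫⁻ y : Bdry d, ‖f (r, y) - f (t, y)‖ₑ ^ p)
      / ‖t - r‖ₑ ^ (1 + s * p / 2) = ∫⁻ r : ℝ, (∫⁻ y : Bdry d, ‖f (t + r, y) - f (t, y)‖ₑ ^ p)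
      / ‖r‖ₑ ^ (1 + s * p / 2) := fun t => by
    refine (lintegral_add_left_eq_self (μ := volume) (fun r : ℝ =>
      (∫⁻ y : Bdry d, ‖f (r, y) - f (t, y)‖ₑ ^ p) / ‖t - r‖ₑ ^ (1 + s * p / 2)) t).symm.trans
      (lintegral_congr fun r => ?_)
    rw [sub_add_cancel_left, enorm_neg]
  simp_rw [e1]
  rw [lintegral_lintegral_swap]
  · refine lintegral_congr fun r => ?_
    simp_rw [div_eq_mul_inv]
    have hm2 : Measurable fun t : ℝ => ∫⁻ y : Bdry d, ‖f (t + r, y) - f (t, y)‖ₑ ^ p := by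
      have := (hm r).lintegral_prod_right' (ν := (volume : Measure (Bdry d)))
      simpa using this
    rw [lintegral_mul_const _ hm2, incr, lintegral_prod_volume (hm r)]
    simp
  · have h1 : Measurable fun v : (ℝ × ℝ) × Bdry d =>
        ‖f (v.1.1 + v.1.2, v.2) - f (v.1.1, v.2)‖ₑ ^ p :=
      (((hf.comp (by fun_prop)).sub (hf.comp (by fun_prop))).enorm).pow_const _
    refine (h1.lintegral_prod_right'.div ?_).aemeasurable
    fun_prop

theorem slobSpace_rpow {d : ℕ} {s p : ℝ} (hp : 0 < p) {f : ℝ × Bdry d → ℂ} (hf : Measurable f) :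
    slobSpace s p f ^ p = ∫⁻ z : Bdry d, incr p f (0, z) / ‖z‖ₑ ^ ((d : ℝ) + s * p) := by
  have hm : ∀ z : Bdry d, Measurable fun w : ℝ × Bdry d => ‖f (w + (0, z)) - f w‖ₑ ^ p := fun z =>
    (((hf.comp (measurable_id.add_const _)).sub hf).enorm).pow_const _
  rw [slobSpace, ← ENNReal.rpow_mul, one_div_mul_cancel hp.ne', ENNReal.rpow_one]
  have h1 : Measurable fun v : (ℝ × Bdry d) × Bdry d =>
      ‖f (v.1.1, v.1.2 + v.2) - f (v.1.1, v.1.2)‖ₑ ^ p / ‖v.2‖ₑ ^ ((d : ℝ) + s * p) :=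
    ((((hf.comp (by fun_prop)).sub (hf.comp (by fun_prop))).enorm).pow_const _).div (by fun_prop)
  have e1 : ∀ (t : ℝ) (y : Bdry d), ∫⁻ z : Bdry d, ‖f (t, y) - f (t, z)‖ₑ ^ p
      / ‖y - z‖ₑ ^ ((d : ℝ) + s * p) = ∫⁻ z : Bdry d, ‖f (t, y + z) - f (t, y)‖ₑ ^ p
      / ‖z‖ₑ ^ ((d : ℝ) + s * p) := fun t y => by
    refine (lintegral_add_left_eq_self (μ := volume) (fun z : Bdry d =>
      ‖f (t, y) - f (t, z)‖ₑ ^ p / ‖y - z‖ₑ ^ ((d : ℝ) + s * p)) y).symm.trans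
      (lintegral_congr fun z => ?_)
    rw [sub_add_cancel_left, enorm_neg, enorm_sub_rev]
  simp_rw [e1]
  rw [← lintegral_prod_volume (f := fun w : ℝ × Bdry d => ∫⁻ z : Bdry d,
    ‖f (w.1, w.2 + z) - f (w.1, w.2)‖ₑ ^ p / ‖z‖ₑ ^ ((d : ℝ) + s * p)) h1.lintegral_prod_right',
    lintegral_lintegral_swap h1.aemeasurable]
  refine lintegral_congr fun z => ?_
  simp_rw [div_eq_mul_inv]
  have hm2 : Measurable fun w : ℝ × Bdry d => ‖f (w.1, w.2 + z) - f (w.1, w.2)‖ₑ ^ p := by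
    have := hm z
    simpa [Prod.add_def] using this
  rw [lintegral_mul_const _ hm2, incr]
  simp [Prod.add_def]

/-- Both seminorms at once: `j` places an increment in time or in space, and `k` is the kernel. The
kernel may be infinite only for the zero increment, where `incr` is 0. -/
theorem tendsto_lintegral_incr {d : ℕ} {Z : Type*} [MeasurableSpace Z] {ν : Measure Z}
    {j : Z → ℝ × Bdry d} (hj : Measurable j) {k : Z → ℝ≥0∞} (hk : Measurable k)
    (hjk : ∀ z, j z = 0 ∨ k z ≠ ⊤) {p : ℝ} (hp : 1 < p)
    (hK : ∫⁻ z, min 1 ‖j z‖ₑ ^ p * k z ∂ν < ⊤) {χ : ℝ × Space d → ℝ}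
    (hχ : ContDiff ℝ ∞ χ) (hc : HasCompactSupport χ) (hχ1 : ∀ z, ‖z‖ ≤ 1 → χ z = 1)
    (h0 : ∀ z, 0 ≤ χ z) (h1 : ∀ z, χ z ≤ 1)
    {g : ℝ × Bdry d → ℂ} (hg : MemLp g (ENNReal.ofReal p) volume) (hm : Measurable g)
    (hgk : ∫⁻ z, incr p g (j z) * k z ∂ν < ⊤) :
    Tendsto (fun ε => ∫⁻ z, incr p (remainder χ g ε) (j z) * k z ∂ν) (𝓝[>] 0) (𝓝 0) := by
  have hp0 : 0 < p := by linarith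
  have hfin : ∫⁻ w, ‖g w‖ₑ ^ p ≠ ⊤ := by
    rw [← eLpNorm_rpow hp]
    have := hg.2.ne
    finiteness
  obtain ⟨C, hC, hC'⟩ := exists_incr_remainder_le hp hχ hc h0 h1
  set I := ∫⁻ w, ‖g w‖ₑ ^ p with hI
  have hr := fun ε => measurable_remainder hχ.continuous hm ε
  have hmin : Measurable fun z => min 1 ‖j z‖ₑ ^ p * k z :=
    ((measurable_const.min hj.enorm).pow_const _).mul hk
  have hgm : Measurable fun z => incr p g (j z) * k z := ((measurable_incr hm).comp hj).mul hk
  have key : Tendsto (fun ε => ∫⁻ z, incr p (remainder χ g ε) (j z) * k z ∂ν) (𝓝[>] 0)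
      (𝓝 (∫⁻ _, 0 ∂ν)) := by
    refine tendsto_lintegral_filter_of_dominated_convergence
      (fun z => C * (incr p g (j z) * k z + I * (min 1 ‖j z‖ₑ ^ p * k z))) ?_ ?_ ?_ ?_
    · exact Eventually.of_forall fun ε => ((measurable_incr (hr ε)).comp hj).mul hk
    · filter_upwards [Ioc_mem_nhdsGT one_pos] with ε hε
      refine Eventually.of_forall fun z => ?_
      refine (mul_le_mul_left (hC' g (tame_of_memLp hp hg) hm ε hε.1 hε.2 (j z)) (k z)).trans
        (le_of_eq ?_)
      ring
    · rw [lintegral_const_mul' _ _ hC, lintegral_add_left hgm, lintegral_const_mul' _ _ hfin]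
      have := hgk.ne
      have := hK.ne
      finiteness
    -- For a fixed increment the `L_p` convergence of the remainder suffices, as `incr` is at most
    -- `2 ^ p` times the integral of its `p`-th power.
    · refine Eventually.of_forall fun z => ?_
      rcases hjk z with hz | hz
      · simp [hz, incr_zero hp0]
      · have h2 := ENNReal.Tendsto.const_mul (a := 2 ^ p)
          (tendsto_lintegral_remainder hp hχ.continuous hχ1 h0 h1 hg hm) (.inr (by finiteness))
        have h3 := ENNReal.Tendsto.mul_const (b := k z) h2 (.inr hz)
        rw [mul_zero, zero_mul] at h3
        refine tendsto_of_tendsto_of_tendsto_of_le_of_le tendsto_const_nhds h3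
          (fun _ => zero_le) fun ε => ?_
        exact mul_le_mul_left (incr_le hp.le (hr ε) _) _
  rwa [lintegral_zero] at key

theorem tendsto_slobNorm_remainder {d : ℕ} {s p : ℝ} (hp : 1 < p) (hs0 : 0 < s) (hs1 : s < 1)
    {χ : ℝ × Space d → ℝ} (hχ : ContDiff ℝ ∞ χ) (hc : HasCompactSupport χ)
    (hχ1 : ∀ z, ‖z‖ ≤ 1 → χ z = 1) (h0 : ∀ z, 0 ≤ χ z) (h1 : ∀ z, χ z ≤ 1)
    {g : ℝ × Bdry d → ℂ} (hg : MemSlob s p g) (hm : Measurable g) :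
    Tendsto (fun ε => slobNorm s p (remainder χ g ε)) (𝓝[>] 0) (𝓝 0) := by
  have hp0 : 0 < p := by linarith
  have hL := hg.memLp
  have hsp : 0 < s * p := by positivity
  -- Integrability of `min 1 ‖a‖ ^ p` against the two kernels requires `s p / 2 < p` in time and `s
  -- p < p` in space.
  have hsp1 : s * p < p := by nlinarith
  have hr := fun ε => measurable_remainder hχ.continuous hm ε
  have root : ∀ F : ℝ → ℝ≥0∞, Tendsto (fun ε => F ε ^ p) (𝓝[>] 0) (𝓝 0) →
      Tendsto F (𝓝[>] 0) (𝓝 0) := fun F hF => by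
    have h := hF.ennrpow_const (1 / p)
    rw [ENNReal.zero_rpow_of_pos (by positivity)] at h
    refine h.congr fun ε => ?_
    rw [← ENNReal.rpow_mul, mul_one_div_cancel hp0.ne', ENNReal.rpow_one]
  have hT : slobTime s p g ^ p < ⊤ := by
    have : slobTime s p g < ⊤ := lt_of_le_of_lt (le_add_self.trans le_self_add) hg.2
    finiteness
  have hS : slobSpace s p g ^ p < ⊤ := by
    have : slobSpace s p g < ⊤ := lt_of_le_of_lt le_add_self hg.2
    finiteness
  have t1 : Tendsto (fun ε => eLpNorm (remainder χ g ε) (ENNReal.ofReal p) volume) (𝓝[>] 0)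
      (𝓝 0) := by
    refine root _ ((tendsto_lintegral_remainder hp hχ.continuous hχ1 h0 h1 hL hm).congr fun ε => ?_)
    rw [eLpNorm_rpow hp]
  have t2 : Tendsto (fun ε => slobTime s p (remainder χ g ε)) (𝓝[>] 0) (𝓝 0) := by
    refine root _ ?_
    rw [slobTime_rpow hp0 hm] at hT
    simp_rw [div_eq_mul_inv] at hT
    have hK := lintegral_min_norm_lt_top (volume : Measure ℝ) (σ := s * p / 2) (p := p)
      (by positivity) (by linarith)
    refine (tendsto_lintegral_incr (ν := (volume : Measure ℝ))
      (j := fun r : ℝ => (r, (0 : Bdry d))) (k := fun r => (‖r‖ₑ ^ (1 + s * p / 2))⁻¹)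
      (by fun_prop) (by fun_prop) (fun r => ?_) hp ?_ hχ hc hχ1 h0 h1 hL hm hT).congr fun ε => ?_
    · by_cases hr0 : r = 0
      · exact .inl (by rw [hr0]; rfl)
      · exact .inr (by simp [hr0])
    · refine lt_of_eq_of_lt (lintegral_congr fun r => ?_) hK
      rw [← div_eq_mul_inv, Module.finrank_self, Nat.cast_one]
      simp [← ofReal_norm]
    · rw [slobTime_rpow hp0 (hr ε)]
      simp_rw [div_eq_mul_inv]
  have t3 : Tendsto (fun ε => slobSpace s p (remainder χ g ε)) (𝓝[>] 0) (𝓝 0) := by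
    refine root _ ?_
    rw [slobSpace_rpow hp0 hm] at hS
    simp_rw [div_eq_mul_inv] at hS
    have hK := lintegral_min_norm_lt_top (volume : Measure (Bdry d)) hsp hsp1
    refine (tendsto_lintegral_incr (ν := (volume : Measure (Bdry d)))
      (j := fun z : Bdry d => ((0 : ℝ), z)) (k := fun z => (‖z‖ₑ ^ ((d : ℝ) + s * p))⁻¹)
      (by fun_prop) (by fun_prop) (fun z => ?_) hp ?_ hχ hc hχ1 h0 h1 hL hm hS).congr fun ε => ?_
    · by_cases hz0 : z = 0
      · exact .inl (by rw [hz0]; rfl)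
      · refine .inr ?_
        simp [hz0]
    · refine lt_of_eq_of_lt (lintegral_congr fun z => ?_) hK
      rw [div_eq_mul_inv, finrank_euclideanSpace_fin]
      simp [← ofReal_norm]
    · rw [slobSpace_rpow hp0 (hr ε)]
      simp_rw [div_eq_mul_inv]
  simpa [slobNorm] using (t1.add t2).add t3

/-! ### The extension in the solution space and its trace -/

theorem timeMeasurable_distOf_cutExt {d : ℕ} {η : ℝ → ℝ} (hη : IsCutoff η) {g : ℝ × Bdry d → ℂ}
    (hg : Tame g) : TimeMeasurable fun t => distOf (cutExt η g t) := by
  have e : ∀ t, cutExt η g t = fun x => cut η (conv poisKer g) (t, x) := fun t =>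
    funext (cutExt_eq η g t)
  simp_rw [e]
  exact timeMeasurable_distOf
    (contDiffOn_cut hη.1 (convKer_poisKer.contDiffOn_conv hg)).continuousOn

theorem exists_solNorm_distOf_cutExt_le {d : ℕ} (P : WeightPartition d) (γ : ℝ) {p θ s : ℝ}
    (hp : 1 < p) (hθ₁ : (d : ℝ) < θ) (hθ₂ : θ < d + p) (hs : s = (d + p - θ) / p) {η : ℝ → ℝ}
    (hη : IsCutoff η) : ∃ N : ℝ≥0, ∀ g : ℝ × Bdry d → ℂ, MemSlob s p g →
      solNorm P γ θ p (fun t => distOf (cutExt η g t)) ≤ N * slobNorm s p g := by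
  have hp0 : 0 < p := by linarith
  obtain ⟨M, C₁, h₁⟩ := exists_solNorm_le P γ θ hp
  obtain ⟨C₂, h₂⟩ := exists_wInt_jet_le d M hp hθ₁ hθ₂ hs hη
  refine ⟨C₁ * C₂, fun g hg => ?_⟩
  have e : ∀ t, cutExt η g t = fun x => cut η (conv poisKer g) (t, x) := fun t =>
    funext (cutExt_eq η g t)
  simp_rw [e]
  refine (h₁ _ (contDiffOn_cut hη.1 (convKer_poisKer.contDiffOn_conv
    (tame_of_memLp hp hg.memLp))) fun z hz => ?_).trans ?_
  · rw [cut, hη.2.2 _ hz.le]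
    simp
  · have h3 := ENNReal.rpow_le_rpow (h₂ g hg) (show 0 ≤ 1 / p by positivity)
    rw [← ENNReal.rpow_mul, mul_one_div_cancel hp0.ne', ENNReal.rpow_one] at h3
    push_cast
    rw [mul_assoc]
    gcongr

/-- The approximating sequence is `approx` with `ε = 1 / (m + 1)`; on the boundary it differs from
the data by `remainder`. -/
theorem hasTrace_distOf_cutExt {d : ℕ} (P : WeightPartition d) {p θ s : ℝ}
    (hp : 1 < p) (hθ₁ : (d : ℝ) < θ) (hθ₂ : θ < d + p) (hs : s = (d + p - θ) / p) {η : ℝ → ℝ}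
    (hη : IsCutoff η) {g : ℝ × Bdry d → ℂ} (hg : MemSlob s p g)
    (hu : MemSol P 1 θ p (fun t => distOf (cutExt η g t))) :
    HasTrace P θ s p (fun t => distOf (cutExt η g t)) g := by
  have hp0 : 0 < p := by linarith
  refine ⟨hu, hg, ?_⟩
  obtain ⟨h, hgh, hm, hh⟩ := hg.exists_measurable
  obtain ⟨χ, hχ, hc, hχ1, hχ0, hχle⟩ := exists_spaceTime_cutoff d
  have hs0 : 0 < s := by
    rw [hs]
    exact div_pos (by linarith) hp0
  have hs1 : s < 1 := by
    rw [hs, div_lt_one hp0]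
    linarith
  have hV := convKer_poisKer.contDiffOn_conv (tame_of_memLp hp hh.memLp)
  have hseq : Tendsto (fun m : ℕ => 1 / ((m : ℝ) + 1)) atTop (𝓝[>] 0) :=
    tendsto_nhdsWithin_iff.2 ⟨tendsto_one_div_add_atTop_nhds_zero_nat,
      Eventually.of_forall fun m => show (0 : ℝ) < 1 / ((m : ℝ) + 1) by positivity⟩
  refine ⟨fun m => approx η χ (1 / ((m : ℝ) + 1)) (conv poisKer h), fun m =>
    ⟨contDiff_approx hη.1 hχ (by positivity) hV, hasCompactSupport_approx η hc (by positivity) _⟩,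
    ?_, ?_⟩
  · have e : cutExt η g = cutExt η h := by
      funext t x
      rw [cutExt, cutExt, poissonExt_congr hgh]
    rw [e]
    exact (tendsto_solNorm_sub_approx P 1 hp hθ₁ hθ₂ hs hη hχ hc hχ1 hh hm).comp hseq
  · refine ((tendsto_slobNorm_remainder hp hs0 hs1 hχ hc hχ1 hχ0 hχle hh hm).comp hseq).congr
      fun m => ?_
    refine (slobNorm_congr ?_).symm
    filter_upwards [hgh] with q hq
    rw [approx_boundary hη χ (by positivity), hq]
    rfl

end WeightedTrace

end

/-! ### The main theorem -/

open WeightedTrace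
theorem mainTheorem3 (d : ℕ) (p θ s : ℝ) (hp : 1 < p) (hθ₁ : (d : ℝ) < θ) (hθ₂ : θ < d + p)
    (hs : s = (d + p - θ) / p) :
    ∃ η : ℝ → ℝ, IsCutoff η ∧
      -- for every `g`, the functions `v` and `u = η(x₁) v` are well defined and smooth inside
      (∀ g : ℝ × Bdry d → ℂ, MemSlob s p g →
        (∀ (t : ℝ) (x : Space d), 0 < x 0 → Integrable (poissonIntegrand g t x) volume) ∧
        SmoothInside (poissonExt g) ∧ SmoothInside (cutExt η g)) ∧
      -- for every `γ`, `u` belongs to the space of order `γ`, has trace `g`, and is bounded by `g`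
      (∀ (P : WeightPartition d) (γ : ℝ), ∃ N : ℝ≥0, ∀ g : ℝ × Bdry d → ℂ, MemSlob s p g →
        MemSol P γ θ p (fun t => distOf (cutExt η g t)) ∧
        HasTrace P θ s p (fun t => distOf (cutExt η g t)) g ∧
        solNorm P γ θ p (fun t => distOf (cutExt η g t)) ≤ N * slobNorm s p g) ∧
      -- weighted estimates for all derivatives of `v` and of `u`
      (∀ m : ℕ, ∃ N : ℝ≥0, ∀ g : ℝ × Bdry d → ℂ, MemSlob s p g →
        (∀ J : Fin (m + 1) → Fin (d + 1),
          weightedLp (θ + m * p) p (fun t => partialD J (poissonExt g t))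
              ≤ N * (slobTime s p g + slobSpace s p g) ∧
          weightedLp (θ + m * p) p (fun t => partialD J (cutExt η g t))
              ≤ N * slobNorm s p g) ∧
        (∀ J : Fin m → Fin (d + 1),
          weightedLp (θ + (m + 1) * p) p
              (fun t => partialD J (fun x => deriv (fun τ => poissonExt g τ x) t))
              ≤ N * (slobTime s p g + slobSpace s p g) ∧
          weightedLp (θ + (m + 1) * p) p
              (fun t => partialD J (fun x => deriv (fun τ => cutExt η g τ x) t))
              ≤ N * slobNorm s p g) ∧
        weightedLp θ p (cutExt η g) ≤ N * slobNorm s p g) := by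
  obtain ⟨η, hη⟩ := exists_isCutoff
  refine ⟨η, hη, fun g hg => ?_, fun P γ => ?_, fun m => ?_⟩
  · have hT := tame_of_memLp hp hg.memLp
    exact ⟨fun t x hx => integrable_poissonIntegrand hT t hx, smoothInside_poissonExt hT,
      smoothInside_cutExt hη.1 hT⟩
  · obtain ⟨N, hN⟩ := exists_solNorm_distOf_cutExt_le P γ hp hθ₁ hθ₂ hs hη
    -- The trace is defined through the space of order 1, so membership there is needed whatever `γ`
    -- is.
    obtain ⟨N₁, hN₁⟩ := exists_solNorm_distOf_cutExt_le P 1 hp hθ₁ hθ₂ hs hη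
    refine ⟨N, fun g hg => ?_⟩
    have hmem : ∀ (γ : ℝ) (N : ℝ≥0), solNorm P γ θ p (fun t => distOf (cutExt η g t)) ≤
        N * slobNorm s p g → MemSol P γ θ p (fun t => distOf (cutExt η g t)) := fun γ N h =>
      ⟨timeMeasurable_distOf_cutExt hη (tame_of_memLp hp hg.memLp),
        h.trans_lt (ENNReal.mul_lt_top ENNReal.coe_lt_top hg.2)⟩
    exact ⟨hmem γ N (hN g hg),
      hasTrace_distOf_cutExt P hp hθ₁ hθ₂ hs hη hg (hmem 1 N₁ (hN₁ g hg)), hN g hg⟩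
  · obtain ⟨N₁, h₁⟩ := exists_weightedLp_poissonExt_le d m hp hθ₁ hθ₂ hs
    obtain ⟨N₂, h₂⟩ := exists_weightedLp_cut_le d m hp hθ₁ hθ₂ hs hη
    have hN₁ : (N₁ : ℝ≥0∞) ≤ (N₁ + N₂ : ℝ≥0) := by exact_mod_cast le_self_add
    have hN₂ : (N₂ : ℝ≥0∞) ≤ (N₁ + N₂ : ℝ≥0) := by exact_mod_cast le_add_self
    refine ⟨N₁ + N₂, fun g hg => ⟨fun J => ⟨?_, ?_⟩, fun J => ⟨?_, ?_⟩, ?_⟩⟩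
    · exact ((h₁ g hg).1 J).trans (mul_le_mul_left hN₁ _)
    · exact ((h₂ g hg).1 J).trans (mul_le_mul_left hN₂ _)
    · exact ((h₁ g hg).2 J).trans (mul_le_mul_left hN₁ _)
    · exact ((h₂ g hg).2.1 J).trans (mul_le_mul_left hN₂ _)
    · exact (h₂ g hg).2.2.trans (mul_le_mul_left hN₂ _)
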